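/- Let $K$ be an algebraically closed field of characteristic $2$ and let $\lambda\in K$, $\lambda\neq 0,1$. Consider the two matrices $$A_1=\begin{pmatrix}0&\lambda&0\\ \lambda&0&1\\ 0&1&0\end{pmatrix},\qquad A_2=\begin{pmatrix}0&1+\lambda&\lambda\\ 1+\lambda&0&1\\ \lambda&1&0\end{pmatrix}.$$ **Lie algebras with Cartan matrix.** For an $n\times n$ matrix $A$, let $l=n-\operatorname{rk}A$ and let $B$ be an $l\times n$ matrix such that the matrix consisting of the rows of $A$ and of $B$ has rank $n$. Let $\tilde{\mathfrak g}(A)$ be the Lie algebra with generators $e_i,f_i,h_i$ ($1\le i\le n$), $d_k$ ($1\le k\le l$) and relations $[e_i,f_j]=\delta_{ij}h_i$, $[h_i,e_j]=A_{ij}e_j$, $[h_i,f_j]=-A_{ij}f_j$, $[d_k,e_j]=B_{kj}e_j$, $[d_k,f_j]=-B_{kj}f_j$, where the $h_i$ and $d_k$ commute with each other. It is $\mathbb Z^n$-graded with $\deg e_i=-\deg f_i=\alpha_i$, the $i$-th unit vector, and $\deg h_i=\deg d_k=0$. Let $\mathfrak g(A)=\tilde{\mathfrak g}(A)/\mathfrak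 r$, where $\mathfrak r$ is the maximal $\mathbb Z^n$-homogeneous ideal that has zero intersection with the span of the $h_i$ and $d_k$. Let $\mathfrak g'(A)$ be the derived algebra and $\mathfrak c$ the center of $\mathfrak g(A)$. The matrices $A_1,A_2$ are the two Cartan matrices of the Weisfeiler--Kac algebra $\mathfrak{wk}(3;\lambda)$, and $\mathfrak g=\mathfrak{wk}'(3;\lambda)/\mathfrak c$ denotes $\mathfrak g'(A)/(\mathfrak g'(A)\cap\mathfrak c)$ for $A=A_1$ or $A=A_2$. An integer vector $r=(r_1r_2r_3)$ defines the $\mathbb Z$-grading $\mathfrak g=\bigoplus_k\mathfrak g_k$ induced by $\deg e_i=-\deg f_i=r_i$. **Cartan prolongs.** Let $\mathcal O(m;\underline M)$, for $\underline M\in(\mathbb N\cup\{\infty\})^m$, be the algebra of divided powers spanned by the $x^{(s)}$ with $s_i<2^{M_i}$. Given a basis $v_1,\dots,v_m$ of $V$ and a Lie algebra $S\subset\mathfrak{gl}(V)$, the Cartan prolong $(V,S)_{*,\underline M}$ is the graded Lie algebra of vector fields $\sum_i f_i\partial_i$ in the indeterminates $x_1,\dots,x_m$ (here $x_i$ is dual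 to $v_i$, and $v_i$ is identified with $\partial_i$) with components $V$ in degree $-1$; the linear vector fields representing $S$ in degree $0$; and, in degree $d\ge 1$, all vector fields with homogeneous coefficients of degree $d+1$ in $\mathcal O(m;\underline M)$ whose brackets with $V$ lie in the component of degree $d-1$. **The Buttin superalgebra.** For $\mu\in K$ and $\underline N=(N_1,N_2)$, let $\mathfrak b_\mu(2;\underline N)$ consist of the functions $f\in\mathcal O(2;\underline N|3)$ in even indeterminates $q_1,q_2$ (with divided powers) and odd ones $\xi_1,\xi_2,\tau$ such that $$(1-\mu E)\frac{\partial f}{\partial\tau}=\mu\sum_i\frac{\partial^2f}{\partial q_i\partial\xi_i},\qquad E=\sum_i q_i\frac{\partial}{\partial q_i},$$ with the contact bracket $$\{f,g\}=(1-E)(f)\frac{\partial g}{\partial\tau}+\frac{\partial f}{\partial\tau}(1-E)(g)+\sum_i\Big(\frac{\partial f}{\partial q_i}\frac{\partial g}{\partial\xi_i}+\frac{\partial f}{\partial\xi_i}\frac{\partial g}{\partial q_i}\Big),$$ the squaring of an odd element given by $f\mapsto(1-E)(f)\frac{\partial f}{\partial\tau}+\sum_i\frac{\partial f}{\partial q_i}\frac{\partial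 f}{\partial\xi_i}$, and the parity of the element with generating function $f$ equal to $p(f)+1$. Let $\mathfrak b_\mu(2;2;\underline N)$ be the same superalgebra regraded by $\deg\xi_i=0$, $\deg q_i=\deg\tau=1$ (the element with generating function $f$ has degree $\deg f-1$). Let $\mathbf F$ denote the desuperization, that is, forgetting the superstructure (parity and squaring). **Claim (a).** In each of the following five cases one has $\mathfrak g_k=0$ for $k<-1$; the algebra $\mathfrak g_0$ acts faithfully on $\mathfrak g_{-1}$; the space $\mathfrak g_{-1}$ has a basis $v_1,\dots,v_4$ of root vectors with $v_i$ of weight $-\rho_i$; and for every such basis and every $\underline M\in\{1,2,\dots,\infty\}^4$ the Cartan prolong $(\mathfrak g_{-1},\mathfrak g_0)_{*,\underline M}$ of the non-positive part of $\mathfrak g$ is isomorphic, as a graded Lie algebra, to $\mathbf F(\mathfrak b_\mu(2;2;\underline N))$: 1. $A_1$, $r=(100)$: $\mu=\lambda$, $\rho=\big((1,0,0),(1,1,0),(1,1,1),(1,2,1)\big)$, $\underline N=(M_2,M_3)$; 2. $A_1$, $r=(001)$: $\mu=\lambda^{-1}$, $\rho=\big((0,0,1),(0,1,1),(1,1,1),(1,2,1)\big)$,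 $\underline N=(M_2,M_3)$; 3. $A_2$, $r=(100)$: $\mu=\lambda$, $\rho=\big((1,0,0),(1,1,0),(1,0,1),(1,1,1)\big)$, $\underline N=(M_1,M_4)$; 4. $A_2$, $r=(010)$: $\mu=\lambda^{-1}$, $\rho=\big((0,1,0),(1,1,0),(0,1,1),(1,1,1)\big)$, $\underline N=(M_1,M_4)$; 5. $A_2$, $r=(001)$: $\mu=\lambda/(1+\lambda)$, $\rho=\big((0,0,1),(1,0,1),(0,1,1),(1,1,1)\big)$, $\underline N=(M_1,M_4)$. **Claim (b).** Let $r=(100)$, and denote the objects related to $A_2$ by a tilde. There are bases $\partial_1,\dots,\partial_4$ of $\mathfrak g_{-1}$ (for $A_1$) and $\tilde\partial_1,\dots,\tilde\partial_4$ of $\tilde{\mathfrak g}_{-1}$ (for $A_2$), consisting of root vectors of the weights $-\rho_i$ listed in cases 1 and 3, respectively, in which the Lie algebra of operators induced by $\mathfrak g_0$ on $\mathfrak g_{-1}$ is generated by $$x_1\partial_2+x_3\partial_4,\quad \lambda x_2\partial_1+(1+\lambda)x_4\partial_3,\quad x_2\partial_3,\quad x_3\partial_2,$$ and the one induced by $\tilde{\mathfrak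 g}_0$ on $\tilde{\mathfrak g}_{-1}$ is generated by $$x_1\tilde\partial_2+x_3\tilde\partial_4,\quad (\lambda+1)x_2\tilde\partial_1+\lambda x_4\tilde\partial_3,\quad x_1\tilde\partial_3+\tfrac{\lambda+1}{\lambda}x_2\tilde\partial_4,\quad \lambda(x_3\tilde\partial_1+x_4\tilde\partial_2)$$ (here $x_i\partial_j$ is the operator that sends $\partial_i$ to $\partial_j$ and the other basis vectors to $0$), and such that the change of basis $$\tilde\partial_1\mapsto\partial_2,\quad\tilde\partial_2\mapsto\partial_4,\quad\tilde\partial_3\mapsto\partial_1,\quad\tilde\partial_4\mapsto\partial_3$$ is an isomorphism of pairs: together with some Lie algebra isomorphism $\psi:\tilde{\mathfrak g}_0\to\mathfrak g_0$, the linear map $\varphi$ that it defines satisfies $\varphi([x,v])=[\psi(x),\varphi(v)]$ for all $x\in\tilde{\mathfrak g}_0$, $v\in\tilde{\mathfrak g}_{-1}$. -/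

import Mathlib

set_option linter.unusedSectionVars false

namespace WeisfeilerKac

noncomputable section

/-! ### Divided powers -/

/-- The algebra of divided powers in the indeterminates `u i`, `i : ι`, with coefficients in `K`: its
basis consists of the monomials `u^(r)`, `r : ι → ℕ`. -/
def DP (ι K : Type*) [Zero K] : Type _ := (ι → ℕ) →₀ K

namespace DP

variable {ι K : Type*} [Fintype ι] [DecidableEq ι] [Field K]

instance : AddCommGroup (DP ι K) := inferInstanceAs (AddCommGroup ((ι → ℕ) →₀ K))
instance : Module K (DP ι K) := inferInstanceAs (Module K ((ι → ℕ) →₀ K))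

/-- The element `a u^(r)`. -/
def mono (r : ι → ℕ) : K →ₗ[K] DP ι K := Finsupp.lsingle r

/-- The coefficient of `u^(r)`. -/
def coeff (r : ι → ℕ) : DP ι K →ₗ[K] K := Finsupp.lapply r

/-- The multi-binomial coefficient `(r + s)! / (r! s!)`. -/
def binom (r s : ι → ℕ) : ℕ := ∏ i, (r i + s i).choose (r i)

/-- The linear map on divided powers that is given on the lines spanned by the monomials. -/
def lift {M : Type*} [AddCommGroup M] [Module K M] (g : (ι → ℕ) → K →ₗ[K] M) : DP ι K →ₗ[K] M :=
  Finsupp.lsum K g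

/-- The multiplication `u^(r) u^(s) = binom (r + s, r) u^(r + s)`. -/
def mulLin : DP ι K →ₗ[K] DP ι K →ₗ[K] DP ι K :=
  lift fun r => (LinearMap.lsmul K (DP ι K →ₗ[K] DP ι K)).flip
    (lift fun s => (binom r s : K) • (mono (r + s) : K →ₗ[K] DP ι K))

instance : Mul (DP ι K) := ⟨fun f g => mulLin f g⟩
instance : One (DP ι K) := ⟨mono 0 1⟩

theorem mul_def (f g : DP ι K) : f * g = mulLin f g := rfl
theorem one_def : (1 : DP ι K) = mono 0 1 := rfl

theorem lift_mono {M : Type*} [AddCommGroup M] [Module K M] (g : (ι → ℕ) → K →ₗ[K] M)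
    (r : ι → ℕ) (a : K) : lift g (mono r a) = g r a :=
  Finsupp.lsum_single K g r a

theorem mono_mul_mono (r s : ι → ℕ) (a b : K) :
    (mono r a * mono s b : DP ι K) = mono (r + s) (binom r s * (a * b)) := by
  rw [mul_def, mulLin, lift_mono, LinearMap.flip_apply, LinearMap.lsmul_apply,
    LinearMap.smul_apply, lift_mono, LinearMap.smul_apply, ← map_smul, ← map_smul]
  congr 1
  simp only [smul_eq_mul]
  ring

@[elab_as_elim]
theorem induction {p : DP ι K → Prop} (f : DP ι K) (h0 : p 0)
    (hadd : ∀ f g, p f → p g → p (f + g)) (hm : ∀ r a, p (mono r a)) : p f :=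
  Finsupp.induction_linear f h0 hadd hm

theorem binom_comm (r s : ι → ℕ) : binom r s = binom s r := by
  unfold binom
  refine Finset.prod_congr rfl fun i _ => ?_
  rw [add_comm, Nat.choose_symm_add]

theorem binom_assoc (r s t : ι → ℕ) :
    binom (r + s) t * binom r s = binom r (s + t) * binom s t := by
  unfold binom
  rw [← Finset.prod_mul_distrib, ← Finset.prod_mul_distrib]
  refine Finset.prod_congr rfl fun i _ => ?_
  simp only [Pi.add_apply]
  have := Nat.choose_mul (n := r i + s i + t i) (k := r i + s i) (s := r i) 
  rw [this (by omega), ← add_assoc]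
  congr 2 <;> omega

theorem binom_zero (r : ι → ℕ) : binom 0 r = 1 := by
  simp [binom]

protected theorem mul_add (f g h : DP ι K) : f * (g + h) = f * g + f * h := map_add _ _ _
protected theorem add_mul (f g h : DP ι K) : (f + g) * h = f * h + g * h := by
  simp only [mul_def, map_add, LinearMap.add_apply]
protected theorem zero_mul (f : DP ι K) : 0 * f = 0 := by
  simp only [mul_def, map_zero, LinearMap.zero_apply]
protected theorem mul_zero (f : DP ι K) : f * 0 = 0 := map_zero _

protected theorem mul_comm (f g : DP ι K) : f * g = g * f := by
  refine DP.induction f (by rw [DP.zero_mul, DP.mul_zero])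
    (fun a b ha hb => by rw [DP.mul_add, DP.add_mul, ha, hb]) fun r a => ?_
  refine DP.induction g (by rw [DP.zero_mul, DP.mul_zero])
    (fun a b ha hb => by rw [DP.mul_add, DP.add_mul, ha, hb]) fun s b => ?_
  rw [mono_mul_mono, mono_mul_mono, add_comm, binom_comm, mul_comm a b]

protected theorem mul_assoc (f g h : DP ι K) : f * g * h = f * (g * h) := by
  refine DP.induction f (by simp only [DP.zero_mul])
    (fun a b ha hb => by simp only [DP.add_mul, ha, hb]) fun r a => ?_
  refine DP.induction g (by simp only [DP.zero_mul, DP.mul_zero])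
    (fun a b ha hb => by simp only [DP.add_mul, DP.mul_add, ha, hb]) fun s b => ?_
  refine DP.induction h (by simp only [DP.mul_zero])
    (fun a b ha hb => by simp only [DP.mul_add, ha, hb]) fun t c => ?_
  simp only [mono_mul_mono, add_assoc]
  congr 1
  have := congrArg (Nat.cast : ℕ → K) (binom_assoc r s t)
  push_cast at this
  linear_combination (a * b * c) * this

protected theorem one_mul (f : DP ι K) : 1 * f = f := by
  refine DP.induction f (by simp only [DP.mul_zero])
    (fun a b ha hb => by simp only [DP.mul_add, ha, hb]) fun r a => ?_
  rw [one_def, mono_mul_mono, binom_zero]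
  simp

instance : CommRing (DP ι K) :=
  { (inferInstance : AddCommGroup (DP ι K)) with
    mul := (· * ·)
    one := 1
    left_distrib := DP.mul_add
    right_distrib := DP.add_mul
    zero_mul := DP.zero_mul
    mul_zero := DP.mul_zero
    mul_assoc := DP.mul_assoc
    mul_comm := DP.mul_comm
    one_mul := DP.one_mul
    mul_one := fun f => by rw [DP.mul_comm, DP.one_mul] }

instance : Algebra K (DP ι K) :=
  Algebra.ofModule (fun c f g => by simp only [mul_def, map_smul, LinearMap.smul_apply])
    (fun c f g => by simp only [mul_def, map_smul])

/-- The indeterminate `u i`. -/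
def X (i : ι) : DP ι K := mono (Pi.single i 1) 1

/-- The distinguished partial derivative as a linear map: the coefficient of `u^(r)` in `∂ᵢ f` is
that of `u^(r + eᵢ)` in `f`. -/
def pdLin (i : ι) : DP ι K →ₗ[K] DP ι K :=
  Finsupp.lcomapDomain (fun r : ι → ℕ => r + Pi.single i 1) (add_left_injective _)

theorem coeff_pdLin (i : ι) (r : ι → ℕ) (f : DP ι K) :
    coeff r (pdLin i f) = coeff (r + Pi.single i 1) f := rfl

theorem ext {f g : DP ι K} (h : ∀ r, coeff r f = coeff r g) : f = g := Finsupp.ext h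

theorem coeff_mono (r s : ι → ℕ) (a : K) :
    coeff s (mono r a : DP ι K) = if r = s then a else 0 := by
  classical
  exact Finsupp.single_apply

theorem pdLin_mono_add (i : ι) (r : ι → ℕ) (a : K) :
    pdLin i (mono (r + Pi.single i 1) a : DP ι K) = mono r a := by
  refine ext fun s => ?_
  simp only [coeff_pdLin, coeff_mono, add_left_inj]

theorem pdLin_mono_zero (i : ι) (r : ι → ℕ) (a : K) (h : r i = 0) :
    pdLin i (mono r a : DP ι K) = 0 := by
  refine ext fun s => ?_
  rw [coeff_pdLin, coeff_mono, if_neg, map_zero]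
  rintro rfl
  simp at h

theorem exists_eq_add_single (i : ι) (r : ι → ℕ) (h : r i ≠ 0) :
    ∃ s : ι → ℕ, r = s + Pi.single i 1 := by
  refine ⟨r - Pi.single i 1, ?_⟩
  funext j
  by_cases hj : j = i
  · subst hj; simp; omega
  · simp [Pi.single_eq_of_ne hj]

theorem binom_pascal (i : ι) (r s : ι → ℕ) :
    binom (r + Pi.single i 1) (s + Pi.single i 1) =
      binom (r + Pi.single i 1) s + binom r (s + Pi.single i 1) := by
  have e : ∀ t u : ι → ℕ, binom t u = (t i + u i).choose (t i) *
      ∏ j ∈ Finset.univ.erase i, (t j + u j).choose (t j) := fun t u =>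
    (Finset.mul_prod_erase Finset.univ _ (Finset.mem_univ i)).symm
  rw [e, e (r + Pi.single i 1) s, e r]
  have h1 : ∀ t u t' u' : ι → ℕ, (∀ j, j ≠ i → t j = t' j) → (∀ j, j ≠ i → u j = u' j) →
      ∏ j ∈ Finset.univ.erase i, (t j + u j).choose (t j) =
      ∏ j ∈ Finset.univ.erase i, (t' j + u' j).choose (t' j) := by
    intro t u t' u' h h'
    refine Finset.prod_congr rfl fun j hj => ?_
    rw [h j (Finset.ne_of_mem_erase hj), h' j (Finset.ne_of_mem_erase hj)]
  rw [h1 (r + Pi.single i 1) (s + Pi.single i 1) r s, h1 (r + Pi.single i 1) s r s,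
    h1 r (s + Pi.single i 1) r s, ← add_mul]
  · congr 1
    simp only [Pi.add_apply, Pi.single_eq_same]
    rw [show r i + 1 + (s i + 1) = (r i + 1 + s i) + 1 by omega, Nat.choose_succ_succ,
      show r i + (s i + 1) = r i + 1 + s i by omega, add_comm]
  all_goals intro j hj; simp [Pi.single_eq_of_ne hj]

theorem binom_single_zero (i : ι) (r s : ι → ℕ) (h : s i = 0) :
    binom (r + Pi.single i 1) s = binom r s := by
  unfold binom
  refine Finset.prod_congr rfl fun j _ => ?_
  by_cases hj : j = i
  · subst hj; simp [h]
  · simp [Pi.single_eq_of_ne hj]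

theorem pdLin_mul (i : ι) (f g : DP ι K) :
    pdLin i (f * g) = f • pdLin i g + g • pdLin i f := by
  simp only [smul_eq_mul]
  refine DP.induction f (by simp)
    (fun a b ha hb => by simp only [add_mul, mul_add, map_add, ha, hb]; abel) fun r a => ?_
  refine DP.induction g (by simp)
    (fun a b ha hb => by simp only [add_mul, mul_add, map_add, ha, hb]; abel) fun s b => ?_
  rw [mono_mul_mono]
  by_cases hr : r i = 0
  · by_cases hs : s i = 0
    · simp [pdLin_mono_zero, hr, hs]
    · obtain ⟨s, rfl⟩ := exists_eq_add_single i s hs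
      rw [← add_assoc, pdLin_mono_add, pdLin_mono_add, pdLin_mono_zero i r a hr, mul_zero, add_zero,
        mono_mul_mono, binom_comm, binom_single_zero i s r hr, binom_comm]
  · obtain ⟨r, rfl⟩ := exists_eq_add_single i r hr
    by_cases hs : s i = 0
    · rw [add_right_comm, pdLin_mono_add, pdLin_mono_add, pdLin_mono_zero i s b hs, mul_zero,
        zero_add, mono_mul_mono, binom_single_zero i r s hs, binom_comm, add_comm, mul_comm a b]
    · obtain ⟨s, rfl⟩ := exists_eq_add_single i s hs
      rw [← add_assoc, pdLin_mono_add, pdLin_mono_add, pdLin_mono_add, mono_mul_mono, mono_mul_mono,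
        binom_pascal, show s + Pi.single i 1 + r = r + Pi.single i 1 + s by abel, ← map_add,
        binom_comm (s + Pi.single i 1) r]
      push_cast
      congr 1
      ring

/-- The distinguished partial derivative `∂ᵢ`, that is, `∂ᵢ (uⱼ^(k)) = δᵢⱼ uⱼ^(k - 1)`. -/
def pd (i : ι) : Derivation K (DP ι K) (DP ι K) := Derivation.mk' (pdLin i) (pdLin_mul i)

theorem coeff_pd (i : ι) (r : ι → ℕ) (f : DP ι K) :
    coeff r (pd i f) = coeff (r + Pi.single i 1) f := rfl

theorem pd_comm (i j : ι) (f : DP ι K) : pd i (pd j f) = pd j (pd i f) := by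
  refine ext fun r => ?_
  simp only [coeff_pd, add_right_comm]

/-- The span of the monomials `u^(r)` with `r ∈ S`. -/
def monoSpan (S : Set (ι → ℕ)) : Submodule K (DP ι K) := Submodule.span K ((mono · 1) '' S)

theorem mem_monoSpan {S : Set (ι → ℕ)} {f : DP ι K} :
    f ∈ monoSpan S ↔ ∀ r, coeff r f ≠ 0 → r ∈ S := by
  have h : (monoSpan S : Submodule K (DP ι K)) = Finsupp.supported K K S :=
    (Finsupp.supported_eq_span_single K S).symm
  rw [h]
  refine (Finsupp.mem_supported K (M := K) f).trans ?_
  refine ⟨fun h r hr => h (Finsupp.mem_support_iff.2 hr), fun h r hr => h r ?_⟩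
  exact Finsupp.mem_support_iff.1 hr

theorem mono_mem_monoSpan {S : Set (ι → ℕ)} {r : ι → ℕ} (h : r ∈ S) (a : K) :
    (mono r a : DP ι K) ∈ monoSpan S := by
  rw [mem_monoSpan]
  intro s hs
  rw [coeff_mono] at hs
  split_ifs at hs with h'
  · exact h' ▸ h
  · exact absurd rfl hs

theorem pd_mem_monoSpan {S T : Set (ι → ℕ)} {i : ι} (h : ∀ r, r + Pi.single i 1 ∈ S → r ∈ T)
    {f : DP ι K} (hf : f ∈ monoSpan S) : pd i f ∈ monoSpan T := by
  rw [mem_monoSpan] at *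
  exact fun r hr => h r (hf _ hr)

theorem mul_mem_monoSpan {S T U : Set (ι → ℕ)}
    (h : ∀ r ∈ S, ∀ s ∈ T, r + s ∈ U ∨ (binom r s : K) = 0) {f g : DP ι K}
    (hf : f ∈ monoSpan S) (hg : g ∈ monoSpan T) : f * g ∈ monoSpan U := by
  refine Submodule.span_induction ?_ (by simp) (fun a b _ _ ha hb => ?_) (fun c a _ ha => ?_) hf
  · rintro _ ⟨r, hr, rfl⟩
    refine Submodule.span_induction ?_ (by simp) (fun a b _ _ ha hb => ?_) (fun c a _ ha => ?_) hg
    · rintro _ ⟨s, hs, rfl⟩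
      simp only [mono_mul_mono]
      rcases h r hr s hs with h | h
      · exact mono_mem_monoSpan h _
      · rw [h, zero_mul, map_zero]; exact zero_mem _
    · rw [mul_add]; exact add_mem ha hb
    · rw [mul_smul_comm]; exact Submodule.smul_mem _ _ ha
  · rw [add_mul]; exact add_mem ha hb
  · rw [smul_mul_assoc]; exact Submodule.smul_mem _ _ ha

/-- The multi-indices `r` with `r i < 2 ^ N i` for all `i`, where `2 ^ ∞ = ∞`. -/
def box (N : ι → ℕ∞) : Set (ι → ℕ) := {r | ∀ i, ∀ n : ℕ, N i = n → r i < 2 ^ n}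

theorem two_dvd_choose {a b n : ℕ} (ha : a < 2 ^ n) (hb : b < 2 ^ n) (h : 2 ^ n ≤ a + b) :
    2 ∣ (a + b).choose a := by
  have hn : n ≠ 0 := by rintro rfl; omega
  by_contra hd
  have h1 := Nat.Prime.emultiplicity_choose' Nat.prime_two (n := b) (k := a)
    (b := n + 1 + (Nat.log 2 (b + a))) (by omega)
  rw [add_comm b a, emultiplicity_eq_zero.2 hd] at h1
  have h2 : (Finset.card {i ∈ Finset.Ico 1 (n + 1 + Nat.log 2 (a + b)) |
      2 ^ i ≤ a % 2 ^ i + b % 2 ^ i} : ℕ∞) = 0 := by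
    rw [← h1]
  rw [Nat.cast_eq_zero, Finset.card_eq_zero] at h2
  have : n ∈ ({i ∈ Finset.Ico 1 (n + 1 + Nat.log 2 (a + b)) |
      2 ^ i ≤ a % 2 ^ i + b % 2 ^ i} : Finset ℕ) := by
    rw [Finset.mem_filter, Finset.mem_Ico, Nat.mod_eq_of_lt ha, Nat.mod_eq_of_lt hb]
    omega
  rw [h2] at this
  simp at this

/-- The subalgebra `𝒪(ι; N)` of divided powers, spanned by the `u^(r)` with `r i < 2 ^ N i`. -/
def trunc [CharP K 2] (N : ι → ℕ∞) : Subalgebra K (DP ι K) :=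
  (monoSpan (box N)).toSubalgebra
    (mono_mem_monoSpan (fun _ _ _ => by simp) 1)
    (fun f g hf hg => by
      refine mul_mem_monoSpan (fun r hr s hs => ?_) hf hg
      by_cases h : r + s ∈ box N
      · exact Or.inl h
      · right
        simp only [box, Set.mem_ofPred_eq, not_forall, not_lt] at h
        obtain ⟨i, n, hn, hi⟩ := h
        rw [CharP.cast_eq_zero_iff K 2]
        exact (two_dvd_choose (hr i n hn) (hs i n hn) hi).trans
          (Finset.dvd_prod_of_mem _ (Finset.mem_univ i)))

theorem mem_trunc [CharP K 2] {N : ι → ℕ∞} {f : DP ι K} : f ∈ trunc N ↔ f ∈ monoSpan (box N) :=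
  Iff.rfl

theorem pd_mem_trunc [CharP K 2] {N : ι → ℕ∞} (i : ι) {f : DP ι K} (hf : f ∈ trunc N) :
    pd i f ∈ trunc N :=
  pd_mem_monoSpan (S := box N) (T := box N)
    (fun _ hr j n hn => lt_of_le_of_lt (Nat.le_add_right _ _) (hr j n hn)) hf

/-- The elements that are homogeneous of degree `d` when `deg (u i) = w i`. -/
def homog (w : ι → ℕ) (d : ℕ) : Submodule K (DP ι K) := monoSpan {r | ∑ i, w i * r i = d}

theorem pd_mem_homog {w : ι → ℕ} {d : ℕ} (i : ι) {f : DP ι K} (hf : f ∈ homog w (d + w i)) :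
    pd i f ∈ homog w d := by
  refine pd_mem_monoSpan (fun r hr => ?_) hf
  simp only [Set.mem_ofPred_eq, Pi.add_apply, mul_add, Finset.sum_add_distrib] at hr ⊢
  have h : ∑ j, w j * (Pi.single i 1 : ι → ℕ) j = w i := by
    rw [Finset.sum_eq_single i (fun j _ hj => by rw [Pi.single_eq_of_ne hj, mul_zero]) (by simp),
      Pi.single_eq_same, mul_one]
  omega

theorem mul_mem_homog {w : ι → ℕ} {d e : ℕ} {f g : DP ι K} (hf : f ∈ homog w d)
    (hg : g ∈ homog w e) : f * g ∈ homog w (d + e) := by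
  refine mul_mem_monoSpan (fun r hr s hs => Or.inl ?_) hf hg
  simp only [Set.mem_ofPred_eq, Pi.add_apply, mul_add, Finset.sum_add_distrib] at hr hs ⊢
  rw [hr, hs]

end DP

/-! ### Vector fields and Cartan prolongs -/

section Prolong

open DP

variable {ι K : Type*} [Fintype ι] [DecidableEq ι] [Field K]

/-- The distinguished derivation `∑ i, f i ∂ᵢ` of the algebra of divided powers. -/
def vectorField : (ι → DP ι K) →ₗ[K] Derivation K (DP ι K) (DP ι K) where
  toFun f := ∑ i, f i • pd i
  map_add' f g := by simp only [Pi.add_apply, add_smul, Finset.sum_add_distrib]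
  map_smul' c f := by simp only [Pi.smul_apply, smul_assoc, Finset.smul_sum, RingHom.id_apply]

theorem vectorField_apply (f : ι → DP ι K) (g : DP ι K) :
    vectorField f g = ∑ i, f i * pd i g := by
  have h : ∀ s : Finset ι, (∑ i ∈ s, f i • pd i : Derivation K (DP ι K) (DP ι K)) g =
      ∑ i ∈ s, f i * pd i g := by
    intro s
    induction s using Finset.induction_on with
    | empty => simp
    | insert a s ha ih =>
      rw [Finset.sum_insert ha, Finset.sum_insert ha, Derivation.add_apply, ih]
      rfl
  exact h _

theorem lie_vectorField (f g : ι → DP ι K) : ⁅vectorField f, vectorField g⁆ =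
    vectorField fun j => vectorField f (g j) - vectorField g (f j) := by
  ext h
  have e : ∀ f g : ι → DP ι K, vectorField f (vectorField g h) =
      vectorField (fun j => vectorField f (g j)) h + ∑ i, ∑ j, f i * g j * pd i (pd j h) := by
    intro f g
    simp only [vectorField_apply, map_sum, Derivation.leibniz, smul_eq_mul, Finset.mul_sum,
      Finset.sum_mul]
    rw [Finset.sum_comm, ← Finset.sum_add_distrib]
    simp only [← Finset.sum_add_distrib]
    rw [Finset.sum_comm]
    refine Finset.sum_congr rfl fun i _ => Finset.sum_congr rfl fun j _ => ?_
    ring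
  have h1 : ∑ i, ∑ j, f i * g j * pd i (pd j h) = ∑ i, ∑ j, g i * f j * pd i (pd j h) := by
    rw [Finset.sum_comm]
    refine Finset.sum_congr rfl fun i _ => Finset.sum_congr rfl fun j _ => ?_
    rw [pd_comm]; ring
  rw [Derivation.commutator_apply, e, e, h1]
  have h2 : vectorField (fun j => vectorField f (g j) - vectorField g (f j)) =
      vectorField (fun j => vectorField f (g j)) - vectorField (fun j => vectorField g (f j)) :=
    map_sub vectorField _ _
  rw [h2, Derivation.sub_apply]
  abel

variable [CharP K 2]

/-- The vector fields `∑ i, f i ∂ᵢ` whose coefficients are homogeneous of degree `d` and lie in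
`𝒪(ι; N)`. When all indeterminates have degree 1, their degree is `d - 1`. -/
def vectPiece (N : ι → ℕ∞) (d : ℕ) : Submodule K (Derivation K (DP ι K) (DP ι K)) :=
  (Submodule.pi Set.univ fun _ => (trunc N).toSubmodule ⊓ homog (fun _ => 1) d).map vectorField

theorem lie_mem_vectPiece {N : ι → ℕ∞} {d e : ℕ} {D E : Derivation K (DP ι K) (DP ι K)}
    (hD : D ∈ vectPiece N (d + 1)) (hE : E ∈ vectPiece N (e + 1)) :
    ⁅D, E⁆ ∈ vectPiece N (d + e + 1) := by
  obtain ⟨f, hf, rfl⟩ := hD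
  obtain ⟨g, hg, rfl⟩ := hE
  rw [lie_vectorField]
  refine ⟨_, fun j _ => ?_, rfl⟩
  have hf := fun i => hf i (Set.mem_univ i)
  have hg := fun i => hg i (Set.mem_univ i)
  simp only [vectorField_apply]
  refine sub_mem (sum_mem fun i _ => ⟨?_, ?_⟩) (sum_mem fun i _ => ⟨?_, ?_⟩)
  · exact mul_mem (S := Subalgebra K (DP ι K)) (hf i).1 (pd_mem_trunc i (hg j).1)
  · rw [show d + e + 1 = d + 1 + e by ring]
    exact mul_mem_homog (hf i).2 (pd_mem_homog i (hg j).2)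
  · exact mul_mem (S := Subalgebra K (DP ι K)) (hg i).1 (pd_mem_trunc i (hf j).1)
  · rw [show d + e + 1 = e + 1 + d by ring]
    exact mul_mem_homog (hg i).2 (pd_mem_homog i (hf j).2)

attribute [local instance 100] LieRing.ofAssociativeRing

variable {V : Type*} [AddCommGroup V] [Module K V]

/-- The vector field with constant coefficients that represents an element of `V`; the basis vector
`b i` is represented by `∂ᵢ`. -/
def constField (b : Module.Basis ι K V) : V →ₗ[K] Derivation K (DP ι K) (DP ι K) :=
  vectorField ∘ₗ LinearMap.pi fun i => (mono 0).comp (b.coord i)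

/-- The homogeneous components of the Cartan prolong `(V, S)_{*, N}`, where `S` is a Lie algebra of
linear operators on `V`, in its realization by vector fields on the space with coordinates dual to
the basis `b`. The component `prolongPiece b S N d` is that of degree `d - 1`: it is `V` for `d = 0`,
it is `S` for `d = 1`, and afterwards it consists of all vector fields of degree `d - 1` with
coefficients in `𝒪(ι; N)` whose brackets with `V` lie in the preceding component. -/
def prolongPiece (b : Module.Basis ι K V) (S : LieSubalgebra K (Module.End K V)) (N : ι → ℕ∞) :
    ℕ → Submodule K (Derivation K (DP ι K) (DP ι K))
  | 0 => LinearMap.range (constField b)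
  | 1 => vectPiece N 1 ⊓
    { carrier := {D | ∃ s ∈ S, ∀ v, ⁅D, constField b v⁆ = constField b (s v)}
      zero_mem' := ⟨0, zero_mem _, fun v => by simp⟩
      add_mem' := by
        rintro D E ⟨s, hs, h⟩ ⟨t, ht, h'⟩
        exact ⟨s + t, add_mem hs ht, fun v => by rw [add_lie, h, h', LinearMap.add_apply, map_add]⟩
      smul_mem' := by
        rintro c D ⟨s, hs, h⟩
        exact ⟨c • s, S.smul_mem c hs, fun v => by
          rw [smul_lie, h, LinearMap.smul_apply, map_smul]⟩ }
  | d + 2 => vectPiece N (d + 2) ⊓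
    { carrier := {D | ∀ v, ⁅D, constField b v⁆ ∈ prolongPiece b S N (d + 1)}
      zero_mem' := fun v => by rw [zero_lie]; exact zero_mem _
      add_mem' := fun h h' v => by rw [add_lie]; exact add_mem (h v) (h' v)
      smul_mem' := fun c _ h v => by rw [smul_lie]; exact Submodule.smul_mem _ c (h v) }

variable (b : Module.Basis ι K V) (S : LieSubalgebra K (Module.End K V)) (N : ι → ℕ∞)

theorem prolongPiece_le (d : ℕ) : prolongPiece b S N (d + 1) ≤ vectPiece N (d + 1) := by
  cases d <;> exact inf_le_left

theorem lie_constField_mem {d : ℕ} {D : Derivation K (DP ι K) (DP ι K)}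
    (hD : D ∈ prolongPiece b S N (d + 1)) (v : V) :
    ⁅D, constField b v⁆ ∈ prolongPiece b S N d := by
  cases d with
  | zero =>
    obtain ⟨-, s, hs, h⟩ := hD
    exact ⟨s v, (h v).symm⟩
  | succ d => exact hD.2 v

theorem mem_prolongPiece_one {D : Derivation K (DP ι K) (DP ι K)} :
    D ∈ prolongPiece b S N 1 ↔ D ∈ vectPiece N 1 ∧
      ∃ s ∈ S, ∀ v, ⁅D, constField b v⁆ = constField b (s v) := Iff.rfl

theorem mem_prolongPiece_add_two {d : ℕ} {D : Derivation K (DP ι K) (DP ι K)} :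
    D ∈ prolongPiece b S N (d + 2) ↔ D ∈ vectPiece N (d + 2) ∧
      ∀ v, ⁅D, constField b v⁆ ∈ prolongPiece b S N (d + 1) := Iff.rfl

theorem lie_mem_prolongPiece_succ (d e : ℕ) {D E : Derivation K (DP ι K) (DP ι K)}
    (hD : D ∈ prolongPiece b S N (d + 1)) (hE : E ∈ prolongPiece b S N (e + 1)) :
    ⁅D, E⁆ ∈ prolongPiece b S N (d + e + 1) := by
  induction hn : d + e generalizing d e D E with
  | zero =>
    obtain ⟨rfl, rfl⟩ : d = 0 ∧ e = 0 := by omega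
    rw [zero_add, mem_prolongPiece_one] at *
    obtain ⟨hD', s, hs, h⟩ := hD
    obtain ⟨hE', t, ht, h'⟩ := hE
    have hvp := lie_mem_vectPiece (d := 0) (e := 0) hD' hE'
    refine ⟨hvp, ⁅s, t⁆, S.lie_mem hs ht, fun v => ?_⟩
    rw [lie_lie, h', h, h, h', ← map_sub]
    rfl
  | succ n ih =>
    have hvp := lie_mem_vectPiece (prolongPiece_le b S N d hD) (prolongPiece_le b S N e hE)
    rw [hn] at hvp
    rw [mem_prolongPiece_add_two]
    refine ⟨hvp, fun v => ?_⟩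
    rw [lie_lie]
    have key : ∀ (d e : ℕ) {D E : Derivation K (DP ι K) (DP ι K)},
        D ∈ prolongPiece b S N (d + 1) → E ∈ prolongPiece b S N (e + 1) → d + e = n + 1 →
        ⁅D, ⁅E, constField b v⁆⁆ ∈ prolongPiece b S N (n + 1) := by
      intro d e D E hD hE hn
      cases e with
      | zero =>
        obtain ⟨w, hw⟩ := lie_constField_mem b S N hE v
        rw [← hw]
        obtain rfl : d = n + 1 := by omega
        exact lie_constField_mem b S N hD w
      | succ e =>
        exact ih d e hD (lie_constField_mem b S N hE v) (by omega)
    exact sub_mem (key d e hD hE hn) (key e d hE hD (by omega))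

theorem lie_constField_constField (v w : V) : ⁅constField b v, constField b w⁆ = 0 := by
  have h : ∀ i j : ι, ∀ x : V, pd i (mono 0 (b.coord j x) : DP ι K) = 0 := fun i j x =>
    pdLin_mono_zero i 0 _ rfl
  unfold constField
  rw [LinearMap.comp_apply, LinearMap.comp_apply, lie_vectorField]
  have h' : ∀ (f : ι → DP ι K) (x : V) (j : ι),
      vectorField f (LinearMap.pi (fun i => (mono 0).comp (b.coord i)) x j : DP ι K) = 0 := by
    intro f x j
    rw [vectorField_apply]
    exact Finset.sum_eq_zero fun i _ => by
      rw [LinearMap.pi_apply, LinearMap.comp_apply, h, mul_zero]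
  simp only [h', sub_zero]
  exact map_zero vectorField

/-- The Cartan prolong `(V, S)_{*, N}`, the direct sum of its homogeneous components. -/
def prolong : LieSubalgebra K (Derivation K (DP ι K) (DP ι K)) where
  __ := ⨆ d, prolongPiece b S N d
  lie_mem' := by
    intro D E hD hE
    change _ ∈ ⨆ d, prolongPiece b S N d
    refine Submodule.iSup_induction _ (motive := fun D => ⁅D, E⁆ ∈ ⨆ d, prolongPiece b S N d) hD
      (fun d D hD => ?_) (by simp) (fun _ _ h h' => by rw [add_lie]; exact add_mem h h')
    refine Submodule.iSup_induction _ (motive := fun E => ⁅D, E⁆ ∈ ⨆ d, prolongPiece b S N d) hE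
      (fun e E hE => ?_) (by simp) (fun _ _ h h' => by rw [lie_add]; exact add_mem h h')
    cases e with
    | zero =>
      obtain ⟨v, rfl⟩ := hE
      cases d with
      | zero =>
        obtain ⟨w, rfl⟩ := hD
        rw [lie_constField_constField]
        exact zero_mem _
      | succ d => exact Submodule.mem_iSup_of_mem d (lie_constField_mem b S N hD v)
    | succ e =>
      cases d with
      | zero =>
        obtain ⟨w, rfl⟩ := hD
        rw [← lie_skew]
        exact neg_mem (Submodule.mem_iSup_of_mem e (lie_constField_mem b S N hE w))
      | succ d => exact Submodule.mem_iSup_of_mem _ (lie_mem_prolongPiece_succ b S N d e hD hE)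

end Prolong

/-! ### The Buttin superalgebra -/

section Identities

/-! Identities for the contact bracket, stated for commuting derivations of a commutative ring. -/

variable {K R : Type*} [Field K] [CommRing R] [Algebra K R]

/-- The contact bracket. -/
def cBr (T E a0 a1 b0 b1 : Derivation K R R) (f g : R) : R :=
  (f - E f) * T g + T f * (g - E g) + ((a0 f * b0 g + b0 f * a0 g) + (a1 f * b1 g + b1 f * a1 g))

/-- The half of the contact bracket of `f` with itself. -/
def cSq (T E a0 a1 b0 b1 : Derivation K R R) (f : R) : R :=
  (f - E f) * T f + (a0 f * b0 f + a1 f * b1 f)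

/-- The expression `(1 - m E) T f - m Δ f`. -/
def cDiv (T E a0 a1 b0 b1 : Derivation K R R) (m : R) (f : R) : R :=
  T f - m * E (T f) - m * (a0 (b0 f) + a1 (b1 f))

/-- The commutation relations between the Euler operator `E` and the partial derivatives `T` in `τ`,
`a i` in `q i`, `b i` in `ξ i`. -/
structure ButtinComm (T E a0 a1 b0 b1 : Derivation K R R) : Prop where
  hE0 : ∀ f, E (a0 f) = a0 (E f) - a0 f
  hE1 : ∀ f, E (a1 f) = a1 (E f) - a1 f
  hEb0 : ∀ f, E (b0 f) = b0 (E f)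
  hEb1 : ∀ f, E (b1 f) = b1 (E f)
  hET : ∀ f, E (T f) = T (E f)
  h1 : ∀ f, a1 (a0 f) = a0 (a1 f)
  h2 : ∀ f, b0 (a0 f) = a0 (b0 f)
  h3 : ∀ f, b1 (a0 f) = a0 (b1 f)
  h4 : ∀ f, b0 (a1 f) = a1 (b0 f)
  h5 : ∀ f, b1 (a1 f) = a1 (b1 f)
  h6 : ∀ f, b1 (b0 f) = b0 (b1 f)
  h7 : ∀ f, T (a0 f) = a0 (T f)
  h8 : ∀ f, T (a1 f) = a1 (T f)
  h9 : ∀ f, T (b0 f) = b0 (T f)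
  h10 : ∀ f, T (b1 f) = b1 (T f)

variable [CharP R 2] {T E a0 a1 b0 b1 : Derivation K R R}

set_option maxHeartbeats 1000000

theorem cBr_jacobi (H : ButtinComm T E a0 a1 b0 b1) (f g h : R) :
    cBr T E a0 a1 b0 b1 f (cBr T E a0 a1 b0 b1 g h) =
      cBr T E a0 a1 b0 b1 (cBr T E a0 a1 b0 b1 f g) h +
      cBr T E a0 a1 b0 b1 g (cBr T E a0 a1 b0 b1 f h) := by
  have e2 : (2 : R) = 0 := CharTwo.two_eq_zero
  unfold cBr
  simp only [map_add, map_sub, Derivation.leibniz, smul_eq_mul, H.hE0, H.hE1, H.hEb0, H.hEb1,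
    H.hET, H.h1, H.h2, H.h3, H.h4, H.h5, H.h6, H.h7, H.h8, H.h9, H.h10]
  rw [← sub_eq_zero]
  ring_nf
  simp only [e2, mul_zero, add_zero, sub_zero]

theorem cDiv_cBr (H : ButtinComm T E a0 a1 b0 b1) (m : R)
    (hTm : T m = 0) (hEm : E m = 0) (hm0 : a0 m = 0) (hm1 : a1 m = 0)
    (hm2 : b0 m = 0) (hm3 : b1 m = 0) (f g : R) (k1 : T (T f) = 0) (k2 : T (T g) = 0)
    (k3 : T (T (E f)) = 0) (k4 : T (T (E g)) = 0)
    (l1 : b0 (b0 f) = 0) (l2 : b0 (b0 g) = 0) (l3 : b1 (b1 f) = 0) (l4 : b1 (b1 g) = 0)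
    (hf : cDiv T E a0 a1 b0 b1 m f = 0) (hg : cDiv T E a0 a1 b0 b1 m g = 0) :
    cDiv T E a0 a1 b0 b1 m (cBr T E a0 a1 b0 b1 f g) = 0 := by
  have e2 : (2 : R) = 0 := CharTwo.two_eq_zero
  have key : cDiv T E a0 a1 b0 b1 m (cBr T E a0 a1 b0 b1 f g) =
      cBr T E a0 a1 b0 b1 (cDiv T E a0 a1 b0 b1 m f) g +
      cBr T E a0 a1 b0 b1 f (cDiv T E a0 a1 b0 b1 m g) +
      cDiv T E a0 a1 b0 b1 m f * T g + T f * cDiv T E a0 a1 b0 b1 m g := by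
    unfold cBr cDiv
    simp only [map_add, map_sub, Derivation.leibniz, smul_eq_mul, H.hE0, H.hE1, H.hEb0, H.hEb1,
      H.hET, H.h1, H.h2, H.h3, H.h4, H.h5, H.h6, H.h7, H.h8, H.h9, H.h10,
      hTm, hEm, hm0, hm1, hm2, hm3, k1, k2, k3, k4, l1, l2, l3, l4, map_zero]
    rw [← sub_eq_zero]
    ring_nf
    simp only [e2, mul_zero, neg_zero, add_zero, sub_zero]
  rw [key, hf, hg]
  simp [cBr]

theorem cDiv_cSq (H : ButtinComm T E a0 a1 b0 b1) (m : R)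
    (hTm : T m = 0) (hEm : E m = 0) (hm0 : a0 m = 0) (hm1 : a1 m = 0)
    (hm2 : b0 m = 0) (hm3 : b1 m = 0) (f : R) (k1 : T (T f) = 0) (k3 : T (T (E f)) = 0)
    (l1 : b0 (b0 f) = 0) (l3 : b1 (b1 f) = 0) (s1 : T f * T f = 0)
    (s2 : T (E f) * T (E f) = 0) (s3 : a0 (b0 f) * a0 (b0 f) = 0) (s4 : a1 (b1 f) * a1 (b1 f) = 0)
    (hf : cDiv T E a0 a1 b0 b1 m f = 0) :
    cDiv T E a0 a1 b0 b1 m (cSq T E a0 a1 b0 b1 f) = 0 := by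
  have e2 : (2 : R) = 0 := CharTwo.two_eq_zero
  have key : cDiv T E a0 a1 b0 b1 m (cSq T E a0 a1 b0 b1 f) =
      cBr T E a0 a1 b0 b1 f (cDiv T E a0 a1 b0 b1 m f) + cDiv T E a0 a1 b0 b1 m f * T f +
      T f * T f + m * (T (E f) * T (E f)) + m * (a0 (b0 f) * a0 (b0 f)) +
      m * (a1 (b1 f) * a1 (b1 f)) := by
    unfold cBr cDiv cSq
    simp only [map_add, map_sub, Derivation.leibniz, smul_eq_mul, H.hE0, H.hE1, H.hEb0, H.hEb1,
      H.hET, H.h1, H.h2, H.h3, H.h4, H.h5, H.h6, H.h7, H.h8, H.h9, H.h10,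
      hTm, hEm, hm0, hm1, hm2, hm3, k1, k3, l1, l3, map_zero]
    rw [← sub_eq_zero]
    ring_nf
    simp only [e2, mul_zero, add_zero, sub_zero]
  rw [key, hf, s1, s2, s3, s4]
  simp [cBr]

theorem cSq_cBr (H : ButtinComm T E a0 a1 b0 b1) (f g : R)
    (k1 : T (T g) = 0) (l1 : b0 (b0 g) = 0) (l3 : b1 (b1 g) = 0)
    (s1 : T f * T f = 0) (s2 : b0 f * b0 f = 0) (s3 : b1 f * b1 f = 0) :
    cBr T E a0 a1 b0 b1 (cSq T E a0 a1 b0 b1 f) g =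
      cBr T E a0 a1 b0 b1 f (cBr T E a0 a1 b0 b1 f g) := by
  have e2 : (2 : R) = 0 := CharTwo.two_eq_zero
  rw [← sub_eq_zero]
  have key : cBr T E a0 a1 b0 b1 (cSq T E a0 a1 b0 b1 f) g -
      cBr T E a0 a1 b0 b1 f (cBr T E a0 a1 b0 b1 f g) =
      (T f * T f) * (E g - E (E g)) - (b0 f * b0 f) * a0 (a0 g) - (b1 f * b1 f) * a1 (a1 g) := by
    unfold cBr cSq
    simp only [map_add, map_sub, Derivation.leibniz, smul_eq_mul, H.hE0, H.hE1, H.hEb0, H.hEb1,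
      H.hET, H.h1, H.h2, H.h3, H.h4, H.h5, H.h6, H.h7, H.h8, H.h9, H.h10, k1, l1, l3]
    rw [← sub_eq_zero]
    ring_nf
    simp only [e2, mul_zero, neg_zero, add_zero, sub_zero]
  rw [key, s1, s2, s3]
  simp

end Identities

/-- A Lie superalgebra over a field of characteristic 2. The bracket of two odd elements is obtained
from the squaring `x ↦ x²` by `[x, y] = (x + y)² - x² - y²`; in particular `[x, x] = 0` for all `x`,
so that the bracket makes the whole space a Lie algebra. -/
structure LieSuperalgebraTwo (K : Type*) [Field K] where
  /-- The underlying space. -/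
  carrier : Type*
  [lieRing : LieRing carrier]
  [lieAlgebra : LieAlgebra K carrier]
  /-- The even part `part 0` and the odd part `part 1`. -/
  part : ZMod 2 → Submodule K carrier
  isCompl_part : IsCompl (part 0) (part 1)
  lie_mem_part : ∀ (i j : ZMod 2) (x y : carrier), x ∈ part i → y ∈ part j → ⁅x, y⁆ ∈ part (i + j)
  /-- The squaring. -/
  sq : part 1 → part 0
  sq_smul : ∀ (c : K) (x : part 1), sq (c • x) = c ^ 2 • sq x
  sq_add : ∀ x y : part 1, (sq (x + y) : carrier) = sq x + sq y + ⁅(x : carrier), (y : carrier)⁆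
  sq_lie : ∀ (x : part 1) (y : carrier),
    ⁅(sq x : carrier), y⁆ = ⁅(x : carrier), ⁅(x : carrier), y⁆⁆

/-- The desuperization `F(S)`: the Lie algebra obtained from the Lie superalgebra `S` by forgetting
the parity and the squaring. -/
def LieSuperalgebraTwo.desuper {K : Type*} [Field K] (S : LieSuperalgebraTwo K) : Type _ := S.carrier

instance {K : Type*} [Field K] (S : LieSuperalgebraTwo K) : LieRing S.desuper := S.lieRing
instance {K : Type*} [Field K] (S : LieSuperalgebraTwo K) : LieAlgebra K S.desuper := S.lieAlgebra

section Buttin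

open DP

variable {K : Type*} [Field K]

/-- The indeterminates `q 0, q 1` (even), `ξ 0, ξ 1` and `τ` (odd). -/
abbrev BVar := Fin 2 ⊕ Fin 2 ⊕ Unit

/-- The even indeterminate `q i`. -/
abbrev qv (i : Fin 2) : BVar := Sum.inl i
/-- The odd indeterminate `ξ i`. -/
abbrev xiv (i : Fin 2) : BVar := Sum.inr (Sum.inl i)
/-- The odd indeterminate `τ`. -/
abbrev tauv : BVar := Sum.inr (Sum.inr ())

/-- The operator `E = q₀ ∂/∂q₀ + q₁ ∂/∂q₁`. -/
def eulerQ : Derivation K (DP BVar K) (DP BVar K) :=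
  (X (qv 0) : DP BVar K) • pd (qv 0) + (X (qv 1) : DP BVar K) • pd (qv 1)

/-- The operator `Δ = ∑ i, ∂²/∂qᵢ∂ξᵢ`. -/
def bvLaplace (f : DP BVar K) : DP BVar K :=
  pd (qv 0) (pd (xiv 0) f) + pd (qv 1) (pd (xiv 1) f)

/-- The contact bracket `(1 - E) f ∂g/∂τ + ∂f/∂τ (1 - E) g + ∑ i, (∂f/∂qᵢ ∂g/∂ξᵢ + ∂f/∂ξᵢ ∂g/∂qᵢ)`
of generating functions. -/
def contactBracket (f g : DP BVar K) : DP BVar K :=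
  (f - eulerQ f) * pd tauv g + pd tauv f * (g - eulerQ g) +
    ((pd (qv 0) f * pd (xiv 0) g + pd (xiv 0) f * pd (qv 0) g) +
      (pd (qv 1) f * pd (xiv 1) g + pd (xiv 1) f * pd (qv 1) g))

/-- The half of the contact bracket of `f` with itself,
`(1 - E) f ∂f/∂τ + ∑ i, ∂f/∂qᵢ ∂f/∂ξᵢ`. -/
def contactSq (f : DP BVar K) : DP BVar K :=
  (f - eulerQ f) * pd tauv f +
    (pd (qv 0) f * pd (xiv 0) f + pd (qv 1) f * pd (xiv 1) f)

theorem DP.pd_X (i j : BVar) : pd i (X j : DP BVar K) = if i = j then 1 else 0 := by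
  split_ifs with h
  · subst h
    have := pdLin_mono_add i (0 : BVar → ℕ) (1 : K)
    rw [zero_add] at this
    exact this
  · exact pdLin_mono_zero i _ _ (Pi.single_eq_of_ne h _)

theorem eulerQ_apply (f : DP BVar K) :
    eulerQ f = X (qv 0) * pd (qv 0) f + X (qv 1) * pd (qv 1) f := rfl

theorem pd_eulerQ (i : BVar) (f : DP BVar K) :
    pd i (eulerQ f) = eulerQ (pd i f) +
      ((if i = qv 0 then pd (qv 0) f else 0) + (if i = qv 1 then pd (qv 1) f else 0)) := by
  simp only [eulerQ_apply, map_add, Derivation.leibniz, pd_X, smul_eq_mul, pd_comm i (qv 0),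
    pd_comm i (qv 1)]
  split_ifs <;> ring

theorem buttinComm : ButtinComm (K := K) (pd tauv) eulerQ (pd (qv 0)) (pd (qv 1)) (pd (xiv 0))
    (pd (xiv 1)) where
  hE0 f := by rw [pd_eulerQ]; simp
  hE1 f := by rw [pd_eulerQ]; simp
  hEb0 f := by rw [pd_eulerQ]; simp
  hEb1 f := by rw [pd_eulerQ]; simp
  hET f := by rw [pd_eulerQ]; simp
  h1 f := pd_comm _ _ f
  h2 f := pd_comm _ _ f
  h3 f := pd_comm _ _ f
  h4 f := pd_comm _ _ f
  h5 f := pd_comm _ _ f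
  h6 f := pd_comm _ _ f
  h7 f := pd_comm _ _ f
  h8 f := pd_comm _ _ f
  h9 f := pd_comm _ _ f
  h10 f := pd_comm _ _ f

theorem X_mul_pd_mono (i : BVar) (r : BVar → ℕ) (a : K) :
    X i * pd i (mono r a : DP BVar K) = mono r (r i * a) := by
  by_cases h : r i = 0
  · have := pdLin_mono_zero i r a h
    change X i * pdLin i _ = _
    rw [this, h]; simp
  · obtain ⟨s, rfl⟩ := exists_eq_add_single i r h
    have := pdLin_mono_add i s a
    change X i * pdLin i _ = _
    rw [this, X, mono_mul_mono, add_comm s]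
    congr 2
    · unfold binom
      rw [Finset.prod_eq_single i (fun j _ hj => by rw [Pi.single_eq_of_ne hj]; simp) (by simp)]
      simp
    · rw [one_mul]

theorem coeff_X_mul_pd (i : BVar) (r : BVar → ℕ) (f : DP BVar K) :
    coeff r (X i * pd i f) = r i * coeff r f := by
  refine DP.induction f (by simp)
    (fun f g hf hg => by rw [map_add, mul_add, map_add, hf, hg, map_add, mul_add]) fun s a => ?_
  rw [X_mul_pd_mono, coeff_mono, coeff_mono]
  split_ifs with h
  · rw [h]
  · simp

theorem eulerQ_mem_monoSpan {S : Set (BVar → ℕ)} {f : DP BVar K} (hf : f ∈ monoSpan S) :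
    eulerQ f ∈ monoSpan S := by
  rw [mem_monoSpan] at *
  intro r hr
  refine hf r fun h => hr ?_
  rw [eulerQ_apply, map_add, coeff_X_mul_pd, coeff_X_mul_pd, h]
  simp

/-- The parity of the monomial `u^(r)`. -/
def parity (r : BVar → ℕ) : ZMod 2 := ((r (xiv 0) + r (xiv 1) + r tauv : ℕ) : ZMod 2)

/-- The functions of parity `p`. -/
def parityPart (p : ZMod 2) : Submodule K (DP BVar K) := monoSpan {r | parity r = p}

theorem pd_q_mem_parityPart {p : ZMod 2} (i : Fin 2) {f : DP BVar K} (hf : f ∈ parityPart p) :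
    pd (qv i) f ∈ parityPart p := by
  refine pd_mem_monoSpan (fun r hr => ?_) hf
  simpa [parity] using hr

theorem pd_xi_mem_parityPart {p : ZMod 2} (i : Fin 2) {f : DP BVar K} (hf : f ∈ parityPart p) :
    pd (xiv i) f ∈ parityPart (p + 1) := by
  refine pd_mem_monoSpan (fun r hr => ?_) hf
  have h2 : (1 : ZMod 2) + 1 = 0 := by decide
  obtain rfl : _ = p := hr
  change parity r = parity _ + 1
  fin_cases i <;> simp [parity] <;> linear_combination -h2

theorem pd_tau_mem_parityPart {p : ZMod 2} {f : DP BVar K} (hf : f ∈ parityPart p) :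
    pd tauv f ∈ parityPart (p + 1) := by
  refine pd_mem_monoSpan (fun r hr => ?_) hf
  have h2 : (1 : ZMod 2) + 1 = 0 := by decide
  obtain rfl : _ = p := hr
  change parity r = parity _ + 1
  simp [parity]
  linear_combination -h2

theorem mul_mem_parityPart {p p' : ZMod 2} {f g : DP BVar K} (hf : f ∈ parityPart p)
    (hg : g ∈ parityPart p') : f * g ∈ parityPart (p + p') := by
  refine mul_mem_monoSpan (fun r hr s hs => Or.inl ?_) hf hg
  obtain rfl : _ = p := hr
  obtain rfl : _ = p' := hs
  change parity _ = _
  simp [parity]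
  ring

theorem contactBracket_mem_parityPart {p p' : ZMod 2} {f g : DP BVar K} (hf : f ∈ parityPart p)
    (hg : g ∈ parityPart p') : contactBracket f g ∈ parityPart (p + p' + 1) := by
  have e1 : p + (p' + 1) = p + p' + 1 := by ring
  have e2 : p + 1 + p' = p + p' + 1 := by ring
  have h := fun {a b : DP BVar K} (h : a ∈ parityPart p) (h' : b ∈ parityPart (p' + 1)) =>
    e1 ▸ mul_mem_parityPart h h'
  have h' := fun {a b : DP BVar K} (h : a ∈ parityPart (p + 1)) (h' : b ∈ parityPart p') =>
    e2 ▸ mul_mem_parityPart h h'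
  refine add_mem (add_mem (h ?_ ?_) (h' ?_ ?_))
    (add_mem (add_mem (h ?_ ?_) (h' ?_ ?_)) (add_mem (h ?_ ?_) (h' ?_ ?_)))
  · exact sub_mem hf (eulerQ_mem_monoSpan hf)
  · exact pd_tau_mem_parityPart hg
  · exact pd_tau_mem_parityPart hf
  · exact sub_mem hg (eulerQ_mem_monoSpan hg)
  · exact pd_q_mem_parityPart _ hf
  · exact pd_xi_mem_parityPart _ hg
  · exact pd_xi_mem_parityPart _ hf
  · exact pd_q_mem_parityPart _ hg
  · exact pd_q_mem_parityPart _ hf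
  · exact pd_xi_mem_parityPart _ hg
  · exact pd_xi_mem_parityPart _ hf
  · exact pd_q_mem_parityPart _ hg

theorem contactSq_mem_parityPart {f : DP BVar K} (hf : f ∈ parityPart 0) :
    contactSq f ∈ parityPart 1 := by
  have h := fun {a b : DP BVar K} (h : a ∈ parityPart 0) (h' : b ∈ parityPart (0 + 1)) =>
    (show (0 : ZMod 2) + (0 + 1) = 1 by decide) ▸ mul_mem_parityPart h h'
  exact add_mem (h (sub_mem hf (eulerQ_mem_monoSpan hf)) (pd_tau_mem_parityPart hf))
    (add_mem (h (pd_q_mem_parityPart _ hf) (pd_xi_mem_parityPart _ hf))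
      (h (pd_q_mem_parityPart _ hf) (pd_xi_mem_parityPart _ hf)))

variable [CharP K 2]

instance : CharP (DP BVar K) 2 := by
  have : Nontrivial (DP BVar K) := ⟨⟨1, 0, fun h => by
    have := congrArg (coeff 0) h
    rw [one_def, coeff_mono, map_zero] at this
    simp at this⟩⟩
  exact charP_of_injective_algebraMap (algebraMap K (DP BVar K)).injective 2

/-- The shearing vector `(N, 1, 1, 1)`: the odd indeterminates occur in degree at most 1. -/
def bShear (N : Fin 2 → ℕ∞) : BVar → ℕ∞ := Sum.elim N fun _ => 1

theorem pd_pd_eq_zero {N : Fin 2 → ℕ∞} (i : Fin 2 ⊕ Unit) {f : DP BVar K}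
    (hf : f ∈ trunc (bShear N)) : pd (Sum.inr i) (pd (Sum.inr i) f) = 0 := by
  refine ext fun r => ?_
  rw [coeff_pd, coeff_pd, map_zero]
  by_contra h
  have := mem_monoSpan.1 (mem_trunc.1 hf) _ h (Sum.inr i) 1 rfl
  simp at this

theorem mul_self_eq_zero_of_odd {f : DP BVar K} (hf : f ∈ parityPart 1) : f * f = 0 := by
  refine Submodule.span_induction ?_ (by simp) (fun a b _ _ ha hb => ?_) (fun c a _ ha => ?_) hf
  · rintro _ ⟨r, hr, rfl⟩
    simp only [mono_mul_mono]
    have h0 : ∃ i, r i ≠ 0 := by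
      by_contra! h
      have : parity r = 0 := by simp [parity, h]
      rw [show parity r = 1 from hr] at this
      exact absurd this (by decide)
    obtain ⟨i, hi⟩ := h0
    have h2 : 2 ∣ binom r r := by
      refine Dvd.dvd.trans ?_ (Finset.dvd_prod_of_mem _ (Finset.mem_univ i))
      rw [← two_mul]
      exact Nat.two_dvd_centralBinom_of_one_le (Nat.one_le_iff_ne_zero.2 hi)
    rw [(CharP.cast_eq_zero_iff K 2 _).2 h2, zero_mul, map_zero]
  · have e2 : (2 : DP BVar K) = 0 := CharTwo.two_eq_zero
    linear_combination ha + hb + (a * b) * e2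
  · rw [smul_mul_smul_comm, ha, smul_zero]

theorem contactBracket_add_left (f g h : DP BVar K) :
    contactBracket (f + g) h = contactBracket f h + contactBracket g h := by
  simp only [contactBracket, map_add]
  ring

theorem contactBracket_add_right (f g h : DP BVar K) :
    contactBracket f (g + h) = contactBracket f g + contactBracket f h := by
  simp only [contactBracket, map_add]
  ring

theorem contactBracket_smul (c : K) (f g : DP BVar K) :
    contactBracket f (c • g) = c • contactBracket f g := by
  simp only [contactBracket, Derivation.map_smul, smul_add, mul_smul_comm, smul_sub, mul_sub]

theorem contactSq_smul (c : K) (f : DP BVar K) : contactSq (c • f) = c ^ 2 • contactSq f := by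
  simp only [contactSq, Derivation.map_smul, ← smul_sub, smul_mul_smul_comm, smul_add, pow_two]

theorem contactSq_add (f g : DP BVar K) :
    contactSq (f + g) = contactSq f + contactSq g + contactBracket f g := by
  simp only [contactSq, contactBracket, map_add]
  ring

/-- The space of generating functions with the contact bracket. -/
def Contact (K : Type*) [Field K] : Type _ := DP BVar K

instance : AddCommGroup (Contact K) := inferInstanceAs (AddCommGroup (DP BVar K))
instance : Module K (Contact K) := inferInstanceAs (Module K (DP BVar K))

instance : LieRing (Contact K) where
  bracket f g := contactBracket (K := K) f g
  add_lie := contactBracket_add_left (K := K)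
  lie_add := contactBracket_add_right (K := K)
  lie_self f := by
    change contactBracket (K := K) _ _ = 0
    have e2 : (2 : DP BVar K) = 0 := CharTwo.two_eq_zero
    have : contactBracket (K := K) f f = 2 * contactSq (K := K) f := by
      simp only [contactBracket, contactSq]; ring
    rw [this, e2, zero_mul]
  leibniz_lie f g h := cBr_jacobi (K := K) (R := DP BVar K) buttinComm f g h

theorem lie_def (f g : Contact K) : ⁅f, g⁆ = contactBracket (K := K) f g := rfl

instance : LieAlgebra K (Contact K) where
  lie_smul := contactBracket_smul (K := K)

theorem contactBracket_mem_trunc {N : Fin 2 → ℕ∞} {f g : DP BVar K} (hf : f ∈ trunc (bShear N))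
    (hg : g ∈ trunc (bShear N)) : contactBracket f g ∈ trunc (bShear N) := by
  have e := fun {f : DP BVar K} (hf : f ∈ trunc (bShear N)) =>
    (show eulerQ f ∈ trunc (bShear N) from eulerQ_mem_monoSpan hf)
  have d := fun (i : BVar) {f : DP BVar K} (hf : f ∈ trunc (bShear N)) => pd_mem_trunc i hf
  exact add_mem (add_mem (mul_mem (sub_mem hf (e hf)) (d _ hg)) (mul_mem (d _ hf) (sub_mem hg (e hg))))
    (add_mem (add_mem (mul_mem (d _ hf) (d _ hg)) (mul_mem (d _ hf) (d _ hg)))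
      (add_mem (mul_mem (d _ hf) (d _ hg)) (mul_mem (d _ hf) (d _ hg))))

theorem contactSq_mem_trunc {N : Fin 2 → ℕ∞} {f : DP BVar K} (hf : f ∈ trunc (bShear N)) :
    contactSq f ∈ trunc (bShear N) := by
  have e := (show eulerQ f ∈ trunc (bShear N) from eulerQ_mem_monoSpan hf)
  have d := fun (i : BVar) => pd_mem_trunc i hf
  exact add_mem (mul_mem (sub_mem hf e) (d _))
    (add_mem (mul_mem (d _) (d _)) (mul_mem (d _) (d _)))

/-- The linear map `f ↦ (1 - μ E) ∂f/∂τ - μ Δ f`. -/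
def buttinDiv (μ : K) : DP BVar K →ₗ[K] DP BVar K where
  toFun f := pd tauv f - μ • eulerQ (pd tauv f) - μ • bvLaplace f
  map_add' f g := by simp only [bvLaplace, map_add, smul_add]; abel
  map_smul' c f := by
    simp only [bvLaplace, Derivation.map_smul, smul_sub, smul_add, RingHom.id_apply, smul_comm c μ]

theorem buttinDiv_eq (μ : K) (f : DP BVar K) : buttinDiv μ f = cDiv (pd tauv) eulerQ (pd (qv 0))
    (pd (qv 1)) (pd (xiv 0)) (pd (xiv 1)) (algebraMap K _ μ) f := by
  simp only [buttinDiv, cDiv, bvLaplace, LinearMap.coe_mk, AddHom.coe_mk, Algebra.smul_def]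

/-- The Lie algebra underlying the Buttin superalgebra: the generating functions `f` in
`𝒪(2; N | 3)` such that `(1 - μ E) ∂f/∂τ = μ Δ f`, with the contact bracket. -/
def buttinAlgebra (μ : K) (N : Fin 2 → ℕ∞) : LieSubalgebra K (Contact K) where
  carrier := {f | f ∈ trunc (K := K) (bShear N) ∧ buttinDiv μ f = 0}
  zero_mem' := ⟨zero_mem (trunc (K := K) (bShear N)), map_zero _⟩
  add_mem' := fun {f g} hf hg => ⟨add_mem (S := Subalgebra K (DP BVar K)) hf.1 hg.1,
    ((buttinDiv μ).map_add f g).trans (by rw [hf.2, hg.2, add_zero])⟩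
  smul_mem' := fun c f hf => ⟨(trunc (K := K) (bShear N)).smul_mem hf.1 c,
    ((buttinDiv μ).map_smul c f).trans (by rw [hf.2, smul_zero])⟩
  lie_mem' := by
    rintro f g ⟨hf, hf'⟩ ⟨hg, hg'⟩
    have e := fun {f : DP BVar K} (hf : f ∈ trunc (bShear N)) =>
      (show eulerQ f ∈ trunc (bShear N) from eulerQ_mem_monoSpan hf)
    refine ⟨contactBracket_mem_trunc hf hg, ?_⟩
    refine (buttinDiv_eq μ _).trans ?_
    exact cDiv_cBr buttinComm _ (by simp) (by simp) (by simp) (by simp) (by simp) (by simp) f g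
      (pd_pd_eq_zero _ hf) (pd_pd_eq_zero _ hg) (pd_pd_eq_zero _ (e hf)) (pd_pd_eq_zero _ (e hg))
      (pd_pd_eq_zero _ hf) (pd_pd_eq_zero _ hg) (pd_pd_eq_zero _ hf) (pd_pd_eq_zero _ hg)
      ((buttinDiv_eq μ _).symm.trans hf') ((buttinDiv_eq μ _).symm.trans hg')

theorem mem_buttinAlgebra {μ : K} {N : Fin 2 → ℕ∞} {f : Contact K} :
    f ∈ buttinAlgebra μ N ↔ f ∈ trunc (K := K) (bShear N) ∧ buttinDiv μ f = 0 := Iff.rfl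

theorem contactSq_mem_buttinAlgebra {μ : K} {N : Fin 2 → ℕ∞} {f : Contact K}
    (hf : f ∈ buttinAlgebra μ N) (h0 : f ∈ parityPart (K := K) 0) :
    contactSq (K := K) f ∈ buttinAlgebra μ N := by
  obtain ⟨hf, hf'⟩ := hf
  have e := fun {f : DP BVar K} (hf : f ∈ trunc (bShear N)) =>
    (show eulerQ f ∈ trunc (bShear N) from eulerQ_mem_monoSpan hf)
  refine ⟨contactSq_mem_trunc hf, ?_⟩
  refine (buttinDiv_eq μ _).trans ?_
  exact cDiv_cSq buttinComm _ (by simp) (by simp) (by simp) (by simp) (by simp) (by simp) f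
    (pd_pd_eq_zero _ hf) (pd_pd_eq_zero _ (e hf)) (pd_pd_eq_zero _ hf) (pd_pd_eq_zero _ hf)
    (mul_self_eq_zero_of_odd (zero_add (1 : ZMod 2) ▸ pd_tau_mem_parityPart h0))
    (mul_self_eq_zero_of_odd
      (zero_add (1 : ZMod 2) ▸ pd_tau_mem_parityPart (eulerQ_mem_monoSpan h0)))
    (mul_self_eq_zero_of_odd
      (zero_add (1 : ZMod 2) ▸ pd_q_mem_parityPart (K := K) (p := 0 + 1) _ (pd_xi_mem_parityPart _ h0)))
    (mul_self_eq_zero_of_odd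
      (zero_add (1 : ZMod 2) ▸ pd_q_mem_parityPart (K := K) (p := 0 + 1) _ (pd_xi_mem_parityPart _ h0)))
    ((buttinDiv_eq μ _).symm.trans hf')

theorem buttinDiv_mem_parityPart {μ : K} {p : ZMod 2} {f : DP BVar K} (hf : f ∈ parityPart p) :
    buttinDiv μ f ∈ parityPart (p + 1) :=
  sub_mem (sub_mem (pd_tau_mem_parityPart hf)
    (Submodule.smul_mem _ _ (eulerQ_mem_monoSpan (pd_tau_mem_parityPart hf))))
    (Submodule.smul_mem _ _ (add_mem (pd_q_mem_parityPart _ (pd_xi_mem_parityPart _ hf))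
      (pd_q_mem_parityPart _ (pd_xi_mem_parityPart _ hf))))

theorem eq_zero_of_mem_parityPart {f : DP BVar K} (h0 : f ∈ parityPart 0)
    (h1 : f ∈ parityPart 1) : f = 0 := by
  refine ext fun r => ?_
  by_contra h
  rw [map_zero] at h
  have a : parity r = 0 := mem_monoSpan.1 h0 r h
  have b : parity r = 1 := mem_monoSpan.1 h1 r h
  rw [a] at b
  exact absurd b (by decide)

theorem exists_parity_decomposition {S : Set (BVar → ℕ)} {f : DP BVar K} (hf : f ∈ monoSpan S) :
    ∃ g h, g ∈ parityPart 0 ∧ h ∈ parityPart 1 ∧ g ∈ monoSpan S ∧ h ∈ monoSpan S ∧ g + h = f := by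
  refine Submodule.span_induction ?_ ⟨0, 0, by simp⟩ ?_ ?_ hf
  · rintro _ ⟨r, hr, rfl⟩
    have h2 : ∀ p : ZMod 2, p = 0 ∨ p = 1 := by decide
    rcases h2 (parity r) with h | h
    · exact ⟨mono r 1, 0, mono_mem_monoSpan h _, zero_mem _, mono_mem_monoSpan hr _, zero_mem _,
        add_zero _⟩
    · exact ⟨0, mono r 1, zero_mem _, mono_mem_monoSpan h _, zero_mem _, mono_mem_monoSpan hr _,
        zero_add _⟩
  · rintro a b - - ⟨g, h, h1, h2, h3, h4, rfl⟩ ⟨g', h', h1', h2', h3', h4', rfl⟩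
    exact ⟨g + g', h + h', add_mem h1 h1', add_mem h2 h2', add_mem h3 h3', add_mem h4 h4', by abel⟩
  · rintro c a - ⟨g, h, h1, h2, h3, h4, rfl⟩
    exact ⟨c • g, c • h, Submodule.smul_mem _ _ h1, Submodule.smul_mem _ _ h2,
      Submodule.smul_mem _ _ h3, Submodule.smul_mem _ _ h4, by rw [smul_add]⟩

/-- The elements of the Buttin superalgebra of parity `p`; the parity of the element with the
generating function `f` is that of `f` plus 1. -/
def buttinPart (μ : K) (N : Fin 2 → ℕ∞) (p : ZMod 2) : Submodule K (buttinAlgebra μ N) :=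
  Submodule.comap (buttinAlgebra μ N).toSubmodule.subtype (parityPart (p + 1))

theorem isCompl_buttinPart (μ : K) (N : Fin 2 → ℕ∞) :
    IsCompl (buttinPart μ N 0) (buttinPart μ N 1) := by
  have e1 : (1 : ZMod 2) + 1 = 0 := by decide
  have e0 : (0 : ZMod 2) + 1 = 1 := by decide
  constructor
  · rw [Submodule.disjoint_def]
    rintro ⟨f, hf⟩ h h'
    have h : f ∈ parityPart (K := K) (0 + 1) := h
    have h' : f ∈ parityPart (K := K) (1 + 1) := h'
    rw [e0] at h
    rw [e1] at h'
    exact Subtype.ext (eq_zero_of_mem_parityPart h' h)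
  · rw [codisjoint_iff, eq_top_iff]
    rintro ⟨f, hf⟩ -
    obtain ⟨g, h, hg0, hh1, hg, hh, e⟩ := exists_parity_decomposition hf.1
    have hd : buttinDiv μ g + buttinDiv μ h = 0 := by rw [← map_add, e]; exact hf.2
    have dg : buttinDiv μ g ∈ parityPart 1 := e0 ▸ buttinDiv_mem_parityPart hg0
    have dh : buttinDiv μ h ∈ parityPart 0 := e1 ▸ buttinDiv_mem_parityPart hh1
    have zg : buttinDiv μ g = 0 := by
      refine eq_zero_of_mem_parityPart ?_ dg
      rw [eq_neg_of_add_eq_zero_left hd]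
      exact neg_mem dh
    have zh : buttinDiv μ h = 0 := by rwa [zg, zero_add] at hd
    refine Submodule.mem_sup.2 ⟨⟨h, hh, zh⟩, ?_, ⟨g, hg, zg⟩, ?_, ?_⟩
    · change h ∈ parityPart (K := K) (0 + 1)
      rwa [e0]
    · change g ∈ parityPart (K := K) (1 + 1)
      rwa [e1]
    · exact Subtype.ext ((add_comm h g).trans e)

theorem mem_buttinPart_one {μ : K} {N : Fin 2 → ℕ∞} (x : buttinPart μ N 1) :
    (x.1.1 : DP BVar K) ∈ parityPart (K := K) 0 := by
  have h : (x.1.1 : DP BVar K) ∈ parityPart (K := K) (1 + 1) := x.2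
  rwa [show (1 : ZMod 2) + 1 = 0 by decide] at h

/-- The Buttin superalgebra `𝔟_μ(2; N)` in characteristic 2. -/
def buttin (μ : K) (N : Fin 2 → ℕ∞) : LieSuperalgebraTwo K where
  carrier := buttinAlgebra μ N
  part := buttinPart μ N
  isCompl_part := isCompl_buttinPart μ N
  lie_mem_part i j x y hx hy := by
    have h := contactBracket_mem_parityPart hx hy
    have e : ∀ i j : ZMod 2, i + 1 + (j + 1) + 1 = i + j + 1 := by decide
    rw [e] at h
    exact h
  sq x := ⟨⟨contactSq (K := K) x.1.1,
    contactSq_mem_buttinAlgebra x.1.2 (mem_buttinPart_one x)⟩, by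
      have h : ∀ p : ZMod 2, p = 1 → contactSq (K := K) x.1.1 ∈ parityPart (K := K) p := by
        rintro _ rfl
        exact contactSq_mem_parityPart (mem_buttinPart_one x)
      exact h (0 + 1) (by decide)⟩
  sq_smul c x := Subtype.ext (Subtype.ext (contactSq_smul (K := K) c x.1.1))
  sq_add x y := Subtype.ext (contactSq_add (K := K) x.1.1 y.1.1)
  sq_lie x y := by
    have e0 : (0 : ZMod 2) + 1 = 1 := by decide
    have hx := mem_buttinPart_one x
    have hy := fun i => pd_pd_eq_zero (K := K) i y.2.1
    have ht := pd_tau_mem_parityPart hx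
    have hxi := fun i => pd_xi_mem_parityPart i hx
    rw [e0] at ht hxi
    exact Subtype.ext (cSq_cBr (K := K) (R := DP BVar K) buttinComm x.1.1 y.1 (hy _) (hy _) (hy _)
      (mul_self_eq_zero_of_odd ht) (mul_self_eq_zero_of_odd (hxi 0))
      (mul_self_eq_zero_of_odd (hxi 1)))

/-- The homogeneous components of `𝔟_μ(2; 2; N)`, the regrading of the Buttin superalgebra with
`deg ξᵢ = 0` and `deg qᵢ = deg τ = 1`: the component `buttinPiece μ N d` consists of the generating
functions of degree `d`, and its degree in the Lie superalgebra is `d - 1`. -/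
def buttinPiece (μ : K) (N : Fin 2 → ℕ∞) (d : ℕ) : Submodule K (buttin μ N).desuper :=
  Submodule.comap (buttinAlgebra μ N).toSubmodule.subtype
    (homog (Sum.elim (fun _ => 1) (Sum.elim (fun _ => 0) fun _ => 1)) d)

end Buttin

/-! ### Lie algebras with Cartan matrix -/

section CartanMatrix

/-- The generators `eᵢ`, `fᵢ`, `hᵢ` and `dₖ` of a Lie algebra with Cartan matrix. -/
inductive ChevalleyGen (n l : ℕ)
  | e (i : Fin n)
  | f (i : Fin n)
  | h (i : Fin n)
  | d (k : Fin l)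

variable {K : Type*} [Field K] {n l : ℕ}

/-- The free generators. -/
abbrev fgen (K : Type*) [Field K] (n l : ℕ) (x : ChevalleyGen n l) :
    FreeLieAlgebra K (ChevalleyGen n l) := FreeLieAlgebra.of K x

/-- The left-hand sides of the relations `x = 0` that define the Lie algebra `g̃(A)`, the matrix `A`
being completed by the rows of the matrix `B`. -/
inductive ChevalleyRel (A : Matrix (Fin n) (Fin n) K) (B : Matrix (Fin l) (Fin n) K) :
    FreeLieAlgebra K (ChevalleyGen n l) → Prop
  | ef (i : Fin n) : ChevalleyRel A B
      (⁅fgen K n l (.e i), fgen K n l (.f i)⁆ - fgen K n l (.h i))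
  | ef_ne (i j : Fin n) (hij : i ≠ j) : ChevalleyRel A B
      ⁅fgen K n l (.e i), fgen K n l (.f j)⁆
  | he (i j : Fin n) : ChevalleyRel A B
      (⁅fgen K n l (.h i), fgen K n l (.e j)⁆ -
        A i j • fgen K n l (.e j))
  | hf (i j : Fin n) : ChevalleyRel A B
      (⁅fgen K n l (.h i), fgen K n l (.f j)⁆ +
        A i j • fgen K n l (.f j))
  | de (k : Fin l) (j : Fin n) : ChevalleyRel A B
      (⁅fgen K n l (.d k), fgen K n l (.e j)⁆ -
        B k j • fgen K n l (.e j))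
  | df (k : Fin l) (j : Fin n) : ChevalleyRel A B
      (⁅fgen K n l (.d k), fgen K n l (.f j)⁆ +
        B k j • fgen K n l (.f j))
  | hh (i j : Fin n) : ChevalleyRel A B
      ⁅fgen K n l (.h i), fgen K n l (.h j)⁆
  | hd (i : Fin n) (k : Fin l) : ChevalleyRel A B
      ⁅fgen K n l (.h i), fgen K n l (.d k)⁆
  | dd (k m : Fin l) : ChevalleyRel A B
      ⁅fgen K n l (.d k), fgen K n l (.d m)⁆

/-- The rows of `B` complete those of the square matrix `A` to a matrix whose rank is the size of `A`,
and their number is the corank of `A`. -/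
def IsCompletion (A : Matrix (Fin n) (Fin n) K) (B : Matrix (Fin l) (Fin n) K) : Prop :=
  A.rank + l = n ∧ (Matrix.fromRows A B).rank = n

variable (A : Matrix (Fin n) (Fin n) K) (B : Matrix (Fin l) (Fin n) K)

/-- The Lie algebra `g̃(A)`. -/
def Tilde : Type _ := FreeLieAlgebra K (ChevalleyGen n l) ⧸
  LieSubmodule.lieSpan K (FreeLieAlgebra K (ChevalleyGen n l)) {x | ChevalleyRel A B x}

instance : LieRing (Tilde A B) := inferInstanceAs (LieRing (_ ⧸ LieSubmodule.lieSpan K _ _))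
instance : LieAlgebra K (Tilde A B) :=
  inferInstanceAs (LieAlgebra K (_ ⧸ LieSubmodule.lieSpan K _ _))

/-- The generators of `g̃(A)`. -/
def tildeGen (x : ChevalleyGen n l) : Tilde A B :=
  LieSubmodule.Quotient.mk (N := LieSubmodule.lieSpan K _ {x | ChevalleyRel A B x}) (fgen K n l x)

section Degree

variable {Γ X L : Type*} [AddCommMonoid Γ] [LieRing L] [LieAlgebra K L]

/-- The iterated brackets of the elements `gen x`, with their degrees when `gen x` is of degree
`deg x`. -/
inductive IsMonomial (gen : X → L) (deg : X → Γ) : Γ → L → Prop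
  | gen (x : X) : IsMonomial gen deg (deg x) (gen x)
  | lie {α β : Γ} {x y : L} : IsMonomial gen deg α x → IsMonomial gen deg β y →
      IsMonomial gen deg (α + β) ⁅x, y⁆

/-- The span of the iterated brackets of the elements `gen x` that are of degree `α`. -/
def degPiece (K : Type*) [Field K] [LieAlgebra K L] (gen : X → L) (deg : X → Γ) (α : Γ) :
    Submodule K L :=
  Submodule.span K {x | IsMonomial gen deg α x}

theorem lie_mem_degPiece {gen : X → L} {deg : X → Γ} {α β : Γ} {x y : L}
    (hx : x ∈ degPiece K gen deg α) (hy : y ∈ degPiece K gen deg β) :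
    ⁅x, y⁆ ∈ degPiece K gen deg (α + β) := by
  refine Submodule.span_induction ?_ (by simp)
    (fun a b _ _ ha hb => by rw [add_lie]; exact add_mem ha hb)
    (fun c a _ ha => by rw [smul_lie]; exact Submodule.smul_mem _ _ ha) hx
  intro x hx
  refine Submodule.span_induction ?_ (by simp)
    (fun a b _ _ ha hb => by rw [lie_add]; exact add_mem ha hb)
    (fun c a _ ha => by rw [lie_smul]; exact Submodule.smul_mem _ _ ha) hy
  intro y hy
  exact Submodule.subset_span (.lie hx hy)

end Degree

/-- The degrees of the generators: `deg (e i) = w i`, `deg (f i) = - w i`, and `h i`, `d k` are of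
degree 0. -/
def chevalleyDeg {Γ : Type*} [AddCommGroup Γ] (w : Fin n → Γ) : ChevalleyGen n l → Γ
  | .e i => w i
  | .f i => - w i
  | .h _ => 0
  | .d _ => 0

/-- The degrees of the generators for the grading by the root lattice `ℤⁿ`. -/
abbrev rootDeg : ChevalleyGen n l → (Fin n → ℤ) := chevalleyDeg fun i => Pi.single i 1

/-- The span of the `hᵢ` and `dₖ`. -/
def tildeCartan : Submodule K (Tilde A B) :=
  Submodule.span K (Set.range (fun i => tildeGen A B (.h i)) ∪
    Set.range fun k => tildeGen A B (.d k))

/-- The maximal ideal among the ideals of `g̃(A)` that are homogeneous with respect to the grading by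
the root lattice and have zero intersection with the span of the `hᵢ` and `dₖ`. -/
def maxIdeal : LieIdeal K (Tilde A B) :=
  sSup {I : LieIdeal K (Tilde A B) |
    I.toSubmodule ≤ ⨆ α, I.toSubmodule ⊓ degPiece K (tildeGen A B) rootDeg α ∧
    I.toSubmodule ⊓ tildeCartan A B = ⊥}

/-- The Lie algebra `g(A)` with Cartan matrix `A`. -/
def Contragredient : Type _ := Tilde A B ⧸ maxIdeal A B

instance : LieRing (Contragredient A B) := inferInstanceAs (LieRing (_ ⧸ maxIdeal A B))
instance : LieAlgebra K (Contragredient A B) := inferInstanceAs (LieAlgebra K (_ ⧸ maxIdeal A B))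

/-- The generators of `g(A)`. -/
def contragredientGen (x : ChevalleyGen n l) : Contragredient A B :=
  LieSubmodule.Quotient.mk (N := maxIdeal A B) (tildeGen A B x)

/-- The derived algebra of a Lie algebra. -/
abbrev derivedIdeal (K L : Type*) [Field K] [LieRing L] [LieAlgebra K L] : LieIdeal K L :=
  ⁅(⊤ : LieIdeal K L), (⊤ : LieIdeal K L)⁆

/-- The derived algebra `g'(A)`. -/
abbrev Derived : LieIdeal K (Contragredient A B) := derivedIdeal K (Contragredient A B)

/-- The center `c` of `g(A)`, or rather its intersection with `g'(A)`. -/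
def derivedCenter : LieIdeal K (Derived A B) :=
  LieIdeal.comap (Derived A B).incl (LieAlgebra.center K (Contragredient A B))

/-- The algebra `g'(A)/c`, where `g'(A)` is the derived algebra of `g(A)` and `c` is the center. -/
def DerivedModCenter : Type _ := Derived A B ⧸ derivedCenter A B

instance : LieRing (DerivedModCenter A B) := inferInstanceAs (LieRing (_ ⧸ derivedCenter A B))
instance : LieAlgebra K (DerivedModCenter A B) :=
  inferInstanceAs (LieAlgebra K (_ ⧸ derivedCenter A B))

/-- The projection `g'(A) → g'(A)/c`. -/
def toDerivedModCenter : Derived A B →ₗ[K] DerivedModCenter A B :=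
  (LieSubmodule.Quotient.mk' (derivedCenter A B)).toLinearMap

/-- The homogeneous components of `g'(A)/c`, when `deg (e i) = w i` and `deg (f i) = - w i`. -/
def piece {Γ : Type*} [AddCommGroup Γ] (w : Fin n → Γ) (γ : Γ) :
    Submodule K (DerivedModCenter A B) :=
  ((degPiece K (contragredientGen A B) (chevalleyDeg w) γ).comap
    (Derived A B).toSubmodule.subtype).map (toDerivedModCenter A B)

/-- The component of `g'(A)/c` of the given weight. -/
abbrev rootPiece (α : Fin n → ℤ) : Submodule K (DerivedModCenter A B) :=
  piece A B (fun i => (Pi.single i 1 : Fin n → ℤ)) α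

theorem lie_mem_piece {Γ : Type*} [AddCommGroup Γ] {w : Fin n → Γ} {α β : Γ}
    {x y : DerivedModCenter A B} (hx : x ∈ piece A B w α) (hy : y ∈ piece A B w β) :
    ⁅x, y⁆ ∈ piece A B w (α + β) := by
  obtain ⟨x, hx, rfl⟩ := hx
  obtain ⟨y, hy, rfl⟩ := hy
  exact ⟨⁅x, y⁆, lie_mem_degPiece (K := K) (L := Contragredient A B) hx hy, rfl⟩

attribute [local instance 100] LieRing.ofAssociativeRing

/-- The Lie algebra of the operators on `V` that are induced by the elements of `U`, where `U` is
closed under the bracket. -/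
def inducedAction {L : Type*} [LieRing L] [LieAlgebra K L] (U V : Submodule K L)
    (hU : ∀ x ∈ U, ∀ y ∈ U, ⁅x, y⁆ ∈ U) : LieSubalgebra K (Module.End K V) where
  carrier := {s | ∃ x ∈ U, ∀ v : V, (s v : L) = ⁅x, (v : L)⁆}
  zero_mem' := ⟨0, zero_mem _, fun v => by simp⟩
  add_mem' := by
    rintro s t ⟨x, hx, hs⟩ ⟨y, hy, ht⟩
    exact ⟨x + y, add_mem hx hy, fun v => by
      rw [LinearMap.add_apply, Submodule.coe_add, hs, ht, add_lie]⟩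
  smul_mem' := by
    rintro c s ⟨x, hx, hs⟩
    exact ⟨c • x, Submodule.smul_mem _ _ hx, fun v => by
      rw [LinearMap.smul_apply, Submodule.coe_smul, hs, smul_lie]⟩
  lie_mem' := by
    rintro s t ⟨x, hx, hs⟩ ⟨y, hy, ht⟩
    refine ⟨⁅x, y⁆, hU x hx y hy, fun v => ?_⟩
    rw [lie_lie, ← ht, ← hs, ← hs, ← ht]
    rfl

/-- The component `g₀` of `g = g'(A)/c`. -/
def zeroPart (r : Fin n → ℤ) : LieSubalgebra K (DerivedModCenter A B) where
  __ := piece A B r 0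
  lie_mem' := by
    intro x y hx hy
    have h := lie_mem_piece A B (w := r) (α := 0) (β := 0) hx hy
    rw [add_zero] at h
    exact h

/-- The Lie algebra of the operators on the component `g₋₁` of `g = g'(A)/c` that are induced by the
elements of the component `g₀`. -/
def zeroAction (r : Fin n → ℤ) : LieSubalgebra K (Module.End K (piece A B r (-1))) :=
  inducedAction (piece A B r 0) (piece A B r (-1)) fun _ hx _ hy => (zeroPart A B r).lie_mem hx hy

theorem lie_mem_piece_neg_one {r : Fin n → ℤ} {x v : DerivedModCenter A B}
    (hx : x ∈ zeroPart A B r) (hv : v ∈ piece A B r (-1)) : ⁅x, v⁆ ∈ piece A B r (-1) := by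
  have h := lie_mem_piece A B (w := r) (α := 0) (β := -1) hx hv
  rwa [zero_add] at h

end CartanMatrix

/-! ### The Weisfeiler-Kac algebra -/

section WK

open Matrix

variable {K : Type*} [Field K]

/-- The first Cartan matrix of `𝔴𝔨(3; a)`. -/
def wkMatrix₁ (a : K) : Matrix (Fin 3) (Fin 3) K := !![0, a, 0; a, 0, 1; 0, 1, 0]

/-- The second Cartan matrix of `𝔴𝔨(3; a)`. -/
def wkMatrix₂ (a : K) : Matrix (Fin 3) (Fin 3) K := !![0, 1 + a, a; 1 + a, 0, 1; a, 1, 0]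

/-- A basis `b` of `g₋₁` consists of weight vectors, and the weight of `b i` is `- ρ i`. -/
def IsWeightBasis (A : Matrix (Fin 3) (Fin 3) K) {l : ℕ} (B : Matrix (Fin l) (Fin 3) K)
    (r : Fin 3 → ℤ) (ρ : Fin 4 → Fin 3 → ℤ) (b : Module.Basis (Fin 4) K (piece A B r (-1))) :
    Prop :=
  ∀ i, (b i : DerivedModCenter A B) ∈ rootPiece A B (- ρ i)

variable [CharP K 2]

/-- Let `g = g'(A)/c` be graded by `deg (e i) = r i = - deg (f i)`. This says that
`g₋₁ ⊕ g₀` is the non-positive part of `g`, that `g₀` acts faithfully on `g₋₁`, that `g₋₁` is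
four-dimensional with the weights `- ρ i`, and that, in the coordinates dual to any basis of weight
vectors and for any shearing vector `M`, the Cartan prolong of `(g₋₁, g₀)` is isomorphic, as a graded
Lie algebra, to `F(𝔟_μ(2; 2; N))` with `N = (M p, M q)`. -/
def ProlongIsButtin (A : Matrix (Fin 3) (Fin 3) K) (r : Fin 3 → ℤ) (ρ : Fin 4 → Fin 3 → ℤ)
    (p q : Fin 4) (μ : K) : Prop :=
  ∀ (l : ℕ) (B : Matrix (Fin l) (Fin 3) K), IsCompletion A B →
    (∀ k < -1, piece A B r k = ⊥) ∧
    (∀ x ∈ zeroPart A B r, (∀ v ∈ piece A B r (-1), ⁅x, v⁆ = 0) → x = 0) ∧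
    (∃ b, IsWeightBasis A B r ρ b) ∧
    ∀ b, IsWeightBasis A B r ρ b → ∀ M : Fin 4 → ℕ∞, (∀ i, 1 ≤ M i) →
      ∃ e : prolong b (zeroAction A B r) M ≃ₗ⁅K⁆ (buttin μ ![M p, M q]).desuper,
        ∀ (d : ℕ) (x : prolong b (zeroAction A B r) M),
          (x : Derivation K (DP (Fin 4) K) (DP (Fin 4) K)) ∈
            prolongPiece b (zeroAction A B r) M d ↔ e x ∈ buttinPiece μ ![M p, M q] d

attribute [local instance 100] LieRing.ofAssociativeRing

/-- The Lie algebra generated by the matrices of the operators `x₁∂₂ + x₃∂₄`,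
`a x₂∂₁ + (1 + a) x₄∂₃`, `x₂∂₃` and `x₃∂₂` on the span of `∂₁, …, ∂₄`. The operator `xᵢ∂ⱼ` sends `∂ᵢ`
to `∂ⱼ`, and the indices of the rows and columns start from 0. -/
def realization₁ (a : K) : LieSubalgebra K (Matrix (Fin 4) (Fin 4) K) :=
  LieSubalgebra.lieSpan K _
    {single 1 0 1 + single 3 2 1, single 0 1 a + single 2 3 (1 + a), single 2 1 1, single 1 2 1}

/-- The Lie algebra generated by the matrices of the operators `x₁∂₂ + x₃∂₄`,
`(a + 1) x₂∂₁ + a x₄∂₃`, `x₁∂₃ + ((a + 1) / a) x₂∂₄` and `a (x₃∂₁ + x₄∂₂)` on the span of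
`∂₁, …, ∂₄`. -/
def realization₂ (a : K) : LieSubalgebra K (Matrix (Fin 4) (Fin 4) K) :=
  LieSubalgebra.lieSpan K _
    {single 1 0 1 + single 3 2 1, single 0 1 (a + 1) + single 2 3 a,
      single 2 0 1 + single 3 1 ((a + 1) / a), single 0 2 a + single 1 3 a}

/-- The matrices in the basis `b` of the operators on `V` that belong to `S` are those of `R`. -/
def HasMatrices {V : Type*} [AddCommGroup V] [Module K V] (b : Module.Basis (Fin 4) K V)
    (S : LieSubalgebra K (Module.End K V)) (R : LieSubalgebra K (Matrix (Fin 4) (Fin 4) K)) : Prop :=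
  ∀ s : Module.End K V, s ∈ S ↔ LinearMap.toMatrix b b s ∈ R

end WK

end
end WeisfeilerKac

namespace WeisfeilerKac

noncomputable section

/-! ### The realization of a Lie algebra by vector fields -/

namespace DP

variable {ι K : Type*} [Fintype ι] [DecidableEq ι] [Field K]

/-! Everything is transported to the Buttin algebra itself, about which three facts are needed.

For infinite heights and `μ ≠ 1`, the regraded Buttin algebra is the maximal prolong of its
components of degree -1 and 0. The component of degree -1 is spanned by the commuting elements 1,
ξ₀, ξ₁, ξ₀ξ₁, and Taylor expansion along them (`Transversal.field`) represents the algebra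
faithfully by vector fields in four indeterminates. Maximality means that every family `f k` with
`[v k, f l] = [v l, f k]` is of the form `[v k, g]`. Brackets with 1, ξ₀, ξ₁ prescribe the
derivatives of `g` in τ and in the q's; the only obstruction to closedness is `∂τ f₀`, which
vanishes by `pd_tau_eq_zero_of_compat`, and divided powers integrate every closed system
(`exists_contactBracket_eq`).

The shearing vector is read off from nilpotency: the coordinates of `x` lie in 𝒪(4; M) exactly when
`(ad v i) ^ 2 ^ M i` kills `x` for every finite `M i`. In characteristic 2 the operators ad 1 and ad
ξ₀ξ₁ have square zero, while ad ξᵢ squares to the second derivative in qᵢ. Hence only the heights of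
the coordinates dual to ξ₀ and ξ₁ matter (`mem_trunc_iff_coord_mem`).

With both heights equal to 1 and `μ ≠ 0, 1`, the Buttin algebra has a basis of 16 root vectors and
is `g'(A)/c` for both Cartan matrices. By `Realization.exists_equiv` it suffices to exhibit
Chevalley generators, nondegenerate pairings of opposite root spaces and a faithful action of the
degree 0 part on the simple root vectors; this is a finite table of brackets. Since functions of
degree at most 1 cannot contain a square of q, the components of degree -1 and 0 are the same as for
infinite heights, and the facts combine in `Realization.prolongIsButtin`.

The remaining three gradings follow from the two basic ones: a transposition of simple roots turns
the Cartan matrix into a multiple of the one with another parameter, and a common factor is absorbed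
by rescaling the `f i`. For claim (b) both algebras are identified with the same Buttin algebra, so
the isomorphism of pairs is the composite of the identifications; the bases are suitable multiples
of the four ξ-monomials in two orders. -/

theorem coeff_zero_mul (f g : DP ι K) : coeff 0 (f * g) = coeff 0 f * coeff 0 g := by
  refine DP.induction f (by simp)
    (fun a b ha hb => by simp only [add_mul, map_add, ha, hb]) fun r a => ?_
  refine DP.induction g (by simp)
    (fun a b ha hb => by simp only [mul_add, map_add, ha, hb]) fun s b => ?_
  rw [mono_mul_mono, coeff_mono, coeff_mono, coeff_mono]
  by_cases hr : r = 0
  · subst hr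
    by_cases hs : s = 0
    · subst hs; simp [binom_zero]
    · simp [hs]
  · have : r + s ≠ 0 := by
      intro h
      apply hr
      funext i
      have := congrFun h i
      simp only [Pi.add_apply, Pi.zero_apply] at this ⊢
      omega
    simp [hr, this]

theorem vectorField_X (f : ι → DP ι K) (i : ι) : vectorField f (X i) = f i := by
  rw [vectorField_apply, Finset.sum_eq_single i]
  · have h : pd i (X i : DP ι K) = 1 := by
      have := pdLin_mono_add i (0 : ι → ℕ) (1 : K)
      rw [zero_add] at this
      exact this
    rw [h, mul_one]
  · intro j _ hj
    have h : pd j (X i : DP ι K) = 0 := pdLin_mono_zero j _ _ (Pi.single_eq_of_ne hj _)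
    rw [h, mul_zero]
  · simp

theorem vectorField_injective : Function.Injective (vectorField : (ι → DP ι K) →ₗ[K] _) :=
  fun f g h => funext fun i => by rw [← vectorField_X f, h, vectorField_X]

/-- The coefficient of `∂ᵢ f` at `r` is that of `f` at `r + eᵢ`, so this induction passes from
statements about derivatives to statements about all coefficients. -/
theorem induction_degree {p : (ι → ℕ) → Prop} (h0 : p 0)
    (h : ∀ r i, p r → p (r + Pi.single i 1)) (r : ι → ℕ) : p r := by
  induction hn : ∑ i, r i generalizing r with
  | zero =>
    have : r = 0 := by
      funext i
      exact Finset.sum_eq_zero_iff.1 hn i (Finset.mem_univ i)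
    exact this ▸ h0
  | succ n ih =>
    obtain ⟨i, hi⟩ : ∃ i, r i ≠ 0 := by
      by_contra! h'
      simp [h'] at hn
    obtain ⟨s, rfl⟩ := exists_eq_add_single i r hi
    refine h s i (ih s ?_)
    simp only [Pi.add_apply, Finset.sum_add_distrib, Finset.sum_pi_single', Finset.mem_univ,
      if_true] at hn
    omega

end DP

section Embedding

open DP

variable {K L : Type*} [Field K] [LieRing L] [LieAlgebra K L]

/-- The monomial of degree `r` in four endomorphisms. -/
def powProd (P : Fin 4 → Module.End K L) (r : Fin 4 → ℕ) : Module.End K L :=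
  P 0 ^ r 0 * P 1 ^ r 1 * P 2 ^ r 2 * P 3 ^ r 3

theorem powProd_zero (P : Fin 4 → Module.End K L) : powProd P 0 = 1 := by
  simp [powProd]

theorem powProd_add {P : Fin 4 → Module.End K L} (hP : ∀ i j, Commute (P i) (P j))
    (r s : Fin 4 → ℕ) : powProd P (r + s) = powProd P r * powProd P s := by
  have c : ∀ i j k l, Commute (P i ^ k) (P j ^ l) := fun i j k l => (hP i j).pow_pow k l
  simp only [powProd, Pi.add_apply, pow_add]
  set a := fun i => P i ^ r i
  set b := fun i => P i ^ s i
  have hc : ∀ i j, b i * a j = a j * b i := fun i j => c i j _ _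
  change a 0 * b 0 * (a 1 * b 1) * (a 2 * b 2) * (a 3 * b 3) =
    a 0 * a 1 * a 2 * a 3 * (b 0 * b 1 * b 2 * b 3)
  have e1 : a 0 * b 0 * (a 1 * b 1) = a 0 * a 1 * (b 0 * b 1) := by
    rw [mul_assoc, ← mul_assoc (b 0), hc 0 1]; simp only [mul_assoc]
  have e2 : a 0 * a 1 * (b 0 * b 1) * (a 2 * b 2) = a 0 * a 1 * a 2 * (b 0 * b 1 * b 2) := by
    have : b 0 * b 1 * a 2 = a 2 * (b 0 * b 1) := by
      rw [mul_assoc, hc 1 2, ← mul_assoc, hc 0 2, mul_assoc]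
    rw [mul_assoc, ← mul_assoc (b 0 * b 1), this]; simp only [mul_assoc]
  have e3 : b 0 * b 1 * b 2 * a 3 = a 3 * (b 0 * b 1 * b 2) := by
    rw [mul_assoc, hc 2 3, ← mul_assoc, mul_assoc (b 0), hc 1 3, ← mul_assoc, hc 0 3]
    simp only [mul_assoc]
  rw [e1, e2, mul_assoc, ← mul_assoc (b 0 * b 1 * b 2), e3]
  simp only [mul_assoc]

theorem powProd_single (P : Fin 4 → Module.End K L) (i : Fin 4) (n : ℕ) :
    powProd P (Pi.single i n) = P i ^ n := by
  fin_cases i <;> simp [powProd]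

/-- Data for the realization of a Lie algebra `L` by vector fields: commuting elements `v i` that
are complementary to a subalgebra, the kernel of `ev`, such that iterated brackets with them are
eventually in this subalgebra. -/
structure Transversal (K L : Type*) [Field K] [LieRing L] [LieAlgebra K L] where
  /-- The commuting elements. -/
  v : Fin 4 → L
  /-- The coordinates of the projection along the subalgebra. -/
  ev : L →ₗ[K] Fin 4 → K
  lie_v : ∀ i j, ⁅v i, v j⁆ = 0
  ev_v : ∀ i, ev (v i) = Pi.single i 1
  ev_lie : ∀ x y, ev x = 0 → ev y = 0 → ev ⁅x, y⁆ = 0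
  -- These values become Taylor coefficients, and elements of `DP` have finite support.
  finite : ∀ x, {r | ev (powProd (fun i => LieAlgebra.ad K L (v i)) r x) ≠ 0}.Finite

namespace Transversal

variable (t : Transversal K L)

/-- The operators `ad (v i)`. -/
def P (i : Fin 4) : Module.End K L := LieAlgebra.ad K L (t.v i)

theorem P_apply (i : Fin 4) (x : L) : t.P i x = ⁅t.v i, x⁆ := rfl

theorem commute_P (i j : Fin 4) : Commute (t.P i) (t.P j) := by
  refine LinearMap.ext fun x => ?_
  simp only [Module.End.mul_apply, P_apply]
  rw [leibniz_lie, t.lie_v, zero_lie, zero_add]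

/-- The coefficients of the vector field that represents an element of `L`. -/
def coord (j : Fin 4) : L →ₗ[K] DP (Fin 4) K where
  toFun x := Finsupp.ofSupportFinite (fun r => t.ev (powProd t.P r x) j)
    ((t.finite x).subset fun r hr h => hr (congrFun h j))
  map_add' x y := Finsupp.ext fun r => by
    change t.ev (powProd t.P r (x + y)) j = t.ev (powProd t.P r x) j + t.ev (powProd t.P r y) j
    simp
  map_smul' c x := Finsupp.ext fun r => by
    change t.ev (powProd t.P r (c • x)) j = c • t.ev (powProd t.P r x) j
    simp

theorem coeff_coord (j : Fin 4) (r : Fin 4 → ℕ) (x : L) :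
    coeff r (t.coord j x) = t.ev (powProd t.P r x) j := rfl

/-- In divided powers a derivative merely shifts coefficients, and so does one more factor `ad (v
i)`. Thus no factorials occur in the Taylor expansion. -/
theorem pd_coord (i j : Fin 4) (x : L) : pd i (t.coord j x) = t.coord j ⁅t.v i, x⁆ := by
  refine DP.ext fun r => ?_
  rw [coeff_pd, coeff_coord, coeff_coord, powProd_add t.commute_P, powProd_single, pow_one]
  rfl

/-- The vector field that represents an element of `L`. -/
def field : L →ₗ[K] Derivation K (DP (Fin 4) K) (DP (Fin 4) K) :=
  vectorField ∘ₗ LinearMap.pi t.coord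

theorem field_apply (x : L) : t.field x = vectorField fun j => t.coord j x := rfl

/-- This is the constant term of the homomorphism property. Subtracting from `x` and `y` their parts
along the commuting `v i` leaves elements of the kernel of `ev`, a subalgebra, so only brackets with
some `v i` contribute. -/
theorem ev_lie_eq (x y : L) :
    t.ev ⁅x, y⁆ = ∑ i, t.ev x i • t.ev ⁅t.v i, y⁆ - ∑ i, t.ev y i • t.ev ⁅t.v i, x⁆ := by
  set x' := ∑ i, t.ev x i • t.v i with hx'
  set y' := ∑ i, t.ev y i • t.v i with hy'
  have ev' : ∀ c : Fin 4 → K, t.ev (∑ i, c i • t.v i) = c := by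
    intro c
    funext j
    simp [t.ev_v, Pi.single_apply]
  have hx : t.ev (x - x') = 0 := by rw [map_sub, hx', ev', sub_self]
  have hy : t.ev (y - y') = 0 := by rw [map_sub, hy', ev', sub_self]
  have h0 : ⁅x', y'⁆ = 0 := by
    simp only [hx', hy', sum_lie, lie_sum, smul_lie, lie_smul, t.lie_v, smul_zero,
      Finset.sum_const_zero]
  have h := t.ev_lie _ _ hx hy
  have h1 : ⁅x', y⁆ = ∑ i, t.ev x i • ⁅t.v i, y⁆ := by
    simp only [hx', sum_lie, smul_lie]
  have h2 : ⁅y', x⁆ = ∑ i, t.ev y i • ⁅t.v i, x⁆ := by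
    simp only [hy', sum_lie, smul_lie]
  have h3 : ⁅x, y⁆ = ⁅x - x', y - y'⁆ + (⁅x', y⁆ - ⁅y', x⁆) := by
    rw [sub_lie, lie_sub, lie_sub, h0, ← lie_skew y' x]
    abel
  rw [h3, map_add, h, zero_add, map_sub, h1, h2]
  simp

/-- The defect of the identity satisfies the Leibniz rule under each derivative, so its coefficients
vanish by induction on the degree, for all `x` and `y` at once, starting from `ev_lie_eq`. -/
theorem field_lie (x y : L) : t.field ⁅x, y⁆ = ⁅t.field x, t.field y⁆ := by
  rw [field_apply, field_apply, field_apply, lie_vectorField]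
  congr 1
  funext j
  set W : L → L → DP (Fin 4) K := fun x y => vectorField (fun j => t.coord j x) (t.coord j y) -
    vectorField (fun j => t.coord j y) (t.coord j x) with hW
  have hW' : ∀ x y, W x y = ∑ i, t.coord i x * t.coord j ⁅t.v i, y⁆ -
      ∑ i, t.coord i y * t.coord j ⁅t.v i, x⁆ := by
    intro x y
    simp only [hW, vectorField_apply, pd_coord]
  change _ = W x y
  rw [← sub_eq_zero]
  -- The derivative of the defect at `(x, y)` is the sum of the defects at `([v k, x], y)` and `(x,
  -- [v k, y])`.
  have hpd : ∀ (k : Fin 4) (x y : L), pd k (t.coord j ⁅x, y⁆ - W x y) =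
      (t.coord j ⁅⁅t.v k, x⁆, y⁆ - W ⁅t.v k, x⁆ y) + (t.coord j ⁅x, ⁅t.v k, y⁆⁆ - W x ⁅t.v k, y⁆) := by
    intro k x y
    have e : ∀ (i : Fin 4) (z : L), ⁅t.v k, ⁅t.v i, z⁆⁆ = ⁅t.v i, ⁅t.v k, z⁆⁆ := by
      intro i z
      rw [leibniz_lie, t.lie_v, zero_lie, zero_add]
    rw [map_sub, pd_coord, leibniz_lie, map_add, hW', hW', hW', map_sub, map_sum, map_sum]
    simp only [Derivation.leibniz, smul_eq_mul, pd_coord, e, Finset.sum_add_distrib]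
    have c : ∀ a b : Fin 4 → DP (Fin 4) K, ∑ i, a i * b i = ∑ i, b i * a i := fun a b =>
      Finset.sum_congr rfl fun i _ => mul_comm _ _
    rw [c (fun i => t.coord j ⁅t.v i, y⁆), c (fun i => t.coord j ⁅t.v i, x⁆)]
    abel
  have key : ∀ (r : Fin 4 → ℕ) (x y : L), coeff r (t.coord j ⁅x, y⁆ - W x y) = 0 := by
    intro r
    induction r using induction_degree with
    | h0 =>
      intro x y
      have c0 : ∀ j x, coeff 0 (t.coord j x) = t.ev x j := fun j x => by
        rw [coeff_coord, powProd_zero, Module.End.one_apply]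
      rw [hW', map_sub, map_sub, map_sum, map_sum, c0, ev_lie_eq]
      simp only [coeff_zero_mul, c0]
      simp
    | h r k ih =>
      intro x y
      rw [← coeff_pd, hpd, map_add, ih, ih, add_zero]
  exact DP.ext fun r => by rw [key, map_zero]

end Transversal

end Embedding

end
end WeisfeilerKac

namespace WeisfeilerKac

noncomputable section

/-! ### Cartan prolongs as images of graded Lie algebras -/

namespace DP

variable {ι K : Type*} [Fintype ι] [DecidableEq ι] [Field K]

theorem box_top : box (fun _ : ι => (⊤ : ℕ∞)) = Set.univ :=
  Set.eq_univ_of_forall fun _ _ _ h => absurd h (ENat.top_ne_natCast _)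

theorem monoSpan_univ : (monoSpan Set.univ : Submodule K (DP ι K)) = ⊤ :=
  eq_top_iff.2 fun _ _ => mem_monoSpan.2 fun _ _ => Set.mem_univ _

theorem mem_trunc_top [CharP K 2] (f : DP ι K) : f ∈ trunc fun _ : ι => (⊤ : ℕ∞) := by
  rw [mem_trunc, box_top, monoSpan_univ]
  exact Submodule.mem_top

theorem eq_zero_of_pd_eq_zero {f : DP ι K} (h0 : coeff 0 f = 0) (h : ∀ i, pd i f = 0) : f = 0 := by
  refine DP.ext fun r => ?_
  rw [map_zero]
  induction r using induction_degree with
  | h0 => exact h0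
  | h r i _ => rw [← coeff_pd, h, map_zero]

theorem coeff_zero_of_mem_homog {d : ℕ} {f : DP ι K} (hf : f ∈ homog (fun _ => 1) (d + 1)) :
    coeff 0 f = 0 := by
  by_contra h
  have := mem_monoSpan.1 hf 0 h
  simp at this

end DP

section Prolong

open DP

attribute [local instance 100] LieRing.ofAssociativeRing

variable {K L : Type*} [Field K] [LieRing L] [LieAlgebra K L]

/-- Each operator lowers the degree by 1 and kills degree 0, so on an element with finitely many
components all sufficiently long monomials vanish. -/
theorem exists_powProd_eq_zero {P : Fin 4 → Module.End K L} (hP : ∀ i j, Commute (P i) (P j))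
    {B : ℕ → Submodule K L} (hB : ⨆ d, B d = ⊤) (h0 : ∀ i, ∀ x ∈ B 0, P i x = 0)
    (hs : ∀ i d, ∀ x ∈ B (d + 1), P i x ∈ B d) (x : L) :
    ∃ n, ∀ r : Fin 4 → ℕ, n ≤ ∑ i, r i → powProd P r x = 0 := by
  have hx : x ∈ ⨆ d, B d := hB ▸ Submodule.mem_top
  refine Submodule.iSup_induction _ (motive := fun x => ∃ n, ∀ r : Fin 4 → ℕ, n ≤ ∑ i, r i →
    powProd P r x = 0) hx (fun d x hx => ⟨d + 1, fun r => ?_⟩) ⟨0, fun r _ => map_zero _⟩ ?_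
  · revert x d
    induction r using induction_degree with
    | h0 => intro d x _ h; simp at h
    | h r i ih =>
      intro d x hx h
      rw [powProd_add hP, powProd_single, pow_one, Module.End.mul_apply]
      cases d with
      | zero => rw [h0 i x hx, map_zero]
      | succ d =>
        refine ih d _ (hs i d x hx) ?_
        simp only [Pi.add_apply, Finset.sum_add_distrib, Finset.sum_pi_single', Finset.mem_univ,
          if_true] at h
        omega
  · rintro x y ⟨m, hm⟩ ⟨n, hn⟩
    exact ⟨max m n, fun r hr => by
      rw [map_add, hm r (le_trans (le_max_left _ _) hr), hn r (le_trans (le_max_right _ _) hr),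
        add_zero]⟩

theorem finite_of_powProd_eq_zero {P : Fin 4 → Module.End K L} {M : Type*} [AddCommGroup M]
    [Module K M] (ev : L →ₗ[K] M) {x : L}
    (h : ∃ n, ∀ r : Fin 4 → ℕ, n ≤ ∑ i, r i → powProd P r x = 0) :
    {r | ev (powProd P r x) ≠ 0}.Finite := by
  obtain ⟨n, hn⟩ := h
  refine (Set.finite_Iic (fun _ : Fin 4 => n)).subset fun r hr => ?_
  rw [Set.mem_Iic]
  intro i
  by_contra hi
  refine hr ?_
  rw [hn r ?_, map_zero]
  exact (not_le.1 hi).le.trans (Finset.single_le_sum (f := r) (fun _ _ => Nat.zero_le _)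
    (Finset.mem_univ i))

namespace Transversal

variable (t : Transversal K L)

/-- The grading `B` of `L`, shifted by 1, makes `L` the maximal prolong of its components of
degree `-1` and `0`, the former being spanned by the elements `v i`. -/
structure IsProlong (B : ℕ → Submodule K L) : Prop where
  zero : B 0 = Submodule.span K (Set.range t.v)
  lie_succ : ∀ d i, ∀ x ∈ B (d + 1), ⁅t.v i, x⁆ ∈ B d
  ev_succ : ∀ d, ∀ x ∈ B (d + 1), t.ev x = 0
  inj : ∀ x, t.ev x = 0 → (∀ i, ⁅t.v i, x⁆ = 0) → x = 0
  exists_lie_eq : ∀ d (f : Fin 4 → L), (∀ i, f i ∈ B (d + 1)) →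
    (∀ i j, ⁅t.v i, f j⁆ = ⁅t.v j, f i⁆) → ∃ x ∈ B (d + 2), ∀ i, ⁅t.v i, x⁆ = f i
  iSup : ⨆ d, B d = ⊤

variable {t} {B : ℕ → Submodule K L} (hB : t.IsProlong B)

include hB

theorem IsProlong.lie_zero (i : Fin 4) (x : L) (hx : x ∈ B 0) : ⁅t.v i, x⁆ = 0 := by
  rw [hB.zero] at hx
  refine Submodule.span_induction ?_ (_root_.lie_zero _)
    (fun a b _ _ ha hb => by rw [lie_add, ha, hb, add_zero])
    (fun c a _ ha => by rw [lie_smul, ha, smul_zero]) hx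
  rintro _ ⟨j, rfl⟩
  exact t.lie_v i j

/-- If the field of `x` vanishes, so do `ev x` and the fields of all `[v i, x]`. Nilpotency provides
an induction that makes the latter brackets zero, and transitivity (`inj`) finishes. -/
theorem IsProlong.field_eq_zero (x : L) (hx : t.field x = 0) : x = 0 := by
  obtain ⟨n, hn⟩ := exists_powProd_eq_zero t.commute_P hB.iSup hB.lie_zero
    (fun i d => hB.lie_succ d i) x
  induction n generalizing x with
  | zero => simpa [powProd_zero] using hn 0 (Nat.zero_le _)
  | succ n ih =>
    have hc : ∀ j, t.coord j x = 0 := fun j =>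
      congrFun (vectorField_injective (hx.trans (map_zero _).symm)) j
    refine hB.inj x (funext fun j => ?_) fun i => ?_
    · have h := congrArg (coeff 0) (hc j)
      rwa [coeff_coord, powProd_zero, map_zero] at h
    · refine ih _ ?_ fun r hr => ?_
      · rw [field_apply]
        have : (fun j => t.coord j ⁅t.v i, x⁆) = 0 := funext fun j => by
          rw [← pd_coord, hc, map_zero]; rfl
        rw [this, map_zero]
      · have h := hn (r + Pi.single i 1) (by
          simp only [Pi.add_apply, Finset.sum_add_distrib, Finset.sum_pi_single', Finset.mem_univ,
            if_true]
          omega)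
        rwa [powProd_add t.commute_P, powProd_single, pow_one] at h

theorem IsProlong.field_injective : Function.Injective t.field :=
  (injective_iff_map_eq_zero _).2 hB.field_eq_zero

/-- A monomial of degree `n` in the `ad (v i)` lowers the index of `B` by `n`, and `ev` sees only `B
0`; hence only monomials of degree `d` occur. -/
theorem IsProlong.coord_mem_homog {d : ℕ} {x : L} (hx : x ∈ B d) (j : Fin 4) :
    t.coord j x ∈ homog (fun _ => 1) d := by
  refine mem_monoSpan.2 fun r => ?_
  change coeff r _ ≠ 0 → ∑ i, 1 * r i = d
  simp only [one_mul]
  rw [coeff_coord]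
  revert d x
  induction r using induction_degree with
  | h0 =>
    intro d x hx h
    cases d with
    | zero => simp
    | succ d => rw [powProd_zero, Module.End.one_apply, hB.ev_succ d x hx] at h; simp at h
  | h r i ih =>
    intro d x hx h
    rw [powProd_add t.commute_P, powProd_single, pow_one, Module.End.mul_apply, P_apply] at h
    cases d with
    | zero => rw [hB.lie_zero i x hx, map_zero, map_zero] at h; simp at h
    | succ d =>
      have := ih (hB.lie_succ d i x hx) h
      simp only [Pi.add_apply, Finset.sum_add_distrib, Finset.sum_pi_single', Finset.mem_univ,
          if_true]
      omega

variable [CharP K 2]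

theorem IsProlong.field_mem_vectPiece {d : ℕ} {x : L} (hx : x ∈ B d) {M : Fin 4 → ℕ∞} :
    t.field x ∈ vectPiece M d ↔ ∀ j, t.coord j x ∈ trunc M := by
  constructor
  · rintro ⟨f, hf, h⟩ j
    rw [field_apply] at h
    rw [← congrFun (vectorField_injective h) j]
    exact (hf j (Set.mem_univ j)).1
  · exact fun h => ⟨_, fun j _ => ⟨h j, hB.coord_mem_homog hx j⟩, rfl⟩

omit hB in
theorem lie_vectorField_const (f : Fin 4 → DP (Fin 4) K) (c : Fin 4 → K) :
    ⁅vectorField f, vectorField fun j => mono 0 (c j)⁆ =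
      vectorField fun j => - ∑ i, c i • pd i (f j) := by
  rw [lie_vectorField]
  congr 1
  funext j
  have h : ∀ (i : Fin 4) (a : K), pd i (mono 0 a : DP (Fin 4) K) = 0 := fun i a =>
    pdLin_mono_zero i 0 a rfl
  have h' : ∀ (a : K) (g : DP (Fin 4) K), mono 0 a * g = a • g := by
    intro a g
    have : (mono 0 a : DP (Fin 4) K) = a • 1 := by rw [one_def, ← map_smul, smul_eq_mul, mul_one]
    rw [this, smul_mul_assoc, one_mul]
  simp only [vectorField_apply, h, mul_zero, Finset.sum_const_zero, zero_sub, h']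

omit hB in
theorem lie_vectorField_const_mem {M : Fin 4 → ℕ∞} {d : ℕ}
    {D : Derivation K (DP (Fin 4) K) (DP (Fin 4) K)} (hD : D ∈ vectPiece M (d + 1))
    (c : Fin 4 → K) : ⁅D, vectorField fun j => mono 0 (c j)⁆ ∈ vectPiece M d := by
  obtain ⟨f, hf, rfl⟩ := hD
  rw [lie_vectorField_const]
  refine ⟨_, fun j _ => ?_, rfl⟩
  have hf := hf j (Set.mem_univ j)
  exact neg_mem (sum_mem fun i _ => Submodule.smul_mem _ _
    ⟨pd_mem_trunc i hf.1, pd_mem_homog i hf.2⟩)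

omit hB in
-- Brackets with constant fields are, up to sign, partial derivatives of the coefficients, and the
-- coefficients have no constant terms here.
theorem eq_zero_of_lie_eq_zero {M : Fin 4 → ℕ∞} {d : ℕ}
    {D : Derivation K (DP (Fin 4) K) (DP (Fin 4) K)} (hD : D ∈ vectPiece M (d + 1))
    (h : ∀ c : Fin 4 → K, ⁅D, vectorField fun j => mono 0 (c j)⁆ = 0) : D = 0 := by
  obtain ⟨f, hf, rfl⟩ := hD
  rw [show f = 0 from funext fun j => eq_zero_of_pd_eq_zero
    (coeff_zero_of_mem_homog (hf j (Set.mem_univ j)).2) fun i => ?_, map_zero]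
  have h := h (Pi.single i 1)
  rw [lie_vectorField_const] at h
  have := congrFun (vectorField_injective (h.trans (map_zero _).symm)) j
  simpa [Pi.single_apply, ite_smul] using this

variable {V : Type*} [AddCommGroup V] [Module K V] {b : Module.Basis (Fin 4) K V}
  {S : LieSubalgebra K (Module.End K V)}

omit hB in
theorem constField_eq (v : V) : constField b v = vectorField fun j => mono 0 (b.repr v j) := rfl

omit hB in
-- Derivatives preserve 𝒪(4; M), so truncation commutes with prolongation: it suffices to know the
-- untruncated prolong and to intersect afterwards.
theorem prolongPiece_succ_eq (M : Fin 4 → ℕ∞) (d : ℕ) : prolongPiece b S M (d + 1) =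
    prolongPiece b S (fun _ => ⊤) (d + 1) ⊓ vectPiece M (d + 1) := by
  have hle : ∀ d, vectPiece (K := K) M d ≤ vectPiece (fun _ => ⊤) d := by
    rintro d _ ⟨f, hf, rfl⟩
    exact ⟨f, fun j hj => ⟨mem_trunc_top _, (hf j hj).2⟩, rfl⟩
  induction d with
  | zero =>
    ext D
    rw [Submodule.mem_inf, mem_prolongPiece_one, mem_prolongPiece_one]
    exact ⟨fun h => ⟨⟨hle _ h.1, h.2⟩, h.1⟩, fun h => ⟨h.2, h.1.2⟩⟩
  | succ d ih =>
    ext D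
    rw [Submodule.mem_inf, mem_prolongPiece_add_two, mem_prolongPiece_add_two]
    refine ⟨fun h => ⟨⟨hle _ h.1, fun v => ?_⟩, h.1⟩, fun h => ⟨h.2, fun v => ?_⟩⟩
    · have h2 := h.2 v
      rw [ih] at h2
      exact h2.1
    · rw [ih]
      exact ⟨h.1.2 v, lie_vectorField_const_mem h.2 _⟩

variable {T : V →ₗ[K] L} (hT : ∀ i, T (b i) = t.v i)
  (hS : ∀ s : Module.End K V, s ∈ S ↔ ∃ x ∈ B 1, ∀ v, T (s v) = ⁅x, T v⁆)

include hT

theorem IsProlong.field_T (v : V) : t.field (T v) = constField b v := by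
  have : t.field ∘ₗ T = constField b := b.ext fun i => by
    rw [LinearMap.comp_apply, hT, constField_eq, field_apply]
    congr 1
    funext j
    refine eq_of_sub_eq_zero (eq_zero_of_pd_eq_zero ?_ fun k => ?_)
    · rw [map_sub, coeff_coord, powProd_zero, Module.End.one_apply, t.ev_v, coeff_mono, if_pos rfl,
        b.repr_self, Finsupp.single_apply, Pi.single_apply, sub_eq_zero]
      simp only [eq_comm]
    · have h : pd k (mono 0 (b.repr (b i) j) : DP (Fin 4) K) = 0 := pdLin_mono_zero k 0 _ rfl
      rw [map_sub, pd_coord, t.lie_v, map_zero, h, sub_zero]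
  exact LinearMap.congr_fun this v

theorem IsProlong.range_T : LinearMap.range T = B 0 := by
  rw [hB.zero, LinearMap.range_eq_map, ← b.span_eq, Submodule.map_span, ← Set.range_comp]
  congr 2
  exact funext hT

include hS

/-- The abstract maximality of `B` matches the recursive definition of the prolong. In positive
degree the brackets of a field with the constant fields come from a compatible family in `L`, which
`exists_lie_eq` integrates. -/
theorem IsProlong.prolongPiece_eq (d : ℕ) :
    prolongPiece b S (fun _ => ⊤) d = (B d).map t.field := by
  have hmem : ∀ {d x}, x ∈ B d → t.field x ∈ vectPiece (fun _ => ⊤) d := fun hx =>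
    (hB.field_mem_vectPiece hx).2 fun _ => mem_trunc_top _
  have hlie : ∀ x v, ⁅t.field x, constField b v⁆ = t.field ⁅x, T v⁆ := fun x v => by
    rw [← hB.field_T hT, ← t.field_lie]
  have hT0 : ∀ v, T v ∈ B 0 := fun v => hB.range_T hT ▸ LinearMap.mem_range_self T v
  have hc : ∀ c : Fin 4 → K, (vectorField fun j => mono 0 (c j)) =
      constField b (∑ i, c i • b i) := by
    intro c
    rw [constField_eq]
    congr 1
    funext j
    rw [b.repr_sum_self]
  cases d with
  | zero =>
    have : constField b = t.field ∘ₗ T := LinearMap.ext fun v => (hB.field_T hT v).symm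
    change LinearMap.range (constField b) = _
    rw [this, LinearMap.range_comp, hB.range_T hT]
  | succ d =>
  induction d with
  | zero =>
    ext D
    rw [mem_prolongPiece_one]
    constructor
    · rintro ⟨hD, s, hs, h⟩
      obtain ⟨x, hx, h'⟩ := (hS s).1 hs
      refine ⟨x, hx, (sub_eq_zero.1 (eq_zero_of_lie_eq_zero (sub_mem hD (hmem hx)) fun c => ?_)).symm⟩
      rw [hc, sub_lie, hlie, h, ← hB.field_T hT, h', sub_self]
    · rintro ⟨x, hx, rfl⟩
      refine ⟨hmem hx, ?_⟩
      have hinj : Function.Injective T := by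
        intro v w h
        have hv := hB.field_T hT v
        rw [h, hB.field_T hT, constField_eq, constField_eq] at hv
        have := vectorField_injective hv
        refine b.repr.injective (Finsupp.ext fun j => ?_)
        have := congrArg (coeff 0) (congrFun this j)
        rw [coeff_mono, coeff_mono, if_pos rfl, if_pos rfl] at this
        exact this.symm
      have hr : ∀ v, ⁅x, T v⁆ ∈ LinearMap.range T := by
        intro v
        rw [hB.range_T hT, ← lie_skew]
        have : ∀ y ∈ B 0, ⁅y, x⁆ ∈ B 0 := by
          intro y hy
          rw [hB.zero] at hy
          refine Submodule.span_induction ?_ (by rw [zero_lie]; exact zero_mem _)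
            (fun a b _ _ ha hb => by rw [add_lie]; exact add_mem ha hb)
            (fun c a _ ha => by rw [smul_lie]; exact Submodule.smul_mem _ _ ha) hy
          rintro _ ⟨i, rfl⟩
          exact hB.lie_succ 0 i x hx
        exact neg_mem (this _ (hT0 v))
      -- The operator `ad x` preserves the range of `T`, which is `B 0`; transported back to `V` it
      -- is the element of `S` attached to `x`.
      let s : Module.End K V := (LinearEquiv.ofInjective T hinj).symm.toLinearMap ∘ₗ
        LinearMap.codRestrict (LinearMap.range T) ((LieAlgebra.ad K L x : Module.End K L) ∘ₗ T) hr
      have hs : ∀ v, T (s v) = ⁅x, T v⁆ := fun v =>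
        congrArg Subtype.val ((LinearEquiv.ofInjective T hinj).apply_symm_apply ⟨⁅x, T v⁆, hr v⟩)
      exact ⟨s, (hS s).2 ⟨x, hx, hs⟩, fun v => by rw [hlie, ← hs, hB.field_T hT]⟩
  | succ d ih =>
    ext D
    rw [mem_prolongPiece_add_two, ih]
    constructor
    · rintro ⟨hD, h⟩
      choose f hf hfD using fun i => h (b i)
      -- The sign comes from the order of the brackets: `f i` represents `[D, ∂ᵢ]`, whereas
      -- `exists_lie_eq` prescribes `[v i, x]`. Compatibility is the Jacobi identity for the
      -- commuting constant fields.
      obtain ⟨x, hx, hxf⟩ := hB.exists_lie_eq d (fun i => - f i) (fun i => neg_mem (hf i)) fun i j => by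
        refine hB.field_injective ?_
        rw [t.field_lie, t.field_lie, map_neg, map_neg, hfD, hfD, ← hT, ← hT, hB.field_T hT,
          hB.field_T hT, lie_neg, lie_neg, leibniz_lie, lie_constField_constField, _root_.lie_zero,
          add_zero, ← lie_skew (constField b (b j)), ← lie_skew D (constField b (b i)), neg_lie, neg_neg]
      refine ⟨x, hx, (sub_eq_zero.1 (eq_zero_of_lie_eq_zero (sub_mem hD (hmem hx)) fun c => ?_)).symm⟩
      rw [hc, sub_lie, map_sum, lie_sum, lie_sum, sub_eq_zero]
      refine Finset.sum_congr rfl fun i _ => ?_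
      rw [map_smul, lie_smul, lie_smul, ← hfD, hlie, hT, ← lie_skew, hxf, neg_neg]
    · rintro ⟨x, hx, rfl⟩
      refine ⟨hmem hx, fun v => ?_⟩
      rw [hlie]
      refine ⟨_, ?_, rfl⟩
      rw [← lie_skew]
      have : ∀ y ∈ B 0, ⁅y, x⁆ ∈ B (d + 1) := by
        intro y hy
        rw [hB.zero] at hy
        refine Submodule.span_induction ?_ (by rw [zero_lie]; exact zero_mem _)
          (fun a b _ _ ha hb => by rw [add_lie]; exact add_mem ha hb)
          (fun c a _ ha => by rw [smul_lie]; exact Submodule.smul_mem _ _ ha) hy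
        rintro _ ⟨i, rfl⟩
        exact hB.lie_succ (d + 1) i x hx
      exact neg_mem (this _ (hT0 v))

/-- The full prolong is `L`; the hypothesis `hM` says that the truncation by `M` cuts out the image
of `Q` in each nonnegative degree, and `h0` says that nothing is lost in degree -1. -/
theorem IsProlong.exists_prolong_equiv {Q : Type*} [LieRing Q] [LieAlgebra K Q] (j : Q →ₗ⁅K⁆ L)
    (hj : Function.Injective j) {M : Fin 4 → ℕ∞} {B' : ℕ → Submodule K Q}
    (hB' : ∀ d y, y ∈ B' d ↔ j y ∈ B d) (hB'top : ⨆ d, B' d = ⊤)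
    (h0 : ∀ x ∈ B 0, ∃ y, j y = x)
    (hM : ∀ d, ∀ x ∈ B (d + 1), (∃ y, j y = x) ↔ ∀ i, t.coord i x ∈ trunc M) :
    ∃ e : prolong b S M ≃ₗ⁅K⁆ Q, ∀ (d : ℕ) (x : prolong b S M),
      (x : Derivation K (DP (Fin 4) K) (DP (Fin 4) K)) ∈ prolongPiece b S M d ↔ e x ∈ B' d := by
  let g : Q →ₗ⁅K⁆ Derivation K (DP (Fin 4) K) (DP (Fin 4) K) :=
    { t.field ∘ₗ j.toLinearMap with
      map_lie' := fun {x y} => by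
        change t.field (j ⁅x, y⁆) = ⁅t.field (j x), t.field (j y)⁆
        rw [LieHom.map_lie, t.field_lie] }
  have hg : ∀ x, g x = t.field (j x) := fun _ => rfl
  have hginj : Function.Injective g := fun x y h => hj (hB.field_injective h)
  have hpiece : ∀ d, prolongPiece b S M d = (B' d).map g.toLinearMap := by
    intro d
    ext D
    cases d with
    | zero =>
      change D ∈ prolongPiece b S (fun _ => ⊤) 0 ↔ _
      rw [hB.prolongPiece_eq hT hS]
      constructor
      · rintro ⟨x, hx, rfl⟩
        obtain ⟨y, rfl⟩ := h0 x hx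
        exact ⟨y, (hB' 0 y).2 hx, rfl⟩
      · rintro ⟨y, hy, rfl⟩
        exact ⟨j y, (hB' 0 y).1 hy, rfl⟩
    | succ d =>
      rw [prolongPiece_succ_eq, Submodule.mem_inf, hB.prolongPiece_eq hT hS]
      constructor
      · rintro ⟨⟨x, hx, rfl⟩, h⟩
        obtain ⟨y, rfl⟩ := (hM d x hx).2 ((hB.field_mem_vectPiece hx).1 h)
        exact ⟨y, (hB' _ y).2 hx, rfl⟩
      · rintro ⟨y, hy, rfl⟩
        have hy := (hB' _ y).1 hy
        exact ⟨⟨j y, hy, rfl⟩, (hB.field_mem_vectPiece hy).2 ((hM d _ hy).1 ⟨y, rfl⟩)⟩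
  have hrange : g.range = prolong b S M := by
    refine LieSubalgebra.toSubmodule_injective ?_
    change LinearMap.range g.toLinearMap = ⨆ d, prolongPiece b S M d
    rw [LinearMap.range_eq_map, ← hB'top, Submodule.map_iSup]
    exact iSup_congr fun d => (hpiece d).symm
  let e := (LieEquiv.ofInjective g hginj).trans (LieEquiv.ofEq _ _ (congrArg _ hrange))
  have he : ∀ x : prolong b S M, g (e.symm x) = x := fun x =>
    congrArg Subtype.val (e.apply_symm_apply x)
  refine ⟨e.symm, fun d x => ?_⟩
  rw [hpiece]
  constructor
  · rintro ⟨y, hy, h⟩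
    rw [← he] at h
    rwa [← hginj h]
  · exact fun h => ⟨_, h, he x⟩

end Transversal

end Prolong

end
end WeisfeilerKac

namespace WeisfeilerKac

noncomputable section

/-! ### Gradings of the Buttin algebra -/

open DP

section Weights

variable {K : Type*} [Field K] {Γ : Type*} [AddCommGroup Γ]

/-- The weight of the monomial `u^(r)` when `u i` has weight `W i`. -/
def wt (W : BVar → Γ) (r : BVar → ℕ) : Γ := ∑ i, r i • W i

theorem wt_add (W : BVar → Γ) (r s : BVar → ℕ) : wt W (r + s) = wt W r + wt W s := by
  simp only [wt, Pi.add_apply, add_smul, Finset.sum_add_distrib]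

theorem wt_single (W : BVar → Γ) (i : BVar) : wt W (Pi.single i 1) = W i := by
  rw [wt, Finset.sum_eq_single i (fun j _ hj => by rw [Pi.single_eq_of_ne hj, zero_smul]) (by simp),
    Pi.single_eq_same, one_smul]

/-- The functions of weight `γ`. -/
def weightPiece (W : BVar → Γ) (γ : Γ) : Submodule K (DP BVar K) := monoSpan {r | wt W r = γ}

theorem mem_weightPiece {W : BVar → Γ} {γ : Γ} {f : DP BVar K} :
    f ∈ weightPiece W γ ↔ ∀ r, coeff r f ≠ 0 → wt W r = γ := mem_monoSpan

theorem mul_mem_weightPiece {W : BVar → Γ} {γ δ ε : Γ} {f g : DP BVar K}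
    (hf : f ∈ weightPiece W γ) (hg : g ∈ weightPiece W δ) (h : ε = γ + δ) :
    f * g ∈ weightPiece W ε := by
  refine mul_mem_monoSpan (fun r hr s hs => Or.inl ?_) hf hg
  change wt W (r + s) = ε
  rw [wt_add, h, show wt W r = γ from hr, show wt W s = δ from hs]

theorem pd_mem_weightPiece {W : BVar → Γ} {γ : Γ} (i : BVar) {f : DP BVar K}
    (hf : f ∈ weightPiece W γ) : pd i f ∈ weightPiece W (γ - W i) := by
  refine pd_mem_monoSpan (fun r hr => ?_) hf
  change wt W _ = _ at hr
  change wt W r = _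
  rw [← hr, wt_add, wt_single, add_sub_cancel_right]

theorem X_mem_weightPiece (W : BVar → Γ) (i : BVar) : (X i : DP BVar K) ∈ weightPiece W (W i) :=
  mono_mem_monoSpan (wt_single W i) _

/-- The weights are compatible with the contact bracket. -/
def IsContactWeight (W : BVar → Γ) : Prop := ∀ i, W tauv = W (qv i) + W (xiv i)

theorem contactBracket_mem_weightPiece {W : BVar → Γ} (hW : IsContactWeight W) {γ δ : Γ}
    {f g : DP BVar K} (hf : f ∈ weightPiece W γ) (hg : g ∈ weightPiece W δ) :
    contactBracket f g ∈ weightPiece W (γ + δ - W tauv) := by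
  have e := fun {γ} {f : DP BVar K} (hf : f ∈ weightPiece W γ) =>
    (show eulerQ f ∈ weightPiece W γ from eulerQ_mem_monoSpan hf)
  refine add_mem (add_mem ?_ ?_) (add_mem (add_mem ?_ ?_) (add_mem ?_ ?_))
  · exact mul_mem_weightPiece (sub_mem hf (e hf)) (pd_mem_weightPiece _ hg) (by abel)
  · exact mul_mem_weightPiece (pd_mem_weightPiece _ hf) (sub_mem hg (e hg)) (by abel)
  all_goals refine mul_mem_weightPiece (pd_mem_weightPiece _ hf) (pd_mem_weightPiece _ hg) ?_
  · rw [hW 0]; abel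
  · rw [hW 0]; abel
  · rw [hW 1]; abel
  · rw [hW 1]; abel

open Classical in
/-- The projection onto the span of the monomials `u^(r)`, `r ∈ S`. -/
def restrict {ι : Type*} (S : Set (ι → ℕ)) : DP ι K →ₗ[K] DP ι K where
  toFun f := Finsupp.filter (M := K) (· ∈ S) f
  map_add' _ _ := Finsupp.filter_add
  map_smul' _ _ := Finsupp.filter_smul

open Classical in
theorem coeff_restrict {ι : Type*} [Fintype ι] [DecidableEq ι] (S : Set (ι → ℕ)) (r : ι → ℕ)
    (f : DP ι K) : coeff r (restrict S f) = if r ∈ S then coeff r f else 0 :=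
  Finsupp.filter_apply (M := K) (· ∈ S) f r

theorem coeff_restrict_of_mem {ι : Type*} [Fintype ι] [DecidableEq ι] {S : Set (ι → ℕ)}
    {r : ι → ℕ} (h : r ∈ S) (f : DP ι K) : coeff r (restrict S f) = coeff r f := by
  rw [coeff_restrict, if_pos h]

theorem coeff_restrict_of_notMem {ι : Type*} [Fintype ι] [DecidableEq ι] {S : Set (ι → ℕ)}
    {r : ι → ℕ} (h : r ∉ S) (f : DP ι K) : coeff r (restrict S f) = 0 := by
  rw [coeff_restrict, if_neg h]

theorem sum_restrict {ι : Type*} [Fintype ι] [DecidableEq ι] {Γ : Type*} (w : (ι → ℕ) → Γ)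
    (f : DP ι K) : ∃ s : Finset Γ, ∑ γ ∈ s, restrict {r | w r = γ} f = f := by
  classical
  refine ⟨(Finsupp.support (α := ι → ℕ) (M := K) f).image w, DP.ext fun r => ?_⟩
  rw [map_sum]
  by_cases h : coeff r f = 0
  · rw [h]
    refine Finset.sum_eq_zero fun γ _ => ?_
    rw [coeff_restrict, h, ite_self]
  · rw [Finset.sum_eq_single (w r), coeff_restrict_of_mem (S := {s | w s = w r}) rfl]
    · intro γ _ hγ
      exact coeff_restrict_of_notMem (fun h => hγ (Eq.symm h)) _
    · intro h'
      exact absurd (Finset.mem_image_of_mem w (Finsupp.mem_support_iff.2 h)) h'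

theorem coeff_buttinDiv (μ : K) (r : BVar → ℕ) (f : DP BVar K) :
    coeff r (buttinDiv μ f) = (1 - μ * (r (qv 0) + r (qv 1))) * coeff (r + Pi.single tauv 1) f -
      μ * (coeff (r + Pi.single (qv 0) 1 + Pi.single (xiv 0) 1) f +
        coeff (r + Pi.single (qv 1) 1 + Pi.single (xiv 1) 1) f) := by
  change coeff r (pd tauv f - μ • eulerQ (pd tauv f) - μ • bvLaplace f) = _
  rw [eulerQ_apply, bvLaplace]
  simp only [map_sub, map_smul, map_add, coeff_X_mul_pd, coeff_pd, smul_eq_mul]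
  ring

/-- Both ∂τ and each ∂²/∂qᵢ∂ξᵢ lower the weight by that of τ, and E preserves it, so the defining
equation splits into weight components. -/
theorem buttinDiv_restrict (μ : K) {W : BVar → Γ} (hW : IsContactWeight W) (γ : Γ)
    (f : DP BVar K) : buttinDiv μ (restrict {r | wt W r = γ} f) =
      restrict {r | wt W r = γ - W tauv} (buttinDiv μ f) := by
  refine DP.ext fun r => ?_
  have h : ∀ i, wt W (r + Pi.single (qv i) 1 + Pi.single (xiv i) 1) = wt W r + W tauv := fun i => by
    rw [wt_add, wt_add, wt_single, wt_single, hW i, add_assoc]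
  by_cases hr : wt W r = γ - W tauv
  · have hr' : wt W r + W tauv = γ := by rw [hr, sub_add_cancel]
    rw [coeff_restrict_of_mem hr, coeff_buttinDiv, coeff_buttinDiv, coeff_restrict_of_mem,
      coeff_restrict_of_mem, coeff_restrict_of_mem]
    · exact (h 1).trans hr'
    · exact (h 0).trans hr'
    · change wt W _ = _
      rw [wt_add, wt_single, hr']
  · have hr' : wt W r + W tauv ≠ γ := fun h => hr (by rw [← h, add_sub_cancel_right])
    rw [coeff_restrict_of_notMem hr, coeff_buttinDiv, coeff_restrict_of_notMem,
      coeff_restrict_of_notMem, coeff_restrict_of_notMem]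
    · ring
    · exact fun h' => hr' ((h 1).symm.trans h')
    · exact fun h' => hr' ((h 0).symm.trans h')
    · intro h'
      change wt W _ = _ at h'
      rw [wt_add, wt_single] at h'
      exact hr' h'

variable [CharP K 2]

theorem restrict_mem_buttinAlgebra {μ : K} {N : Fin 2 → ℕ∞} {W : BVar → Γ} (hW : IsContactWeight W)
    (γ : Γ) {f : DP BVar K} (hf : f ∈ buttinAlgebra μ N) :
    restrict {r | wt W r = γ} f ∈ buttinAlgebra μ N := by
  refine ⟨mem_trunc.2 (mem_monoSpan.2 fun r hr => ?_), ?_⟩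
  · refine mem_monoSpan.1 (mem_trunc.1 hf.1) r fun h => hr ?_
    rw [coeff_restrict, h, ite_self]
  · refine (buttinDiv_restrict μ hW γ f).trans ?_
    rw [show buttinDiv μ f = 0 from hf.2, map_zero]

theorem restrict_mem_weightPiece (W : BVar → Γ) (γ : Γ) (f : DP BVar K) :
    restrict {r | wt W r = γ} f ∈ weightPiece W γ := by
  refine mem_weightPiece.2 fun r hr => ?_
  by_contra h
  exact hr (coeff_restrict_of_notMem h f)

/-- The components of the Buttin algebra with respect to the grading by weights. -/
def buttinWeight (μ : K) (N : Fin 2 → ℕ∞) (W : BVar → Γ) (γ : Γ) :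
    Submodule K (buttinAlgebra μ N) :=
  (weightPiece W γ).comap (buttinAlgebra μ N).toSubmodule.subtype

theorem iSup_buttinWeight (μ : K) (N : Fin 2 → ℕ∞) {W : BVar → Γ} (hW : IsContactWeight W) :
    ⨆ γ, buttinWeight μ N W γ = ⊤ := by
  refine eq_top_iff.2 fun x _ => ?_
  obtain ⟨s, hs⟩ := sum_restrict (wt W) (x.1 : DP BVar K)
  have hx : x = ∑ γ ∈ s, (⟨restrict {r | wt W r = γ} (x.1 : DP BVar K),
      restrict_mem_buttinAlgebra hW γ x.2⟩ : buttinAlgebra μ N) := by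
    refine Subtype.ext ?_
    have h := map_sum (buttinAlgebra μ N).toSubmodule.subtype (fun γ =>
      (⟨restrict {r | wt W r = γ} (x.1 : DP BVar K),
        restrict_mem_buttinAlgebra hW γ x.2⟩ : buttinAlgebra μ N)) s
    exact Eq.trans (Eq.symm hs) (Eq.symm h)
  rw [hx]
  exact sum_mem fun γ _ => Submodule.mem_iSup_of_mem γ (restrict_mem_weightPiece W γ _)

/-- A function of weight γ that is also a sum of functions of other weights has no monomials left.
-/
theorem iSupIndep_buttinWeight (μ : K) (N : Fin 2 → ℕ∞) (W : BVar → Γ) :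
    iSupIndep (buttinWeight μ N W) := by
  rw [iSupIndep_def]
  intro γ
  rw [Submodule.disjoint_def]
  intro x hx hx'
  have hle : ⨆ δ, ⨆ (_ : δ ≠ γ), buttinWeight μ N W δ ≤
      (monoSpan {r | wt W r ≠ γ}).comap (buttinAlgebra μ N).toSubmodule.subtype := by
    refine iSup₂_le fun δ hδ y hy => mem_monoSpan.2 fun r hr => ?_
    change wt W r ≠ γ
    rw [mem_weightPiece.1 hy r hr]
    exact hδ
  refine Subtype.ext (DP.ext fun r => ?_)
  by_contra h
  exact mem_monoSpan.1 (hle hx') r h (mem_weightPiece.1 hx r h)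

theorem lie_mem_buttinWeight {μ : K} {N : Fin 2 → ℕ∞} {W : BVar → Γ} (hW : IsContactWeight W)
    {γ δ : Γ} {x y : buttinAlgebra μ N} (hx : x ∈ buttinWeight μ N W γ)
    (hy : y ∈ buttinWeight μ N W δ) : ⁅x, y⁆ ∈ buttinWeight μ N W (γ + δ - W tauv) :=
  contactBracket_mem_weightPiece hW hx hy

end Weights

/-- The degrees of the indeterminates: 1 for `q i` and `τ`, 0 for `ξ i`. -/
def bDeg : BVar → ℕ := Sum.elim (fun _ => 1) (Sum.elim (fun _ => 0) fun _ => 1)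

section Degree

variable {K : Type*} [Field K]

theorem homog_bDeg (d : ℕ) : (homog bDeg d : Submodule K (DP BVar K)) =
    weightPiece (fun i => (bDeg i : ℤ)) d := by
  unfold homog weightPiece wt
  congr 1
  ext r
  simp only [Set.mem_ofPred_eq, nsmul_eq_mul]
  rw [← Nat.cast_inj (R := ℤ)]
  push_cast
  simp only [mul_comm]

theorem isContactWeight_bDeg : IsContactWeight fun i => (bDeg i : ℤ) := fun _ => rfl

theorem eq_zero_of_neg {γ : ℤ} (hγ : γ < 0) {f : DP BVar K}
    (hf : f ∈ weightPiece (fun i => (bDeg i : ℤ)) γ) : f = 0 := by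
  refine DP.ext fun r => ?_
  by_contra h
  have := mem_weightPiece.1 hf r h
  have h0 : 0 ≤ wt (fun i => (bDeg i : ℤ)) r :=
    Finset.sum_nonneg fun i _ => nsmul_nonneg (Nat.cast_nonneg _) _
  omega

variable [CharP K 2]

/-- The elements of the Buttin algebra of degree `d - 1`. -/
def buttinDeg (μ : K) (N : Fin 2 → ℕ∞) (d : ℕ) : Submodule K (buttinAlgebra μ N) :=
  (homog bDeg d).comap (buttinAlgebra μ N).toSubmodule.subtype

theorem buttinDeg_eq (μ : K) (N : Fin 2 → ℕ∞) (d : ℕ) :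
    buttinDeg μ N d = buttinWeight μ N (fun i => (bDeg i : ℤ)) d := by
  rw [buttinDeg, homog_bDeg]; rfl

theorem iSup_buttinDeg (μ : K) (N : Fin 2 → ℕ∞) : ⨆ d, buttinDeg μ N d = ⊤ := by
  rw [eq_top_iff, ← iSup_buttinWeight μ N isContactWeight_bDeg]
  refine iSup_le fun γ => ?_
  rcases lt_or_ge γ 0 with h | h
  · intro x hx
    rw [show x = 0 from Subtype.ext (eq_zero_of_neg h hx)]
    exact zero_mem _
  · lift γ to ℕ using h
    rw [← buttinDeg_eq]
    exact le_iSup (buttinDeg μ N) γ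

end Degree

end
end WeisfeilerKac

namespace WeisfeilerKac

noncomputable section

/-! ### The Buttin algebra as a maximal prolong -/

open DP

section Vanishing

variable {K : Type*} [Field K]

theorem contactBracket_one (f : DP BVar K) : contactBracket 1 f = pd tauv f := by
  simp [contactBracket, eulerQ_apply]

/-- Together with the bracket with 1, this expresses the derivatives of `f` in τ and in the q's
through brackets with elements of degree -1. -/
theorem contactBracket_xi (i : Fin 2) (f : DP BVar K) :
    contactBracket (X (xiv i)) f = X (xiv i) * pd tauv f + pd (qv i) f := by
  fin_cases i <;> simp [contactBracket, eulerQ_apply, pd_X]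

theorem contactBracket_xi_xi (f : DP BVar K) : contactBracket (X (xiv 0) * X (xiv 1)) f =
    X (xiv 0) * X (xiv 1) * pd tauv f + X (xiv 1) * pd (qv 0) f + X (xiv 0) * pd (qv 1) f := by
  simp [contactBracket, eulerQ_apply, pd_X, Derivation.leibniz, add_assoc]

/-- The exponents of the monomials `1`, `ξ₀`, `ξ₁`, `ξ₀ξ₁`. -/
def xiExp : Fin 4 → BVar → ℕ :=
  ![0, Pi.single (xiv 0) 1, Pi.single (xiv 1) 1, Pi.single (xiv 0) 1 + Pi.single (xiv 1) 1]

/-- The monomials `1`, `ξ₀`, `ξ₁`, `ξ₀ξ₁`. -/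
def xiMono (k : Fin 4) : DP BVar K := mono (xiExp k) 1

theorem xiMono_zero : (xiMono 0 : DP BVar K) = 1 := rfl
theorem xiMono_one : (xiMono 1 : DP BVar K) = X (xiv 0) := rfl
theorem xiMono_two : (xiMono 2 : DP BVar K) = X (xiv 1) := rfl
theorem xiMono_three : (xiMono 3 : DP BVar K) = X (xiv 0) * X (xiv 1) := by
  rw [X, X, mono_mul_mono, xiMono, xiExp]
  congr 2
  rw [show binom (Pi.single (xiv 0) 1) (Pi.single (xiv 1) 1 : BVar → ℕ) = 1 by decide]
  simp

theorem xiExp_injective : Function.Injective xiExp := by decide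

theorem wt_xiExp (k : Fin 4) : wt (fun i => (bDeg i : ℤ)) (xiExp k) = 0 := by
  revert k; decide

theorem exists_eq_xiExp {r : BVar → ℕ} (hr : wt (fun i => (bDeg i : ℤ)) r = 0)
    (h : ∀ i, r (xiv i) < 2) : ∃ k, r = xiExp k := by
  have h' : r (qv 0) = 0 ∧ r (qv 1) = 0 ∧ r tauv = 0 := by
    simp only [wt, bDeg, Fintype.sum_sum_type, Fin.sum_univ_two, Sum.elim_inl, Sum.elim_inr,
      Finset.univ_unique, Finset.sum_singleton, nsmul_eq_mul] at hr
    push_cast at hr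
    change (r (qv 0) : ℤ) * 1 + r (qv 1) * 1 + (r (xiv 0) * 0 + r (xiv 1) * 0 + r tauv * 1) = 0 at hr
    omega
  have hx := h 0
  have hy := h 1
  obtain ⟨h1, h2, h3⟩ := h'
  have hx' : r (xiv 0) = 0 ∨ r (xiv 0) = 1 := by omega
  have hy' : r (xiv 1) = 0 ∨ r (xiv 1) = 1 := by omega
  have key : ∀ k, r (xiv 0) = xiExp k (xiv 0) → r (xiv 1) = xiExp k (xiv 1) → ∃ k, r = xiExp k := by
    intro k a b
    refine ⟨k, funext fun i => ?_⟩
    have hk : ∀ k, xiExp k (qv 0) = 0 ∧ xiExp k (qv 1) = 0 ∧ xiExp k tauv = 0 := by decide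
    have hk := hk k
    rcases i with i | i | i
    · fin_cases i
      · exact h1.trans hk.1.symm
      · exact h2.trans hk.2.1.symm
    · fin_cases i
      · exact a
      · exact b
    · exact h3.trans hk.2.2.symm
  rcases hx' with a | a <;> rcases hy' with b | b
  · exact key 0 a b
  · exact key 2 a b
  · exact key 1 a b
  · exact key 3 a b

/-- A function without term of degree 0 is zero if its derivatives in `q i` and `τ` are zero. -/
theorem eq_zero_of_pd_q_tau {f : DP BVar K}
    (h0 : ∀ r, wt (fun i => (bDeg i : ℤ)) r = 0 → coeff r f = 0)
    (ht : pd tauv f = 0) (hq : ∀ i, pd (qv i) f = 0) : f = 0 := by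
  refine DP.ext fun r => ?_
  rw [map_zero]
  have key : ∀ i, pd i f = 0 → r i ≠ 0 → coeff r f = 0 := by
    intro i hi hr
    obtain ⟨s, rfl⟩ := exists_eq_add_single i r hr
    rw [← coeff_pd, hi, map_zero]
  by_cases h1 : r (qv 0) = 0
  · by_cases h2 : r (qv 1) = 0
    · by_cases h3 : r tauv = 0
      · refine h0 r ?_
        simp [wt, bDeg, Fintype.sum_sum_type, h1, h2, h3]
      · exact key _ ht h3
    · exact key _ (hq 1) h2
  · exact key _ (hq 0) h1

theorem coeff_eq_zero_of_pos {d : ℕ} {f : DP BVar K} (hf : f ∈ homog bDeg (d + 1)) (r : BVar → ℕ)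
    (hr : wt (fun i => (bDeg i : ℤ)) r = 0) : coeff r f = 0 := by
  by_contra h
  rw [homog_bDeg] at hf
  have := mem_weightPiece.1 hf r h
  rw [hr] at this
  push_cast at this
  omega

theorem pd_q_eq_zero {f : DP BVar K} (hf : f ∈ homog bDeg 0) (i : Fin 2) : pd (qv i) f = 0 := by
  refine eq_zero_of_neg (γ := -1) (by norm_num) ?_
  rw [homog_bDeg] at hf
  have h := pd_mem_weightPiece (qv i) hf
  rwa [show ((0 : ℕ) : ℤ) - (bDeg (qv i) : ℤ) = -1 from rfl] at h

variable [CharP K 2]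

theorem X_mul_self (i : BVar) : (X i * X i : DP BVar K) = 0 := by
  rw [X, mono_mul_mono]
  have h2 : 2 ∣ binom (Pi.single i 1 : BVar → ℕ) (Pi.single i 1) := by
    refine Dvd.dvd.trans ?_ (Finset.dvd_prod_of_mem _ (Finset.mem_univ i))
    simp
  rw [(CharP.cast_eq_zero_iff K 2 _).2 h2, zero_mul, map_zero]

/-- The first step towards the integration of a compatible family: the derivative in `τ` of its
first member vanishes. -/
theorem pd_tau_eq_zero_of_compat {μ : K} (hμ : μ ≠ 1) {N : Fin 2 → ℕ∞} {d : ℕ} {f : Fin 4 → DP BVar K}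
    (hf : ∀ k, f k ∈ homog bDeg (d + 1)) (ht : ∀ k, f k ∈ trunc (bShear N))
    (hd : ∀ k, buttinDiv μ (f k) = 0)
    (hc : ∀ k l, contactBracket (xiMono k) (f l) = contactBracket (xiMono l) (f k)) :
    pd tauv (f 0) = 0 := by
  have hT : ∀ k, pd tauv (pd tauv (f k)) = 0 := fun k => pd_pd_eq_zero (Sum.inr ()) (ht k)
  have c1 := hc 0 1
  have c2 := hc 0 2
  have c12 := hc 1 2
  rw [xiMono_zero, xiMono_one, contactBracket_one, contactBracket_xi] at c1
  rw [xiMono_zero, xiMono_two, contactBracket_one, contactBracket_xi] at c2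
  rw [xiMono_one, xiMono_two, contactBracket_xi, contactBracket_xi] at c12
  cases d with
  | succ d =>
    -- In this range of degrees `∂τ f₀` has positive degree, so its derivatives decide.
    -- Differentiating the compatibility relations in τ and using that `∂τ²` is zero gives the
    -- vanishing of its q-derivatives.
    refine eq_zero_of_pd_q_tau (coeff_eq_zero_of_pos (pd_mem_homog tauv (hf 0))) (hT 0) fun i => ?_
    have h : ∀ i, ∀ g : DP BVar K, pd tauv g = X (xiv i) * pd tauv (f 0) + pd (qv i) (f 0) →
        pd tauv (pd tauv g) = 0 → pd (qv i) (pd tauv (f 0)) = 0 := by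
      intro i g hg hg'
      rw [hg, map_add, Derivation.leibniz, hT, pd_X, if_neg (by simp), smul_zero, smul_zero,
        zero_add, zero_add, pd_comm] at hg'
      exact hg'
    fin_cases i
    · exact h 0 _ c1 (hT 1)
    · exact h 1 _ c2 (hT 2)
  | zero =>
    have e2 : (2 : DP BVar K) = 0 := CharTwo.two_eq_zero
    set m : DP BVar K := algebraMap K _ μ with hm
    have dm : ∀ i, pd i m = 0 := fun i => Derivation.map_algebraMap _ _
    -- In the lowest degree the `∂τ f k` depend on ξ only, so the operator E disappears from the
    -- defining equation and `∂τ f k = μ Δ f k`.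
    have hTq : ∀ k i, pd (qv i) (pd tauv (f k)) = 0 := fun k i =>
      pd_q_eq_zero (pd_mem_homog tauv (hf k)) i
    have hdiv : ∀ k, pd tauv (f k) = m * (pd (qv 0) (pd (xiv 0) (f k)) +
        pd (qv 1) (pd (xiv 1) (f k))) := by
      intro k
      have h := hd k
      rw [buttinDiv_eq, cDiv, eulerQ_apply, hTq, hTq] at h
      linear_combination h
    have x0 : ∀ k, pd (xiv 0) (pd (xiv 0) (f k)) = 0 := fun k =>
      pd_pd_eq_zero (Sum.inl 0) (ht k)
    have x1 : ∀ k, pd (xiv 1) (pd (xiv 1) (f k)) = 0 := fun k =>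
      pd_pd_eq_zero (Sum.inl 1) (ht k)
    have y0 : ∀ k, pd (xiv 0) (pd tauv (f k)) = m * pd (qv 1) (pd (xiv 0) (pd (xiv 1) (f k))) := by
      intro k
      rw [hdiv, Derivation.leibniz, dm, map_add, pd_comm (xiv 0) (qv 0), x0,
        pd_comm (xiv 0) (qv 1)]
      simp
    have y1 : ∀ k, pd (xiv 1) (pd tauv (f k)) = m * pd (qv 0) (pd (xiv 0) (pd (xiv 1) (f k))) := by
      intro k
      rw [hdiv, Derivation.leibniz, dm, map_add, pd_comm (xiv 1) (qv 1), x1,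
        pd_comm (xiv 1) (qv 0), pd_comm (xiv 1) (xiv 0)]
      simp
    have y01 : ∀ k, pd (xiv 0) (pd (xiv 1) (pd tauv (f k))) = 0 := by
      intro k
      rw [y1, Derivation.leibniz, dm, pd_comm (xiv 0) (qv 0), pd_comm (xiv 0) (xiv 1) (f k),
        pd_comm (xiv 0) (xiv 1), x0]
      simp
    -- The hypothesis `μ ≠ 1` enters here.
    have hu : ∀ g : DP BVar K, g = m * g → g = 0 := by
      intro g hg
      have h : (1 - μ) • g = 0 := by
        rw [sub_smul, one_smul, Algebra.smul_def, ← hm, ← hg, sub_self]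
      exact (smul_eq_zero.1 h).resolve_left (sub_ne_zero.2 hμ.symm)
    set A := pd (qv 0) (pd (xiv 0) (pd (xiv 1) (f 2))) with hA
    set B := pd (qv 1) (pd (xiv 0) (pd (xiv 1) (f 1))) with hB
    -- Applying `∂ξ₀∂ξ₁` to the relation between `f₁` and `f₂` gives `(1 + μ)(A - B) = 0`.
    have hAB : A = B := by
      have h := congrArg (fun g => pd (xiv 0) (pd (xiv 1) g)) c12
      simp only [map_add, Derivation.leibniz, pd_X, smul_eq_mul, y01] at h
      simp only [Sum.inr.injEq, Sum.inl.injEq, if_true, if_false, map_zero,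
        mul_zero, mul_one, zero_add, add_zero, zero_ne_one, one_ne_zero, y0, y1,
        pd_comm (xiv 1) (qv 0), pd_comm (xiv 0) (qv 0), pd_comm (xiv 1) (qv 1),
        pd_comm (xiv 0) (qv 1), Derivation.map_one_eq_zero] at h
      refine sub_eq_zero.1 (hu _ ?_)
      linear_combination h - m * (A - B) * e2
    set b := pd tauv (f 0) with hb
    -- Substituting the q-derivatives of `f₀` into `b = μ Δ f₀` produces the terms `μ² (A + B)` and
    -- `2 μ b`, which vanish in characteristic 2 since `A = B`. Differentiating the resulting
    -- equation in each ξᵢ then gives `∂ξᵢ b = μ ∂ξᵢ b`.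
    have hb1 : b = m * (X (xiv 0) * pd (xiv 0) b + X (xiv 1) * pd (xiv 1) b) := by
      have h0 : pd (qv 0) (f 0) = pd tauv (f 1) - X (xiv 0) * b := by rw [c1]; ring
      have h1 : pd (qv 1) (f 0) = pd tauv (f 2) - X (xiv 1) * b := by rw [c2]; ring
      have h := hdiv 0
      rw [← pd_comm (xiv 0), ← pd_comm (xiv 1), h0, h1, map_sub, map_sub, y0, y1, ← hA, ← hB, hAB,
        Derivation.leibniz, Derivation.leibniz, pd_X, pd_X, if_pos rfl, if_pos rfl, ← hb] at h
      simp only [smul_eq_mul] at h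
      linear_combination h + (m * m * B - m * b - m * (X (xiv 0) * pd (xiv 0) b +
        X (xiv 1) * pd (xiv 1) b)) * e2
    have z01 : pd (xiv 0) (pd (xiv 1) b) = 0 := y01 0
    have z00 : pd (xiv 0) (pd (xiv 0) b) = 0 := by rw [hb, pd_comm _ tauv, pd_comm _ tauv, x0, map_zero]
    have z11 : pd (xiv 1) (pd (xiv 1) b) = 0 := by rw [hb, pd_comm _ tauv, pd_comm _ tauv, x1, map_zero]
    have z0 : pd (xiv 0) b = 0 := by
      refine hu _ ?_
      conv_lhs => rw [hb1]
      simp [Derivation.leibniz, dm, z00, z01, pd_X]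
    have z1 : pd (xiv 1) b = 0 := by
      refine hu _ ?_
      conv_lhs => rw [hb1]
      simp [Derivation.leibniz, dm, z11, pd_comm (xiv 1) (xiv 0), z01, pd_X]
    rw [hb1, z0, z1]
    simp

end Vanishing

end
end WeisfeilerKac

/-! ### Integration of compatible families in the Buttin algebra -/

namespace WeisfeilerKac

noncomputable section

open DP

namespace DP

variable {ι K : Type*} [Fintype ι] [DecidableEq ι] [Field K]

/-- The integration `u^(r) ↦ u^(r + eᵢ)`. -/
def integral (i : ι) : DP ι K →ₗ[K] DP ι K := lift fun r => mono (r + Pi.single i 1)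

theorem integral_mono (i : ι) (r : ι → ℕ) (a : K) :
    integral i (mono r a : DP ι K) = mono (r + Pi.single i 1) a := lift_mono _ _ _

theorem pd_integral (i : ι) (f : DP ι K) : pd i (integral i f) = f := by
  refine DP.induction f (by simp) (fun a b ha hb => by rw [map_add, map_add, ha, hb]) fun r a => ?_
  rw [integral_mono]
  exact pdLin_mono_add i r a

theorem pd_integral_of_ne {i j : ι} (h : j ≠ i) (f : DP ι K) :
    pd j (integral i f) = integral i (pd j f) := by
  refine DP.induction f (by simp) (fun a b ha hb => by simp only [map_add, ha, hb]) fun r a => ?_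
  rw [integral_mono]
  by_cases hr : r j = 0
  · have h1 : pd j (mono r a : DP ι K) = 0 := pdLin_mono_zero j r a hr
    rw [h1, map_zero]
    exact pdLin_mono_zero j _ a (by simp [hr, Pi.single_eq_of_ne h])
  · obtain ⟨s, rfl⟩ := exists_eq_add_single j r hr
    have h1 : pd j (mono (s + Pi.single j 1) a : DP ι K) = mono s a := pdLin_mono_add j s a
    rw [h1, integral_mono, add_right_comm]
    exact pdLin_mono_add j _ a

theorem integral_mem_homog {w : ι → ℕ} {d : ℕ} (i : ι) {f : DP ι K} (hf : f ∈ homog w d) :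
    integral i f ∈ homog w (d + w i) := by
  refine Submodule.span_induction ?_ (by simp) (fun a b _ _ ha hb => by
    rw [map_add]; exact add_mem ha hb) (fun c a _ ha => by
    rw [map_smul]; exact Submodule.smul_mem _ c ha) hf
  rintro _ ⟨r, hr, rfl⟩
  simp only [integral_mono]
  refine mono_mem_monoSpan ?_ _
  simp only [Set.mem_ofPred_eq, Pi.add_apply, mul_add, Finset.sum_add_distrib] at hr ⊢
  rw [hr, Finset.sum_eq_single i (fun j _ hj => by rw [Pi.single_eq_of_ne hj, mul_zero]) (by simp),
    Pi.single_eq_same, mul_one]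

end DP

section Poincare

variable {K : Type*} [Field K]

/-- The Poincaré lemma in the directions τ, q₀, q₁. Integration of divided powers requires no
division, and integrating in one variable after another corrects each derivative without spoiling
the earlier ones, by closedness. -/
theorem exists_pd_eq {d : ℕ} {g h₀ h₁ : DP BVar K} (hg : g ∈ homog bDeg d) (hh₀ : h₀ ∈ homog bDeg d)
    (hh₁ : h₁ ∈ homog bDeg d) (e₀ : pd tauv h₀ = pd (qv 0) g) (e₁ : pd tauv h₁ = pd (qv 1) g)
    (e₀₁ : pd (qv 0) h₁ = pd (qv 1) h₀) :
    ∃ f ∈ homog bDeg (d + 1), pd tauv f = g ∧ pd (qv 0) f = h₀ ∧ pd (qv 1) f = h₁ := by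
  set f₁ := integral tauv g with hf₁
  have hf₁d : f₁ ∈ homog bDeg (d + 1) := integral_mem_homog tauv hg
  set k₀ := h₀ - pd (qv 0) f₁ with hk₀
  have hk₀d : k₀ ∈ homog bDeg d := sub_mem hh₀ (pd_mem_homog (qv 0) hf₁d)
  have hk₀t : pd tauv k₀ = 0 := by
    rw [hk₀, map_sub, e₀, pd_comm, hf₁, pd_integral, sub_self]
  set f₂ := f₁ + integral (qv 0) k₀ with hf₂
  have hf₂d : f₂ ∈ homog bDeg (d + 1) := add_mem hf₁d (integral_mem_homog (qv 0) hk₀d)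
  have hf₂t : pd tauv f₂ = g := by
    rw [hf₂, map_add, hf₁, pd_integral, pd_integral_of_ne (by simp), hk₀t, map_zero, add_zero]
  have hf₂0 : pd (qv 0) f₂ = h₀ := by
    rw [hf₂, map_add, pd_integral, hk₀, add_sub_cancel]
  set k₁ := h₁ - pd (qv 1) f₂ with hk₁
  have hk₁d : k₁ ∈ homog bDeg d := sub_mem hh₁ (pd_mem_homog (qv 1) hf₂d)
  have hk₁t : pd tauv k₁ = 0 := by
    rw [hk₁, map_sub, e₁, pd_comm, hf₂t, sub_self]
  have hk₁0 : pd (qv 0) k₁ = 0 := by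
    rw [hk₁, map_sub, e₀₁, pd_comm, hf₂0, sub_self]
  refine ⟨f₂ + integral (qv 1) k₁, add_mem hf₂d (integral_mem_homog (qv 1) hk₁d), ?_, ?_, ?_⟩
  · rw [map_add, hf₂t, pd_integral_of_ne (by simp), hk₁t, map_zero, add_zero]
  · rw [map_add, hf₂0, pd_integral_of_ne (by simp), hk₁0, map_zero, add_zero]
  · rw [map_add, pd_integral, hk₁, add_sub_cancel]

theorem pd_tau_homog {d : ℕ} {f : DP BVar K} (hf : f ∈ homog bDeg (d + 1)) :
    pd tauv f ∈ homog bDeg d := pd_mem_homog tauv hf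

theorem pd_q_homog {d : ℕ} (i : Fin 2) {f : DP BVar K} (hf : f ∈ homog bDeg (d + 1)) :
    pd (qv i) f ∈ homog bDeg d := pd_mem_homog (qv i) hf

theorem xi_mul_homog {d : ℕ} (i : Fin 2) {f : DP BVar K} (hf : f ∈ homog bDeg d) :
    X (xiv i) * f ∈ homog bDeg d := by
  have h : (X (xiv i) : DP BVar K) ∈ homog bDeg 0 := by
    rw [homog_bDeg]
    exact X_mem_weightPiece (fun i => (bDeg i : ℤ)) (xiv i)
  have := mul_mem_homog h hf
  rwa [zero_add] at this

theorem contactBracket_xiMono_mem {d : ℕ} (k : Fin 4) {f : DP BVar K}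
    (hf : f ∈ homog bDeg (d + 1)) : contactBracket (xiMono k) f ∈ homog bDeg d := by
  fin_cases k
  · change contactBracket (xiMono 0) f ∈ _
    rw [xiMono_zero, contactBracket_one]
    exact pd_tau_homog hf
  · change contactBracket (xiMono 1) f ∈ _
    rw [xiMono_one, contactBracket_xi]
    exact add_mem (xi_mul_homog _ (pd_tau_homog hf)) (pd_q_homog _ hf)
  · change contactBracket (xiMono 2) f ∈ _
    rw [xiMono_two, contactBracket_xi]
    exact add_mem (xi_mul_homog _ (pd_tau_homog hf)) (pd_q_homog _ hf)
  · change contactBracket (xiMono 3) f ∈ _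
    rw [xiMono_three, contactBracket_xi_xi, mul_assoc]
    exact add_mem (add_mem (xi_mul_homog _ (xi_mul_homog _ (pd_tau_homog hf)))
      (xi_mul_homog _ (pd_q_homog _ hf))) (xi_mul_homog _ (pd_q_homog _ hf))

/-- Brackets with 1, ξ₀, ξ₁ already determine the derivatives in τ and q; the condition for ξ₀ξ₁
would be redundant. This is why the index 3 is excluded. -/
theorem eq_zero_of_contactBracket_xiMono {f : DP BVar K}
    (h0 : ∀ r, wt (fun i => (bDeg i : ℤ)) r = 0 → coeff r f = 0)
    (h : ∀ k : Fin 4, k ≠ 3 → contactBracket (xiMono k) f = 0) : f = 0 := by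
  have ht := h 0 (by decide)
  have h1 := h 1 (by decide)
  have h2 := h 2 (by decide)
  rw [xiMono_zero, contactBracket_one] at ht
  rw [xiMono_one, contactBracket_xi, ht, mul_zero, zero_add] at h1
  rw [xiMono_two, contactBracket_xi, ht, mul_zero, zero_add] at h2
  exact eq_zero_of_pd_q_tau h0 ht (Fin.forall_fin_two.2 ⟨h1, h2⟩)

variable [CharP K 2]

/-- Functions of ξ alone commute under the contact bracket, and the Jacobi identity passes this on
to their inner derivations. -/
theorem contactBracket_xiMono_comm (k l : Fin 4) (f : DP BVar K) :
    contactBracket (xiMono k) (contactBracket (xiMono l) f) =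
      contactBracket (xiMono l) (contactBracket (xiMono k) f) := by
  have h0 : contactBracket (K := K) (xiMono k) (xiMono l) = 0 := by
    have e2 : (2 : DP BVar K) = 0 := CharTwo.two_eq_zero
    have p : ∀ i k, pd (qv i) (xiMono k : DP BVar K) = 0 := by
      intro i k
      refine pdLin_mono_zero _ _ _ ?_
      revert i k; decide
    have q : ∀ k, pd tauv (xiMono k : DP BVar K) = 0 := by
      intro k
      refine pdLin_mono_zero _ _ _ ?_
      revert k; decide
    simp [contactBracket, p, q]
  have h := cBr_jacobi (K := K) (R := DP BVar K) buttinComm (xiMono k) (xiMono l) f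
  change contactBracket (xiMono k) (contactBracket (xiMono l) f) =
    contactBracket (contactBracket (xiMono k) (xiMono l)) f +
      contactBracket (xiMono l) (contactBracket (xiMono k) f) at h
  rw [h, h0]
  simp [contactBracket]

/-- For ξᵢ two extra terms `μ ∂qᵢ∂τ f` arise, from moving E past `∂qᵢ` and from Δ acting on the
factor ξᵢ, and they cancel. No equation for `f` is needed, so this can be applied to a function not
yet known to lie in the Buttin algebra. -/
theorem buttinDiv_contactBracket_xiMono (μ : K) {k : Fin 4} (hk : k ≠ 3) (f : DP BVar K) :
    buttinDiv μ (contactBracket (xiMono k) f) = contactBracket (xiMono k) (buttinDiv μ f) := by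
  have H := buttinComm (K := K)
  have dm : ∀ i, pd i (algebraMap K (DP BVar K) μ) = 0 := fun i => Derivation.map_algebraMap _ _
  have key : ∀ i, buttinDiv μ (contactBracket (X (xiv i)) f) =
      contactBracket (X (xiv i)) (buttinDiv μ f) := by
    intro i
    rw [contactBracket_xi, contactBracket_xi, buttinDiv_eq, buttinDiv_eq]
    have hE : (eulerQ (X (xiv i)) : DP BVar K) = 0 := by simp [eulerQ_apply, pd_X]
    fin_cases i <;>
    · simp only [cDiv, map_add, map_sub, Derivation.leibniz, smul_eq_mul, H.hE0, H.hE1,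
        H.hET, H.h1, H.h2, H.h3, H.h4, H.h5, H.h7, H.h8, H.h9, H.h10, dm, pd_X,
        Fin.zero_eta, Fin.mk_one] at hE ⊢
      simp [hE]
      ring
  fin_cases k
  · change buttinDiv μ (contactBracket (xiMono 0) f) = contactBracket (xiMono 0) _
    rw [xiMono_zero, contactBracket_one, contactBracket_one, buttinDiv_eq, buttinDiv_eq]
    simp only [cDiv, map_add, map_sub, Derivation.leibniz, smul_eq_mul, H.hET, H.h7, H.h8, H.h9,
      H.h10, dm]
    ring
  · exact key 0
  · exact key 1
  · exact absurd rfl hk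

theorem buttinDiv_mem_homog (μ : K) {d : ℕ} {f : DP BVar K} (hf : f ∈ homog bDeg (d + 1)) :
    buttinDiv μ f ∈ homog bDeg d := by
  have hx : ∀ i, pd (xiv i) f ∈ homog bDeg (d + 1) := fun i => pd_mem_homog (xiv i) hf
  exact sub_mem (sub_mem (pd_tau_homog hf) (Submodule.smul_mem _ _
    (eulerQ_mem_monoSpan (pd_tau_homog hf))))
    (Submodule.smul_mem _ _ (add_mem (pd_q_homog 0 (hx 0)) (pd_q_homog 1 (hx 1))))

/-- Separates the condition on the odd indeterminates, stated by second derivatives, from the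
heights of the even ones. For infinite heights only the former remains. -/
theorem mem_trunc_bShear {N : Fin 2 → ℕ∞} {f : DP BVar K} : f ∈ trunc (bShear N) ↔
    (∀ i, pd (Sum.inr i) (pd (Sum.inr i) f) = 0) ∧
      ∀ i, ∀ n : ℕ, N i = n → ∀ r, 2 ^ n ≤ r (qv i) → coeff r f = 0 := by
  constructor
  · intro h
    refine ⟨fun i => pd_pd_eq_zero i h, fun i n hn r hr => ?_⟩
    by_contra hr'
    exact absurd (mem_monoSpan.1 (mem_trunc.1 h) r hr' (qv i) n hn) (not_lt.2 hr)
  · rintro ⟨h, h'⟩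
    refine mem_trunc.2 (mem_monoSpan.2 fun r hr i n hn => ?_)
    by_contra hlt
    refine hr ?_
    rcases i with i | i
    · exact h' i n hn r (not_lt.1 hlt)
    · obtain rfl : n = 1 := by exact_mod_cast (show ((1 : ℕ) : ℕ∞) = n from hn).symm
      obtain ⟨s, rfl⟩ := exists_eq_add_single (Sum.inr i) r (by omega)
      obtain ⟨t, rfl⟩ := exists_eq_add_single (Sum.inr i) s (by
        simp only [Pi.add_apply, Pi.single_eq_same] at hlt
        omega)
      rw [← coeff_pd, ← coeff_pd, h, map_zero]

/-- A compatible family of elements of positive degree can be integrated in the Buttin algebra. -/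
theorem exists_contactBracket_eq {μ : K} (hμ : μ ≠ 1) {d : ℕ} {f : Fin 4 → DP BVar K}
    (hf : ∀ k, f k ∈ homog bDeg (d + 1)) (hb : ∀ k, f k ∈ buttinAlgebra μ fun _ => ⊤)
    (hc : ∀ k l, contactBracket (xiMono k) (f l) = contactBracket (xiMono l) (f k)) :
    ∃ g ∈ homog bDeg (d + 2), g ∈ buttinAlgebra μ (fun _ => ⊤) ∧
      ∀ k, contactBracket (xiMono k) g = f k := by
  -- Once this obstruction is gone, the compatibility relations say exactly that the prescribed
  -- derivatives below form a closed system.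
  have ht : pd tauv (f 0) = 0 :=
    pd_tau_eq_zero_of_compat hμ hf (fun k => (hb k).1) (fun k => (hb k).2) hc
  have c1 := hc 0 1
  have c2 := hc 0 2
  have c12 := hc 1 2
  rw [xiMono_zero, xiMono_one, contactBracket_one, contactBracket_xi, ht, mul_zero, zero_add] at c1
  rw [xiMono_zero, xiMono_two, contactBracket_one, contactBracket_xi, ht, mul_zero, zero_add] at c2
  rw [xiMono_one, xiMono_two, contactBracket_xi, contactBracket_xi] at c12
  -- The prescribed derivatives are obtained by solving `∂τ g = f₀` and `ξᵢ ∂τ g + ∂qᵢ g = f (i +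
  -- 1)`.
  obtain ⟨g, hg, hgt, hg0, hg1⟩ := exists_pd_eq (g := f 0) (h₀ := f 1 - X (xiv 0) * f 0)
    (h₁ := f 2 - X (xiv 1) * f 0) (hf 0) (sub_mem (hf 1) (xi_mul_homog _ (hf 0)))
    (sub_mem (hf 2) (xi_mul_homog _ (hf 0)))
    (by rw [map_sub, Derivation.leibniz, ht, pd_X, c1]; simp)
    (by rw [map_sub, Derivation.leibniz, ht, pd_X, c2]; simp)
    (by
      rw [map_sub, map_sub, Derivation.leibniz, Derivation.leibniz, pd_X, pd_X, ← c1, ← c2]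
      simp only [reduceCtorEq, if_false, smul_eq_mul]
      linear_combination c12)
  have hgk : ∀ k : Fin 4, k ≠ 3 → contactBracket (xiMono k) g = f k := by
    intro k hk
    fin_cases k
    · exact (contactBracket_one g).trans hgt
    · refine (contactBracket_xi 0 g).trans ?_
      rw [hgt, hg0]
      exact add_sub_cancel _ _
    · refine (contactBracket_xi 1 g).trans ?_
      rw [hgt, hg1]
      exact add_sub_cancel _ _
    · exact absurd rfl hk
  refine ⟨g, hg, ⟨?_, ?_⟩, fun k => ?_⟩
  · refine mem_trunc_bShear.2 ⟨fun i => ?_, fun i n hn => absurd hn (ENat.top_ne_natCast n)⟩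
    have hX : ∀ i : Fin 2, (X (xiv i) : DP BVar K) ∈ trunc (bShear fun _ => ⊤) := fun i =>
      mem_trunc.2 (mono_mem_monoSpan (fun j n hn => by
        rcases j with j | j
        · exact absurd hn (ENat.top_ne_natCast n)
        · obtain rfl : n = 1 := by exact_mod_cast (show ((1 : ℕ) : ℕ∞) = n from hn).symm
          by_cases h : Sum.inr j = xiv i
          · rw [h]; simp
          · rw [Pi.single_eq_of_ne h]; simp) 1)
    -- Square-freeness in ξ is inherited from the derivatives of `g`, which are built from the `f
    -- k`; square-freeness in τ is `∂τ f₀ = 0`.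
    have ht0 : ∀ i j, pd (Sum.inr i) (pd (Sum.inr i) (pd j g)) = pd j (pd (Sum.inr i) (pd (Sum.inr i) g)) :=
      fun i j => by rw [pd_comm _ j, pd_comm _ j]
    rcases i with i | i
    · refine eq_zero_of_pd_q_tau (coeff_eq_zero_of_pos (d := d + 1)
        (pd_mem_homog (xiv i) (pd_mem_homog (xiv i) hg))) ?_ fun j => ?_
      · rw [← ht0, hgt]
        exact pd_pd_eq_zero _ (hb 0).1
      · rw [← ht0]
        refine pd_pd_eq_zero (N := fun _ => ⊤) _ ?_
        fin_cases j
        · exact hg0 ▸ sub_mem (hb 1).1 (mul_mem (hX 0) (hb 0).1)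
        · exact hg1 ▸ sub_mem (hb 2).1 (mul_mem (hX 1) (hb 0).1)
    · exact (congrArg _ hgt).trans ht
  -- The defect of the defining equation for `g` has positive degree, and its brackets with 1, ξ₀,
  -- ξ₁ are the vanishing defects for the `f k`.
  · refine eq_zero_of_contactBracket_xiMono (coeff_eq_zero_of_pos (d := d) ?_) fun k hk => ?_
    · exact buttinDiv_mem_homog μ hg
    · rw [← buttinDiv_contactBracket_xiMono μ hk, hgk k hk]
      exact (hb k).2
  -- The bracket with ξ₀ξ₁ was not used in constructing `g`; its value is forced, since the
  -- difference is killed by brackets with 1, ξ₀, ξ₁.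
  · refine sub_eq_zero.1 (eq_zero_of_contactBracket_xiMono (coeff_eq_zero_of_pos (d := d)
      (sub_mem (contactBracket_xiMono_mem k hg) (hf k))) fun l hl => ?_)
    have h : ∀ a b c : DP BVar K, contactBracket a (b - c) = contactBracket a b - contactBracket a c := by
      intro a b c
      simp only [contactBracket, map_sub]
      ring
    rw [h, contactBracket_xiMono_comm, hgk l hl, hc k l, sub_self]

end Poincare

end
end WeisfeilerKac

/-! ### The component of degree -1 and the maximal prolong property -/

namespace WeisfeilerKac

noncomputable section

open DP

section ButtinProlong

variable {K : Type*} [Field K] [CharP K 2]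

theorem pd_q_xiMono (i : Fin 2) (k : Fin 4) : pd (qv i) (xiMono k : DP BVar K) = 0 :=
  pdLin_mono_zero _ _ _ (by revert i k; decide)

theorem pd_tau_xiMono (k : Fin 4) : pd tauv (xiMono k : DP BVar K) = 0 :=
  pdLin_mono_zero _ _ _ (by revert k; decide)

theorem contactBracket_xiMono_eq_zero (k : Fin 4) {f : DP BVar K} (hf : f ∈ homog bDeg 0) :
    contactBracket (xiMono k) f = 0 := by
  have hq := pd_q_eq_zero hf
  have ht : pd tauv f = 0 := by
    refine eq_zero_of_neg (γ := -1) (by norm_num) ?_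
    rw [homog_bDeg] at hf
    have h := pd_mem_weightPiece tauv hf
    rwa [show ((0 : ℕ) : ℤ) - (bDeg tauv : ℤ) = -1 from rfl] at h
  simp [contactBracket, pd_q_xiMono, pd_tau_xiMono, hq, ht]

theorem xiMono_mem (μ : K) (N : Fin 2 → ℕ∞) (k : Fin 4) :
    (xiMono k : DP BVar K) ∈ buttinAlgebra μ N := by
  refine ⟨mem_trunc.2 (mono_mem_monoSpan (fun j n hn => ?_) 1), ?_⟩
  · rcases j with j | j
    · have h : ∀ k j, xiExp k (qv j) = 0 := by decide
      rw [h]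
      positivity
    · obtain rfl : n = 1 := by exact_mod_cast (show ((1 : ℕ) : ℕ∞) = n from hn).symm
      have h : ∀ k j, xiExp k (Sum.inr j) < 2 ^ 1 := by decide
      exact h k j
  · change pd tauv (xiMono k) - μ • eulerQ (pd tauv (xiMono k)) - μ • bvLaplace (xiMono k) = 0
    simp [pd_tau_xiMono, bvLaplace, pd_comm (qv _), pd_q_xiMono]

/-- The elements of the Buttin algebra of degree `-1`. -/
def xiEl (μ : K) (N : Fin 2 → ℕ∞) (k : Fin 4) : buttinAlgebra μ N := ⟨xiMono k, xiMono_mem μ N k⟩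

theorem coeff_xiMono (k l : Fin 4) : coeff (xiExp k) (xiMono l : DP BVar K) = if l = k then 1 else 0 := by
  rw [xiMono, coeff_mono]
  simp only [xiExp_injective.eq_iff]

variable {μ : K} {N : Fin 2 → ℕ∞}

theorem coe_lie (x y : buttinAlgebra μ N) :
    ((⁅x, y⁆ : buttinAlgebra μ N).1 : DP BVar K) = contactBracket (K := K) x.1 y.1 := rfl

theorem lie_xiEl_mem {d : ℕ} (k : Fin 4) {x : buttinAlgebra μ N} (hx : x ∈ buttinDeg μ N (d + 1)) :
    ⁅xiEl μ N k, x⁆ ∈ buttinDeg μ N d := contactBracket_xiMono_mem k hx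

theorem coeff_eq_zero_of_coeff_xiExp {x : buttinAlgebra μ N}
    (h : ∀ k, coeff (xiExp k) (x.1 : DP BVar K) = 0) (r : BVar → ℕ)
    (hr : wt (fun i => (bDeg i : ℤ)) r = 0) : coeff r (x.1 : DP BVar K) = 0 := by
  by_contra hne
  obtain ⟨k, rfl⟩ := exists_eq_xiExp hr fun i => by
    simpa using mem_monoSpan.1 (mem_trunc.1 x.2.1) r hne (xiv i) 1 rfl
  exact hne (h k)

/-- Transitivity of the regraded Buttin algebra; it also yields the faithfulness of the degree 0
action. -/
theorem eq_zero_of_lie_xiEl {x : buttinAlgebra μ N}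
    (h : ∀ k, coeff (xiExp k) (x.1 : DP BVar K) = 0) (h' : ∀ k, ⁅xiEl μ N k, x⁆ = 0) : x = 0 :=
  Subtype.ext (eq_zero_of_contactBracket_xiMono (coeff_eq_zero_of_coeff_xiExp h) fun k _ =>
    congrArg Subtype.val (h' k))

theorem coeff_xiExp_of_mem_buttinDeg {d : ℕ} {x : buttinAlgebra μ N}
    (hx : x ∈ buttinDeg μ N (d + 1)) (k : Fin 4) : coeff (xiExp k) (x.1 : DP BVar K) = 0 :=
  coeff_eq_zero_of_pos (d := d) hx _ (wt_xiExp k)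

theorem xiEl_mem_buttinDeg (k : Fin 4) : xiEl μ N k ∈ buttinDeg μ N 0 := by
  rw [buttinDeg_eq]
  exact mono_mem_monoSpan (wt_xiExp k) _

theorem eq_sum_xiEl {x : buttinAlgebra μ N} (hx : x ∈ buttinDeg μ N 0) :
    x = ∑ k, coeff (xiExp k) (x.1 : DP BVar K) • xiEl μ N k := by
  refine sub_eq_zero.1 (eq_zero_of_lie_xiEl (fun k => ?_) fun k => ?_)
  · have h := map_sum (buttinAlgebra μ N).toSubmodule.subtype
      (fun k => coeff (xiExp k) (x.1 : DP BVar K) • xiEl μ N k) Finset.univ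
    have h' : coeff (xiExp k) ((∑ k, coeff (xiExp k) (x.1 : DP BVar K) • xiEl μ N k).1 : DP BVar K) =
        ∑ l, coeff (xiExp k) (coeff (xiExp l) (x.1 : DP BVar K) • xiMono l : DP BVar K) :=
      (congrArg (coeff (K := K) (xiExp k)) h).trans (map_sum (coeff (K := K) (xiExp k)) _ _)
    refine (map_sub (coeff (K := K) (xiExp k)) _ _).trans (sub_eq_zero.2 ?_)
    refine Eq.trans ?_ h'.symm
    simp [coeff_xiMono]
  · have h0 : ∀ y ∈ buttinDeg μ N 0, ⁅xiEl μ N k, y⁆ = 0 := by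
      intro y hy
      exact Subtype.ext (contactBracket_xiMono_eq_zero k hy)
    exact h0 _ (sub_mem hx (sum_mem fun l _ => Submodule.smul_mem _ _ (xiEl_mem_buttinDeg l)))

/-- Functions without terms in ξ alone form a subalgebra: in each summand of the bracket one of the
two factors is not differentiated in q or τ, except by the degree-preserving E, so it keeps positive
degree. -/
theorem contactBracket_mem_pos {f g : DP BVar K}
    (hf : ∀ r, wt (fun i => (bDeg i : ℤ)) r = 0 → coeff r f = 0)
    (hg : ∀ r, wt (fun i => (bDeg i : ℤ)) r = 0 → coeff r g = 0) :
    ∀ r, wt (fun i => (bDeg i : ℤ)) r = 0 → coeff r (contactBracket f g) = 0 := by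
  set S : Set (BVar → ℕ) := {r | wt (fun i => (bDeg i : ℤ)) r ≠ 0} with hS
  have iff : ∀ f : DP BVar K, (∀ r, wt (fun i => (bDeg i : ℤ)) r = 0 → coeff r f = 0) ↔
      f ∈ monoSpan S := fun f => by
    rw [mem_monoSpan]
    exact forall_congr' fun r => by rw [hS, Set.mem_ofPred_eq, not_imp_not]
  rw [iff] at *
  have nn : ∀ r, 0 ≤ wt (fun i => (bDeg i : ℤ)) r := fun r =>
    Finset.sum_nonneg fun i _ => nsmul_nonneg (Nat.cast_nonneg _) _
  have ml : ∀ {f g : DP BVar K}, f ∈ monoSpan S → f * g ∈ monoSpan S := by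
    intro f g hf
    refine mul_mem_monoSpan (T := Set.univ) (fun r hr s _ => Or.inl ?_) hf
      (monoSpan_univ (K := K) (ι := BVar) ▸ Submodule.mem_top)
    change wt _ (r + s) ≠ 0
    rw [wt_add]
    have h1 := nn r
    have h2 := nn s
    have h3 : wt (fun i => (bDeg i : ℤ)) r ≠ 0 := hr
    omega
  have mr : ∀ {f g : DP BVar K}, g ∈ monoSpan S → f * g ∈ monoSpan S := fun {f g} h => by
    rw [mul_comm]
    exact ml h
  have hx : ∀ i, ∀ {f : DP BVar K}, f ∈ monoSpan S → pd (xiv i) f ∈ monoSpan S := by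
    intro i f hf
    refine pd_mem_monoSpan (fun r hr => ?_) hf
    change wt _ _ ≠ 0 at hr
    rw [wt_add, wt_single, show ((bDeg (xiv i) : ℕ) : ℤ) = 0 from rfl, add_zero] at hr
    exact hr
  exact add_mem (add_mem (ml (sub_mem hf (eulerQ_mem_monoSpan hf)))
    (mr (sub_mem hg (eulerQ_mem_monoSpan hg)))) (add_mem (add_mem (mr (hx 0 hg)) (ml (hx 0 hf)))
      (add_mem (mr (hx 1 hg)) (ml (hx 1 hf))))

/-- The coordinates of the component of degree `-1`. -/
def xiCoeff (μ : K) (N : Fin 2 → ℕ∞) (k : Fin 4) : buttinAlgebra μ N →ₗ[K] K :=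
  (coeff (xiExp k) : DP BVar K →ₗ[K] K).comp (buttinAlgebra μ N).toSubmodule.subtype

theorem xiCoeff_apply (k : Fin 4) (x : buttinAlgebra μ N) :
    xiCoeff μ N k x = coeff (xiExp k) (x.1 : DP BVar K) := rfl

theorem lie_xiEl_xiEl (k l : Fin 4) : ⁅xiEl μ N k, xiEl μ N l⁆ = 0 := by
  refine Subtype.ext ?_
  change contactBracket (xiMono k : DP BVar K) (xiMono l) = 0
  simp [contactBracket, pd_q_xiMono, pd_tau_xiMono]

variable (μ N) in
/-- The realization of the Buttin algebra by vector fields, in the coordinates dual to multiples of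
`1`, `ξ₀`, `ξ₁`, `ξ₀ξ₁`. -/
def buttinTransversal (π : Equiv.Perm (Fin 4)) (c : Fin 4 → K) (hc : ∀ i, c i ≠ 0) :
    Transversal K (buttinAlgebra μ N) where
  v i := c i • xiEl μ N (π i)
  ev := LinearMap.pi fun i => (c i)⁻¹ • xiCoeff μ N (π i)
  lie_v i j := by rw [smul_lie, lie_smul, lie_xiEl_xiEl, smul_zero, smul_zero]
  ev_v i := by
    funext j
    rw [LinearMap.pi_apply, LinearMap.smul_apply, map_smul, xiCoeff_apply]
    change (c j)⁻¹ • c i • coeff (xiExp (π j)) (xiMono (π i)) = _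
    rw [coeff_xiMono]
    by_cases h : i = j
    · subst h
      simp [hc]
    · simp [h]
  ev_lie x y hx hy := by
    have h : ∀ x : buttinAlgebra μ N, (LinearMap.pi fun i => (c i)⁻¹ • xiCoeff μ N (π i)) x = 0 →
        ∀ r, wt (fun i => (bDeg i : ℤ)) r = 0 → coeff r (x.1 : DP BVar K) = 0 := by
      intro x hx
      refine coeff_eq_zero_of_coeff_xiExp fun k => ?_
      have h := congrFun hx (π.symm k)
      rw [LinearMap.pi_apply, LinearMap.smul_apply, Equiv.apply_symm_apply] at h
      exact (smul_eq_zero.1 h).resolve_left (inv_ne_zero (hc _))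
    funext i
    rw [LinearMap.pi_apply, LinearMap.smul_apply, xiCoeff_apply, coe_lie,
      contactBracket_mem_pos (h x hx) (h y hy) _ (wt_xiExp _)]
    simp
  finite x := by
    refine finite_of_powProd_eq_zero _ (exists_powProd_eq_zero (B := buttinDeg μ N) (fun i j => ?_)
      (iSup_buttinDeg μ N) (fun i x hx => ?_) (fun i d x hx => ?_) x)
    · refine LinearMap.ext fun x => ?_
      simp only [Module.End.mul_apply, LieAlgebra.ad_apply]
      rw [leibniz_lie, smul_lie, lie_smul, lie_xiEl_xiEl, smul_zero, smul_zero, zero_lie, zero_add]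
    · rw [LieAlgebra.ad_apply, eq_sum_xiEl hx, lie_sum]
      refine Finset.sum_eq_zero fun k _ => ?_
      rw [smul_lie, lie_smul, lie_xiEl_xiEl, smul_zero, smul_zero]
    · rw [LieAlgebra.ad_apply, smul_lie]
      exact Submodule.smul_mem _ _ (lie_xiEl_mem _ hx)

/-- All but `exists_lie_eq` hold for any `μ`. Permutation and multiples are carried along because a
weight basis of the component of degree -1 is determined only up to scalars and its order depends on
the Cartan matrix. -/
theorem isProlong_buttinTransversal (hμ : μ ≠ 1) (π : Equiv.Perm (Fin 4)) (c : Fin 4 → K)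
    (hc : ∀ i, c i ≠ 0) : (buttinTransversal μ (fun _ => ⊤) π c hc).IsProlong
      (buttinDeg μ fun _ => ⊤) where
  zero := by
    refine le_antisymm (fun x hx => ?_) (Submodule.span_le.2 ?_)
    · rw [eq_sum_xiEl hx]
      refine sum_mem fun k _ => Submodule.smul_mem _ _ ?_
      have h : xiEl μ (fun _ => ⊤) k = (c (π.symm k))⁻¹ • (c (π.symm k) • xiEl μ _ (π (π.symm k))) := by
        rw [smul_smul, inv_mul_cancel₀ (hc _), one_smul, Equiv.apply_symm_apply]
      rw [h]
      exact Submodule.smul_mem _ _ (Submodule.subset_span ⟨_, rfl⟩)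
    · rintro _ ⟨i, rfl⟩
      exact Submodule.smul_mem _ _ (xiEl_mem_buttinDeg _)
  lie_succ d i x hx := by
    change ⁅c i • xiEl μ _ (π i), x⁆ ∈ _
    rw [smul_lie]
    exact Submodule.smul_mem _ _ (lie_xiEl_mem _ hx)
  ev_succ d x hx := by
    funext i
    change (c i)⁻¹ • coeff (xiExp (π i)) (x.1 : DP BVar K) = 0
    rw [coeff_xiExp_of_mem_buttinDeg hx, smul_zero]
  inj x h h' := by
    refine eq_zero_of_lie_xiEl (fun k => ?_) fun k => ?_
    · have h := congrFun h (π.symm k)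
      change (c _)⁻¹ • coeff (xiExp (π (π.symm k))) (x.1 : DP BVar K) = 0 at h
      rw [Equiv.apply_symm_apply] at h
      exact (smul_eq_zero.1 h).resolve_left (inv_ne_zero (hc _))
    · have h := h' (π.symm k)
      change ⁅c _ • xiEl μ _ (π (π.symm k)), x⁆ = 0 at h
      rw [Equiv.apply_symm_apply, smul_lie] at h
      exact (smul_eq_zero.1 h).resolve_left (hc _)
  exists_lie_eq d f hf hff := by
    have hv : ∀ (k : Fin 4) (x : buttinAlgebra μ fun _ => ⊤), ⁅xiEl μ (fun _ => ⊤) k, x⁆ = (c (π.symm k))⁻¹ •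
        ⁅(buttinTransversal μ (fun _ => ⊤) π c hc).v (π.symm k), x⁆ := by
      intro k x
      change _ = (c _)⁻¹ • ⁅c _ • xiEl μ _ (π (π.symm k)), x⁆
      rw [Equiv.apply_symm_apply, smul_lie, smul_smul, inv_mul_cancel₀ (hc _), one_smul]
    -- The given family refers to `c i • ξ-monomial (π i)`; reindexing by the inverse permutation
    -- and dividing by the scalars makes it a family for the ξ-monomials themselves.
    obtain ⟨g, hg, hgb, h⟩ := exists_contactBracket_eq hμ (d := d)
      (f := fun k => ((c (π.symm k))⁻¹ • f (π.symm k) : buttinAlgebra μ fun _ => ⊤).1)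
      (fun k => Submodule.smul_mem _ _ (hf _))
      (fun k => ((c (π.symm k))⁻¹ • f (π.symm k) : buttinAlgebra μ fun _ => ⊤).2) fun k l => by
        have e : ⁅xiEl μ (fun _ => ⊤) k, (c (π.symm l))⁻¹ • f (π.symm l)⁆ =
            ⁅xiEl μ (fun _ => ⊤) l, (c (π.symm k))⁻¹ • f (π.symm k)⁆ := by
          rw [lie_smul, lie_smul, hv, hv, hff, smul_comm]
        exact congrArg Subtype.val e
    refine ⟨⟨g, hgb⟩, hg, fun i => ?_⟩
    have h : ⁅xiEl μ (fun _ => ⊤) (π i), (⟨g, hgb⟩ : buttinAlgebra μ fun _ => ⊤)⁆ = (c i)⁻¹ • f i := by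
      have h := h (π i)
      simp only [Equiv.symm_apply_apply] at h
      exact Subtype.ext h
    change ⁅c i • xiEl μ (fun _ => ⊤) (π i), _⁆ = _
    rw [smul_lie, h, smul_smul, mul_inv_cancel₀ (hc i), one_smul]
  iSup := iSup_buttinDeg μ _

end ButtinProlong

end
end WeisfeilerKac

/-! ### Shearing vectors and nilpotency of inner derivations -/

namespace WeisfeilerKac

noncomputable section

open DP

section ButtinProlong

attribute [local instance 100] LieRing.ofAssociativeRing

variable {K : Type*} [Field K] [CharP K 2] {μ : K}

/-- For 1 this is `∂τ² = 0`. For ξ₀ξ₁ every term of the square contains ξ₀², ξ₁² or a factor 2.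
Therefore the heights of these two coordinates do not affect the prolong. -/
theorem lie_xiEl_sq_of_tau (k : Fin 4) (hk : k = 0 ∨ k = 3) {N : Fin 2 → ℕ∞}
    (x : buttinAlgebra μ N) : ⁅xiEl μ N k, ⁅xiEl μ N k, x⁆⁆ = 0 := by
  refine Subtype.ext ?_
  have hT : pd tauv (pd tauv (x.1 : DP BVar K)) = 0 := pd_pd_eq_zero (Sum.inr ()) x.2.1
  have key : ∀ f : DP BVar K, pd tauv (pd tauv f) = 0 →
      contactBracket (xiMono k) (contactBracket (xiMono k) f) = 0 := by
    intro f hT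
    rcases hk with rfl | rfl
    · rw [xiMono_zero, contactBracket_one, contactBracket_one, hT]
    · have e2 : (2 : DP BVar K) = 0 := CharTwo.two_eq_zero
      have x0 := X_mul_self (K := K) (xiv 0)
      have x1 := X_mul_self (K := K) (xiv 1)
      rw [xiMono_three, contactBracket_xi_xi, contactBracket_xi_xi]
      have n0 : ∀ j, (tauv : BVar) ≠ xiv j := by simp
      have n1 : ∀ i j, (qv i : BVar) ≠ xiv j := by simp
      simp only [map_add, Derivation.leibniz, pd_X, hT, smul_eq_mul, pd_comm tauv (qv 0),
        pd_comm tauv (qv 1), pd_comm (qv 1) (qv 0), n0, n1, if_false, mul_zero, add_zero, zero_add]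
      generalize (X (xiv 0) : DP BVar K) = a at *
      generalize (X (xiv 1) : DP BVar K) = b at *
      generalize pd (qv 0) (pd tauv f) = t0
      generalize pd (qv 1) (pd tauv f) = t1
      generalize pd (qv 0) (pd (qv 0) f) = q00
      generalize pd (qv 0) (pd (qv 1) f) = q01
      generalize pd (qv 1) (pd (qv 1) f) = q11
      linear_combination (2 * a * t0 + q00) * x1 + (2 * b * t1 + q11) * x0 + a * b * q01 * e2
  exact key _ hT

/-- The mixed term occurs twice and so vanishes in characteristic 2. -/
theorem contactBracket_xi_sq (i : Fin 2) {f : DP BVar K} (hT : pd tauv (pd tauv f) = 0) :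
    contactBracket (X (xiv i)) (contactBracket (X (xiv i)) f) = pd (qv i) (pd (qv i) f) := by
  have e2 : (2 : DP BVar K) = 0 := CharTwo.two_eq_zero
  rw [contactBracket_xi, contactBracket_xi]
  simp only [map_add, Derivation.leibniz, pd_X, hT, smul_eq_mul, pd_comm tauv (qv i)]
  have hne : (tauv : BVar) ≠ xiv i := by simp
  have hne' : (qv i : BVar) ≠ xiv i := by simp
  simp only [hne, hne', if_false, mul_zero, add_zero, zero_add]
  linear_combination X (xiv i) * pd (qv i) (pd tauv f) * e2

/-- The element `ξ i` of the Buttin algebra. -/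
def xiIndex (i : Fin 2) : Fin 4 := ![1, 2] i

theorem coeff_ad_xiEl_pow (i : Fin 2) {N : Fin 2 → ℕ∞} (n : ℕ) (x : buttinAlgebra μ N)
    (r : BVar → ℕ) : coeff r (((LieAlgebra.ad K _ (xiEl μ N (xiIndex i)) ^ (2 * n)) x).1 : DP BVar K) =
      coeff (r + Pi.single (qv i) (2 * n)) (x.1 : DP BVar K) := by
  induction n generalizing x with
  | zero => simp
  | succ n ih =>
    rw [mul_add, mul_one, pow_add, Module.End.mul_apply, ih]
    have h : (((LieAlgebra.ad K _ (xiEl μ N (xiIndex i)) ^ 2) x).1 : DP BVar K) =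
        pd (qv i) (pd (qv i) (x.1 : DP BVar K)) := by
      have hT : pd tauv (pd tauv (x.1 : DP BVar K)) = 0 := pd_pd_eq_zero (Sum.inr ()) x.2.1
      rw [← contactBracket_xi_sq i hT]
      fin_cases i <;> rfl
    rw [h, show 2 * n + 2 = 2 * n + 1 + 1 from rfl, Pi.single_add, Pi.single_add, ← add_assoc,
      ← add_assoc]
    rfl

/-- Both sides say that `(ad v i) ^ 2 ^ M i` kills `x` whenever `M i` is finite. On the left this is
a condition only at the positions of ξ₀ and ξ₁, where even powers of ad ξᵢ are even powers of `∂qᵢ`.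
-/
theorem mem_trunc_iff_coord_mem (hμ : μ ≠ 1) (π : Equiv.Perm (Fin 4)) (c : Fin 4 → K)
    (hc : ∀ i, c i ≠ 0) (M : Fin 4 → ℕ∞) (hM : ∀ i, 1 ≤ M i) (x : buttinAlgebra μ fun _ => ⊤) :
    (x.1 : DP BVar K) ∈ trunc (bShear ![M (π.symm 1), M (π.symm 2)]) ↔
      ∀ j, (buttinTransversal μ (fun _ => ⊤) π c hc).coord j x ∈ trunc M := by
  set t := buttinTransversal μ (fun _ => ⊤) π c hc with ht
  have hP : ∀ i, t.P i = c i • LieAlgebra.ad K _ (xiEl μ (fun _ => ⊤) (π i)) := fun i =>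
    map_smul (LieAlgebra.ad K (buttinAlgebra μ fun _ => ⊤)) _ _
  have hPn : ∀ i n, t.P i ^ n = c i ^ n • LieAlgebra.ad K _ (xiEl μ (fun _ => ⊤) (π i)) ^ n :=
    fun i n => by rw [hP, smul_pow]
  have hN : ∀ i, (![M (π.symm 1), M (π.symm 2)] : Fin 2 → ℕ∞) i = M (π.symm (xiIndex i)) := by
    intro i; fin_cases i <;> rfl
  -- The hypothesis `1 ≤ M i` makes the exponent even, so the formulas for squares apply.
  have htwo : ∀ i, ∀ n : ℕ, M i = n → ∃ m, m ≠ 0 ∧ 2 ^ n = 2 * m := by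
    intro i n hn
    have h := hM i
    rw [hn] at h
    have h1 : 1 ≤ n := by exact_mod_cast h
    obtain ⟨k, rfl⟩ := Nat.exists_eq_add_of_le h1
    exact ⟨2 ^ k, by positivity, by rw [pow_add, pow_one]⟩
  refine (mem_trunc_bShear (f := (x.1 : DP BVar K))).trans ?_
  constructor
  · rintro ⟨-, h⟩ j
    refine mem_trunc.2 (mem_monoSpan.2 fun r hr i n hn => ?_)
    by_contra hlt
    rw [not_lt] at hlt
    refine hr ?_
    have hzero : (t.P i ^ 2 ^ n) x = 0 := by
      obtain ⟨m, hm, hm'⟩ := htwo i n hn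
      rw [hPn, LinearMap.smul_apply]
      refine smul_eq_zero_of_right _ ?_
      have h4 : ∀ k : Fin 4, k = 0 ∨ k = 3 ∨ ∃ a, k = xiIndex a := by decide
      have h03 : π i = 0 ∨ π i = 3 →
          (LieAlgebra.ad K _ (xiEl μ (fun _ => ⊤) (π i)) ^ 2 ^ n) x = 0 := by
        intro hk
        have h2 : LieAlgebra.ad K _ (xiEl μ (fun _ => ⊤) (π i)) ^ 2 = 0 :=
          LinearMap.ext fun x => lie_xiEl_sq_of_tau _ hk x
        rw [hm', pow_mul, h2, zero_pow hm, LinearMap.zero_apply]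
      rcases h4 (π i) with hk | hk | ⟨a, hk⟩
      · exact h03 (Or.inl hk)
      · exact h03 (Or.inr hk)
      · refine Subtype.ext (DP.ext fun s => ?_)
        rw [hk, hm', coeff_ad_xiEl_pow]
        refine h a n ?_ _ ?_
        · rw [hN, ← hk, Equiv.symm_apply_apply, hn]
        · rw [hm']; simp
    have hr' : r = (r - Pi.single i (2 ^ n)) + Pi.single i (2 ^ n) := by
      funext k
      by_cases hk : k = i
      · subst hk; simp; omega
      · simp [Pi.single_eq_of_ne hk]
    rw [Transversal.coeff_coord, hr', powProd_add t.commute_P, powProd_single, Module.End.mul_apply,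
      hzero, map_zero, map_zero]
    rfl
  · intro h
    refine ⟨fun i => pd_pd_eq_zero i x.2.1, fun i n hn r hr => ?_⟩
    rw [hN] at hn
    set i' := π.symm (xiIndex i) with hi'
    obtain ⟨m, hm, hm'⟩ := htwo i' n hn
    -- The coordinates of this element are derivatives of order `2 ^ n` of the truncated coordinates
    -- of `x`, hence zero, and the realization by fields is injective.
    have hzero : (t.P i' ^ 2 ^ n) x = 0 := by
      refine (isProlong_buttinTransversal hμ π c hc).field_eq_zero _ ?_
      change t.field _ = 0
      rw [Transversal.field_apply]
      have : (fun j => t.coord j ((t.P i' ^ 2 ^ n) x)) = 0 := by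
        funext j
        refine DP.ext fun s => ?_
        by_contra hne
        rw [Transversal.coeff_coord, ← powProd_single, ← Module.End.mul_apply,
          ← powProd_add t.commute_P, ← Transversal.coeff_coord] at hne
        have := mem_monoSpan.1 (mem_trunc.1 (h j)) _ hne i' n hn
        simp at this
      rw [this, map_zero]
    rw [hPn, LinearMap.smul_apply] at hzero
    have hz := (smul_eq_zero.1 hzero).resolve_left (pow_ne_zero _ (hc _))
    rw [hi', Equiv.apply_symm_apply, hm'] at hz
    have hr' : r = (r - Pi.single (qv i) (2 * m)) + Pi.single (qv i) (2 * m) := by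
      funext k
      by_cases hk : k = qv i
      · subst hk; simp; omega
      · simp [Pi.single_eq_of_ne hk]
    rw [hr', ← coeff_ad_xiEl_pow, hz]
    exact map_zero (coeff (K := K) _)

theorem mem_buttinDeg {N : Fin 2 → ℕ∞} {d : ℕ} {x : buttinAlgebra μ N} :
    x ∈ buttinDeg μ N d ↔ (x.1 : DP BVar K) ∈ homog bDeg d := Iff.rfl

theorem inclusion_mem_buttinDeg {N N' : Fin 2 → ℕ∞} (h : buttinAlgebra μ N ≤ buttinAlgebra μ N') {d : ℕ}
    {x : buttinAlgebra μ N} :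
    LieSubalgebra.inclusion h x ∈ buttinDeg μ N' d ↔ x ∈ buttinDeg μ N d := by
  rw [mem_buttinDeg, mem_buttinDeg, LieSubalgebra.inclusion_apply]

theorem inclusion_xiEl {N N' : Fin 2 → ℕ∞} (h : buttinAlgebra μ N ≤ buttinAlgebra μ N') (k : Fin 4) :
    LieSubalgebra.inclusion h (xiEl μ N k) = xiEl μ N' k := rfl

/-- The Cartan prolong of the components of degree `-1` and `0` of the Buttin algebra, in the
coordinates dual to multiples of `1`, `ξ₀`, `ξ₁`, `ξ₀ξ₁`, is the Buttin algebra. -/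
theorem exists_prolong_equiv_buttin (hμ : μ ≠ 1) {V : Type*} [AddCommGroup V] [Module K V]
    {b : Module.Basis (Fin 4) K V} {S : LieSubalgebra K (Module.End K V)} (π : Equiv.Perm (Fin 4))
    (c : Fin 4 → K) (hc : ∀ i, c i ≠ 0) (M : Fin 4 → ℕ∞) (hM : ∀ i, 1 ≤ M i)
    {T : V →ₗ[K] buttinAlgebra μ fun _ => ⊤} (hT : ∀ i, T (b i) = c i • xiEl μ _ (π i))
    (hS : ∀ s : Module.End K V, s ∈ S ↔
      ∃ x ∈ buttinDeg μ (fun _ => ⊤) 1, ∀ v, T (s v) = ⁅x, T v⁆) :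
    ∃ e : prolong b S M ≃ₗ⁅K⁆ (buttin μ ![M (π.symm 1), M (π.symm 2)]).desuper,
      ∀ (d : ℕ) (x : prolong b S M),
        (x : Derivation K (DP (Fin 4) K) (DP (Fin 4) K)) ∈ prolongPiece b S M d ↔
          e x ∈ buttinPiece μ ![M (π.symm 1), M (π.symm 2)] d := by
  set N : Fin 2 → ℕ∞ := ![M (π.symm 1), M (π.symm 2)] with hN
  have hle : buttinAlgebra μ N ≤ buttinAlgebra μ fun _ => ⊤ := fun f hf =>
    ⟨mem_trunc_bShear.2 ⟨(mem_trunc_bShear.1 hf.1).1,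
      fun i n hn => absurd hn (ENat.top_ne_natCast n)⟩, hf.2⟩
  have hex : ∀ x : buttinAlgebra μ fun _ => ⊤,
      (∃ y, LieSubalgebra.inclusion hle y = x) ↔ (x.1 : DP BVar K) ∈ trunc (bShear N) := by
    intro x
    constructor
    · rintro ⟨y, rfl⟩
      rw [LieSubalgebra.inclusion_apply]
      exact y.2.1
    · exact fun h => ⟨⟨x.1, h, x.2.2⟩, LieSubalgebra.inclusion_apply hle _⟩
  exact (isProlong_buttinTransversal hμ π c hc).exists_prolong_equiv hT hS (Q := buttinAlgebra μ N)
    (LieSubalgebra.inclusion hle) (LieSubalgebra.inclusion_injective hle) (B' := buttinDeg μ N)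
    (fun d y => (inclusion_mem_buttinDeg hle).symm) (iSup_buttinDeg μ N)
    (fun x hx => by
      rw [eq_sum_xiEl hx]
      refine ⟨∑ k, coeff (xiExp k) (x.1 : DP BVar K) • xiEl μ N k, ?_⟩
      rw [map_sum]
      exact Finset.sum_congr rfl fun k _ => map_smul (LieSubalgebra.inclusion hle) _ (xiEl μ N k))
    (fun d x _ => (hex x).trans (mem_trunc_iff_coord_mem hμ π c hc M hM x))

end ButtinProlong

end
end WeisfeilerKac

namespace WeisfeilerKac

noncomputable section

/-! ### Gradings -/

section Grading

variable {K Γ L : Type*} [Field K]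

/-- The maps `π α` are the projections to the components of a grading. -/
structure IsGradingProj [AddCommGroup L] [Module K L] (𝒢 : Γ → Submodule K L)
    (π : Γ → L →ₗ[K] L) : Prop where
  mem : ∀ α x, π α x ∈ 𝒢 α
  same : ∀ {α x}, x ∈ 𝒢 α → π α x = x
  ne : ∀ {α β x}, x ∈ 𝒢 β → α ≠ β → π α x = 0
  sum : ∀ x, ∃ s : Finset Γ, x = ∑ α ∈ s, π α x

section Module

variable [AddCommGroup L] [Module K L] {𝒢 : Γ → Submodule K L} {π : Γ → L →ₗ[K] L}

theorem IsGradingProj.eq_of_forall (h : IsGradingProj 𝒢 π) {α : Γ} {x : L}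
    (hx : ∀ β, β ≠ α → π β x = 0) : x ∈ 𝒢 α := by
  obtain ⟨s, hs⟩ := h.sum x
  rw [hs]
  refine sum_mem fun β _ => ?_
  by_cases hβ : β = α
  · exact hβ ▸ h.mem β x
  · rw [hx β hβ]
    exact zero_mem _

theorem IsGradingProj.ext_hom (h : IsGradingProj 𝒢 π) {M : Type*} [AddCommGroup M] [Module K M]
    {f g : L →ₗ[K] M} (hfg : ∀ α, ∀ x ∈ 𝒢 α, f x = g x) : f = g := by
  refine LinearMap.ext fun x => ?_
  obtain ⟨s, hs⟩ := h.sum x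
  rw [hs, map_sum, map_sum]
  exact Finset.sum_congr rfl fun α _ => hfg α _ (h.mem α x)

theorem exists_isGradingProj [DecidableEq Γ] (h : iSupIndep 𝒢) (h' : ⨆ α, 𝒢 α = ⊤) :
    ∃ π : Γ → L →ₗ[K] L, IsGradingProj 𝒢 π := by
  have hI := DirectSum.isInternal_submodule_of_iSupIndep_of_iSup_eq_top h h'
  let _ := hI.chooseDecomposition
  refine ⟨fun α => (𝒢 α).subtype ∘ₗ DirectSum.component K Γ (fun α => 𝒢 α) α ∘ₗ
    (DirectSum.decomposeLinearEquiv 𝒢).toLinearMap, fun α x => (DirectSum.decompose 𝒢 x α).2,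
    fun hx => DirectSum.decompose_of_mem_same 𝒢 hx,
    fun hx hne => DirectSum.decompose_of_mem_ne 𝒢 hx hne.symm, fun x => ?_⟩
  classical
  exact ⟨_, (DirectSum.sum_support_decompose 𝒢 x).symm⟩

/-- Supplies the operators by which the generators `d k` will act. -/
theorem exists_diagonal [DecidableEq Γ] (h : iSupIndep 𝒢) (h' : ⨆ α, 𝒢 α = ⊤) (χ : Γ → K) :
    ∃ D : L →ₗ[K] L, ∀ α, ∀ x ∈ 𝒢 α, D x = χ α • x := by
  have hI := DirectSum.isInternal_submodule_of_iSupIndep_of_iSup_eq_top h h'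
  let _ := hI.chooseDecomposition
  refine ⟨DirectSum.toModule K Γ L (fun α => χ α • (𝒢 α).subtype) ∘ₗ
    (DirectSum.decomposeLinearEquiv 𝒢).toLinearMap, fun α x hx => ?_⟩
  have := DirectSum.decompose_of_mem 𝒢 hx
  rw [LinearMap.comp_apply, LinearEquiv.coe_coe, DirectSum.decomposeLinearEquiv_apply, this]
  exact (DirectSum.toModule_lof K (M := fun α => 𝒢 α) (φ := fun α => χ α • (𝒢 α).subtype) α
    ⟨x, hx⟩).trans rfl

/-- Coarsening of gradings: since the fine pieces span everything and the coarse ones are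
independent, no inclusion can be strict. Used to pass from the root grading to the ℤ-grading. -/
theorem eq_iSup_of_le {Δ : Type*} {ℬ : Δ → Submodule K L} (hℬ : iSupIndep ℬ)
    (h𝒢 : ⨆ α, 𝒢 α = ⊤) (f : Γ → Δ) (hf : ∀ α, 𝒢 α ≤ ℬ (f α)) (k : Δ) :
    ⨆ (α) (_ : f α = k), 𝒢 α = ℬ k := by
  have hle : ∀ k, ⨆ (α) (_ : f α = k), 𝒢 α ≤ ℬ k := fun k => iSup₂_le fun α hα => hα ▸ hf α
  refine le_antisymm (hle k) fun x hx => ?_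
  have htop : (⨆ (α) (_ : f α = k), 𝒢 α) ⊔ ⨆ (j) (_ : j ≠ k), ℬ j = ⊤ := by
    rw [eq_top_iff, ← h𝒢]
    refine iSup_le fun α => ?_
    by_cases hα : f α = k
    · exact le_sup_of_le_left (le_iSup₂_of_le α hα le_rfl)
    · exact le_sup_of_le_right (le_iSup₂_of_le (f α) hα (hf α))
  obtain ⟨y, hy, z, hz, rfl⟩ := Submodule.mem_sup.1 (htop ▸ Submodule.mem_top : x ∈ _)
  have hz' : z ∈ ℬ k := by simpa using sub_mem hx (hle k hy)
  have : z = 0 := by simpa using (Submodule.disjoint_def.1 (hℬ k)) z hz' hz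
  rwa [this, add_zero]

end Module

section Monomial

variable [LieRing L] [LieAlgebra K L]

theorem degPiece_induction [AddCommMonoid Γ] {X : Type*} {gen : X → L} {deg : X → Γ} {α : Γ}
    {V : Γ → Submodule K L} (hgen : ∀ x, gen x ∈ V (deg x))
    (hlie : ∀ α β x y, IsMonomial gen deg α x → IsMonomial gen deg β y → x ∈ V α → y ∈ V β →
      ⁅x, y⁆ ∈ V (α + β)) : degPiece K gen deg α ≤ V α := by
  refine Submodule.span_le.2 fun x hx => ?_
  induction hx with
  | gen x => exact hgen x
  | lie hx hy ihx ihy => exact hlie _ _ _ _ hx hy ihx ihy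

theorem iSup_degPiece_eq_top [AddCommMonoid Γ] {X : Type*} {gen : X → L} (deg : X → Γ)
    (h : LieSubalgebra.lieSpan K L (Set.range gen) = ⊤) : ⨆ α, degPiece K gen deg α = ⊤ := by
  let S : LieSubalgebra K L :=
    { (⨆ α, degPiece K gen deg α : Submodule K L) with
      lie_mem' := by
        intro x y hx hy
        refine Submodule.iSup_induction _ (motive := fun x => ⁅x, y⁆ ∈ ⨆ α, degPiece K gen deg α)
          hx (fun α x hx => ?_) (by simp) (fun a b ha hb => by rw [add_lie]; exact add_mem ha hb)
        refine Submodule.iSup_induction _ (motive := fun y => ⁅x, y⁆ ∈ ⨆ α, degPiece K gen deg α)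
          hy (fun β y hy => ?_) (by simp) (fun a b ha hb => by rw [lie_add]; exact add_mem ha hb)
        exact Submodule.mem_iSup_of_mem _ (lie_mem_degPiece hx hy) }
  have hS : (⊤ : LieSubalgebra K L) ≤ S := by
    rw [← h, LieSubalgebra.lieSpan_le]
    rintro _ ⟨x, rfl⟩
    exact Submodule.mem_iSup_of_mem (deg x) (Submodule.subset_span (.gen x))
  exact eq_top_iff.2 fun x _ => hS (LieSubalgebra.mem_top x)

theorem map_degPiece [AddCommMonoid Γ] {X M : Type*} [LieRing M] [LieAlgebra K M] (f : L →ₗ⁅K⁆ M)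
    (gen : X → L) (deg : X → Γ) (α : Γ) :
    (degPiece K gen deg α).map (f : L →ₗ[K] M) = degPiece K (fun x => f (gen x)) deg α := by
  unfold degPiece
  rw [Submodule.map_span]
  congr 1
  ext y
  constructor
  · rintro ⟨x, hx, rfl⟩
    induction hx with
    | gen x => exact .gen x
    | lie hx hy ihx ihy =>
      rw [LieHom.coe_toLinearMap, LieHom.map_lie]
      exact .lie ihx ihy
  · intro hy
    induction hy with
    | gen x => exact ⟨_, .gen x, rfl⟩
    | lie _ _ ihx ihy =>
      obtain ⟨x, hx, rfl⟩ := ihx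
      obtain ⟨y, hy, rfl⟩ := ihy
      exact ⟨⁅x, y⁆, .lie hx hy, LieHom.map_lie f x y⟩

/-- A monomial of a coarse degree has a fine degree as well, obtained along its bracketing. -/
theorem degPiece_le_iSup [AddCommMonoid Γ] {Δ : Type*} [AddCommMonoid Δ] {X : Type*} {gen : X → L}
    {deg : X → Γ} {f : Γ →+ Δ} {δ : Δ} :
    degPiece K gen (fun x => f (deg x)) δ ≤ ⨆ (α) (_ : f α = δ), degPiece K gen deg α := by
  refine Submodule.span_le.2 fun x hx => ?_
  suffices ∃ α, f α = δ ∧ IsMonomial gen deg α x by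
    obtain ⟨α, hα, h⟩ := this
    exact Submodule.mem_iSup_of_mem α (Submodule.mem_iSup_of_mem hα (Submodule.subset_span h))
  induction hx with
  | gen x => exact ⟨_, rfl, .gen x⟩
  | lie hx hy ihx ihy =>
    obtain ⟨α, rfl, hα⟩ := ihx
    obtain ⟨β, rfl, hβ⟩ := ihy
    exact ⟨α + β, map_add f α β, .lie hα hβ⟩

theorem IsMonomial.map_deg [AddCommMonoid Γ] {Δ : Type*} [AddCommMonoid Δ] {X : Type*} {gen : X → L}
    {deg : X → Γ} (f : Γ →+ Δ) {α : Γ} {x : L} (h : IsMonomial gen deg α x) :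
    IsMonomial gen (fun x => f (deg x)) (f α) x := by
  induction h with
  | gen x => exact .gen x
  | lie hx hy ihx ihy =>
    rw [map_add]
    exact .lie ihx ihy

/-- If the components of a grading are closed under the bracket and contain the generators, then they
are spanned by the monomials in the generators. -/
theorem IsGradingProj.le_degPiece [AddCommMonoid Γ] {X : Type*} {gen : X → L} {deg : X → Γ}
    {𝒢 : Γ → Submodule K L} {π : Γ → L →ₗ[K] L} (h : IsGradingProj 𝒢 π)
    (hlie : ∀ {α β x y}, x ∈ 𝒢 α → y ∈ 𝒢 β → ⁅x, y⁆ ∈ 𝒢 (α + β)) (hgen : ∀ x, gen x ∈ 𝒢 (deg x))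
    (htop : LieSubalgebra.lieSpan K L (Set.range gen) = ⊤) (α : Γ) :
    𝒢 α ≤ degPiece K gen deg α := by
  have hle : ∀ β, degPiece K gen deg β ≤ 𝒢 β := fun β =>
    degPiece_induction hgen fun _ _ _ _ _ _ hx hy => hlie hx hy
  intro x hx
  have key : ∀ y ∈ ⨆ β, degPiece K gen deg β, π α y ∈ degPiece K gen deg α := by
    intro y hy
    refine Submodule.iSup_induction _ (motive := fun y => π α y ∈ degPiece K gen deg α) hy
      (fun β y hy => ?_) (by simp) (fun a b ha hb => by rw [map_add]; exact add_mem ha hb)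
    by_cases hβ : α = β
    · subst hβ
      rwa [h.same (hle _ hy)]
    · rw [h.ne (hle _ hy) hβ]
      exact zero_mem _
  rw [← h.same hx]
  exact key x (iSup_degPiece_eq_top (K := K) deg htop ▸ Submodule.mem_top)

end Monomial

end Grading

end
end WeisfeilerKac

namespace WeisfeilerKac

noncomputable section

/-! ### Triangular decomposition -/

section Tower

variable {K L : Type*} [Field K] [LieRing L] [LieAlgebra K L] {n : ℕ}

/-- The spans of the iterated brackets `[e i₁, [e i₂, …, [e i_{k - 1}, e i_k]…]]`, and `H` for
`k = 0`. -/
def tower (e : Fin n → L) (H : Submodule K L) : ℕ → Submodule K L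
  | 0 => H
  | 1 => Submodule.span K (Set.range e)
  | k + 2 => ⨆ i, (tower e H (k + 1)).map (LieAlgebra.ad K L (e i) : L →ₗ[K] L)

/-- The towers of the `e i` and of the `f i` in the positive and the negative degrees. -/
def triangular (e f : Fin n → L) (H : Submodule K L) : ℤ → Submodule K L
  | .ofNat k => tower e H k
  | .negSucc k => tower f H (k + 1)

variable {e f : Fin n → L} {H : Submodule K L}

theorem lie_mem_tower_succ (he : ∀ h ∈ H, ∀ i, ⁅e i, h⁆ ∈ Submodule.span K {e i}) (i : Fin n)
    {k : ℕ} {x : L} (hx : x ∈ tower e H k) : ⁅e i, x⁆ ∈ tower e H (k + 1) := by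
  cases k with
  | zero => exact Submodule.span_mono (by simp) (he x hx i)
  | succ k => exact Submodule.mem_iSup_of_mem i ⟨x, hx, rfl⟩

theorem lie_mem_tower (hH : ∀ h ∈ H, ∀ h' ∈ H, ⁅h, h'⁆ = 0)
    (he : ∀ h ∈ H, ∀ i, ⁅e i, h⁆ ∈ Submodule.span K {e i}) {k : ℕ} {x h : L} (hh : h ∈ H)
    (hx : x ∈ tower e H k) : ⁅h, x⁆ ∈ tower e H k := by
  induction k generalizing x with
  | zero =>
    rw [hH h hh x hx]
    exact zero_mem _
  | succ k ih =>
    cases k with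
    | zero =>
      refine Submodule.span_induction ?_ (by simp)
        (fun a b _ _ ha hb => by rw [lie_add]; exact add_mem ha hb)
        (fun c a _ ha => by rw [lie_smul]; exact Submodule.smul_mem _ _ ha) hx
      rintro _ ⟨i, rfl⟩
      rw [← lie_skew]
      exact neg_mem (Submodule.span_mono (by simp) (he h hh i))
    | succ k =>
      refine Submodule.iSup_induction _ (motive := fun x => ⁅h, x⁆ ∈ tower e H (k + 2)) hx
        ?_ (by simp) (fun a b ha hb => by rw [lie_add]; exact add_mem ha hb)
      rintro i _ ⟨y, hy, rfl⟩
      obtain ⟨c, hc⟩ := Submodule.mem_span_singleton.1 (he h hh i)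
      change ⁅h, ⁅e i, y⁆⁆ ∈ _
      rw [leibniz_lie, ← lie_skew h, ← hc, neg_lie, smul_lie]
      exact add_mem (neg_mem (Submodule.smul_mem _ _ (lie_mem_tower_succ he i hy)))
        (lie_mem_tower_succ he i (ih hy))

/-- Moving `f i` inwards through `[e j, y]` leaves an element of `H` acting on `y` plus a bracket
with a shorter term. -/
theorem lie_mem_tower_pred (hH : ∀ h ∈ H, ∀ h' ∈ H, ⁅h, h'⁆ = 0)
    (he : ∀ h ∈ H, ∀ i, ⁅e i, h⁆ ∈ Submodule.span K {e i}) (hfe : ∀ i j, ⁅f i, e j⁆ ∈ H)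
    (i : Fin n) {k : ℕ} {x : L} (hx : x ∈ tower e H (k + 1)) : ⁅f i, x⁆ ∈ tower e H k := by
  induction k generalizing x with
  | zero =>
    refine Submodule.span_induction ?_ (by simp)
      (fun a b _ _ ha hb => by rw [lie_add]; exact add_mem ha hb)
      (fun c a _ ha => by rw [lie_smul]; exact Submodule.smul_mem _ _ ha) hx
    rintro _ ⟨j, rfl⟩
    exact hfe i j
  | succ k ih =>
    refine Submodule.iSup_induction _ (motive := fun x => ⁅f i, x⁆ ∈ tower e H (k + 1)) hx
      ?_ (by simp) (fun a b ha hb => by rw [lie_add]; exact add_mem ha hb)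
    rintro j _ ⟨y, hy, rfl⟩
    change ⁅f i, ⁅e j, y⁆⁆ ∈ _
    rw [leibniz_lie]
    exact add_mem (lie_mem_tower hH he (hfe i j) hy) (lie_mem_tower_succ he j (ih hy))

/-- The sum of the two towers and `H` is stable under all generators, each shifting the height by
its own height. This yields the triangular decomposition. -/
theorem lie_mem_triangular (hH : ∀ h ∈ H, ∀ h' ∈ H, ⁅h, h'⁆ = 0)
    (he : ∀ h ∈ H, ∀ i, ⁅e i, h⁆ ∈ Submodule.span K {e i})
    (hf : ∀ h ∈ H, ∀ i, ⁅f i, h⁆ ∈ Submodule.span K {f i})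
    (hef : ∀ i j, ⁅e i, f j⁆ ∈ H) (hfe : ∀ i j, ⁅f i, e j⁆ ∈ H) (k : ℤ) {x : L}
    (hx : x ∈ triangular e f H k) :
    (∀ h ∈ H, ⁅h, x⁆ ∈ triangular e f H k) ∧
    (∀ i, ⁅e i, x⁆ ∈ triangular e f H (1 + k)) ∧
    ∀ i, ⁅f i, x⁆ ∈ triangular e f H (-1 + k) := by
  -- Degree 0 is `ofNat 0` and degree -1 is `negSucc 0`: at 0 the operators enter the two towers,
  -- and at ±1 the opposite generators return to `H`.
  match k, hx with
  | .ofNat 0, hx =>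
    exact ⟨fun h hh => lie_mem_tower hH he hh hx, fun i => lie_mem_tower_succ (k := 0) he i hx,
      fun i => lie_mem_tower_succ (k := 0) hf i hx⟩
  | .ofNat (k + 1), hx =>
    have h1 : (1 : ℤ) + Int.ofNat (k + 1) = Int.ofNat (k + 2) := by simp; ring
    have h2 : (-1 : ℤ) + Int.ofNat (k + 1) = Int.ofNat k := by simp
    rw [h1, h2]
    exact ⟨fun h hh => lie_mem_tower hH he hh hx, fun i => lie_mem_tower_succ he i hx,
      fun i => lie_mem_tower_pred hH he hfe i hx⟩
  | .negSucc 0, hx =>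
    exact ⟨fun h hh => lie_mem_tower hH hf hh hx, fun i => lie_mem_tower_pred hH hf hef i hx,
      fun i => lie_mem_tower_succ hf i hx⟩
  | .negSucc (k + 1), hx =>
    have h1 : (1 : ℤ) + Int.negSucc (k + 1) = Int.negSucc k := by
      rw [Int.negSucc_eq, Int.negSucc_eq]; push_cast; ring
    have h2 : (-1 : ℤ) + Int.negSucc (k + 1) = Int.negSucc (k + 2) := by
      rw [Int.negSucc_eq, Int.negSucc_eq]; push_cast; ring
    rw [h1, h2]
    exact ⟨fun h hh => lie_mem_tower hH hf hh hx, fun i => lie_mem_tower_pred hH hf hef i hx,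
      fun i => lie_mem_tower_succ hf i hx⟩

end Tower

section Quotient

variable {K L M : Type*} [Field K] [LieRing L] [LieAlgebra K L] [LieRing M] [LieAlgebra K M]

theorem exists_quotient_lift (I : LieIdeal K L) (f : L →ₗ⁅K⁆ M) (h : I ≤ f.ker) :
    ∃ g : (L ⧸ I) →ₗ⁅K⁆ M, ∀ x, g (LieSubmodule.Quotient.mk x) = f x := by
  let F : (L ⧸ I) →ₗ[K] M := Submodule.liftQ I.toSubmodule (f : L →ₗ[K] M) h
  have hF : ∀ x, F (LieSubmodule.Quotient.mk x) = f x := fun x => rfl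
  refine ⟨{ F with map_lie' := ?_ }, hF⟩
  intro x y
  obtain ⟨x, rfl⟩ := LieSubmodule.Quotient.surjective_mk' I x
  obtain ⟨y, rfl⟩ := LieSubmodule.Quotient.surjective_mk' I y
  exact LieHom.map_lie f x y

theorem exists_equiv_of_ker_eq (I : LieIdeal K L) (f : L →ₗ⁅K⁆ M) (h : f.ker = I)
    (hf : Function.Surjective f) : ∃ g : (L ⧸ I) ≃ₗ⁅K⁆ M, ∀ x, g (LieSubmodule.Quotient.mk x) = f x := by
  obtain ⟨g, hg⟩ := exists_quotient_lift I f h.ge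
  refine ⟨LieEquiv.ofBijective g ⟨?_, fun y => ?_⟩, hg⟩
  · refine (injective_iff_map_eq_zero _).2 fun x hx => ?_
    obtain ⟨x, rfl⟩ := LieSubmodule.Quotient.surjective_mk' I x
    refine (LieSubmodule.Quotient.mk_eq_zero' (N := I)).2 (h ▸ ?_)
    exact (hg x).symm.trans hx
  · obtain ⟨x, rfl⟩ := hf y
    exact ⟨_, hg x⟩

theorem exists_factor {L' : Type*} [LieRing L'] [LieAlgebra K L'] (f : L →ₗ⁅K⁆ M)
    (hf : Function.Injective f) (g : L' →ₗ⁅K⁆ M) (h : ∀ x, ∃ y, f y = g x) :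
    ∃ θ : L' →ₗ⁅K⁆ L, ∀ x, f (θ x) = g x := by
  choose θ hθ using h
  refine ⟨{ toFun := θ, map_add' := fun x y => hf ?_, map_smul' := fun c x => hf ?_,
            map_lie' := fun {x y} => hf ?_ }, hθ⟩
  · rw [map_add, hθ, hθ, hθ, map_add]
  · rw [map_smul, hθ, hθ, map_smul]
    rfl
  · rw [LieHom.map_lie, hθ, hθ, hθ, LieHom.map_lie]

end Quotient

section TildeGrading

variable {K : Type*} [Field K] {n l : ℕ} {A : Matrix (Fin n) (Fin n) K}
  {B : Matrix (Fin l) (Fin n) K} {L : Type*} [LieRing L] [LieAlgebra K L]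

variable (A B) in
/-- The projection of the free Lie algebra onto `g̃(A)`. -/
def tildeMk : FreeLieAlgebra K (ChevalleyGen n l) →ₗ⁅K⁆ Tilde A B where
  __ := (LieSubmodule.Quotient.mk' (LieSubmodule.lieSpan K _ {x | ChevalleyRel A B x})).toLinearMap
  map_lie' := rfl

theorem tildeMk_of (x : ChevalleyGen n l) :
    tildeMk A B (FreeLieAlgebra.of K x) = tildeGen A B x := rfl

theorem tildeMk_surjective : Function.Surjective (tildeMk A B) :=
  LieSubmodule.Quotient.surjective_mk' _

theorem tildeMk_eq_zero_of_rel {x} (h : ChevalleyRel A B x) : tildeMk A B x = 0 :=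
  (LieSubmodule.Quotient.mk_eq_zero' (N := LieSubmodule.lieSpan K _ {x | ChevalleyRel A B x})).2
    (LieSubmodule.subset_lieSpan h)

theorem exists_tilde_lift (g : ChevalleyGen n l → L)
    (hg : ∀ x, ChevalleyRel A B x → FreeLieAlgebra.lift K g x = 0) :
    ∃ F : Tilde A B →ₗ⁅K⁆ L, ∀ x, F (tildeGen A B x) = g x := by
  have hle : LieSubmodule.lieSpan K _ {x | ChevalleyRel A B x} ≤ (FreeLieAlgebra.lift K g).ker :=
    LieSubmodule.lieSpan_le.2 fun x hx => hg x hx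
  obtain ⟨F, hF⟩ := exists_quotient_lift _ _ hle
  exact ⟨F, fun x => (hF _).trans (FreeLieAlgebra.lift_of_apply g x)⟩

/-- The projection from the free Lie algebra factors through the subalgebra by uniqueness on free
generators. -/
theorem lieSpan_tildeGen : LieSubalgebra.lieSpan K (Tilde A B) (Set.range (tildeGen A B)) = ⊤ := by
  set S := LieSubalgebra.lieSpan K (Tilde A B) (Set.range (tildeGen A B)) with hS
  let g : FreeLieAlgebra K (ChevalleyGen n l) →ₗ⁅K⁆ S := FreeLieAlgebra.lift K fun x =>
    ⟨tildeGen A B x, LieSubalgebra.subset_lieSpan ⟨x, rfl⟩⟩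
  have hg : S.incl.comp g = tildeMk A B := by
    refine FreeLieAlgebra.hom_ext fun x => ?_
    rw [LieHom.comp_apply, FreeLieAlgebra.lift_of_apply]
    rfl
  refine eq_top_iff.2 fun x _ => ?_
  obtain ⟨x, rfl⟩ := tildeMk_surjective x
  rw [← hg]
  exact (g x).2

end TildeGrading

end
end WeisfeilerKac

/-! ### The root grading of `g̃(A)` -/

namespace WeisfeilerKac

noncomputable section

section TildeGrading

variable {K : Type*} [Field K] {n l : ℕ} {A : Matrix (Fin n) (Fin n) K}
  {B : Matrix (Fin l) (Fin n) K}

theorem lie_tilde_ef (i j : Fin n) : ⁅tildeGen A B (.e i), tildeGen A B (.f j)⁆ =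
    if i = j then tildeGen A B (.h i) else 0 := by
  split_ifs with h
  · subst h
    simpa [sub_eq_zero, tildeMk_of] using tildeMk_eq_zero_of_rel (.ef (A := A) (B := B) i)
  · simpa [tildeMk_of] using tildeMk_eq_zero_of_rel (.ef_ne (A := A) (B := B) i j h)

theorem lie_tilde_he (i j : Fin n) : ⁅tildeGen A B (.h i), tildeGen A B (.e j)⁆ =
    A i j • tildeGen A B (.e j) := by
  simpa [sub_eq_zero, tildeMk_of] using tildeMk_eq_zero_of_rel (.he (A := A) (B := B) i j)

theorem lie_tilde_hf (i j : Fin n) : ⁅tildeGen A B (.h i), tildeGen A B (.f j)⁆ =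
    -(A i j • tildeGen A B (.f j)) := by
  simpa [add_eq_zero_iff_eq_neg, tildeMk_of] using
    tildeMk_eq_zero_of_rel (.hf (A := A) (B := B) i j)

theorem lie_tilde_de (k : Fin l) (j : Fin n) : ⁅tildeGen A B (.d k), tildeGen A B (.e j)⁆ =
    B k j • tildeGen A B (.e j) := by
  simpa [sub_eq_zero, tildeMk_of] using tildeMk_eq_zero_of_rel (.de (A := A) (B := B) k j)

theorem lie_tilde_df (k : Fin l) (j : Fin n) : ⁅tildeGen A B (.d k), tildeGen A B (.f j)⁆ =
    -(B k j • tildeGen A B (.f j)) := by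
  simpa [add_eq_zero_iff_eq_neg, tildeMk_of] using
    tildeMk_eq_zero_of_rel (.df (A := A) (B := B) k j)

theorem tildeCartan_le_of {S : Submodule K (Tilde A B)} (hh : ∀ i, tildeGen A B (.h i) ∈ S)
    (hd : ∀ k, tildeGen A B (.d k) ∈ S) : tildeCartan A B ≤ S := by
  refine Submodule.span_le.2 ?_
  rintro _ (⟨i, rfl⟩ | ⟨k, rfl⟩)
  · exact hh i
  · exact hd k

theorem h_mem_tildeCartan (i : Fin n) : tildeGen A B (.h i) ∈ tildeCartan A B :=
  Submodule.subset_span (Or.inl ⟨i, rfl⟩)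

theorem d_mem_tildeCartan (k : Fin l) : tildeGen A B (.d k) ∈ tildeCartan A B :=
  Submodule.subset_span (Or.inr ⟨k, rfl⟩)

theorem lie_tildeCartan {x y : Tilde A B} (hx : x ∈ tildeCartan A B) (hy : y ∈ tildeCartan A B) :
    ⁅x, y⁆ = 0 := by
  have hhd : ∀ i k, ⁅tildeGen A B (.h i), tildeGen A B (.d k)⁆ = 0 := fun i k => by
    simpa [tildeMk_of] using tildeMk_eq_zero_of_rel (.hd (A := A) (B := B) i k)
  have hx' : ∀ z, (∀ i, ⁅z, tildeGen A B (.h i)⁆ = 0) → (∀ k, ⁅z, tildeGen A B (.d k)⁆ = 0) →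
      ⁅z, y⁆ = 0 := fun z hh hd =>
    tildeCartan_le_of (S := (LieAlgebra.ad K _ z : Tilde A B →ₗ[K] Tilde A B).ker) hh hd hy
  have hy' : ∀ i, ⁅y, tildeGen A B (.h i)⁆ = 0 := fun i => by
    rw [← lie_skew, hx' _ (fun j => by
      simpa [tildeMk_of] using tildeMk_eq_zero_of_rel (.hh (A := A) (B := B) i j)) (hhd i), neg_zero]
  have hy'' : ∀ k, ⁅y, tildeGen A B (.d k)⁆ = 0 := fun k => by
    rw [← lie_skew, hx' _ (fun j => by rw [← lie_skew, hhd, neg_zero]) (fun m => by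
      simpa [tildeMk_of] using tildeMk_eq_zero_of_rel (.dd (A := A) (B := B) k m)), neg_zero]
  rw [← lie_skew, neg_eq_zero]
  exact tildeCartan_le_of (S := (LieAlgebra.ad K _ y : Tilde A B →ₗ[K] Tilde A B).ker) hy' hy'' hx

theorem lie_e_tildeCartan {x : Tilde A B} (hx : x ∈ tildeCartan A B) (i : Fin n) :
    ⁅tildeGen A B (.e i), x⁆ ∈ Submodule.span K {tildeGen A B (.e i)} := by
  refine tildeCartan_le_of (S := (Submodule.span K {tildeGen A B (.e i)}).comap
    (LieAlgebra.ad K _ (tildeGen A B (.e i)) : Tilde A B →ₗ[K] Tilde A B))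
    (fun j => ?_) (fun k => ?_) hx
  · rw [Submodule.mem_comap, LieAlgebra.ad_apply, ← lie_skew, lie_tilde_he]
    exact neg_mem (Submodule.smul_mem _ _ (Submodule.mem_span_singleton_self _))
  · rw [Submodule.mem_comap, LieAlgebra.ad_apply, ← lie_skew, lie_tilde_de]
    exact neg_mem (Submodule.smul_mem _ _ (Submodule.mem_span_singleton_self _))

theorem lie_f_tildeCartan {x : Tilde A B} (hx : x ∈ tildeCartan A B) (i : Fin n) :
    ⁅tildeGen A B (.f i), x⁆ ∈ Submodule.span K {tildeGen A B (.f i)} := by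
  refine tildeCartan_le_of (S := (Submodule.span K {tildeGen A B (.f i)}).comap
    (LieAlgebra.ad K _ (tildeGen A B (.f i)) : Tilde A B →ₗ[K] Tilde A B))
    (fun j => ?_) (fun k => ?_) hx
  · rw [Submodule.mem_comap, LieAlgebra.ad_apply, ← lie_skew, lie_tilde_hf, neg_neg]
    exact Submodule.smul_mem _ _ (Submodule.mem_span_singleton_self _)
  · rw [Submodule.mem_comap, LieAlgebra.ad_apply, ← lie_skew, lie_tilde_df, neg_neg]
    exact Submodule.smul_mem _ _ (Submodule.mem_span_singleton_self _)

/-- The components of `g̃(A)` with respect to the grading by the root lattice. -/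
abbrev tildePiece (A : Matrix (Fin n) (Fin n) K) (B : Matrix (Fin l) (Fin n) K)
    (α : Fin n → ℤ) : Submodule K (Tilde A B) := degPiece K (tildeGen A B) rootDeg α

/-- The height of an element of the root lattice. -/
def height : (Fin n → ℤ) →+ ℤ := ∑ i, Pi.evalAddMonoidHom (fun _ => ℤ) i

theorem height_single (i : Fin n) : height (Pi.single i (1 : ℤ)) = 1 := by
  simp [height, AddMonoidHom.finsetSum_apply]

/-- Only the heights 0 and ±1 will be used: they identify the component of degree 0 with the Cartan
subalgebra and confine those of degrees ±αᵢ to the spans of the generators. -/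
theorem tildePiece_le_triangular (α : Fin n → ℤ) : tildePiece A B α ≤
    triangular (fun i => tildeGen A B (.e i)) (fun i => tildeGen A B (.f i)) (tildeCartan A B)
      (height α) := by
  set V := triangular (fun i => tildeGen A B (.e i)) (fun i => tildeGen A B (.f i))
    (tildeCartan A B) with hV
  have hef : ∀ i j, ⁅tildeGen A B (.e i), tildeGen A B (.f j)⁆ ∈ tildeCartan A B := by
    intro i j
    rw [lie_tilde_ef]
    split_ifs
    · exact h_mem_tildeCartan i
    · exact zero_mem _
  have hlie := fun k (x : Tilde A B) (hx : x ∈ V k) => lie_mem_triangular (f := fun i =>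
    tildeGen A B (.f i)) (e := fun i => tildeGen A B (.e i))
    (fun h hh h' hh' => lie_tildeCartan (A := A) (B := B) hh hh')
    (fun h hh i => lie_e_tildeCartan hh i) (fun h hh i => lie_f_tildeCartan hh i) hef
    (fun i j => by rw [← lie_skew]; exact neg_mem (hef j i)) k hx
  -- For arbitrary monomials the shift of height follows from that of the generators, since `ad [x,
  -- y]` is a commutator.
  have hmono : ∀ α (x : Tilde A B), IsMonomial (tildeGen A B) rootDeg α x → ∀ k, ∀ y ∈ V k,
      ⁅x, y⁆ ∈ V (height α + k) := by
    intro α x hx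
    induction hx with
    | gen x =>
      intro k y hy
      cases x with
      | e i =>
        rw [rootDeg, chevalleyDeg, height_single]
        exact (hlie k y hy).2.1 i
      | f i =>
        rw [rootDeg, chevalleyDeg, map_neg, height_single]
        exact (hlie k y hy).2.2 i
      | h i =>
        rw [rootDeg, chevalleyDeg, map_zero, zero_add]
        exact (hlie k y hy).1 _ (h_mem_tildeCartan i)
      | d i =>
        rw [rootDeg, chevalleyDeg, map_zero, zero_add]
        exact (hlie k y hy).1 _ (d_mem_tildeCartan i)
    | lie hx hy ihx ihy =>
      intro k z hz
      rw [lie_lie, map_add]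
      refine sub_mem ?_ ?_
      · rw [add_assoc]
        exact ihx _ _ (ihy _ _ hz)
      · rw [add_comm (height _), add_assoc]
        exact ihy _ _ (ihx _ _ hz)
  refine degPiece_induction (V := fun α => V (height α)) ?_ fun α β x y hx hy _ hy' => ?_
  · rintro (i | i | i | i)
    · rw [rootDeg, chevalleyDeg, height_single]
      exact Submodule.subset_span ⟨i, rfl⟩
    · rw [rootDeg, chevalleyDeg, map_neg, height_single]
      exact Submodule.subset_span ⟨i, rfl⟩
    · rw [rootDeg, chevalleyDeg, map_zero]
      exact h_mem_tildeCartan i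
    · rw [rootDeg, chevalleyDeg, map_zero]
      exact d_mem_tildeCartan i
  · rw [map_add]
    exact hmono α x hx _ y hy'

theorem tildePiece_zero_le : tildePiece A B 0 ≤ tildeCartan A B := by
  have := tildePiece_le_triangular (A := A) (B := B) 0
  rwa [map_zero] at this

theorem tildeGen_mem (x : ChevalleyGen n l) : tildeGen A B x ∈ tildePiece A B (rootDeg x) :=
  Submodule.subset_span (.gen x)

theorem tildeCartan_le : tildeCartan A B ≤ tildePiece A B 0 :=
  tildeCartan_le_of (fun i => tildeGen_mem (.h i)) fun k => tildeGen_mem (.d k)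

theorem tildePiece_single_le (i : Fin n) : tildePiece A B (Pi.single i 1) ≤
    Submodule.span K (Set.range fun i => tildeGen A B (.e i)) := by
  have := tildePiece_le_triangular (A := A) (B := B) (Pi.single i 1)
  rwa [height_single] at this

theorem tildePiece_neg_single_le (i : Fin n) : tildePiece A B (-Pi.single i 1) ≤
    Submodule.span K (Set.range fun i => tildeGen A B (.f i)) := by
  have := tildePiece_le_triangular (A := A) (B := B) (-Pi.single i 1)
  rwa [map_neg, height_single] at this

open TensorProduct in
-- That the root grading is direct is seen in the loop algebra K[ℤⁿ] ⊗ g̃(A): the defining relations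
-- are homogeneous, so `x ↦ t^(deg x) ⊗ x` on the generators extends to a homomorphism, and its
-- coefficients are the projections.
theorem exists_isGradingProj_tilde (A : Matrix (Fin n) (Fin n) K) (B : Matrix (Fin l) (Fin n) K) :
    ∃ π, IsGradingProj (tildePiece A B) π := by
  let s (α : Fin n → ℤ) (x : Tilde A B) : LieAlgebra.loopAlgebra K (Fin n → ℤ) (Tilde A B) :=
    AddMonoidAlgebra.single α 1 ⊗ₜ x
  have hs : ∀ α β x y, ⁅s α x, s β y⁆ = s (α + β) ⁅x, y⁆ := fun α β x y => by
    simp [s, LieAlgebra.ExtendScalars.bracket_tmul, AddMonoidAlgebra.single_mul_single]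
  have hsub : ∀ α x y, s α x - s α y = s α (x - y) := fun α x y => (TensorProduct.tmul_sub _ _ _).symm
  have hadd : ∀ α x y, s α x + s α y = s α (x + y) := fun α x y => (TensorProduct.tmul_add _ _ _).symm
  have hsmul : ∀ (c : K) α x, c • s α x = s α (c • x) := fun c α x => (TensorProduct.tmul_smul _ _ _).symm
  have hs0 : ∀ α, s α 0 = 0 := fun α => TensorProduct.tmul_zero _ _
  obtain ⟨F, hF⟩ := exists_tilde_lift (A := A) (B := B) (fun x => s (rootDeg x) (tildeGen A B x)) (by
    intro x hx
    have h := tildeMk_eq_zero_of_rel hx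
    cases hx <;>
    simp only [map_sub, map_add, LieHom.map_lie, map_smul, fgen,
      FreeLieAlgebra.lift_of_apply, tildeMk_of, chevalleyDeg] at h ⊢ <;>
    simp only [hs, hsmul, add_neg_cancel, zero_add, add_zero, hsub, hadd, h, hs0])
  have hFm : ∀ α, ∀ x ∈ tildePiece A B α, F x = s α x := fun α x hx =>
    (degPiece_induction (V := fun α => LinearMap.eqLocus (F : Tilde A B →ₗ[K] LieAlgebra.loopAlgebra K (Fin n → ℤ) (Tilde A B))
      (TensorProduct.mk K (AddMonoidAlgebra K (Fin n → ℤ)) (Tilde A B)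
        (AddMonoidAlgebra.single α 1))) (fun x => hF x)
      (fun α β x y _ _ hx hy => by
        rw [LinearMap.mem_eqLocus] at hx hy ⊢
        change F x = s α x at hx
        change F y = s β y at hy
        change F ⁅x, y⁆ = s (α + β) ⁅x, y⁆
        rw [LieHom.map_lie, hx, hy, hs]) : tildePiece A B α ≤ _) hx
  let G : Tilde A B →ₗ[K] (Fin n → ℤ) →₀ Tilde A B :=
    (LieAlgebra.LoopAlgebra.toFinsupp K (Fin n → ℤ) (Tilde A B)).toLinearMap ∘ₗ
      (F : Tilde A B →ₗ[K] _)
  have hG : ∀ α, ∀ x ∈ tildePiece A B α, G x = Finsupp.single α x := fun α x hx => by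
    change LieAlgebra.LoopAlgebra.toFinsupp K (Fin n → ℤ) (Tilde A B) (F x) = _
    rw [hFm α x hx]
    exact LieAlgebra.LoopAlgebra.toFinsupp_single_tmul ..
  have htop : ∀ x : Tilde A B, x ∈ ⨆ α, tildePiece A B α := fun x =>
    iSup_degPiece_eq_top (K := K) rootDeg lieSpan_tildeGen ▸ Submodule.mem_top
  refine ⟨fun α => Finsupp.lapply α ∘ₗ G, fun α x => ?_, fun hx => ?_, fun hx hne => ?_,
    fun x => ⟨(G x).support, ?_⟩⟩
  · refine Submodule.iSup_induction _ (motive := fun x => G x α ∈ tildePiece A B α) (htop x)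
      (fun β y hy => ?_) (by simp) (fun a b ha hb => by
        rw [map_add]
        exact add_mem ha hb)
    rw [hG β y hy]
    by_cases h : β = α
    · subst h
      rwa [Finsupp.single_eq_same]
    · rw [Finsupp.single_eq_of_ne' h]
      exact zero_mem _
  · rw [LinearMap.comp_apply, hG _ _ hx]
    exact Finsupp.single_eq_same
  · rw [LinearMap.comp_apply, hG _ _ hx]
    exact Finsupp.single_eq_of_ne hne
  · refine Eq.symm (?_ : (G x).sum (fun _ y => y) = x)
    refine Submodule.iSup_induction _ (motive := fun x => (G x).sum (fun _ y => y) = x) (htop x)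
      (fun β y hy => ?_) (by simp) (fun a b ha hb => ?_)
    · rw [hG β y hy, Finsupp.sum_single_index rfl]
    · rw [map_add, Finsupp.sum_add_index' (fun _ => rfl) (fun _ _ _ => rfl), ha, hb]

end TildeGrading

end
end WeisfeilerKac

namespace WeisfeilerKac

noncomputable section

/-! ### Realizations of Cartan matrices -/

section Realization

attribute [local instance 100] LieRing.ofAssociativeRing

variable {K G : Type*} [Field K] [LieRing G] [LieAlgebra K G] {n l : ℕ}

/-- A graded Lie algebra with Chevalley generators that satisfy the relations given by the matrix `A`,
such that every nonzero homogeneous ideal meets the components of degrees `± αᵢ`. -/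
structure Realization (A : Matrix (Fin n) (Fin n) K) (𝒢 : (Fin n → ℤ) → Submodule K G) where
  E : Fin n → G
  F : Fin n → G
  H : Fin n → G
  indep : iSupIndep 𝒢
  iSup_eq_top : ⨆ α, 𝒢 α = ⊤
  lie_mem : ∀ {α β x y}, x ∈ 𝒢 α → y ∈ 𝒢 β → ⁅x, y⁆ ∈ 𝒢 (α + β)
  E_mem : ∀ i, E i ∈ 𝒢 (Pi.single i 1)
  F_mem : ∀ i, F i ∈ 𝒢 (-Pi.single i 1)
  H_mem : ∀ i, H i ∈ 𝒢 0
  lie_E_F : ∀ i j, ⁅E i, F j⁆ = if i = j then H i else 0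
  lie_H_E : ∀ i j, ⁅H i, E j⁆ = A i j • E j
  lie_H_F : ∀ i j, ⁅H i, F j⁆ = -(A i j • F j)
  lie_H_H : ∀ i j, ⁅H i, H j⁆ = 0
  lieSpan_eq_top : LieSubalgebra.lieSpan K G (Set.range E ∪ Set.range F) = ⊤
  E_ne_zero : ∀ i, E i ≠ 0
  F_ne_zero : ∀ i, F i ≠ 0
  eq_zero : ∀ α, α ≠ 0 → ∀ x ∈ 𝒢 α, (∀ y ∈ 𝒢 (-α), ⁅x, y⁆ = 0) → x = 0
  eq_zero_of_zero : ∀ x ∈ 𝒢 0, (∀ i, ⁅x, E i⁆ = 0) → x = 0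

/-- The operators of the given degree that are the sums of an inner derivation and of an operator
that acts on the components by an additive function of the degree. -/
def adPiece (𝒢 : (Fin n → ℤ) → Submodule K G) (α : Fin n → ℤ) : Submodule K (Module.End K G) where
  carrier := {s | ∃ X ∈ 𝒢 α, ∃ χ : (Fin n → ℤ) →+ K, (α ≠ 0 → χ = 0) ∧
    ∀ β, ∀ y ∈ 𝒢 β, s y = ⁅X, y⁆ + χ β • y}
  zero_mem' := ⟨0, zero_mem _, 0, fun _ => rfl, by simp⟩
  add_mem' := by
    rintro s t ⟨X, hX, χ, hχ, hs⟩ ⟨Y, hY, ψ, hψ, ht⟩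
    refine ⟨X + Y, add_mem hX hY, χ + ψ, fun h => by rw [hχ h, hψ h, add_zero], fun β y hy => ?_⟩
    rw [LinearMap.add_apply, hs β y hy, ht β y hy, add_lie, AddMonoidHom.add_apply, add_smul]
    abel
  smul_mem' := by
    rintro c s ⟨X, hX, χ, hχ, hs⟩
    refine ⟨c • X, Submodule.smul_mem _ c hX, (AddMonoidHom.mulLeft c).comp χ,
      fun h => by rw [hχ h, AddMonoidHom.comp_zero], fun β y hy => ?_⟩
    rw [LinearMap.smul_apply, hs β y hy, smul_lie, smul_add, smul_smul]
    rfl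

namespace Realization

variable {A : Matrix (Fin n) (Fin n) K} {𝒢 : (Fin n → ℤ) → Submodule K G} (R : Realization A 𝒢)
  (B : Matrix (Fin l) (Fin n) K)

include R

theorem exists_proj : ∃ π, IsGradingProj 𝒢 π := exists_isGradingProj R.indep R.iSup_eq_top

theorem ad_mem_adPiece {α : Fin n → ℤ} {X : G} (hX : X ∈ 𝒢 α) :
    LieAlgebra.ad K G X ∈ adPiece 𝒢 α :=
  ⟨X, hX, 0, fun _ => rfl, fun β y hy => by simp⟩

/-- The parts acting by additive functions commute with each other, and additivity makes their
commutators with inner derivations inner. Hence brackets lose the outer part, which later sends the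
derived algebra into ad `G`. -/
theorem exists_lie_eq_ad {α β : Fin n → ℤ} {s t : Module.End K G} (hs : s ∈ adPiece 𝒢 α)
    (ht : t ∈ adPiece 𝒢 β) : ∃ Z ∈ 𝒢 (α + β), ⁅s, t⁆ = LieAlgebra.ad K G Z := by
  obtain ⟨X, hX, χ, hχ, hs⟩ := hs
  obtain ⟨Y, hY, ψ, hψ, ht⟩ := ht
  obtain ⟨π, hπ⟩ := R.exists_proj
  refine ⟨⁅X, Y⁆ + χ β • Y - ψ α • X, sub_mem (add_mem (R.lie_mem hX hY) ?_) ?_,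
    hπ.ext_hom fun γ y hy => ?_⟩
  · by_cases h : α = 0
    · subst h
      rw [zero_add]
      exact Submodule.smul_mem _ _ hY
    · rw [hχ h, AddMonoidHom.zero_apply, zero_smul]
      exact zero_mem _
  · by_cases h : β = 0
    · subst h
      rw [add_zero]
      exact Submodule.smul_mem _ _ hX
    · rw [hψ h, AddMonoidHom.zero_apply, zero_smul]
      exact zero_mem _
  · rw [LieAlgebra.ad_apply]
    change s (t y) - t (s y) = _
    rw [ht γ y hy, hs γ y hy, map_add, map_add, map_smul, map_smul, hs γ y hy, ht γ y hy,
      hs _ _ (R.lie_mem hY hy), ht _ _ (R.lie_mem hX hy), map_add, map_add, sub_lie, add_lie,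
      lie_lie, smul_lie, smul_lie]
    module

theorem lie_mem_adPiece {α β : Fin n → ℤ} {s t : Module.End K G} (hs : s ∈ adPiece 𝒢 α)
    (ht : t ∈ adPiece 𝒢 β) : ⁅s, t⁆ ∈ adPiece 𝒢 (α + β) := by
  obtain ⟨Z, hZ, h⟩ := R.exists_lie_eq_ad hs ht
  exact h ▸ R.ad_mem_adPiece hZ

theorem lie_ad {χ : (Fin n → ℤ) →+ K} {D : Module.End K G} (hD : ∀ α, ∀ x ∈ 𝒢 α, D x = χ α • x)
    {α : Fin n → ℤ} {X : G} (hX : X ∈ 𝒢 α) :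
    ⁅D, LieAlgebra.ad K G X⁆ = χ α • LieAlgebra.ad K G X := by
  obtain ⟨π, hπ⟩ := R.exists_proj
  refine hπ.ext_hom fun β y hy => ?_
  change D ⁅X, y⁆ - ⁅X, D y⁆ = χ α • ⁅X, y⁆
  rw [hD _ _ (R.lie_mem hX hy), hD _ _ hy, lie_smul, map_add]
  module

/-- The generators `e i`, `f i`, `h i` act as inner derivations of `G`, but the `d k` need not; they
act by the diagonal operators with eigenvalue `B k j` on the root αⱼ. This is why the target is `End
G` rather than `G`. -/
theorem exists_hom : ∃ φ : Tilde A B →ₗ⁅K⁆ Module.End K G,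
    (∀ i, φ (tildeGen A B (.e i)) = LieAlgebra.ad K G (R.E i)) ∧
    (∀ i, φ (tildeGen A B (.f i)) = LieAlgebra.ad K G (R.F i)) ∧
    ∀ α, tildePiece A B α ≤ (adPiece 𝒢 α).comap (φ : Tilde A B →ₗ[K] Module.End K G) := by
  let χ (k : Fin l) : (Fin n → ℤ) →+ K := ∑ j, (AddMonoidHom.mulLeft (B k j)).comp
    ((Int.castAddHom K).comp (Pi.evalAddMonoidHom (fun _ => ℤ) j))
  have hχ : ∀ k j, χ k (Pi.single j 1) = B k j := fun k j => by
    simp [χ, AddMonoidHom.finsetSum_apply, Pi.single_apply]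
  choose D hD using fun k => exists_diagonal R.indep R.iSup_eq_top (χ k)
  obtain ⟨π, hπ⟩ := R.exists_proj
  have hDD : ∀ k m, ⁅D k, D m⁆ = 0 := fun k m => hπ.ext_hom fun β y hy => by
    change D k (D m y) - D m (D k y) = 0
    rw [hD m _ _ hy, hD k _ _ hy, map_smul, map_smul, hD m _ _ hy, hD k _ _ hy]
    module
  let g : ChevalleyGen n l → Module.End K G
    | .e i => LieAlgebra.ad K G (R.E i)
    | .f i => LieAlgebra.ad K G (R.F i)
    | .h i => LieAlgebra.ad K G (R.H i)
    | .d k => D k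
  obtain ⟨φ, hφ⟩ := exists_tilde_lift (A := A) (B := B) g (by
    intro x hx
    cases hx <;>
    simp only [map_sub, map_add, LieHom.map_lie, map_smul, fgen, FreeLieAlgebra.lift_of_apply, g,
      hDD, R.lie_ad (hD _) (R.E_mem _), R.lie_ad (hD _) (R.F_mem _), hχ, map_neg, sub_self, neg_smul,
      neg_add_cancel]
    case ef i => rw [← LieHom.map_lie, R.lie_E_F, if_pos rfl, sub_self]
    case ef_ne i j hij => rw [← LieHom.map_lie, R.lie_E_F, if_neg hij, map_zero]
    case he i j => rw [← LieHom.map_lie, R.lie_H_E, map_smul, sub_self]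
    case hf i j => rw [← LieHom.map_lie, R.lie_H_F, map_neg, map_smul, neg_add_cancel]
    case hh i j => rw [← LieHom.map_lie, R.lie_H_H, map_zero]
    case hd i k => rw [← lie_skew, R.lie_ad (hD _) (R.H_mem _), map_zero, zero_smul, neg_zero])
  refine ⟨φ, fun i => hφ (.e i), fun i => hφ (.f i), fun α => degPiece_induction
    (V := fun α => (adPiece 𝒢 α).comap (φ : Tilde A B →ₗ[K] Module.End K G)) (fun x => ?_)
    fun α β x y _ _ hx hy => ?_⟩
  · rw [Submodule.mem_comap]
    change φ (tildeGen A B x) ∈ _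
    rw [hφ]
    rcases x with i | i | i | i
    · exact R.ad_mem_adPiece (R.E_mem i)
    · exact R.ad_mem_adPiece (R.F_mem i)
    · exact R.ad_mem_adPiece (R.H_mem i)
    · exact ⟨0, zero_mem _, χ i, fun h => absurd rfl h, fun β y hy => by
        rw [zero_lie, zero_add]
        exact hD i β y hy⟩
  · rw [Submodule.mem_comap] at hx hy ⊢
    change φ ⁅x, y⁆ ∈ _
    rw [LieHom.map_lie]
    exact R.lie_mem_adPiece hx hy

end Realization

end Realization

end
end WeisfeilerKac

/-! ### The maximal ideal acts by zero -/

namespace WeisfeilerKac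

noncomputable section

section Realization

attribute [local instance 100] LieRing.ofAssociativeRing

variable {K G : Type*} [Field K] [LieRing G] [LieAlgebra K G] {n l : ℕ}

/-- The generators `e i` and `f i`. -/
def efGen (A : Matrix (Fin n) (Fin n) K) (B : Matrix (Fin l) (Fin n) K) :
    Fin n ⊕ Fin n → Tilde A B :=
  Sum.elim (fun i => tildeGen A B (.e i)) fun i => tildeGen A B (.f i)

/-- The degrees of the generators `e i` and `f i`. -/
def efDeg : Fin n ⊕ Fin n → Fin n → ℤ := Sum.elim (fun i => Pi.single i 1) fun i => -Pi.single i 1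

theorem degPiece_efGen_le (A : Matrix (Fin n) (Fin n) K) (B : Matrix (Fin l) (Fin n) K)
    (α : Fin n → ℤ) : degPiece K (efGen A B) efDeg α ≤ tildePiece A B α := by
  refine degPiece_induction (V := tildePiece A B) ?_ fun _ _ _ _ _ _ hx hy => lie_mem_degPiece hx hy
  rintro (i | i)
  · exact tildeGen_mem (.e i)
  · exact tildeGen_mem (.f i)

namespace Realization

variable {A : Matrix (Fin n) (Fin n) K} {𝒢 : (Fin n → ℤ) → Submodule K G} (R : Realization A 𝒢)
  {B : Matrix (Fin l) (Fin n) K}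

include R

theorem lie_proj {π : (Fin n → ℤ) → G →ₗ[K] G} (hπ : IsGradingProj 𝒢 π) (α : Fin n → ℤ)
    {β : Fin n → ℤ} (X : G) {y : G} (hy : y ∈ 𝒢 β) : ⁅π α X, y⁆ = π (α + β) ⁅X, y⁆ := by
  have : (LieAlgebra.ad K G y : G →ₗ[K] G) ∘ₗ π α =
      π (α + β) ∘ₗ (LieAlgebra.ad K G y : G →ₗ[K] G) := hπ.ext_hom fun γ x hx => by
    have hyx : ⁅y, x⁆ ∈ 𝒢 (γ + β) := add_comm γ β ▸ R.lie_mem hy hx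
    by_cases h : α = γ
    · subst h
      change ⁅y, π α x⁆ = π (α + β) ⁅y, x⁆
      rw [hπ.same hx, hπ.same hyx]
    · change ⁅y, π α x⁆ = π (α + β) ⁅y, x⁆
      rw [hπ.ne hx h, hπ.ne hyx (fun h' => h (add_right_cancel h')), lie_zero]
  have h := LinearMap.congr_fun this X
  change ⁅y, π α X⁆ = π (α + β) ⁅y, X⁆ at h
  rw [← lie_skew, h, ← lie_skew X, map_neg]

/-- Homogeneous components of a central element are central; in nonzero degree the pairing with the
opposite component kills them, and in degree 0 faithfulness on the `E i` does. -/
theorem eq_zero_of_central {X : G} (hX : ∀ y : G, ⁅X, y⁆ = 0) : X = 0 := by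
  obtain ⟨π, hπ⟩ := R.exists_proj
  have h0 : ∀ α β, ∀ y ∈ 𝒢 β, ⁅π α X, y⁆ = 0 := fun α β y hy => by
    rw [R.lie_proj hπ α X hy, hX, map_zero]
  have hmem : X ∈ 𝒢 0 := hπ.eq_of_forall fun β hβ =>
    R.eq_zero β hβ _ (hπ.mem β X) fun y hy => h0 β _ y hy
  exact R.eq_zero_of_zero X hmem fun i => hX _

theorem ad_injective : Function.Injective (LieAlgebra.ad K G) := by
  intro X Y h
  refine sub_eq_zero.1 (R.eq_zero_of_central fun y => ?_)
  rw [sub_lie, sub_eq_zero]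
  exact LinearMap.congr_fun h y

theorem mem_zero_of_forall {X : G} (hX : ∀ β, ∀ y ∈ 𝒢 β, ⁅X, y⁆ ∈ 𝒢 β) : X ∈ 𝒢 0 := by
  obtain ⟨π, hπ⟩ := R.exists_proj
  refine hπ.eq_of_forall fun α hα => R.eq_zero α hα _ (hπ.mem α X) fun y hy => ?_
  rw [R.lie_proj hπ α X hy, hπ.ne (hX _ y hy)]
  simpa using hα

theorem lieSpan_range :
    LieSubalgebra.lieSpan K G (Set.range (Sum.elim R.E R.F)) = ⊤ := by
  rw [Set.Sum.elim_range, R.lieSpan_eq_top]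

theorem eq_zero_of_lie_EF {X : G} (hE : ∀ i, ⁅X, R.E i⁆ = 0) (hF : ∀ i, ⁅X, R.F i⁆ = 0) : X = 0 := by
  refine R.eq_zero_of_central fun y => ?_
  have hy : y ∈ LieSubalgebra.lieSpan K G (Set.range (Sum.elim R.E R.F)) := by
    rw [R.lieSpan_range]
    exact LieSubalgebra.mem_top y
  induction hy using LieSubalgebra.lieSpan_induction with
  | mem y hy =>
    obtain ⟨i | i, rfl⟩ := hy
    · exact hE i
    · exact hF i
  | zero => exact lie_zero X
  | add x y _ _ hx hy => rw [lie_add, hx, hy, add_zero]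
  | smul c x _ hx => rw [lie_smul, hx, smul_zero]
  | lie x y _ _ hx hy => rw [leibniz_lie, hx, hy, zero_lie, lie_zero, add_zero]

variable {φ : Tilde A B →ₗ⁅K⁆ Module.End K G}
  (hE : ∀ i, φ (tildeGen A B (.e i)) = LieAlgebra.ad K G (R.E i))
  (hF : ∀ i, φ (tildeGen A B (.f i)) = LieAlgebra.ad K G (R.F i))
  (hφ : ∀ α, tildePiece A B α ≤ (adPiece 𝒢 α).comap (φ : Tilde A B →ₗ[K] Module.End K G))

include hE hF

/-- Since the `E i` and `F i` generate `G`, a homogeneous element is a combination of their words of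
the same degree; the same words in the `e i` and `f i` give the lift. Such lifts avoid the `d k`, so
they will lie over the derived algebra. -/
theorem exists_lift {α : Fin n → ℤ} {Y : G} (hY : Y ∈ 𝒢 α) :
    ∃ t ∈ degPiece K (efGen A B) efDeg α, φ t = LieAlgebra.ad K G Y := by
  obtain ⟨π, hπ⟩ := R.exists_proj
  have hY' : Y ∈ degPiece K (Sum.elim R.E R.F) efDeg α :=
    hπ.le_degPiece R.lie_mem (by
      rintro (i | i)
      · exact R.E_mem i
      · exact R.F_mem i) R.lieSpan_range α hY
  have h : LieAlgebra.ad K G Y ∈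
      (degPiece K (Sum.elim R.E R.F) efDeg α).map (LieAlgebra.ad K G : G →ₗ[K] _) := ⟨Y, hY', rfl⟩
  have heq : (fun x => LieAlgebra.ad K G (Sum.elim R.E R.F x)) = fun x => φ (efGen A B x) := by
    funext x
    rcases x with i | i
    · exact (hE i).symm
    · exact (hF i).symm
  rw [map_degPiece, heq, ← map_degPiece] at h
  exact h

include hφ

/-- Let `x` be a homogeneous element of nonzero degree in an admissible ideal. Its brackets with
lifts of the opposite component lie in the ideal and in the Cartan subalgebra, hence vanish, and
nondegeneracy of the pairing in `G` makes the image of `x` zero. -/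
theorem maxIdeal_le_ker : maxIdeal A B ≤ φ.ker := by
  refine sSup_le fun I ⟨hI, hI0⟩ => ?_
  rw [← LieSubmodule.toSubmodule_le_toSubmodule]
  refine hI.trans (iSup_le fun α => ?_)
  rintro x ⟨hxI, hx⟩
  change φ x = 0
  have hI0' : ∀ z ∈ I, z ∈ tildePiece A B 0 → z = 0 := fun z hz hz' => by
    have : z ∈ I.toSubmodule ⊓ tildeCartan A B := ⟨hz, tildePiece_zero_le hz'⟩
    rwa [hI0] at this
  by_cases hα : α = 0
  · subst hα
    rw [hI0' x hxI hx, map_zero]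
  · obtain ⟨X, hX, χ, hχ, h⟩ := hφ α hx
    have hxX : φ x = LieAlgebra.ad K G X := by
      obtain ⟨π, hπ⟩ := R.exists_proj
      refine hπ.ext_hom fun β y hy => (h β y hy).trans ?_
      rw [hχ hα, AddMonoidHom.zero_apply, zero_smul, add_zero]
      rfl
    rw [hxX, R.eq_zero α hα X hX fun y hy => ?_, map_zero]
    obtain ⟨t, ht, hty⟩ := R.exists_lift hE hF hy
    have h0 : ⁅x, t⁆ = 0 := hI0' _ (lie_mem_left K _ I x t hxI) (by
      simpa using lie_mem_degPiece hx (degPiece_efGen_le A B _ ht))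
    refine R.ad_injective ?_
    rw [LieHom.map_lie, ← hxX, ← hty, ← LieHom.map_lie, h0, map_zero, map_zero]

end Realization

end Realization

end
end WeisfeilerKac

/-! ### The kernel modulo the maximal ideal -/

namespace WeisfeilerKac

noncomputable section

section Realization

attribute [local instance 100] LieRing.ofAssociativeRing

variable {K G : Type*} [Field K] [LieRing G] [LieAlgebra K G] {n l : ℕ}

namespace Realization

variable {A : Matrix (Fin n) (Fin n) K} {𝒢 : (Fin n → ℤ) → Submodule K G} (R : Realization A 𝒢)
  {B : Matrix (Fin l) (Fin n) K}

include R

omit R in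
theorem single_one_injective : Function.Injective fun i : Fin n => (Pi.single i 1 : Fin n → ℤ) := by
  intro i j h
  by_contra hij
  have := congrFun h i
  simp [Pi.single_eq_of_ne hij] at this

theorem linearIndependent_E : LinearIndependent K R.E :=
  (R.indep.comp single_one_injective).linearIndependent _ R.E_mem R.E_ne_zero

theorem linearIndependent_F : LinearIndependent K R.F :=
  (R.indep.comp (neg_injective.comp single_one_injective)).linearIndependent _ R.F_mem
    R.F_ne_zero

variable {φ : Tilde A B →ₗ⁅K⁆ Module.End K G}
  (hE : ∀ i, φ (tildeGen A B (.e i)) = LieAlgebra.ad K G (R.E i))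
  (hF : ∀ i, φ (tildeGen A B (.f i)) = LieAlgebra.ad K G (R.F i))
  (hφ : ∀ α, tildePiece A B α ≤ (adPiece 𝒢 α).comap (φ : Tilde A B →ₗ[K] Module.End K G))

/-- Applied to the `e i` and to the `f i`: the map `φ` is injective on their spans, because the
images are inner derivations by independent elements of the centerless algebra `G`. -/
theorem eq_zero_of_mem_span {g : Fin n → Tilde A B} {Y : Fin n → G} (hY : LinearIndependent K Y)
    (h : ∀ i, φ (g i) = LieAlgebra.ad K G (Y i)) {t : Tilde A B}
    (ht : t ∈ Submodule.span K (Set.range g)) (h0 : φ t = 0) : t = 0 := by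
  obtain ⟨c, rfl⟩ := (Submodule.mem_span_range_iff_exists_fun K).1 ht
  have hc : ∑ i, c i • Y i = 0 := by
    refine R.ad_injective ?_
    rw [map_sum, map_zero, ← h0, map_sum]
    exact Finset.sum_congr rfl fun i _ => by rw [map_smul, map_smul, h]
  refine Finset.sum_eq_zero fun i _ => ?_
  rw [Fintype.linearIndependent_iff.1 hY c hc i, zero_smul]

omit R in
/-- The span of the homogeneous elements of nonzero degree in the kernel of the homomorphism `φ`. -/
def kerNonzero (φ : Tilde A B →ₗ⁅K⁆ Module.End K G) : Submodule K (Tilde A B) :=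
  ⨆ (α) (_ : α ≠ 0), φ.ker.toSubmodule ⊓ tildePiece A B α

omit R in
theorem mem_kerNonzero {α : Fin n → ℤ} (hα : α ≠ 0) {t : Tilde A B} (h : φ t = 0)
    (ht : t ∈ tildePiece A B α) : t ∈ kerNonzero φ :=
  Submodule.mem_iSup_of_mem α (Submodule.mem_iSup_of_mem hα ⟨h, ht⟩)

include hE hF

/-- The only danger is that the bracket falls into degree 0. Then `t` has degree αᵢ or -αᵢ, where
the kernel is zero. -/
theorem lie_gen_mem_kerNonzero (x : ChevalleyGen n l) {α : Fin n → ℤ} (hα : α ≠ 0)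
    {t : Tilde A B} (h : φ t = 0) (ht : t ∈ tildePiece A B α) :
    ⁅tildeGen A B x, t⁆ ∈ kerNonzero φ := by
  by_cases h0 : rootDeg x + α = 0
  · suffices t = 0 by
      rw [this, lie_zero]
      exact zero_mem _
    rw [add_comm, add_eq_zero_iff_eq_neg] at h0
    rcases x with i | i | i | i
    · rw [h0] at ht
      exact R.eq_zero_of_mem_span R.linearIndependent_F hF (tildePiece_neg_single_le i ht) h
    · replace h0 : α = Pi.single i 1 := h0.trans (neg_neg _)
      rw [h0] at ht
      exact R.eq_zero_of_mem_span R.linearIndependent_E hE (tildePiece_single_le i ht) h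
    · exact absurd (h0.trans neg_zero) hα
    · exact absurd (h0.trans neg_zero) hα
  · refine mem_kerNonzero h0 ?_ (lie_mem_degPiece (tildeGen_mem x) ht)
    rw [LieHom.map_lie, h, lie_zero]

theorem lie_mem_kerNonzero (x : Tilde A B) {t : Tilde A B} (ht : t ∈ kerNonzero φ) :
    ⁅x, t⁆ ∈ kerNonzero φ := by
  have hx : x ∈ LieSubalgebra.lieSpan K _ (Set.range (tildeGen A B)) := by
    rw [lieSpan_tildeGen]
    exact LieSubalgebra.mem_top x
  induction hx using LieSubalgebra.lieSpan_induction generalizing t with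
  | mem x hx =>
    obtain ⟨x, rfl⟩ := hx
    refine Submodule.iSup_induction _ (motive := fun t => ⁅tildeGen A B x, t⁆ ∈ kerNonzero φ) ht
      (fun α t ht => ?_) (by simp) fun a b ha hb => by rw [lie_add]; exact add_mem ha hb
    refine Submodule.iSup_induction _ (motive := fun t => ⁅tildeGen A B x, t⁆ ∈ kerNonzero φ) ht
      (fun hα t ht => ?_) (by simp) fun a b ha hb => by rw [lie_add]; exact add_mem ha hb
    exact R.lie_gen_mem_kerNonzero hE hF x hα ht.1 ht.2
  | zero =>
    rw [zero_lie]
    exact zero_mem _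
  | add x y _ _ hx hy =>
    rw [add_lie]
    exact add_mem (hx ht) (hy ht)
  | smul c x _ hx =>
    rw [smul_lie]
    exact Submodule.smul_mem _ c (hx ht)
  | lie x y _ _ hx hy =>
    rw [lie_lie]
    exact sub_mem (hx (hy ht)) (hy (hx ht))

/-- This span is a homogeneous ideal without component of degree 0, hence one of those whose
supremum is `maxIdeal`. -/
theorem kerNonzero_le : kerNonzero φ ≤ (maxIdeal A B).toSubmodule := by
  let J : LieIdeal K (Tilde A B) :=
    { kerNonzero φ with lie_mem := fun {x t} ht => R.lie_mem_kerNonzero hE hF x ht }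
  have hJ : J.toSubmodule = kerNonzero φ := rfl
  suffices J ≤ maxIdeal A B from this
  refine le_sSup ⟨?_, ?_⟩
  · rw [hJ]
    exact iSup₂_le fun α hα => le_iSup_of_le α
      (le_inf (le_iSup₂_of_le α hα le_rfl) inf_le_right)
  · rw [hJ, eq_bot_iff]
    rintro t ⟨ht, ht0⟩
    obtain ⟨π, hπ⟩ := exists_isGradingProj_tilde A B
    have h0 : kerNonzero φ ≤ (π 0).ker := iSup₂_le fun α hα t ht => hπ.ne ht.2 hα.symm
    have h := h0 ht
    rw [LinearMap.mem_ker, hπ.same (tildeCartan_le ht0)] at h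
    exact h

omit hE hF
include hφ

/-- The kernel is homogeneous: an operator of degree α shifts the components of `G` by α, so the
components of an operator can be recovered by projecting its values. -/
theorem map_proj_eq_zero {π : (Fin n → ℤ) → Tilde A B →ₗ[K] Tilde A B}
    (hπ : IsGradingProj (tildePiece A B) π) {t : Tilde A B} (ht : φ t = 0) (α : Fin n → ℤ) :
    φ (π α t) = 0 := by
  obtain ⟨ϖ, hϖ⟩ := R.exists_proj
  refine hϖ.ext_hom fun β y hy => ?_
  have h : LinearMap.applyₗ y ∘ₗ (φ : Tilde A B →ₗ[K] Module.End K G) ∘ₗ π α =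
      ϖ (α + β) ∘ₗ LinearMap.applyₗ y ∘ₗ (φ : Tilde A B →ₗ[K] Module.End K G) := by
    refine hπ.ext_hom fun γ t ht => ?_
    have hty : φ t y ∈ 𝒢 (γ + β) := by
      obtain ⟨X, hX, χ, hχ, h⟩ := hφ γ ht
      rw [show φ t y = _ from h β y hy]
      refine add_mem (R.lie_mem hX hy) ?_
      by_cases hγ : γ = 0
      · rw [hγ, zero_add]
        exact Submodule.smul_mem _ _ hy
      · rw [hχ hγ, AddMonoidHom.zero_apply, zero_smul]
        exact zero_mem _
    change φ (π α t) y = ϖ (α + β) (φ t y)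
    by_cases hα : α = γ
    · subst hα
      rw [hπ.same ht, hϖ.same hty]
    · rw [hπ.ne ht hα, hϖ.ne hty (fun h => hα (add_right_cancel h)), map_zero, LinearMap.zero_apply]
  have h' := LinearMap.congr_fun h t
  change φ (π α t) y = ϖ (α + β) (φ t y) at h'
  rw [h', ht, LinearMap.zero_apply, map_zero]

include hE hF

/-- The bracket of `t` with `e i` or `f i` is a multiple of that generator in the kernel of `φ`,
hence zero. -/
theorem lie_eq_zero_of_mem_cartan {t : Tilde A B} (ht : t ∈ tildeCartan A B) (h0 : φ t = 0)
    (x : Tilde A B) : ⁅x, t⁆ = 0 := by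
  have hx : x ∈ LieSubalgebra.lieSpan K _ (Set.range (tildeGen A B)) := by
    rw [lieSpan_tildeGen]
    exact LieSubalgebra.mem_top x
  have hker : ∀ y, φ ⁅y, t⁆ = 0 := fun y => by rw [LieHom.map_lie, h0, lie_zero]
  induction hx using LieSubalgebra.lieSpan_induction with
  | mem x hx =>
    obtain ⟨i | i | i | i, rfl⟩ := hx
    · exact R.eq_zero_of_mem_span R.linearIndependent_E hE
        (Submodule.span_mono (by simp) (lie_e_tildeCartan ht i)) (hker _)
    · exact R.eq_zero_of_mem_span R.linearIndependent_F hF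
        (Submodule.span_mono (by simp) (lie_f_tildeCartan ht i)) (hker _)
    · exact lie_tildeCartan (h_mem_tildeCartan i) ht
    · exact lie_tildeCartan (d_mem_tildeCartan i) ht
  | zero => exact zero_lie t
  | add x y _ _ hx hy => rw [add_lie, hx, hy, add_zero]
  | smul c x _ hx => rw [smul_lie, hx, smul_zero]
  | lie x y _ _ hx hy => rw [lie_lie, hx, hy, lie_zero, lie_zero, sub_zero]

/-- Components of nonzero degree lie in the maximal ideal, and the one of degree 0 is central
already in g̃(A). So the kernel of `φ` becomes central in g(A), which accounts for dividing by c. -/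
theorem lie_mem_maxIdeal_of_map_eq_zero {t : Tilde A B} (ht : φ t = 0) (x : Tilde A B) :
    ⁅x, t⁆ ∈ maxIdeal A B := by
  obtain ⟨π, hπ⟩ := exists_isGradingProj_tilde A B
  obtain ⟨s, hs⟩ := hπ.sum t
  rw [hs, lie_sum]
  refine sum_mem fun α _ => ?_
  have h := R.map_proj_eq_zero hφ hπ ht α
  by_cases hα : α = 0
  · subst hα
    rw [R.lie_eq_zero_of_mem_cartan hE hF hφ (tildePiece_zero_le (hπ.mem 0 t)) h]
    exact zero_mem _
  · exact lie_mem_right K _ (maxIdeal A B) x _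
      (R.kerNonzero_le hE hF (mem_kerNonzero hα h (hπ.mem α t)))

end Realization

end Realization

end
end WeisfeilerKac

/-! ### The isomorphism of `g'(A)/c` with a realization -/

namespace WeisfeilerKac

noncomputable section

section Realization

attribute [local instance 100] LieRing.ofAssociativeRing

variable {K G : Type*} [Field K] [LieRing G] [LieAlgebra K G] {n l : ℕ}

/-- The projection of `g̃(A)` onto `g(A)`. -/
def contraMk (A : Matrix (Fin n) (Fin n) K) (B : Matrix (Fin l) (Fin n) K) :
    Tilde A B →ₗ⁅K⁆ Contragredient A B where
  __ := (LieSubmodule.Quotient.mk' (maxIdeal A B)).toLinearMap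
  map_lie' := rfl

/-- The homomorphism from the root lattice that sends the simple roots to the `w i`. -/
def latticeHom {Γ : Type*} [AddCommGroup Γ] (w : Fin n → Γ) : (Fin n → ℤ) →+ Γ :=
  ∑ i, ((zmultiplesHom Γ) (w i)).comp (Pi.evalAddMonoidHom (fun _ => ℤ) i)

theorem latticeHom_apply {Γ : Type*} [AddCommGroup Γ] (w : Fin n → Γ) (α : Fin n → ℤ) :
    latticeHom w α = ∑ i, α i • w i := by
  simp [latticeHom, AddMonoidHom.finsetSum_apply]

theorem latticeHom_rootDeg {Γ : Type*} [AddCommGroup Γ] (w : Fin n → Γ) :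
    (fun x : ChevalleyGen n l => latticeHom w (rootDeg x)) = chevalleyDeg w := by
  have h : ∀ i, latticeHom w (Pi.single i 1) = w i := fun i => by
    simp [latticeHom_apply, Pi.single_apply]
  funext x
  rcases x with i | i | i | i
  · exact h i
  · exact (map_neg _ _).trans (congrArg _ (h i))
  · exact map_zero _
  · exact map_zero _

section Contra

variable {A : Matrix (Fin n) (Fin n) K} {B : Matrix (Fin l) (Fin n) K}

theorem contraMk_surjective : Function.Surjective (contraMk A B) :=
  LieSubmodule.Quotient.surjective_mk' _

theorem contraMk_eq_zero {x : Tilde A B} : contraMk A B x = 0 ↔ x ∈ maxIdeal A B :=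
  LieSubmodule.Quotient.mk_eq_zero' (N := maxIdeal A B)

theorem lie_mem_derived (x y : Contragredient A B) : ⁅x, y⁆ ∈ Derived A B :=
  LieSubmodule.lie_mem_lie (LieSubmodule.mem_top x) (LieSubmodule.mem_top y)

/-- A nonzero entry `A i j` exhibits `e j` and `f j` as multiples of brackets with `h i`. -/
theorem contraMk_efGen_mem (hA : ∀ j, ∃ i, A i j ≠ 0) (x : Fin n ⊕ Fin n) :
    contraMk A B (efGen A B x) ∈ Derived A B := by
  have key : ∀ (i j : Fin n) (c : K) (y : Tilde A B), c ≠ 0 → ⁅tildeGen A B (.h i), y⁆ = c • y →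
      contraMk A B y ∈ Derived A B := fun i j c y hc h => by
    have : contraMk A B y = c⁻¹ • ⁅contraMk A B (tildeGen A B (.h i)), contraMk A B y⁆ := by
      rw [← LieHom.map_lie, h, map_smul, smul_smul, inv_mul_cancel₀ hc, one_smul]
    rw [this]
    exact Submodule.smul_mem _ _ (lie_mem_derived _ _)
  rcases x with j | j
  · obtain ⟨i, hi⟩ := hA j
    exact key i j _ _ hi (lie_tilde_he i j)
  · obtain ⟨i, hi⟩ := hA j
    exact key i j (-A i j) _ (neg_ne_zero.2 hi) ((lie_tilde_hf i j).trans (neg_smul _ _).symm)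

theorem contraMk_mem_derived (hA : ∀ j, ∃ i, A i j ≠ 0) {α : Fin n → ℤ} {t : Tilde A B}
    (ht : t ∈ degPiece K (efGen A B) efDeg α) : contraMk A B t ∈ Derived A B :=
  (degPiece_induction (V := fun _ => (Derived A B).toSubmodule.comap
    (contraMk A B : Tilde A B →ₗ[K] Contragredient A B))
    (fun x => contraMk_efGen_mem hA x) (fun _ _ x y _ _ _ _ => by
      rw [Submodule.mem_comap, LieHom.coe_toLinearMap, LieHom.map_lie]
      exact lie_mem_derived _ _) : degPiece K (efGen A B) efDeg α ≤ _) ht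

theorem degPiece_contra_eq {Γ : Type*} [AddCommGroup Γ] (w : Fin n → Γ) (γ : Γ) :
    degPiece K (contragredientGen A B) (chevalleyDeg w) γ =
      (degPiece K (tildeGen A B) (chevalleyDeg w) γ).map (contraMk A B : Tilde A B →ₗ[K] _) :=
  (map_degPiece (contraMk A B) (tildeGen A B) (chevalleyDeg w) γ).symm

end Contra

namespace Realization

variable {A : Matrix (Fin n) (Fin n) K} {𝒢 : (Fin n → ℤ) → Submodule K G} (R : Realization A 𝒢)
  {B : Matrix (Fin l) (Fin n) K}

include R

variable {φ : Tilde A B →ₗ⁅K⁆ Module.End K G}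
  (hE : ∀ i, φ (tildeGen A B (.e i)) = LieAlgebra.ad K G (R.E i))
  (hF : ∀ i, φ (tildeGen A B (.f i)) = LieAlgebra.ad K G (R.F i))
  (hφ : ∀ α, tildePiece A B α ≤ (adPiece 𝒢 α).comap (φ : Tilde A B →ₗ[K] Module.End K G))

include hφ

theorem exists_map_lie_eq_ad (s t : Tilde A B) : ∃ X, LieAlgebra.ad K G X = φ ⁅s, t⁆ := by
  obtain ⟨π, hπ⟩ := exists_isGradingProj_tilde A B
  change φ ⁅s, t⁆ ∈ LinearMap.range (LieAlgebra.ad K G : G →ₗ[K] Module.End K G)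
  obtain ⟨I, hI⟩ := hπ.sum s
  obtain ⟨J, hJ⟩ := hπ.sum t
  rw [hI, hJ, LieHom.map_lie, map_sum, map_sum, sum_lie]
  refine sum_mem fun α _ => ?_
  rw [lie_sum]
  refine sum_mem fun β _ => ?_
  obtain ⟨Z, -, hZ⟩ := R.exists_lie_eq_ad (hφ α (hπ.mem α s)) (hφ β (hπ.mem β t))
  exact ⟨Z, hZ.symm⟩

include hE hF

/-- The homomorphism to `End G` factors through g(A); brackets go to inner derivations, and ad is
injective on `G`, so on the derived algebra it lifts uniquely to `G`. -/
theorem exists_derivedHom : ∃ θ : Derived A B →ₗ⁅K⁆ G, ∀ (t : Tilde A B)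
    (ht : contraMk A B t ∈ Derived A B), LieAlgebra.ad K G (θ ⟨contraMk A B t, ht⟩) = φ t := by
  obtain ⟨ψ, hψ⟩ : ∃ ψ : Contragredient A B →ₗ⁅K⁆ Module.End K G,
      ∀ t, ψ (contraMk A B t) = φ t := exists_quotient_lift (maxIdeal A B) φ (R.maxIdeal_le_ker hE hF hφ)
  obtain ⟨θ, hθ⟩ := exists_factor (LieAlgebra.ad K G) R.ad_injective
    (ψ.comp (Derived A B).incl) (fun x => by
      have hle : (Derived A B).toSubmodule ≤ (LinearMap.range (LieAlgebra.ad K G :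
          G →ₗ[K] Module.End K G)).comap (ψ : Contragredient A B →ₗ[K] Module.End K G) := by
        rw [LieSubmodule.lieIdeal_oper_eq_linear_span, Submodule.span_le]
        rintro _ ⟨⟨x, -⟩, ⟨y, -⟩, rfl⟩
        obtain ⟨s, rfl⟩ := contraMk_surjective x
        obtain ⟨t, rfl⟩ := contraMk_surjective y
        obtain ⟨X, hX⟩ := R.exists_map_lie_eq_ad hφ s t
        exact ⟨X, hX.trans (hψ ⁅s, t⁆).symm⟩
      exact hle x.2)
  exact ⟨θ, fun t ht => (hθ _).trans (hψ t)⟩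

variable {θ : Derived A B →ₗ⁅K⁆ G} (hθ : ∀ (t : Tilde A B)
    (ht : contraMk A B t ∈ Derived A B), LieAlgebra.ad K G (θ ⟨contraMk A B t, ht⟩) = φ t)

include hθ

/-- Zero image implies central by `lie_mem_maxIdeal_of_map_eq_zero`. Conversely, a central element
has an image that commutes with all `E i` and `F i`, which generate `G`. -/
theorem ker_derivedHom : θ.ker = derivedCenter A B := by
  ext ⟨x, hx⟩
  obtain ⟨t, rfl⟩ := contraMk_surjective x
  rw [LieHom.mem_ker]
  change _ ↔ contraMk A B t ∈ LieAlgebra.center K (Contragredient A B)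
  rw [LieModule.mem_maxTrivSubmodule]
  constructor
  · intro h s
    obtain ⟨s, rfl⟩ := contraMk_surjective s
    rw [← LieHom.map_lie, contraMk_eq_zero]
    refine R.lie_mem_maxIdeal_of_map_eq_zero hE hF hφ ?_ s
    rw [← hθ t hx, h, map_zero]
  · intro h
    have h0 : ∀ s, φ ⁅s, t⁆ = 0 := fun s => R.maxIdeal_le_ker hE hF hφ (by
      rw [← contraMk_eq_zero, LieHom.map_lie, h])
    refine R.eq_zero_of_lie_EF (fun i => R.ad_injective ?_) fun i => R.ad_injective ?_
    · rw [← lie_skew, map_neg, LieHom.map_lie, ← hE, hθ, ← LieHom.map_lie, h0, neg_zero, map_zero]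
    · rw [← lie_skew, map_neg, LieHom.map_lie, ← hF, hθ, ← LieHom.map_lie, h0, neg_zero, map_zero]

theorem exists_derivedHom_eq (hA : ∀ j, ∃ i, A i j ≠ 0) {α : Fin n → ℤ} {Y : G} (hY : Y ∈ 𝒢 α) :
    ∃ t ∈ tildePiece A B α, ∃ ht : contraMk A B t ∈ Derived A B, θ ⟨contraMk A B t, ht⟩ = Y := by
  obtain ⟨t, ht, htY⟩ := R.exists_lift hE hF hY
  exact ⟨t, degPiece_efGen_le A B α ht, contraMk_mem_derived hA ht,
    R.ad_injective ((hθ t _).trans htY)⟩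

theorem derivedHom_surjective (hA : ∀ j, ∃ i, A i j ≠ 0) : Function.Surjective θ := by
  intro Y
  change Y ∈ θ.range
  obtain ⟨π, hπ⟩ := R.exists_proj
  obtain ⟨s, hs⟩ := hπ.sum Y
  rw [hs]
  refine sum_mem fun α _ => ?_
  obtain ⟨t, -, ht, h⟩ := R.exists_derivedHom_eq hE hF hφ hθ hA (hπ.mem α Y)
  exact ⟨_, h⟩

/-- The homogeneous parts of a lift of `x` need not belong to the derived algebra, so `θ` cannot be
applied to them one by one. The operator `φ t` is controlled instead, as an inner derivation of the
right degree plus scalars on the components. -/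
theorem derivedHom_mem {Γ : Type*} [AddCommGroup Γ] {w : Fin n → Γ} {γ : Γ} {x : Derived A B}
    (hx : (x : Contragredient A B) ∈ degPiece K (contragredientGen A B) (chevalleyDeg w) γ) :
    θ x ∈ ⨆ (α) (_ : latticeHom w α = γ), 𝒢 α := by
  obtain ⟨x, hx'⟩ := x
  rw [degPiece_contra_eq, ← latticeHom_rootDeg] at hx
  obtain ⟨t, ht, rfl⟩ := hx
  replace ht := degPiece_le_iSup ht
  obtain ⟨X, hX, χ, hχ, h⟩ : ∃ X ∈ ⨆ (α) (_ : latticeHom w α = γ), 𝒢 α, ∃ χ : (Fin n → ℤ) → K,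
      (γ ≠ 0 → χ = 0) ∧ ∀ β, ∀ y ∈ 𝒢 β, φ t y = ⁅X, y⁆ + χ β • y := by
    have hz : ∃ X ∈ ⨆ (α) (_ : latticeHom w α = γ), 𝒢 α, ∃ χ : (Fin n → ℤ) → K,
      (γ ≠ 0 → χ = 0) ∧ ∀ β, ∀ y ∈ 𝒢 β, φ (0 : Tilde A B) y = ⁅X, y⁆ + χ β • y :=
      ⟨0, zero_mem _, 0, fun _ => rfl, fun β y hy => by simp⟩
    have hadd : ∀ s t : Tilde A B, (∃ X ∈ ⨆ (α) (_ : latticeHom w α = γ), 𝒢 α,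
      ∃ χ : (Fin n → ℤ) → K, (γ ≠ 0 → χ = 0) ∧ ∀ β, ∀ y ∈ 𝒢 β, φ s y = ⁅X, y⁆ + χ β • y) →
      (∃ X ∈ ⨆ (α) (_ : latticeHom w α = γ), 𝒢 α,
      ∃ χ : (Fin n → ℤ) → K, (γ ≠ 0 → χ = 0) ∧ ∀ β, ∀ y ∈ 𝒢 β, φ t y = ⁅X, y⁆ + χ β • y) →
      (∃ X ∈ ⨆ (α) (_ : latticeHom w α = γ), 𝒢 α,
      ∃ χ : (Fin n → ℤ) → K, (γ ≠ 0 → χ = 0) ∧ ∀ β, ∀ y ∈ 𝒢 β, φ (s + t) y = ⁅X, y⁆ + χ β • y) := by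
      rintro s t ⟨X, hX, χ, hχ, hs⟩ ⟨Y, hY, ψ, hψ, ht⟩
      refine ⟨X + Y, add_mem hX hY, χ + ψ, fun h => by rw [hχ h, hψ h, add_zero], fun β y hy => ?_⟩
      rw [map_add, LinearMap.add_apply, hs β y hy, ht β y hy, add_lie, Pi.add_apply, add_smul]
      abel
    refine Submodule.iSup_induction _ (motive := fun t => ∃ X ∈ ⨆ (α) (_ : latticeHom w α = γ), 𝒢 α,
      ∃ χ : (Fin n → ℤ) → K, (γ ≠ 0 → χ = 0) ∧ ∀ β, ∀ y ∈ 𝒢 β, φ t y = ⁅X, y⁆ + χ β • y) ht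
      (fun α t ht => ?_) hz hadd
    refine Submodule.iSup_induction _ (motive := fun t => ∃ X ∈ ⨆ (α) (_ : latticeHom w α = γ), 𝒢 α,
      ∃ χ : (Fin n → ℤ) → K, (γ ≠ 0 → χ = 0) ∧ ∀ β, ∀ y ∈ 𝒢 β, φ t y = ⁅X, y⁆ + χ β • y) ht
      (fun hα t ht => ?_) hz hadd
    obtain ⟨X, hX, χ, hχ, h⟩ := hφ α ht
    refine ⟨X, Submodule.mem_iSup_of_mem α (Submodule.mem_iSup_of_mem hα hX), χ, fun hγ => ?_, h⟩
    rw [hχ (fun h0 => hγ (by rw [← hα, h0, map_zero]))]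
    rfl
  -- The difference acts by scalars on the components. Hence it has degree 0, and for nonzero γ it
  -- acts as zero and is zero.
  have hθX : ∀ β, ∀ y ∈ 𝒢 β, ⁅θ ⟨contraMk A B t, hx'⟩ - X, y⁆ = χ β • y := fun β y hy => by
    have h1 := LinearMap.congr_fun (hθ t hx') y
    rw [LieAlgebra.ad_apply, h β y hy] at h1
    rw [sub_lie, h1, add_sub_cancel_left]
  have hmem : θ ⟨contraMk A B t, hx'⟩ - X ∈ ⨆ (α) (_ : latticeHom w α = γ), 𝒢 α := by
    by_cases hγ : γ = 0
    · refine Submodule.mem_iSup_of_mem 0 (Submodule.mem_iSup_of_mem (by rw [map_zero, hγ]) ?_)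
      refine R.mem_zero_of_forall fun β y hy => ?_
      rw [hθX β y hy]
      exact Submodule.smul_mem _ _ hy
    · suffices h : θ ⟨contraMk A B t, hx'⟩ - X = 0 from h ▸ zero_mem _
      refine R.eq_zero_of_lie_EF (fun i => ?_) fun i => ?_
      · rw [hθX _ _ (R.E_mem i), hχ hγ, Pi.zero_apply, zero_smul]
      · rw [hθX _ _ (R.F_mem i), hχ hγ, Pi.zero_apply, zero_smul]
  simpa using add_mem hmem hX

omit hE hF hφ hθ in
variable (B) in
/-- A realization of the matrix `A` is isomorphic to `g'(A)/c`. -/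
theorem exists_equiv (hA : ∀ j, ∃ i, A i j ≠ 0) : ∃ Θ : DerivedModCenter A B ≃ₗ⁅K⁆ G,
    ∀ {Γ : Type} [AddCommGroup Γ] (w : Fin n → Γ) (γ : Γ) (x : DerivedModCenter A B),
      x ∈ piece A B w γ ↔ Θ x ∈ ⨆ (α) (_ : latticeHom w α = γ), 𝒢 α := by
  obtain ⟨φ, hE, hF, hφ⟩ := R.exists_hom B
  obtain ⟨θ, hθ⟩ := R.exists_derivedHom hE hF hφ
  obtain ⟨Θ, hΘ⟩ : ∃ Θ : DerivedModCenter A B ≃ₗ⁅K⁆ G, ∀ x, Θ (toDerivedModCenter A B x) = θ x :=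
    exists_equiv_of_ker_eq (derivedCenter A B) θ (R.ker_derivedHom hE hF hφ hθ)
    (R.derivedHom_surjective hE hF hφ hθ hA)
  refine ⟨Θ, fun w γ x => ⟨?_, fun hx => ?_⟩⟩
  · rintro ⟨x, hx, rfl⟩
    have h := R.derivedHom_mem hE hF hφ hθ hx
    rwa [← hΘ] at h
  · suffices h : (⨆ (α) (_ : latticeHom w α = γ), 𝒢 α) ≤
        (piece A B w γ).map (Θ.toLinearEquiv : DerivedModCenter A B →ₗ[K] G) by
      obtain ⟨y, hy, hyx⟩ := h hx
      rwa [← Θ.injective hyx]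
    refine iSup₂_le fun α hα Y hY => ?_
    obtain ⟨t, ht, ht', hY⟩ := R.exists_derivedHom_eq hE hF hφ hθ hA hY
    refine ⟨toDerivedModCenter A B ⟨contraMk A B t, ht'⟩, ⟨_, ?_, rfl⟩, (hΘ _).trans hY⟩
    change contraMk A B t ∈ degPiece K (contragredientGen A B) (chevalleyDeg w) γ
    rw [degPiece_contra_eq, ← latticeHom_rootDeg, ← hα]
    refine ⟨t, ?_, rfl⟩
    exact Submodule.span_mono (fun x hx => IsMonomial.map_deg (latticeHom w) hx) ht

end Realization

end Realization

end
end WeisfeilerKac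

namespace WeisfeilerKac

noncomputable section

open DP

/-! ### The Buttin algebra with all heights equal to 1 -/

section SmallButtin

variable {K : Type*} [Field K]

theorem coeff_X_tau_mul {r : BVar → ℕ} (hr : r tauv = 0) (f : DP BVar K) :
    coeff r (X tauv * f) = 0 := by
  refine DP.induction f (by simp) (fun f g hf hg => by rw [mul_add, map_add, hf, hg, add_zero])
    fun s a => ?_
  rw [X, mono_mul_mono, coeff_mono, if_neg]
  rintro rfl
  simp at hr

theorem X_mul_mono (i : BVar) {s : BVar → ℕ} (hs : s i = 0) (a : K) :
    (X i * mono s a : DP BVar K) = mono (s + Pi.single i 1) a := by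
  rw [X, mono_mul_mono, add_comm, one_mul]
  have h := binom_single_zero i 0 s hs
  rw [zero_add, binom_zero] at h
  rw [h, Nat.cast_one, one_mul]

/-- The exponents of the square-free monomials without `τ`. -/
def sqExp : Fin 16 → BVar → ℕ :=
  ![0, Pi.single (xiv 0) 1, Pi.single (xiv 1) 1, Pi.single (xiv 1) 1 + Pi.single (xiv 0) 1,
    Pi.single (xiv 1) 1 + Pi.single (qv 0) 1,
    Pi.single (xiv 1) 1 + Pi.single (xiv 0) 1 + Pi.single (qv 0) 1,
    Pi.single (xiv 1) 1 + Pi.single (xiv 0) 1 + Pi.single (qv 1) 1,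
    Pi.single (xiv 0) 1 + Pi.single (qv 0) 1, Pi.single (xiv 1) 1 + Pi.single (qv 1) 1,
    Pi.single (qv 0) 1, Pi.single (qv 1) 1, Pi.single (xiv 0) 1 + Pi.single (qv 1) 1,
    Pi.single (qv 1) 1 + Pi.single (qv 0) 1,
    Pi.single (xiv 0) 1 + Pi.single (qv 1) 1 + Pi.single (qv 0) 1,
    Pi.single (xiv 1) 1 + Pi.single (qv 1) 1 + Pi.single (qv 0) 1,
    Pi.single (xiv 1) 1 + Pi.single (xiv 0) 1 + Pi.single (qv 1) 1 + Pi.single (qv 0) 1]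

set_option maxRecDepth 4000 in
theorem sqExp_injective : Function.Injective sqExp := by decide

theorem sqExp_tau (i : Fin 16) : sqExp i tauv = 0 := by
  revert i; decide

set_option maxRecDepth 10000 in
theorem exists_sqExp_eq {r : BVar → ℕ} (h0 : r tauv = 0) (h : ∀ i, r i < 2) :
    ∃ j, sqExp j = r := by
  have key : ∀ a b c d : Fin 2, ∃ j, sqExp j (qv 0) = a ∧ sqExp j (qv 1) = b ∧
    sqExp j (xiv 0) = c ∧ sqExp j (xiv 1) = d := by decide
  obtain ⟨j, h1, h2, h3, h4⟩ := key ⟨r (qv 0), h _⟩ ⟨r (qv 1), h _⟩ ⟨r (xiv 0), h _⟩ ⟨r (xiv 1), h _⟩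
  refine ⟨j, funext fun i => ?_⟩
  rcases i with i | i | i
  · fin_cases i
    · exact h1
    · exact h2
  · fin_cases i
    · exact h3
    · exact h4
  · exact (sqExp_tau j).trans h0.symm

/-- The leading coefficients of the elements of the basis of the Buttin algebra. -/
def sqCoeff (μ : K) (i : Fin 16) : K := if i < 13 then 1 else 1 + μ

variable (μ : K)

/-- The generating functions that form a basis of the Buttin algebra with all heights equal to 1. -/
def betaFun : Fin 16 → DP BVar K :=
  ![1, X (xiv 0), X (xiv 1), X (xiv 0) * X (xiv 1), X (qv 0) * X (xiv 1),
    X (qv 0) * (X (xiv 0) * X (xiv 1)) + algebraMap K _ μ * (X tauv * X (xiv 1)),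
    X (qv 1) * (X (xiv 0) * X (xiv 1)) + algebraMap K _ μ * (X tauv * X (xiv 0)),
    X (qv 0) * X (xiv 0) + algebraMap K _ μ * X tauv,
    X (qv 1) * X (xiv 1) + algebraMap K _ μ * X tauv,
    X (qv 0), X (qv 1), X (qv 1) * X (xiv 0), X (qv 0) * X (qv 1),
    algebraMap K _ (1 + μ) * (X (qv 0) * (X (qv 1) * X (xiv 0))) +
      algebraMap K _ μ * (X tauv * X (qv 1)),
    algebraMap K _ (1 + μ) * (X (qv 0) * (X (qv 1) * X (xiv 1))) +
      algebraMap K _ μ * (X tauv * X (qv 0)),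
    algebraMap K _ (1 + μ) * (X (qv 0) * (X (qv 1) * (X (xiv 0) * X (xiv 1)))) +
      algebraMap K _ μ * (X tauv * (X (qv 0) * X (xiv 0) + X (qv 1) * X (xiv 1)))]

/-- Modulo τ, each function is a multiple of a single square-free monomial. The three terms of
highest q-degree carry the factor `1 + μ`, which clears the denominator that solving for the
coefficient of τ would produce. -/
theorem betaFun_eq (i : Fin 16) : ∃ f, betaFun μ i =
    sqCoeff μ i • mono (sqExp i) (1 : K) + X tauv * f := by
  have m1 : (1 : DP BVar K) = mono 0 1 := rfl
  have hx : ∀ i s (_ : s i = 0), (mono (s + Pi.single i 1) 1 : DP BVar K) = X i * mono s 1 :=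
    fun i s hs => (X_mul_mono i hs 1).symm
  have hx0 : ∀ i, (mono (Pi.single i 1) 1 : DP BVar K) = X i := fun i => rfl
  have key : mono (sqExp i) 1 = (![1, X (xiv 0), X (xiv 1), X (xiv 0) * X (xiv 1), X (qv 0) * X (xiv 1),
    X (qv 0) * (X (xiv 0) * X (xiv 1)), X (qv 1) * (X (xiv 0) * X (xiv 1)),
    X (qv 0) * X (xiv 0), X (qv 1) * X (xiv 1),
    X (qv 0), X (qv 1), X (qv 1) * X (xiv 0), X (qv 0) * X (qv 1),
    X (qv 0) * (X (qv 1) * X (xiv 0)), X (qv 0) * (X (qv 1) * X (xiv 1)),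
    X (qv 0) * (X (qv 1) * (X (xiv 0) * X (xiv 1)))] : Fin 16 → DP BVar K) i := by
    fin_cases i <;> simp [sqExp, hx, hx0, m1.symm]
  refine ⟨algebraMap K _ μ * (![0, 0, 0, 0, 0, X (xiv 1), X (xiv 0), 1, 1, 0, 0, 0, 0, X (qv 1),
    X (qv 0), X (qv 0) * X (xiv 0) + X (qv 1) * X (xiv 1)] : Fin 16 → DP BVar K) i, ?_⟩
  rw [key]
  fin_cases i <;> simp [betaFun, sqCoeff, Algebra.smul_def] <;> ring

theorem coeff_betaFun {r : BVar → ℕ} (hr : r tauv = 0) (i : Fin 16) :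
    coeff r (betaFun μ i) = if sqExp i = r then sqCoeff μ i else 0 := by
  obtain ⟨f, hf⟩ := betaFun_eq μ i
  rw [hf, map_add, coeff_X_tau_mul hr, add_zero, map_smul, coeff_mono, smul_eq_mul]
  split_ifs
  · rw [mul_one]
  · rw [mul_zero]

variable [CharP K 2]

theorem X_mem_trunc_one (i : BVar) : (X i : DP BVar K) ∈ trunc (bShear fun _ => 1) := by
  refine mono_mem_monoSpan (fun j n hn => ?_) 1
  have h1 : (n : ℕ∞) = 1 := by
    rcases j with j | j <;> exact hn.symm
  have h2 : n = 1 := by exact_mod_cast h1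
  subst h2
  by_cases h : j = i
  · subst h
    simp
  · simp [Pi.single_eq_of_ne h]

theorem betaFun_mem (i : Fin 16) : betaFun μ i ∈ buttinAlgebra μ fun _ => 1 := by
  have hX := X_mem_trunc_one (K := K)
  have hC := fun a => (trunc (K := K) (bShear fun _ => 1)).algebraMap_mem a
  constructor
  · fin_cases i
    · exact one_mem _
    · exact hX _
    · exact hX _
    · exact mul_mem (hX _) (hX _)
    · exact mul_mem (hX _) (hX _)
    · exact add_mem (mul_mem (hX _) (mul_mem (hX _) (hX _))) (mul_mem (hC _) (mul_mem (hX _) (hX _)))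
    · exact add_mem (mul_mem (hX _) (mul_mem (hX _) (hX _))) (mul_mem (hC _) (mul_mem (hX _) (hX _)))
    · exact add_mem (mul_mem (hX _) (hX _)) (mul_mem (hC _) (hX _))
    · exact add_mem (mul_mem (hX _) (hX _)) (mul_mem (hC _) (hX _))
    · exact hX _
    · exact hX _
    · exact mul_mem (hX _) (hX _)
    · exact mul_mem (hX _) (hX _)
    · exact add_mem (mul_mem (hC _) (mul_mem (hX _) (mul_mem (hX _) (hX _))))
        (mul_mem (hC _) (mul_mem (hX _) (hX _)))
    · exact add_mem (mul_mem (hC _) (mul_mem (hX _) (mul_mem (hX _) (hX _))))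
        (mul_mem (hC _) (mul_mem (hX _) (hX _)))
    · exact add_mem (mul_mem (hC _) (mul_mem (hX _) (mul_mem (hX _) (mul_mem (hX _) (hX _)))))
        (mul_mem (hC _) (mul_mem (hX _) (add_mem (mul_mem (hX _) (hX _)) (mul_mem (hX _) (hX _)))))
  · change pd tauv (betaFun μ i) - μ • eulerQ (pd tauv (betaFun μ i)) - μ • bvLaplace (betaFun μ i) = 0
    have e2 : (2 : DP BVar K) = 0 := CharTwo.two_eq_zero
    fin_cases i <;> simp [betaFun, eulerQ_apply, bvLaplace, Derivation.leibniz, pd_X, Algebra.smul_def]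
    all_goals grind

variable {μ} in
-- The defining equation determines the coefficient of a monomial with τ from the τ-free ones, after
-- division by `1 - μ · (q-degree)`. In characteristic 2 this number is 1 or `1 - μ`, so it is
-- nonzero.
theorem eq_zero_of_buttinDiv {N : Fin 2 → ℕ∞} (hμ : μ ≠ 1) {f : DP BVar K}
    (hf : f ∈ trunc (bShear N)) (hd : buttinDiv μ f = 0) (h : ∀ r, r tauv = 0 → coeff r f = 0) :
    f = 0 := by
  refine DP.ext fun r => ?_
  rw [map_zero]
  by_cases h0 : r tauv = 0
  · exact h r h0
  obtain ⟨s, rfl⟩ := exists_eq_add_single tauv r h0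
  by_cases hs : s tauv = 0
  · have hd := congrArg (coeff s) hd
    rw [coeff_buttinDiv, map_zero, h (s + _ + _) (by simp [hs]), h (s + _ + _) (by simp [hs]), add_zero,
      mul_zero, sub_zero, mul_eq_zero] at hd
    refine hd.resolve_left fun h1 => ?_
    rw [← Nat.cast_add] at h1
    rcases CharTwo.natCast_cases (R := K) (s (qv 0) + s (qv 1)) with h2 | h2 <;> rw [h2] at h1
    · simp at h1
    · rw [mul_one, sub_eq_zero] at h1
      exact hμ h1.symm
  · have := pd_pd_eq_zero (Sum.inr ()) hf
    obtain ⟨s, rfl⟩ := exists_eq_add_single tauv s hs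
    have h2 := congrArg (coeff s) this
    rw [map_zero] at h2
    exact h2

variable {μ} in
theorem eq_zero_of_coeff_eq_zero {N : Fin 2 → ℕ∞} (hμ : μ ≠ 1) {x : buttinAlgebra μ N}
    (h : ∀ r, r tauv = 0 → coeff r (x.1 : DP BVar K) = 0) : x = 0 :=
  Subtype.ext (eq_zero_of_buttinDiv hμ x.2.1 x.2.2 h)

/-- The basis of the Buttin algebra with all heights equal to 1. -/
def beta (i : Fin 16) : buttinAlgebra μ fun _ => 1 := ⟨betaFun μ i, betaFun_mem μ i⟩

variable {μ}

theorem sqCoeff_ne_zero (hμ : μ ≠ 1) (i : Fin 16) : sqCoeff μ i ≠ 0 := by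
  unfold sqCoeff
  split_ifs
  · exact one_ne_zero
  · rw [CharTwo.add_eq_zero.ne]
    exact hμ.symm

/-- An element is determined by its τ-free part, which for heights 1 is a combination of the 16
square-free monomials. -/
theorem eq_sum_beta (hμ : μ ≠ 1) (x : buttinAlgebra μ fun _ => 1) :
    x = ∑ i, ((sqCoeff μ i)⁻¹ * coeff (sqExp i) (x.1 : DP BVar K)) • beta μ i := by
  obtain ⟨f, hf⟩ : ∃ f : DP BVar K, f = x.1 := ⟨_, rfl⟩
  rw [← sub_eq_zero, ← hf]
  refine eq_zero_of_coeff_eq_zero hμ fun r hr => ?_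
  have hval : (buttinAlgebra μ fun _ => 1).toSubmodule.subtype
      (x - ∑ i, ((sqCoeff μ i)⁻¹ * coeff (sqExp i) f) • beta μ i) =
        f - ∑ i, ((sqCoeff μ i)⁻¹ * coeff (sqExp i) f) • betaFun μ i := by
    rw [map_sub, map_sum, hf]
    rfl
  refine (congrArg (coeff r) hval).trans ?_
  rw [map_sub, map_sum]
  simp only [map_smul, coeff_betaFun μ hr, smul_eq_mul]
  by_cases h : ∃ j, sqExp j = r
  · obtain ⟨j, rfl⟩ := h
    rw [Finset.sum_eq_single j]
    · rw [if_pos rfl]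
      field_simp [sqCoeff_ne_zero hμ j]
      ring
    · intro i _ hij
      rw [if_neg (fun h => hij (sqExp_injective h)), mul_zero]
    · simp
  · rw [Finset.sum_eq_zero fun i _ => by rw [if_neg (fun hi => h ⟨i, hi⟩), mul_zero], sub_zero]
    by_contra hne
    refine h (exists_sqExp_eq hr fun i => ?_)
    have hi := mem_monoSpan.1 (mem_trunc.1 x.2.1) r (hf ▸ hne) i 1 (by rcases i with i | i <;> rfl)
    simpa using hi

/-- The weight is visible on the τ-free part, since the weight component has the same τ-free part as
the element itself. -/
theorem mem_buttinWeight_of_coeff {N : Fin 2 → ℕ∞} (hμ : μ ≠ 1) {Γ : Type*} [AddCommGroup Γ]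
    [DecidableEq Γ] {W : BVar → Γ} (hW : IsContactWeight W) {γ : Γ} {x : buttinAlgebra μ N}
    (h : ∀ r, r tauv = 0 → coeff r (x.1 : DP BVar K) ≠ 0 → wt W r = γ) :
    x ∈ buttinWeight μ N W γ := by
  have hx : x = ⟨restrict {r | wt W r = γ} (x.1 : DP BVar K),
      restrict_mem_buttinAlgebra hW γ x.2⟩ := by
    rw [← sub_eq_zero]
    refine eq_zero_of_coeff_eq_zero hμ fun r hr => ?_
    have key : ∀ f : DP BVar K, (coeff r f ≠ 0 → wt W r = γ) →
        coeff r (f - restrict {r | wt W r = γ} f) = 0 := by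
      intro f hf
      rw [map_sub, coeff_restrict]
      split_ifs with hγ
      · exact sub_self _
      · rw [sub_zero]
        by_contra hne
        exact hγ (hf hne)
    exact key _ (h r hr)
  rw [hx]
  exact restrict_mem_weightPiece W γ _

theorem beta_mem (hμ : μ ≠ 1) {Γ : Type*} [AddCommGroup Γ] [DecidableEq Γ] {W : BVar → Γ}
    (hW : IsContactWeight W) (i : Fin 16) :
    beta μ i ∈ buttinWeight μ (fun _ => 1) W (wt W (sqExp i)) := by
  refine mem_buttinWeight_of_coeff hμ hW fun r hr h => ?_
  have h' : coeff r (betaFun μ i) ≠ 0 := h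
  rw [coeff_betaFun μ hr] at h'
  split_ifs at h' with hi
  · rw [hi]
  · exact absurd rfl h'

theorem beta_ne_zero (hμ : μ ≠ 1) (i : Fin 16) : beta μ i ≠ 0 := by
  intro h
  have h' : coeff (sqExp i) (betaFun μ i) = 0 :=
    (congrArg (fun y : buttinAlgebra μ fun _ => 1 => coeff (sqExp i) (y.1 : DP BVar K)) h).trans
      (map_zero (coeff (sqExp i)))
  rw [coeff_betaFun μ (sqExp_tau i), if_pos rfl] at h'
  exact sqCoeff_ne_zero hμ i h'

end SmallButtin

end
end WeisfeilerKac

/-! ### Structure constants of the 16-dimensional Buttin algebra -/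

namespace WeisfeilerKac

noncomputable section

open DP

section BetaBrackets

variable {K : Type*} [Field K] [CharP K 2] {μ : K}

theorem lie_comm_of_charTwo {L : Type*} [LieRing L] [LieAlgebra K L] (x y : L) : ⁅x, y⁆ = ⁅y, x⁆ := by
  rw [← lie_skew, ← neg_one_smul K, CharTwo.neg_eq, one_smul]

theorem lie_beta_smul {i j k : Fin 16} {c : K} (h : contactBracket (betaFun μ i) (betaFun μ j) =
    algebraMap K _ c * betaFun μ k) : ⁅beta μ i, beta μ j⁆ = c • beta μ k :=
  Subtype.ext (h.trans (Algebra.smul_def c (betaFun μ k)).symm)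

theorem lie_beta_add {i j : Fin 16} {c d : K} (h : contactBracket (betaFun μ i) (betaFun μ j) =
    algebraMap K _ c * betaFun μ 7 + algebraMap K _ d * betaFun μ 8) :
    ⁅beta μ i, beta μ j⁆ = c • beta μ 7 + d • beta μ 8 :=
  Subtype.ext (h.trans (congrArg₂ (· + ·) (Algebra.smul_def c (betaFun μ 7)).symm
    (Algebra.smul_def d (betaFun μ 8)).symm))

/-- The eigenvalues of the inner derivation by the element with the leading term `q₁ξ₁`. -/
def eigSeven (μ : K) : Fin 16 → K :=
  ![μ, 1 + μ, μ, 1 + μ, 1, 0, 1, 0, 0, 1, 0, 1, 1 + μ, μ, 1 + μ, μ]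

/-- The eigenvalues of the inner derivation by the element with the leading term `q₂ξ₂`. -/
def eigEight (μ : K) : Fin 16 → K :=
  ![μ, μ, 1 + μ, 1 + μ, 1, 1, 0, 0, 0, 0, 1, 1, 1 + μ, 1 + μ, μ, μ]

/-- The reversal `i ↦ 15 - i` exchanges opposite root vectors; their eigenvalues are negatives of
each other, hence equal in characteristic 2. -/
theorem eigSeven_rev (i : Fin 16) : eigSeven μ i.rev = eigSeven μ i := by
  fin_cases i <;> rfl

theorem eigEight_rev (i : Fin 16) : eigEight μ i.rev = eigEight μ i := by
  fin_cases i <;> rfl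

theorem lie_beta_seven (i : Fin 16) : ⁅beta μ 7, beta μ i⁆ = eigSeven μ i • beta μ i := by
  have e2 : (2 : DP BVar K) = 0 := CharTwo.two_eq_zero
  have x1 := X_mul_self (K := K) (qv 0)
  have x2 := X_mul_self (K := K) (qv 1)
  have x3 := X_mul_self (K := K) (xiv 0)
  have x4 := X_mul_self (K := K) (xiv 1)
  have x5 := X_mul_self (K := K) tauv
  refine lie_beta_smul ?_
  fin_cases i <;>
  simp [betaFun, eigSeven, contactBracket, eulerQ_apply, Derivation.leibniz, pd_X] <;> grind

theorem lie_beta_eight (i : Fin 16) : ⁅beta μ 8, beta μ i⁆ = eigEight μ i • beta μ i := by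
  have e2 : (2 : DP BVar K) = 0 := CharTwo.two_eq_zero
  have x1 := X_mul_self (K := K) (qv 0)
  have x2 := X_mul_self (K := K) (qv 1)
  have x3 := X_mul_self (K := K) (xiv 0)
  have x4 := X_mul_self (K := K) (xiv 1)
  have x5 := X_mul_self (K := K) tauv
  refine lie_beta_smul ?_
  fin_cases i <;>
  simp [betaFun, eigEight, contactBracket, eulerQ_apply, Derivation.leibniz, pd_X] <;> grind

/-- Brackets of opposite root vectors. These elements of the torus spanned by `beta μ 7` and `beta μ
8` supply both the coroots and the nondegeneracy of the pairings. -/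
theorem lie_beta_rev (i : Fin 7) : ⁅beta μ (Fin.castLE (by norm_num) i),
    beta μ (Fin.castLE (by norm_num : 7 ≤ 16) i).rev⁆ =
    (![μ, μ, 1 + μ, 1, 1, 1, 0] : Fin 7 → K) i • beta μ 7 +
      (![μ, 1 + μ, μ, 1, 1, 0, 1] : Fin 7 → K) i • beta μ 8 := by
  have e2 : (2 : DP BVar K) = 0 := CharTwo.two_eq_zero
  have x1 := X_mul_self (K := K) (qv 0)
  have x2 := X_mul_self (K := K) (qv 1)
  have x3 := X_mul_self (K := K) (xiv 0)
  have x4 := X_mul_self (K := K) (xiv 1)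
  have x5 := X_mul_self (K := K) tauv
  refine lie_beta_add ?_
  fin_cases i <;>
  simp [betaFun, Fin.rev, contactBracket, eulerQ_apply, Derivation.leibniz, pd_X] <;> grind

/-- Just the brackets needed to generate the root vectors from the simple ones, and those of degree
0 from the generators in claim (b). -/
theorem lie_beta_rows : ⁅beta μ 0, beta μ 6⁆ = μ • beta μ 1 ∧ ⁅beta μ 1, beta μ 4⁆ = (1 : K) • beta μ 2 ∧
    ⁅beta μ 4, beta μ 6⁆ = (1 : K) • beta μ 5 ∧ ⁅beta μ 2, beta μ 6⁆ = (1 + μ) • beta μ 3 ∧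
    ⁅beta μ 9, beta μ 11⁆ = (1 : K) • beta μ 10 ∧ ⁅beta μ 9, beta μ 15⁆ = (1 : K) • beta μ 14 ∧
    ⁅beta μ 10, beta μ 15⁆ = (1 : K) • beta μ 13 ∧ ⁅beta μ 9, beta μ 13⁆ = (1 + μ) • beta μ 12 ∧
    ⁅beta μ 1, beta μ 5⁆ = (1 + μ) • beta μ 3 ∧ ⁅beta μ 1, beta μ 9⁆ = (1 : K) • beta μ 0 ∧
    ⁅beta μ 0, beta μ 5⁆ = μ • beta μ 2 ∧ ⁅beta μ 5, beta μ 9⁆ = (1 : K) • beta μ 4 ∧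
    ⁅beta μ 6, beta μ 10⁆ = (1 : K) • beta μ 11 ∧ ⁅beta μ 10, beta μ 14⁆ = (1 + μ) • beta μ 12 ∧
    ⁅beta μ 6, beta μ 14⁆ = μ • beta μ 15 := by
  have e2 : (2 : DP BVar K) = 0 := CharTwo.two_eq_zero
  have x1 := X_mul_self (K := K) (qv 0)
  have x2 := X_mul_self (K := K) (qv 1)
  have x3 := X_mul_self (K := K) (xiv 0)
  have x4 := X_mul_self (K := K) (xiv 1)
  have x5 := X_mul_self (K := K) tauv
  refine ⟨?_, ?_, ?_, ?_, ?_, ?_, ?_, ?_, ?_, ?_, ?_, ?_, ?_, ?_, ?_⟩ <;> refine lie_beta_smul ?_ <;>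
  simp [betaFun, contactBracket, eulerQ_apply, Derivation.leibniz, pd_X] <;> grind

end BetaBrackets

end
end WeisfeilerKac

/-! ### Root gradings of the 16-dimensional Buttin algebra -/

namespace WeisfeilerKac

noncomputable section

open DP

section Realizations

variable {K : Type*} [Field K] [CharP K 2] {μ : K}

/-- The weights of the elements of the basis of the Buttin algebra. -/
def betaWt {Γ : Type*} [AddCommGroup Γ] (W : BVar → Γ) (i : Fin 16) : Γ := wt W (sqExp i) - W tauv

/-- The components of the Buttin algebra with all heights equal to 1. -/
abbrev betaPiece {Γ : Type*} [AddCommGroup Γ] (μ : K) (W : BVar → Γ) (α : Γ) :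
    Submodule K (buttinAlgebra μ fun _ => 1) := buttinWeight μ (fun _ => 1) W (α + W tauv)

section Pieces

variable {Γ : Type*} [AddCommGroup Γ] [DecidableEq Γ] {W : BVar → Γ}

theorem beta_mem_betaPiece (hμ : μ ≠ 1) (hW : IsContactWeight W) (i : Fin 16) :
    beta μ i ∈ betaPiece μ W (betaWt W i) := by
  unfold betaPiece betaWt
  rw [sub_add_cancel]
  exact beta_mem hμ hW i

theorem lie_mem_betaPiece (hW : IsContactWeight W) {α β : Γ} {x y : buttinAlgebra μ fun _ => 1}
    (hx : x ∈ betaPiece μ W α) (hy : y ∈ betaPiece μ W β) : ⁅x, y⁆ ∈ betaPiece μ W (α + β) := by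
  have h := lie_mem_buttinWeight hW hx hy
  rwa [show α + W tauv + (β + W tauv) - W tauv = α + β + W tauv by abel] at h

theorem iSup_betaPiece (hW : IsContactWeight W) : ⨆ α, betaPiece μ W α = ⊤ := by
  rw [← iSup_buttinWeight μ (fun _ => 1) hW]
  exact (Equiv.addRight (W tauv)).iSup_congr fun _ => rfl

theorem iSupIndep_betaPiece : iSupIndep (betaPiece μ W) :=
  (iSupIndep_buttinWeight μ (fun _ => 1) W).comp (add_left_injective (W tauv))

theorem exists_eq_sum_beta (hμ : μ ≠ 1) {α : Γ} {x : buttinAlgebra μ fun _ => 1}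
    (hx : x ∈ betaPiece μ W α) : ∃ c : Fin 16 → K, (∀ i, c i ≠ 0 → betaWt W i = α) ∧
      x = ∑ i, c i • beta μ i := by
  refine ⟨_, fun i hi => ?_, eq_sum_beta hμ x⟩
  rw [betaWt, mem_weightPiece.1 hx (sqExp i) (right_ne_zero_of_mul hi), add_sub_cancel_right]

theorem eq_zero_of_betaWt_ne (hμ : μ ≠ 1) {α : Γ} (hα : ∀ i, betaWt W i ≠ α)
    {x : buttinAlgebra μ fun _ => 1} (hx : x ∈ betaPiece μ W α) : x = 0 := by
  obtain ⟨c, hc, rfl⟩ := exists_eq_sum_beta hμ hx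
  refine Finset.sum_eq_zero fun i _ => ?_
  rw [not_not.1 fun h => hα i (hc i h), zero_smul]

theorem exists_eq_smul_beta (hμ : μ ≠ 1) {i : Fin 16} (hi : ∀ j, betaWt W j = betaWt W i → j = i)
    {x : buttinAlgebra μ fun _ => 1} (hx : x ∈ betaPiece μ W (betaWt W i)) :
    ∃ c : K, x = c • beta μ i := by
  obtain ⟨c, hc, rfl⟩ := exists_eq_sum_beta hμ hx
  refine ⟨c i, Finset.sum_eq_single i (fun j _ hj => ?_) (by simp)⟩
  rw [not_not.1 fun h => hj (hi j (hc j h)), zero_smul]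

/-- The eigenvalues on `beta μ 9` and `beta μ 10` are `(1, 0)` and `(0, 1)`, so these two vectors
read off the coefficients. -/
theorem eq_zero_of_add_eq_zero (hμ : μ ≠ 1) {c d : K} (h : c • beta μ 7 + d • beta μ 8 = 0) :
    c = 0 ∧ d = 0 := by
  have h7 := lie_beta_seven (μ := μ) 9
  have h8 := lie_beta_eight (μ := μ) 9
  have h7' := lie_beta_seven (μ := μ) 10
  have h8' := lie_beta_eight (μ := μ) 10
  have h9 : ⁅c • beta μ 7 + d • beta μ 8, beta μ 9⁆ = c • beta μ 9 := by
    rw [add_lie, smul_lie, smul_lie, h7, h8]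
    simp [eigSeven, eigEight]
  have h10 : ⁅c • beta μ 7 + d • beta μ 8, beta μ 10⁆ = d • beta μ 10 := by
    rw [add_lie, smul_lie, smul_lie, h7', h8']
    simp [eigSeven, eigEight]
  rw [h, zero_lie] at h9 h10
  exact ⟨(smul_eq_zero.1 h9.symm).resolve_right (beta_ne_zero hμ 9),
    (smul_eq_zero.1 h10.symm).resolve_right (beta_ne_zero hμ 10)⟩

theorem lie_beta_rev_ne_zero (h0 : μ ≠ 0) (hμ : μ ≠ 1) {i : Fin 16} (h7 : i ≠ 7) (h8 : i ≠ 8) :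
    ⁅beta μ i, beta μ i.rev⁆ ≠ 0 := by
  have key : ∀ i : Fin 7, ⁅beta μ (Fin.castLE (by norm_num) i),
      beta μ (Fin.castLE (by norm_num : 7 ≤ 16) i).rev⁆ ≠ 0 := by
    intro i h
    rw [lie_beta_rev] at h
    have := eq_zero_of_add_eq_zero hμ h
    fin_cases i <;> simp [h0] at this
  have hi : ∀ i : Fin 16, i ≠ 7 → i ≠ 8 → (∃ j : Fin 7, i = Fin.castLE (by norm_num) j) ∨
      ∃ j : Fin 7, i.rev = Fin.castLE (by norm_num) j := by decide
  rcases hi i h7 h8 with ⟨j, rfl⟩ | ⟨j, hj⟩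
  · exact key j
  · rw [← Fin.rev_rev i, hj, Fin.rev_rev, lie_comm_of_charTwo (K := K)]
    exact key j

/-- The conditions on the weights that make the Buttin algebra into a realization. -/
structure IsRootWeight (W : BVar → Γ) : Prop where
  contact : IsContactWeight W
  inj : ∀ i j, betaWt W i ≠ 0 → betaWt W j = betaWt W i → j = i
  rev : ∀ i : Fin 16, betaWt W i.rev = -betaWt W i
  zero : ∀ i, betaWt W i = 0 ↔ i = 7 ∨ i = 8

/-- Nonzero roots are simple, so the pairing of opposite components is a single bracket, nonzero by
`lie_beta_rev_ne_zero`. -/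
theorem eq_zero_of_lie_betaPiece (h0 : μ ≠ 0) (hμ : μ ≠ 1) (hW : IsRootWeight W) {α : Γ}
    (hα : α ≠ 0) {x : buttinAlgebra μ fun _ => 1} (hx : x ∈ betaPiece μ W α)
    (h : ∀ y ∈ betaPiece μ W (-α), ⁅x, y⁆ = 0) : x = 0 := by
  by_cases hi : ∃ i, betaWt W i = α
  · obtain ⟨i, rfl⟩ := hi
    obtain ⟨c, rfl⟩ := exists_eq_smul_beta hμ (fun j => hW.inj i j hα) hx
    have hy := h _ (hW.rev i ▸ beta_mem_betaPiece hμ hW.contact i.rev)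
    rw [smul_lie, smul_eq_zero] at hy
    rw [hy.resolve_right (lie_beta_rev_ne_zero h0 hμ (fun h => hα ((hW.zero i).2 (Or.inl h)))
      fun h => hα ((hW.zero i).2 (Or.inr h))), zero_smul]
  · exact eq_zero_of_betaWt_ne hμ (fun i h => hi ⟨i, h⟩) hx

theorem exists_eq_add_of_mem_zero (hμ : μ ≠ 1) (hW : IsRootWeight W) {x : buttinAlgebra μ fun _ => 1}
    (hx : x ∈ betaPiece μ W 0) : ∃ c d : K, x = c • beta μ 7 + d • beta μ 8 := by
  obtain ⟨c, hc, rfl⟩ := exists_eq_sum_beta hμ hx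
  refine ⟨c 7, c 8, Finset.sum_eq_add (7 : Fin 16) 8 (by decide) (fun i _ hi => ?_) (by simp) (by simp)⟩
  rw [not_not.1 fun h => not_or.2 hi ((hW.zero i).1 (hc i h)), zero_smul]

end Pieces

theorem lieSpan_eq_top_of_beta (hμ : μ ≠ 1) {s : Set (buttinAlgebra μ fun _ => 1)}
    (h : ∀ i, beta μ i ∈ LieSubalgebra.lieSpan K _ s) : LieSubalgebra.lieSpan K _ s = ⊤ := by
  refine eq_top_iff.2 fun x _ => ?_
  rw [eq_sum_beta hμ x]
  exact sum_mem fun i _ => (LieSubalgebra.lieSpan K _ s).smul_mem _ (h i)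

/-- The weights of the indeterminates for the first Cartan matrix. -/
def rootWt₁ : BVar → Fin 3 → ℤ :=
  Sum.elim ![![1, 1, 0], ![1, 1, 1]] (Sum.elim ![![0, -1, 0], ![0, -1, -1]] fun _ => ![1, 0, 0])

/-- The weights of the indeterminates for the second Cartan matrix. -/
def rootWt₂ : BVar → Fin 3 → ℤ :=
  Sum.elim ![![1, 0, 0], ![1, 1, 1]] (Sum.elim ![![0, 0, 1], ![0, -1, 0]] fun _ => ![1, 0, 1])

/-- The explicit table reduces the checks on roots to decidable statements. The entries 15, 9, 11
are the simple roots. -/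
theorem betaWt_rootWt₁ : betaWt rootWt₁ = ![![-1, 0, 0], ![-1, -1, 0], ![-1, -1, -1], ![-1, -2, -1],
    ![0, 0, -1], ![0, -1, -1], ![0, -1, 0], 0, 0, ![0, 1, 0], ![0, 1, 1], ![0, 0, 1], ![1, 2, 1],
    ![1, 1, 1], ![1, 1, 0], ![1, 0, 0]] := by
  funext i
  fin_cases i <;> decide

/-- The same algebra with another system of simple roots, at the entries 14, 10, 6. -/
theorem betaWt_rootWt₂ : betaWt rootWt₂ = ![![-1, 0, -1], ![-1, 0, 0], ![-1, -1, -1], ![-1, -1, 0],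
    ![0, -1, -1], ![0, -1, 0], ![0, 0, 1], 0, 0, ![0, 0, -1], ![0, 1, 0], ![0, 1, 1], ![1, 1, 0],
    ![1, 1, 1], ![1, 0, 0], ![1, 0, 1]] := by
  funext i
  fin_cases i <;> decide

set_option maxRecDepth 10000 in
theorem isRootWeight₁ : IsRootWeight rootWt₁ where
  contact := by unfold IsContactWeight; decide
  inj := by rw [betaWt_rootWt₁]; decide
  rev := by rw [betaWt_rootWt₁]; decide
  zero := by rw [betaWt_rootWt₁]; decide

set_option maxRecDepth 10000 in
theorem isRootWeight₂ : IsRootWeight rootWt₂ where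
  contact := by unfold IsContactWeight; decide
  inj := by rw [betaWt_rootWt₂]; decide
  rev := by rw [betaWt_rootWt₂]; decide
  zero := by rw [betaWt_rootWt₂]; decide

end Realizations

end
end WeisfeilerKac

/-! ### Chevalley generators in the Buttin algebra -/

namespace WeisfeilerKac

noncomputable section

open DP

section Realizations

variable {K : Type*} [Field K] [CharP K 2] {μ : K}

theorem beta_mem_of_lie_eq {S : LieSubalgebra K (buttinAlgebra μ fun _ => 1)} {i j k : Fin 16} {c : K}
    (hc : c ≠ 0) (h : ⁅beta μ i, beta μ j⁆ = c • beta μ k) (hi : beta μ i ∈ S) (hj : beta μ j ∈ S) :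
    beta μ k ∈ S := by
  have h' := S.smul_mem c⁻¹ (S.lie_mem hi hj)
  rwa [h, smul_smul, inv_mul_cancel₀ hc, one_smul] at h'

theorem beta_seven_mem {S : LieSubalgebra K (buttinAlgebra μ fun _ => 1)} (h5 : beta μ 5 ∈ S)
    (h10 : beta μ 10 ∈ S) : beta μ 7 ∈ S := by
  have h : ⁅beta μ 5, beta μ 10⁆ = _ := lie_beta_rev (μ := μ) 5
  have h' := S.lie_mem h5 h10
  rw [h] at h'
  simpa using h'

theorem beta_eight_mem {S : LieSubalgebra K (buttinAlgebra μ fun _ => 1)} (h6 : beta μ 6 ∈ S)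
    (h9 : beta μ 9 ∈ S) : beta μ 8 ∈ S := by
  have h : ⁅beta μ 6, beta μ 9⁆ = _ := lie_beta_rev (μ := μ) 6
  have h' := S.lie_mem h6 h9
  rw [h] at h'
  simpa using h'

theorem one_add_ne_zero_of_ne_one (hμ : μ ≠ 1) : 1 + μ ≠ 0 := fun h =>
  hμ (CharTwo.add_eq_zero.1 h).symm

/-- Every remaining root vector arises from a bracket whose coefficient is 1, `μ` or `1 + μ`, all
nonzero; the torus comes from two coroots. -/
theorem beta_mem_of_mem₁ (h0 : μ ≠ 0) (hμ : μ ≠ 1)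
    {S : LieSubalgebra K (buttinAlgebra μ fun _ => 1)} (b15 : beta μ 15 ∈ S) (b9 : beta μ 9 ∈ S)
    (b11 : beta μ 11 ∈ S) (b0 : beta μ 0 ∈ S) (b6 : beta μ 6 ∈ S) (b4 : beta μ 4 ∈ S) (i : Fin 16) :
    beta μ i ∈ S := by
  have hμ' := one_add_ne_zero_of_ne_one hμ
  obtain ⟨r1, r2, r3, r4, r5, r6, r7, r8, -⟩ := lie_beta_rows (μ := μ)
  have b1 := beta_mem_of_lie_eq h0 r1 b0 b6
  have b2 := beta_mem_of_lie_eq one_ne_zero r2 b1 b4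
  have b3 := beta_mem_of_lie_eq hμ' r4 b2 b6
  have b5 := beta_mem_of_lie_eq one_ne_zero r3 b4 b6
  have b10 := beta_mem_of_lie_eq one_ne_zero r5 b9 b11
  have b14 := beta_mem_of_lie_eq one_ne_zero r6 b9 b15
  have b13 := beta_mem_of_lie_eq one_ne_zero r7 b10 b15
  have b12 := beta_mem_of_lie_eq hμ' r8 b9 b13
  have b7 := beta_seven_mem b5 b10
  have b8 := beta_eight_mem b6 b9
  fin_cases i
  exacts [b0, b1, b2, b3, b4, b5, b6, b7, b8, b9, b10, b11, b12, b13, b14, b15]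

theorem beta_mem_of_mem₂ (h0 : μ ≠ 0) (hμ : μ ≠ 1)
    {S : LieSubalgebra K (buttinAlgebra μ fun _ => 1)} (b14 : beta μ 14 ∈ S) (b10 : beta μ 10 ∈ S)
    (b6 : beta μ 6 ∈ S) (b1 : beta μ 1 ∈ S) (b5 : beta μ 5 ∈ S) (b9 : beta μ 9 ∈ S) (i : Fin 16) :
    beta μ i ∈ S := by
  have hμ' := one_add_ne_zero_of_ne_one hμ
  obtain ⟨-, -, -, -, -, -, r7, -, r9, r10, r11, r12, r13, r14, r15⟩ := lie_beta_rows (μ := μ)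
  have b3 := beta_mem_of_lie_eq hμ' r9 b1 b5
  have b0 := beta_mem_of_lie_eq one_ne_zero r10 b1 b9
  have b2 := beta_mem_of_lie_eq h0 r11 b0 b5
  have b4 := beta_mem_of_lie_eq one_ne_zero r12 b5 b9
  have b11 := beta_mem_of_lie_eq one_ne_zero r13 b6 b10
  have b12 := beta_mem_of_lie_eq hμ' r14 b10 b14
  have b15 := beta_mem_of_lie_eq h0 r15 b6 b14
  have b13 := beta_mem_of_lie_eq one_ne_zero r7 b10 b15
  have b7 := beta_seven_mem b5 b10
  have b8 := beta_eight_mem b6 b9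
  fin_cases i
  exacts [b0, b1, b2, b3, b4, b5, b6, b7, b8, b9, b10, b11, b12, b13, b14, b15]

theorem lie_add_beta (c d : K) (i : Fin 16) : ⁅c • beta μ 7 + d • beta μ 8, beta μ i⁆ =
    (c * eigSeven μ i + d * eigEight μ i) • beta μ i := by
  rw [add_lie, smul_lie, smul_lie, lie_beta_seven, lie_beta_eight, smul_smul, smul_smul, add_smul]

theorem lie_add_beta_add (c d c' d' : K) :
    ⁅c • beta μ 7 + d • beta μ 8, c' • beta μ 7 + d' • beta μ 8⁆ = 0 := by
  rw [lie_add, lie_smul, lie_smul, lie_add_beta, lie_add_beta]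
  simp [eigSeven, eigEight]

/-- A realization in the Buttin algebra whose generators are elements of the basis. -/
def buttinRealization {A : Matrix (Fin 3) (Fin 3) K} (h0 : μ ≠ 0) (hμ : μ ≠ 1)
    {W : BVar → Fin 3 → ℤ} (hW : IsRootWeight W) (e : Fin 3 → Fin 16)
    (he : ∀ i, betaWt W (e i) = Pi.single i 1)
    (hne : ∀ i j, i ≠ j → ∀ k, betaWt W k ≠ Pi.single i 1 + -Pi.single j 1) (c d : Fin 3 → K)
    (hH : ∀ i, ⁅beta μ (e i), beta μ (e i).rev⁆ = c i • beta μ 7 + d i • beta μ 8)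
    (hA : ∀ i j, c i * eigSeven μ (e j) + d i * eigEight μ (e j) = A i j)
    (hS : ∀ S : LieSubalgebra K (buttinAlgebra μ fun _ => 1), (∀ i, beta μ (e i) ∈ S) →
      (∀ i, beta μ (e i).rev ∈ S) → ∀ i, beta μ i ∈ S)
    (hz : ∀ c d : K, (∀ j, c * eigSeven μ (e j) + d * eigEight μ (e j) = 0) → c = 0 ∧ d = 0) :
    Realization A (betaPiece μ W) where
  E i := beta μ (e i)
  F i := beta μ (e i).rev
  H i := c i • beta μ 7 + d i • beta μ 8
  indep := iSupIndep_betaPiece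
  iSup_eq_top := iSup_betaPiece hW.contact
  lie_mem := lie_mem_betaPiece hW.contact
  E_mem i := he i ▸ beta_mem_betaPiece hμ hW.contact (e i)
  F_mem i := by
    rw [← he, ← hW.rev]
    exact beta_mem_betaPiece hμ hW.contact _
  H_mem i := by
    have h7 := beta_mem_betaPiece hμ hW.contact 7
    have h8 := beta_mem_betaPiece hμ hW.contact 8
    rw [(hW.zero 7).2 (Or.inl rfl)] at h7
    rw [(hW.zero 8).2 (Or.inr rfl)] at h8
    exact add_mem (Submodule.smul_mem _ _ h7) (Submodule.smul_mem _ _ h8)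
  lie_E_F i j := by
    split_ifs with h
    · rw [← h, hH]
    · refine eq_zero_of_betaWt_ne hμ (hne i j h) (lie_mem_betaPiece hW.contact ?_ ?_)
      · rw [← he]
        exact beta_mem_betaPiece hμ hW.contact _
      · rw [← he, ← hW.rev]
        exact beta_mem_betaPiece hμ hW.contact _
  lie_H_E i j := by rw [lie_add_beta, hA]
  lie_H_F i j := by
    rw [lie_add_beta, eigSeven_rev, eigEight_rev, hA, ← neg_smul, CharTwo.neg_eq]
  lie_H_H i j := lie_add_beta_add ..
  lieSpan_eq_top := lieSpan_eq_top_of_beta hμ (hS _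
    (fun i => LieSubalgebra.subset_lieSpan (Or.inl ⟨i, rfl⟩))
    fun i => LieSubalgebra.subset_lieSpan (Or.inr ⟨i, rfl⟩))
  E_ne_zero i := beta_ne_zero hμ _
  F_ne_zero i := beta_ne_zero hμ _
  eq_zero α hα x hx h := eq_zero_of_lie_betaPiece h0 hμ hW hα hx h
  eq_zero_of_zero x hx h := by
    obtain ⟨c, d, rfl⟩ := exists_eq_add_of_mem_zero hμ hW hx
    obtain ⟨rfl, rfl⟩ := hz c d fun j => by
      have h := h j
      rw [lie_add_beta, smul_eq_zero] at h
      exact h.resolve_right (beta_ne_zero hμ _)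
    rw [zero_smul, zero_smul, add_zero]

/-- The realization of the first Cartan matrix in the Buttin algebra. -/
def buttinRealization₁ (h0 : μ ≠ 0) (hμ : μ ≠ 1) :
    Realization (wkMatrix₁ μ) (betaPiece μ rootWt₁) :=
  -- The negative generators are the reversed entries 0, 6, 4. The coefficient vectors that follow
  -- are the coroots, read from `lie_beta_rev` at 0, 6, 4.
  buttinRealization h0 hμ isRootWeight₁ ![15, 9, 11]
    (by rw [betaWt_rootWt₁]; decide) (by rw [betaWt_rootWt₁]; decide) ![μ, 0, 1] ![μ, 1, 1]
    (fun i => by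
      rw [lie_comm_of_charTwo (K := K)]
      fin_cases i
      exacts [lie_beta_rev 0, lie_beta_rev 6, lie_beta_rev 4])
    (fun i j => by
      have e2 : (2 : K) = 0 := CharTwo.two_eq_zero
      fin_cases i <;> fin_cases j <;> simp [eigSeven, eigEight, wkMatrix₁] <;> grind)
    (fun S hE hF => beta_mem_of_mem₁ h0 hμ (hE 0) (hE 1) (hE 2) (hF 0) (hF 1) (hF 2))
    (fun c d h => by
      have h1 := h 1
      have h2 := h 2
      simp [eigSeven, eigEight] at h1 h2
      simp_all)

/-- The realization of the second Cartan matrix in the Buttin algebra. -/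
def buttinRealization₂ (h0 : μ ≠ 0) (hμ : μ ≠ 1) :
    Realization (wkMatrix₂ μ) (betaPiece μ rootWt₂) :=
  -- The negative generators are the entries 1, 5, 9; the coroots are rows 1, 5, 6 of
  -- `lie_beta_rev`.
  buttinRealization h0 hμ isRootWeight₂ ![14, 10, 6]
    (by rw [betaWt_rootWt₂]; decide) (by rw [betaWt_rootWt₂]; decide) ![μ, 1, 0] ![1 + μ, 0, 1]
    (fun i => by
      fin_cases i
      · exact (lie_comm_of_charTwo (K := K) _ _).trans (lie_beta_rev 1)
      · exact (lie_comm_of_charTwo (K := K) _ _).trans (lie_beta_rev 5)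
      · exact lie_beta_rev 6)
    (fun i j => by
      have e2 : (2 : K) = 0 := CharTwo.two_eq_zero
      fin_cases i <;> fin_cases j <;> (simp [eigSeven, eigEight, wkMatrix₂]; try grind))
    (fun S hE hF => beta_mem_of_mem₂ h0 hμ (hE 0) (hE 1) (hE 2) (hF 0) (hF 1) (hF 2))
    (fun c d h => by
      have h1 := h 1
      have h2 := h 2
      simp [eigSeven, eigEight] at h1 h2
      simp_all)

end Realizations

end
end WeisfeilerKac

/-! ### Renumbering of simple roots and comparison of gradings -/

namespace WeisfeilerKac

noncomputable section

open DP

section Reindex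

variable {K G : Type*} [Field K] [LieRing G] [LieAlgebra K G] {n : ℕ}

theorem single_comp_symm (σ : Equiv.Perm (Fin n)) (i : Fin n) (c : ℤ) :
    (Pi.single i c : Fin n → ℤ) ∘ σ.symm = Pi.single (σ i) c := by
  funext j
  simp only [Function.comp_apply, Pi.single_apply, Equiv.symm_apply_eq]

/-- A permutation of the indices and a rescaling of the elements of negative degree. -/
def Realization.reindex {A A' : Matrix (Fin n) (Fin n) K} {𝒢 : (Fin n → ℤ) → Submodule K G}
    (R : Realization A 𝒢) (σ : Equiv.Perm (Fin n)) {s : K} (hs : s ≠ 0)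
    (hA : ∀ i j, A' i j = s * A (σ i) (σ j)) : Realization A' fun α => 𝒢 (α ∘ σ.symm) where
  E i := R.E (σ i)
  F i := s • R.F (σ i)
  H i := s • R.H (σ i)
  indep := R.indep.comp fun _ _ h => σ.symm.surjective.injective_comp_right h
  iSup_eq_top := by
    rw [← R.iSup_eq_top]
    exact (σ.arrowCongr (Equiv.refl ℤ)).iSup_congr fun _ => rfl
  lie_mem := R.lie_mem
  E_mem i := by
    rw [single_comp_symm]
    exact R.E_mem _
  F_mem i := by
    have h := Submodule.smul_mem _ s (R.F_mem (σ i))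
    rwa [← single_comp_symm] at h
  H_mem i := Submodule.smul_mem _ s (R.H_mem (σ i))
  lie_E_F i j := by
    rw [lie_smul, R.lie_E_F]
    simp only [σ.injective.eq_iff, smul_ite, smul_zero]
  lie_H_E i j := by rw [smul_lie, R.lie_H_E, hA, mul_smul]
  lie_H_F i j := by rw [smul_lie, lie_smul, R.lie_H_F, hA, mul_smul, smul_neg, smul_neg, smul_comm s (A _ _)]
  lie_H_H i j := by rw [smul_lie, lie_smul, R.lie_H_H, smul_zero, smul_zero]
  lieSpan_eq_top := by
    rw [eq_top_iff, ← R.lieSpan_eq_top, LieSubalgebra.lieSpan_le]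
    rintro _ (⟨i, rfl⟩ | ⟨i, rfl⟩)
    · exact LieSubalgebra.subset_lieSpan (Or.inl ⟨σ.symm i, by simp⟩)
    · have h : s • R.F i ∈ LieSubalgebra.lieSpan K G
          ((Set.range fun i => R.E (σ i)) ∪ Set.range fun i => s • R.F (σ i)) :=
        LieSubalgebra.subset_lieSpan (Or.inr ⟨σ.symm i, by simp⟩)
      have h' := LieSubalgebra.smul_mem _ s⁻¹ h
      rwa [smul_smul, inv_mul_cancel₀ hs, one_smul] at h'
  E_ne_zero i := R.E_ne_zero _
  F_ne_zero i := smul_ne_zero hs (R.F_ne_zero _)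
  eq_zero α hα x hx h := R.eq_zero _ (fun h0 => hα (by
    funext i
    simpa using congrFun h0 (σ i))) x hx h
  eq_zero_of_zero x hx h := R.eq_zero_of_zero x hx fun i => by simpa using h (σ.symm i)

end Reindex

section Model

variable {K : Type*} [Field K] [CharP K 2] {μ : K} {A : Matrix (Fin 3) (Fin 3) K} {l : ℕ}
  {B : Matrix (Fin l) (Fin 3) K} {r : Fin 3 → ℤ} {W : BVar → Fin 3 → ℤ} {σ : Equiv.Perm (Fin 3)}

/-- An isomorphism with the Buttin algebra that relates the gradings. -/
structure IsButtinModel (r : Fin 3 → ℤ) (W : BVar → Fin 3 → ℤ) (σ : Equiv.Perm (Fin 3))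
    (Θ : DerivedModCenter A B ≃ₗ⁅K⁆ buttinAlgebra μ fun _ => 1) : Prop where
  mem_piece : ∀ k x, x ∈ piece A B r k ↔
    Θ x ∈ buttinWeight μ (fun _ => 1) (fun i => (bDeg i : ℤ)) (k + 1)
  mem_rootPiece : ∀ α x, x ∈ rootPiece A B α ↔ Θ x ∈ betaPiece μ W (α ∘ σ.symm)

theorem wt_apply (W : BVar → Fin 3 → ℤ) (i : Fin 3) (e : BVar → ℕ) :
    wt W e i = wt (fun v => W v i) e := by
  simp [wt]

/-- The coordinate 0 of the weights is the degree of the indeterminates, and `r` singles out the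
simple root that `σ` sends to 0. So the ℤ-grading by `r` is a coarsening of the root grading that
agrees with the degree of generating functions. -/
theorem Realization.exists_isButtinModel (R : Realization A fun α => betaPiece μ W (α ∘ σ.symm))
    (hA : ∀ j, ∃ i, A i j ≠ 0) (hW : ∀ v, W v 0 = bDeg v)
    (hr : r ∘ σ.symm = Pi.single 0 1) (B : Matrix (Fin l) (Fin 3) K) :
    ∃ Θ : DerivedModCenter A B ≃ₗ⁅K⁆ buttinAlgebra μ fun _ => 1, IsButtinModel r W σ Θ := by
  obtain ⟨Θ, hΘ⟩ := R.exists_equiv B hA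
  have hr' : ∀ α, latticeHom r α = α (σ.symm 0) := by
    intro α
    have h : ∀ i, r i = if i = σ.symm 0 then 1 else 0 := by
      intro i
      have := congrFun hr (σ i)
      rw [Function.comp_apply, Equiv.symm_apply_apply, Pi.single_apply] at this
      rw [this]
      simp only [Equiv.eq_symm_apply]
    simp [latticeHom_apply, h]
  refine ⟨Θ, fun k x => ?_, fun α x => ?_⟩
  -- The shift by 1 accounts for the degree of an element being that of its generating function
  -- minus 1.
  · rw [hΘ, eq_iSup_of_le (ℬ := fun k : ℤ => buttinWeight μ (fun _ => 1) (fun i => (bDeg i : ℤ)) (k + 1))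
      ((iSupIndep_buttinWeight μ (fun _ => 1) _).comp (add_left_injective 1)) R.iSup_eq_top]
    intro α x hx
    refine mem_weightPiece.2 fun e he => ?_
    have h := congrFun (mem_weightPiece.1 hx e he) 0
    rw [wt_apply, show (fun v => W v 0) = fun i => (bDeg i : ℤ) from funext hW] at h
    rw [h, hr', Pi.add_apply, hW]
    rfl
  · have h : ∀ β : Fin 3 → ℤ, latticeHom (fun i => (Pi.single i 1 : Fin 3 → ℤ)) β = β := by
      intro β
      rw [latticeHom_apply]
      funext j
      simp [Finset.sum_apply, Pi.single_apply]
    rw [hΘ]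
    simp only [h, iSup_iSup_eq_left]

end Model

end
end WeisfeilerKac

/-! ### Transfer of the prolong from the Buttin algebra -/

namespace WeisfeilerKac

noncomputable section

open DP

section Degrees

variable {K : Type*} [Field K] [CharP K 2] {μ : K}

/-- The basis of the component of degree `-1` of the Buttin algebra. -/
def xiBasis (μ : K) (N : Fin 2 → ℕ∞) : Module.Basis (Fin 4) K (buttinDeg μ N 0) :=
  Module.Basis.mk (v := fun k => ⟨xiEl μ N k, xiEl_mem_buttinDeg k⟩)
    (Fintype.linearIndependent_iff.2 fun g hg k => by
      have h := congrArg (xiCoeff μ N k ∘ₗ (buttinDeg μ N 0).subtype) hg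
      simp only [map_sum, map_smul, map_zero, LinearMap.comp_apply, Submodule.subtype_apply,
        xiCoeff_apply] at h
      have h' : ∑ i, g i • (if i = k then (1 : K) else 0) = 0 :=
        (Finset.sum_congr rfl fun i _ => congrArg (g i • ·) (coeff_xiMono k i).symm).trans h
      simpa using h')
    (fun x _ => by
      have h : x = ∑ k, coeff (xiExp k) (x.1.1 : DP BVar K) •
          (⟨xiEl μ N k, xiEl_mem_buttinDeg k⟩ : buttinDeg μ N 0) := by
        refine Subtype.ext ((eq_sum_xiEl x.2).trans ?_)
        rw [AddSubmonoidClass.coe_finsetSum]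
        rfl
      rw [h]
      exact sum_mem fun k _ => Submodule.smul_mem _ _ (Submodule.subset_span ⟨k, rfl⟩))

theorem coe_xiBasis (N : Fin 2 → ℕ∞) (k : Fin 4) : (xiBasis μ N k : buttinAlgebra μ N) = xiEl μ N k := by
  rw [xiBasis, Module.Basis.mk_apply]

theorem beta_castLE (k : Fin 4) : beta μ (Fin.castLE (by norm_num) k) = xiEl μ (fun _ => 1) k := by
  refine Subtype.ext ?_
  fin_cases k
  · exact xiMono_zero.symm
  · exact xiMono_one.symm
  · exact xiMono_two.symm
  · exact xiMono_three.symm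

theorem buttinAlgebra_one_le : buttinAlgebra μ (fun _ => 1) ≤ buttinAlgebra μ fun _ => ⊤ := fun _ hf =>
  ⟨mem_trunc_bShear.2 ⟨(mem_trunc_bShear.1 hf.1).1, fun _ n hn => absurd hn (ENat.top_ne_natCast n)⟩,
    hf.2⟩

/-- A function of degree 1 is at most linear in each qᵢ, so the component of degree 0 does not
depend on the heights. This links the 16-dimensional algebra to the one of infinite heights. -/
theorem exists_eq_inclusion {x : buttinAlgebra μ fun _ => ⊤} (hx : x ∈ buttinDeg μ (fun _ => ⊤) 1) :
    ∃ y ∈ buttinDeg μ (fun _ => 1) 1, LieSubalgebra.inclusion buttinAlgebra_one_le y = x := by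
  have hx' := mem_buttinDeg.1 hx
  have hm : x.1 ∈ buttinAlgebra μ fun _ => 1 := by
    refine ⟨mem_trunc_bShear.2 ⟨(mem_trunc_bShear.1 x.2.1).1, fun i n hn r hr => ?_⟩, x.2.2⟩
    obtain rfl : n = 1 := by exact_mod_cast hn.symm
    by_contra hne
    have h1 : ∑ j, bDeg j * r j = 1 := mem_monoSpan.1 hx' r hne
    have h2 := Finset.single_le_sum (f := fun j => bDeg j * r j) (fun _ _ => Nat.zero_le _)
      (Finset.mem_univ (qv i))
    have h3 : bDeg (qv i) = 1 := rfl
    simp only [h1, h3] at h2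
    omega
  exact ⟨⟨x.1, hm⟩, mem_buttinDeg.2 hx', LieSubalgebra.inclusion_apply buttinAlgebra_one_le ⟨x.1, hm⟩⟩

end Degrees

section Model

variable {K : Type*} [Field K] [CharP K 2] {μ : K} {A : Matrix (Fin 3) (Fin 3) K} {l : ℕ}
  {B : Matrix (Fin l) (Fin 3) K} {r : Fin 3 → ℤ} {W : BVar → Fin 3 → ℤ} {σ : Equiv.Perm (Fin 3)}
  {ρ : Fin 4 → Fin 3 → ℤ} {π : Equiv.Perm (Fin 4)}

namespace IsButtinModel

variable {Θ : DerivedModCenter A B ≃ₗ⁅K⁆ buttinAlgebra μ fun _ => 1} (h : IsButtinModel r W σ Θ)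

include h

theorem piece_eq_bot {k : ℤ} (hk : k < -1) : piece A B r k = ⊥ := by
  refine (Submodule.eq_bot_iff _).2 fun x hx => ?_
  have hx' : Θ x = 0 := Subtype.ext (eq_zero_of_neg (by omega) ((h.mem_piece k x).1 hx))
  simpa using hx'

theorem mem_piece_neg_one (x : DerivedModCenter A B) :
    x ∈ piece A B r (-1) ↔ Θ x ∈ buttinDeg μ (fun _ => 1) 0 := by
  rw [h.mem_piece, buttinDeg_eq]
  rfl

theorem mem_piece_zero (x : DerivedModCenter A B) :
    x ∈ piece A B r 0 ↔ Θ x ∈ buttinDeg μ (fun _ => 1) 1 := by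
  rw [h.mem_piece, buttinDeg_eq]
  rfl

theorem symm_xiEl_mem (k : Fin 4) : Θ.symm (xiEl μ _ k) ∈ piece A B r (-1) := by
  rw [h.mem_piece_neg_one, LieEquiv.apply_symm_apply]
  exact xiEl_mem_buttinDeg k

theorem eq_zero_of_lie (x : DerivedModCenter A B) (hx : x ∈ zeroPart A B r)
    (h0 : ∀ v ∈ piece A B r (-1), ⁅x, v⁆ = 0) : x = 0 := by
  have hx' : Θ x = 0 := eq_zero_of_lie_xiEl
    (coeff_xiExp_of_mem_buttinDeg ((h.mem_piece_zero x).1 hx)) fun k => by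
      have h' := h0 _ (h.symm_xiEl_mem k)
      rw [lie_comm_of_charTwo (K := K), ← Θ.apply_symm_apply (xiEl μ _ k), ← LieEquiv.map_lie, h',
        map_zero]
  simpa using hx'

/-- The isomorphism of the components of degree `-1`. -/
def equivNegOne : piece A B r (-1) ≃ₗ[K] buttinDeg μ (fun _ => 1) 0 :=
  Θ.toLinearEquiv.ofSubmodules _ _ (by
    ext y
    rw [Submodule.mem_map]
    constructor
    · rintro ⟨x, hx, rfl⟩
      exact (h.mem_piece_neg_one x).1 hx
    · exact fun hy => ⟨Θ.symm y, (h.mem_piece_neg_one _).2 (by rwa [LieEquiv.apply_symm_apply]),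
        Θ.apply_symm_apply y⟩)

theorem coe_equivNegOne (x : piece A B r (-1)) : (h.equivNegOne x : buttinAlgebra μ fun _ => 1) = Θ x :=
  rfl

/-- The basis of `g₋₁` that corresponds to multiples of `1`, `ξ₁`, `ξ₂`, `ξ₁ξ₂`. -/
def negBasis (π : Equiv.Perm (Fin 4)) (c : Fin 4 → Kˣ) : Module.Basis (Fin 4) K (piece A B r (-1)) :=
  (((xiBasis μ _).map h.equivNegOne.symm).reindex π.symm).unitsSMul c

theorem map_negBasis (c : Fin 4 → Kˣ) (i : Fin 4) :
    Θ (h.negBasis π c i) = (c i : K) • xiEl μ _ (π i) := by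
  rw [← h.coe_equivNegOne, negBasis, Module.Basis.unitsSMul_apply, Module.Basis.reindex_apply,
    Module.Basis.map_apply, Units.smul_def, map_smul, LinearEquiv.apply_symm_apply,
    Submodule.coe_smul, coe_xiBasis, Equiv.symm_symm]

/-- Roots of degree -1 have multiplicity one; hence every weight basis corresponds to nonzero
multiples of the ξ-monomials in the order `π`. -/
theorem mem_rootPiece_iff (hμ : μ ≠ 1) (hW : IsRootWeight W)
    (hρ : ∀ i, betaWt W (Fin.castLE (by norm_num) (π i)) = (-ρ i) ∘ σ.symm)
    (hρ0 : ∀ i, ρ i ≠ 0) (i : Fin 4) (x : DerivedModCenter A B) :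
    x ∈ rootPiece A B (-ρ i) ↔ ∃ c : K, Θ x = c • xiEl μ _ (π i) := by
  rw [h.mem_rootPiece, ← hρ, ← beta_castLE]
  refine ⟨exists_eq_smul_beta hμ fun j => hW.inj _ j ?_, ?_⟩
  · rw [hρ]
    intro h0
    refine hρ0 i (neg_eq_zero.1 (funext fun j => ?_))
    simpa using congrFun h0 (σ j)
  · rintro ⟨c, hc⟩
    rw [hc]
    exact Submodule.smul_mem _ _ (beta_mem_betaPiece hμ hW.contact _)

theorem isWeightBasis_negBasis (hμ : μ ≠ 1) (hW : IsRootWeight W)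
    (hρ : ∀ i, betaWt W (Fin.castLE (by norm_num) (π i)) = (-ρ i) ∘ σ.symm)
    (hρ0 : ∀ i, ρ i ≠ 0) (c : Fin 4 → Kˣ) : IsWeightBasis A B r ρ (h.negBasis π c) := fun i =>
  (h.mem_rootPiece_iff hμ hW hρ hρ0 i _).2 ⟨_, h.map_negBasis c i⟩

theorem mem_zeroAction_iff (s : Module.End K (piece A B r (-1))) :
    s ∈ zeroAction A B r ↔
      ∃ x ∈ buttinDeg μ (fun _ => 1) 1, ∀ v : piece A B r (-1), Θ (s v) = ⁅x, Θ v⁆ := by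
  constructor
  · rintro ⟨x, hx, hs⟩
    exact ⟨Θ x, (h.mem_piece_zero x).1 hx, fun v => by rw [hs, LieEquiv.map_lie]⟩
  · rintro ⟨x, hx, hs⟩
    refine ⟨Θ.symm x, (h.mem_piece_zero _).2 (by rwa [LieEquiv.apply_symm_apply]), fun v => ?_⟩
    refine Θ.injective ((hs v).trans ?_)
    change _ = Θ _
    rw [LieEquiv.map_lie, LieEquiv.apply_symm_apply]

/-- The heights that survive are those at the positions of ξ₀ and ξ₁ in the basis, `π.symm 1` and
`π.symm 2`. -/
theorem exists_prolong_equiv (hμ : μ ≠ 1) (hW : IsRootWeight W)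
    (hρ : ∀ i, betaWt W (Fin.castLE (by norm_num) (π i)) = (-ρ i) ∘ σ.symm)
    (hρ0 : ∀ i, ρ i ≠ 0) {b : Module.Basis (Fin 4) K (piece A B r (-1))}
    (hb : IsWeightBasis A B r ρ b) {M : Fin 4 → ℕ∞} (hM : ∀ i, 1 ≤ M i) :
    ∃ e : prolong b (zeroAction A B r) M ≃ₗ⁅K⁆ (buttin μ ![M (π.symm 1), M (π.symm 2)]).desuper,
      ∀ (d : ℕ) (x : prolong b (zeroAction A B r) M),
        (x : Derivation K (DP (Fin 4) K) (DP (Fin 4) K)) ∈ prolongPiece b (zeroAction A B r) M d ↔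
          e x ∈ buttinPiece μ ![M (π.symm 1), M (π.symm 2)] d := by
  choose c hc using fun i => (h.mem_rootPiece_iff hμ hW hρ hρ0 i _).1 (hb i)
  have hc0 : ∀ i, c i ≠ 0 := by
    intro i h0
    have h' := hc i
    rw [h0, zero_smul] at h'
    exact b.ne_zero i (Subtype.ext (Θ.injective (h'.trans (map_zero Θ).symm)))
  set J := LieSubalgebra.inclusion (buttinAlgebra_one_le (μ := μ)) with hJ
  have hJi : Function.Injective J := LieSubalgebra.inclusion_injective _
  refine exists_prolong_equiv_buttin hμ π c hc0 M hM
    (T := (J : _ →ₗ[K] _) ∘ₗ Θ.toLinearEquiv.toLinearMap ∘ₗ (piece A B r (-1)).subtype) (fun i => ?_)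
    fun s => (h.mem_zeroAction_iff s).trans ⟨?_, ?_⟩
  · change J (Θ (b i)) = _
    rw [hc, map_smul, hJ, inclusion_xiEl]
  · rintro ⟨x, hx, hs⟩
    refine ⟨J x, (inclusion_mem_buttinDeg _).2 hx, fun v => ?_⟩
    change J (Θ (s v)) = ⁅J x, J (Θ v)⁆
    rw [hs, LieHom.map_lie]
  · rintro ⟨x, hx, hs⟩
    obtain ⟨y, hy, rfl⟩ := exists_eq_inclusion hx
    refine ⟨y, hy, fun v => hJi ?_⟩
    have h' : J (Θ (s v)) = ⁅J y, J (Θ v)⁆ := hs v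
    rw [h', LieHom.map_lie]

end IsButtinModel

theorem Realization.prolongIsButtin (R : Realization A fun α => betaPiece μ W (α ∘ σ.symm))
    (hA : ∀ j, ∃ i, A i j ≠ 0) (hμ : μ ≠ 1) (hW : IsRootWeight W) (hdeg : ∀ v, W v 0 = bDeg v)
    (hr : r ∘ σ.symm = Pi.single 0 1) (π : Equiv.Perm (Fin 4))
    (hρ : ∀ i, betaWt W (Fin.castLE (by norm_num) (π i)) = (-ρ i) ∘ σ.symm) (hρ0 : ∀ i, ρ i ≠ 0) :
    ProlongIsButtin A r ρ (π.symm 1) (π.symm 2) μ := by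
  intro l B _
  obtain ⟨Θ, h⟩ := R.exists_isButtinModel hA hdeg hr B
  exact ⟨fun _ => h.piece_eq_bot, h.eq_zero_of_lie,
    ⟨_, h.isWeightBasis_negBasis hμ hW hρ hρ0 fun _ => 1⟩,
    fun b hb M hM => h.exists_prolong_equiv hμ hW hρ hρ0 hb hM⟩

end Model

end
end WeisfeilerKac

/-! ### The five gradings -/

namespace WeisfeilerKac

noncomputable section

open DP

section Cases

variable {K : Type*} [Field K] {a : K}

theorem exists_wkMatrix₁_ne_zero (h0 : a ≠ 0) (j : Fin 3) : ∃ i, wkMatrix₁ a i j ≠ 0 := by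
  fin_cases j
  · exact ⟨1, by simpa [wkMatrix₁] using h0⟩
  · exact ⟨0, by simpa [wkMatrix₁] using h0⟩
  · exact ⟨1, by simp [wkMatrix₁]⟩

theorem exists_wkMatrix₂_ne_zero (h0 : a ≠ 0) (j : Fin 3) : ∃ i, wkMatrix₂ a i j ≠ 0 := by
  fin_cases j
  · exact ⟨2, by simpa [wkMatrix₂] using h0⟩
  · exact ⟨2, by simp [wkMatrix₂]⟩
  · exact ⟨1, by simp [wkMatrix₂]⟩

variable [CharP K 2]

/-- Exchanging the end nodes scales the matrix and inverts the parameter. The overall factor is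
harmless, being absorbed by rescaling the `f i` in `Realization.reindex`. -/
theorem wkMatrix₁_swap (h0 : a ≠ 0) (i j : Fin 3) :
    wkMatrix₁ a i j = a * wkMatrix₁ a⁻¹ (Equiv.swap 0 2 i) (Equiv.swap 0 2 j) := by
  fin_cases i <;> fin_cases j <;> simp [wkMatrix₁, Equiv.swap_apply_def, h0]

theorem wkMatrix₂_swap_zero_one (h0 : a ≠ 0) (i j : Fin 3) :
    wkMatrix₂ a i j = a * wkMatrix₂ a⁻¹ (Equiv.swap 0 1 i) (Equiv.swap 0 1 j) := by
  fin_cases i <;> fin_cases j <;> simp [wkMatrix₂, Equiv.swap_apply_def, h0, mul_add, add_comm]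

/-- In characteristic 2, `1 + a / (1 + a)` equals `1 / (1 + a)`. -/
theorem wkMatrix₂_swap_zero_two (h1 : a ≠ 1) (i j : Fin 3) : wkMatrix₂ a i j =
    (1 + a) * wkMatrix₂ (a / (1 + a)) (Equiv.swap 0 2 i) (Equiv.swap 0 2 j) := by
  have h : 1 + a ≠ 0 := one_add_ne_zero_of_ne_one h1
  have h2 : (1 + a) * (1 + a / (1 + a)) = 1 := by
    have e2 : (2 : K) = 0 := CharTwo.two_eq_zero
    field_simp
    linear_combination a * e2
  have h3 : (1 + a) * (a / (1 + a)) = a := by field_simp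
  fin_cases i <;> fin_cases j <;> simp [wkMatrix₂, Equiv.swap_apply_def, h2, h3]

theorem rootWt₁_zero (v : BVar) : rootWt₁ v 0 = bDeg v := by
  revert v
  decide

theorem rootWt₂_zero (v : BVar) : rootWt₂ v 0 = bDeg v := by
  revert v
  decide

/-- The listed roots occur in the order 1, ξ₀, ξ₁, ξ₀ξ₁, so no permutation is needed and the heights
are those of the two middle coordinates. -/
theorem prolongIsButtin_wkMatrix₁_first (h0 : a ≠ 0) (h1 : a ≠ 1) :
    ProlongIsButtin (wkMatrix₁ a) ![1, 0, 0]
      ![![1, 0, 0], ![1, 1, 0], ![1, 1, 1], ![1, 2, 1]] 1 2 a :=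
  (buttinRealization₁ h0 h1).prolongIsButtin (σ := Equiv.refl _) (exists_wkMatrix₁_ne_zero h0) h1
    isRootWeight₁ rootWt₁_zero (by decide) (Equiv.refl _) (by rw [betaWt_rootWt₁]; decide) (by decide)

theorem prolongIsButtin_wkMatrix₁_third (h0 : a ≠ 0) (h1 : a ≠ 1) :
    ProlongIsButtin (wkMatrix₁ a) ![0, 0, 1]
      ![![0, 0, 1], ![0, 1, 1], ![1, 1, 1], ![1, 2, 1]] 1 2 a⁻¹ :=
  have h : a⁻¹ ≠ 1 := fun h => h1 (inv_eq_one.1 h)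
  ((buttinRealization₁ (inv_ne_zero h0) h).reindex (Equiv.swap 0 2) h0
    (wkMatrix₁_swap h0)).prolongIsButtin (exists_wkMatrix₁_ne_zero h0) h isRootWeight₁ rootWt₁_zero
    (by decide) (Equiv.refl _) (by rw [betaWt_rootWt₁]; decide) (by decide)

/-- The order of the elements `1`, `ξ₁`, `ξ₂`, `ξ₁ξ₂` that corresponds to the order of the roots for the
second Cartan matrix. -/
def xiPerm : Equiv.Perm (Fin 4) := ⟨![1, 3, 0, 2], ![2, 0, 3, 1], by decide, by decide⟩

/-- The order of the elements `1`, `ξ₁`, `ξ₂`, `ξ₁ξ₂` that corresponds to the order of the roots for the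
second Cartan matrix and the grading by the third root. -/
def xiPerm' : Equiv.Perm (Fin 4) := ⟨![1, 0, 3, 2], ![1, 0, 3, 2], by decide, by decide⟩

/-- Here the listed roots occur in the order ξ₀, ξ₀ξ₁, 1, ξ₁, so the heights come from the outer
coordinates. -/
theorem prolongIsButtin_wkMatrix₂_first (h0 : a ≠ 0) (h1 : a ≠ 1) :
    ProlongIsButtin (wkMatrix₂ a) ![1, 0, 0]
      ![![1, 0, 0], ![1, 1, 0], ![1, 0, 1], ![1, 1, 1]] 0 3 a :=
  (buttinRealization₂ h0 h1).prolongIsButtin (σ := Equiv.refl _) (exists_wkMatrix₂_ne_zero h0) h1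
    isRootWeight₂ rootWt₂_zero (by decide) xiPerm (by rw [betaWt_rootWt₂]; decide) (by decide)

theorem prolongIsButtin_wkMatrix₂_second (h0 : a ≠ 0) (h1 : a ≠ 1) :
    ProlongIsButtin (wkMatrix₂ a) ![0, 1, 0]
      ![![0, 1, 0], ![1, 1, 0], ![0, 1, 1], ![1, 1, 1]] 0 3 a⁻¹ :=
  have h : a⁻¹ ≠ 1 := fun h => h1 (inv_eq_one.1 h)
  ((buttinRealization₂ (inv_ne_zero h0) h).reindex (Equiv.swap 0 1) h0
    (wkMatrix₂_swap_zero_one h0)).prolongIsButtin (exists_wkMatrix₂_ne_zero h0) h isRootWeight₂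
    rootWt₂_zero (by decide) xiPerm (by rw [betaWt_rootWt₂]; decide) (by decide)

theorem prolongIsButtin_wkMatrix₂_third (h0 : a ≠ 0) (h1 : a ≠ 1) :
    ProlongIsButtin (wkMatrix₂ a) ![0, 0, 1]
      ![![0, 0, 1], ![1, 0, 1], ![0, 1, 1], ![1, 1, 1]] 0 3 (a / (1 + a)) :=
  have h1' : 1 + a ≠ 0 := one_add_ne_zero_of_ne_one h1
  have h : a / (1 + a) ≠ 1 := fun h => one_ne_zero (by
    rw [div_eq_one_iff_eq h1'] at h
    linear_combination -h : (1 : K) = 0)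
  ((buttinRealization₂ (div_ne_zero h0 h1') h).reindex (Equiv.swap 0 2) h1'
    (wkMatrix₂_swap_zero_two h1)).prolongIsButtin (exists_wkMatrix₂_ne_zero h0) h isRootWeight₂
    rootWt₂_zero (by decide) xiPerm' (by rw [betaWt_rootWt₂]; decide) (by decide)

end Cases

end
end WeisfeilerKac

/-! ### Matrices of the degree 0 action -/

namespace WeisfeilerKac

noncomputable section

open DP

section Matrices

open Matrix

variable {K : Type*} [Field K] [CharP K 2] {μ : K}

/-- The elements of the basis of the Buttin algebra that are of degree 0 and not in the torus. -/
def zeroIndex : Fin 6 → Fin 16 := ![4, 5, 6, 9, 10, 11]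

/-- The matrices of the operators on the span of `1`, `ξ₁`, `ξ₂`, `ξ₁ξ₂` given by elements of degree 0
of the Buttin algebra. -/
def zeroMatrix (μ : K) : Fin 6 → Matrix (Fin 4) (Fin 4) K :=
  ![single 2 1 1, single 2 0 μ + single 3 1 (1 + μ), single 1 0 μ + single 3 2 (1 + μ),
    single 0 1 1 + single 2 3 1, single 0 2 1 + single 1 3 1, single 1 2 1]

theorem lie_beta_xiEl (t : Fin 6) (i : Fin 4) : ⁅beta μ (zeroIndex t), xiEl μ (fun _ => 1) i⁆ =
    ∑ j, zeroMatrix μ t j i • xiEl μ (fun _ => 1) j := by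
  have e2 : (2 : DP BVar K) = 0 := CharTwo.two_eq_zero
  have x1 := X_mul_self (K := K) (qv 0)
  have x2 := X_mul_self (K := K) (qv 1)
  have x3 := X_mul_self (K := K) (xiv 0)
  have x4 := X_mul_self (K := K) (xiv 1)
  refine Subtype.ext ?_
  have h : contactBracket (betaFun μ (zeroIndex t)) (xiMono i) =
      ∑ j, algebraMap K _ (zeroMatrix μ t j i) * xiMono j := by
    simp only [Fin.sum_univ_four, xiMono_zero, xiMono_one, xiMono_two, xiMono_three]
    fin_cases t <;> fin_cases i <;>
    simp [betaFun, zeroIndex, zeroMatrix, xiMono_zero, xiMono_one, xiMono_two,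
      xiMono_three, contactBracket, eulerQ_apply, Derivation.leibniz, pd_X] <;> grind
  refine Eq.trans h (Eq.trans ?_ (map_sum (buttinAlgebra μ fun _ => 1).toSubmodule.subtype
    (fun j => zeroMatrix μ t j i • xiEl μ (fun _ => 1) j) Finset.univ).symm)
  exact Finset.sum_congr rfl fun j _ =>
    (Algebra.smul_def (zeroMatrix μ t j i) (xiMono j : DP BVar K)).symm

/-- The basis elements with indices from 4 to 11 are those of degree 0, so a subalgebra containing
them contains the whole component. -/
theorem exists_eq_sum_beta_of_mem (hμ : μ ≠ 1) {x : buttinAlgebra μ fun _ => 1}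
    (hx : x ∈ buttinDeg μ (fun _ => 1) 1) {S : LieSubalgebra K (buttinAlgebra μ fun _ => 1)}
    (hS : ∀ i, 4 ≤ i → i ≤ 11 → beta μ i ∈ S) : x ∈ S := by
  -- Rewrites degree 1 of functions as weight 0 shifted by the degree of τ, the form of `betaPiece`.
  rw [buttinDeg_eq, ← sub_add_cancel ((1 : ℕ) : ℤ) ((bDeg tauv : ℕ) : ℤ)] at hx
  obtain ⟨c, hc, rfl⟩ := exists_eq_sum_beta (W := fun i => (bDeg i : ℤ)) hμ hx
  refine sum_mem fun i _ => ?_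
  by_cases h : c i = 0
  · rw [h, zero_smul]
    exact zero_mem _
  · have key : ∀ i, betaWt (fun i => (bDeg i : ℤ)) i = ((1 : ℕ) : ℤ) - ((bDeg tauv : ℕ) : ℤ) →
        4 ≤ i ∧ i ≤ 11 := by decide
    exact S.smul_mem _ (hS i (key i (hc i h)).1 (key i (hc i h)).2)

theorem beta_mem_buttinDeg (hμ : μ ≠ 1) (t : Fin 6) :
    beta μ (zeroIndex t) ∈ buttinDeg μ (fun _ => 1) 1 := by
  have h : wt (fun i => (bDeg i : ℤ)) (sqExp (zeroIndex t)) = ((1 : ℕ) : ℤ) := by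
    revert t
    decide
  rw [buttinDeg_eq, ← h]
  exact beta_mem hμ isContactWeight_bDeg _

end Matrices

section Model

attribute [local instance 100] LieRing.ofAssociativeRing

variable {K : Type*} [Field K] [CharP K 2] {μ : K} {A : Matrix (Fin 3) (Fin 3) K} {l : ℕ}
  {B : Matrix (Fin l) (Fin 3) K} {r : Fin 3 → ℤ} {W : BVar → Fin 3 → ℤ} {σ : Equiv.Perm (Fin 3)}
  {π : Equiv.Perm (Fin 4)} {Θ : DerivedModCenter A B ≃ₗ⁅K⁆ buttinAlgebra μ fun _ => 1}

/-- The elements whose action on `g₋₁` has a matrix that belongs to `R`. -/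
def matrixAction (Θ : DerivedModCenter A B ≃ₗ⁅K⁆ buttinAlgebra μ fun _ => 1)
    (b : Module.Basis (Fin 4) K (piece A B r (-1))) (R : LieSubalgebra K (Matrix (Fin 4) (Fin 4) K)) :
    LieSubalgebra K (buttinAlgebra μ fun _ => 1) where
  carrier := {x | ∃ M ∈ R, ∀ v : piece A B r (-1), Θ (Matrix.toLinAlgEquiv b M v) = ⁅x, Θ v⁆}
  zero_mem' := ⟨0, zero_mem _, fun v => by simp⟩
  add_mem' := by
    rintro x y ⟨M, hM, hx⟩ ⟨N, hN, hy⟩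
    refine ⟨M + N, add_mem hM hN, fun v => ?_⟩
    rw [map_add, LinearMap.add_apply, Submodule.coe_add, map_add, hx, hy, add_lie]
  smul_mem' := by
    rintro c x ⟨M, hM, hx⟩
    refine ⟨c • M, R.smul_mem c hM, fun v => ?_⟩
    rw [map_smul, LinearMap.smul_apply, Submodule.coe_smul, map_smul, hx, smul_lie]
  lie_mem' := by
    rintro x y ⟨M, hM, hx⟩ ⟨N, hN, hy⟩
    refine ⟨⁅M, N⁆, R.lie_mem hM hN, fun v => ?_⟩
    rw [Ring.lie_def, map_sub, map_mul, map_mul, LinearMap.sub_apply, Submodule.coe_sub, map_sub,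
      Module.End.mul_apply, Module.End.mul_apply, hx, hy, hy, hx, lie_lie]

namespace IsButtinModel

variable (h : IsButtinModel r W σ Θ)

include h

/-- `N t` is the matrix of `x t` in the ξ-monomials, and `hM` is the change to the permuted and
rescaled basis. One inclusion holds because the `x t` generate the degree 0 component, the other
because the matrices `M t` come from elements of degree 0. -/
theorem hasMatrices_lieSpan (hμ : μ ≠ 1) (c : Fin 4 → Kˣ) {x : Fin 4 → buttinAlgebra μ fun _ => 1}
    {M N : Fin 4 → Matrix (Fin 4) (Fin 4) K} (hx : ∀ t, x t ∈ buttinDeg μ (fun _ => 1) 1)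
    (hN : ∀ t i, ⁅x t, xiEl μ (fun _ => 1) i⁆ = ∑ j, N t j i • xiEl μ (fun _ => 1) j)
    (hM : ∀ t i j, (c i : K) * N t (π j) (π i) = M t j i * c j)
    (hS : ∀ S : LieSubalgebra K (buttinAlgebra μ fun _ => 1), (∀ t, x t ∈ S) →
      ∀ i, 4 ≤ i → i ≤ 11 → beta μ i ∈ S) :
    HasMatrices (h.negBasis π c) (zeroAction A B r) (LieSubalgebra.lieSpan K _ (Set.range M)) := by
  set b := h.negBasis π c with hb
  have hΘb : ∀ i, Θ (b i) = (c i : K) • xiEl μ _ (π i) := h.map_negBasis c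
  have key : ∀ t (v : piece A B r (-1)), Θ (Matrix.toLinAlgEquiv b (M t) v) = ⁅x t, Θ v⁆ := by
    intro t v
    have h' : Θ.toLinearEquiv.toLinearMap ∘ₗ (piece A B r (-1)).subtype ∘ₗ
        Matrix.toLinAlgEquiv b (M t) = LieAlgebra.ad K _ (x t) ∘ₗ
        Θ.toLinearEquiv.toLinearMap ∘ₗ (piece A B r (-1)).subtype := by
      refine b.ext fun i => ?_
      change Θ (Matrix.toLinAlgEquiv b (M t) (b i)) = ⁅x t, Θ (b i)⁆
      rw [Matrix.toLinAlgEquiv_self, AddSubmonoidClass.coe_finsetSum, map_sum, hΘb, lie_smul, hN,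
        Finset.smul_sum, 
        ← Equiv.sum_comp π fun j => (c i : K) • N t j (π i) • xiEl μ (fun _ => 1) j]
      refine Finset.sum_congr rfl fun j _ => ?_
      rw [Submodule.coe_smul, map_smul, hΘb, smul_smul, smul_smul, hM]
    exact LinearMap.congr_fun h' v
  intro s
  constructor
  · intro hs
    obtain ⟨y, hy, hs⟩ := (h.mem_zeroAction_iff s).1 hs
    obtain ⟨m, hm, hmy⟩ : y ∈ matrixAction Θ b (LieSubalgebra.lieSpan K _ (Set.range M)) :=
      exists_eq_sum_beta_of_mem hμ hy (hS _ fun t =>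
        ⟨M t, LieSubalgebra.subset_lieSpan ⟨t, rfl⟩, key t⟩)
    have hsm : s = Matrix.toLin b b m := LinearMap.ext fun v =>
      Subtype.ext (Θ.injective ((hs v).trans (hmy v).symm))
    rwa [hsm, LinearMap.toMatrix_toLin]
  · intro hs
    have hle : LieSubalgebra.lieSpan K _ (Set.range M) ≤
        (zeroAction A B r).comap (Matrix.toLinAlgEquiv b).toAlgHom.toLieHom := by
      rw [LieSubalgebra.lieSpan_le]
      rintro _ ⟨t, rfl⟩
      exact (h.mem_zeroAction_iff _).2 ⟨x t, hx t, key t⟩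
    have h' : Matrix.toLin b b (LinearMap.toMatrix b b s) ∈ zeroAction A B r := hle hs
    rwa [Matrix.toLin_toMatrix] at h'

end IsButtinModel

end Model

end
end WeisfeilerKac

/-! ### Claim (b): the two pairs inside one Buttin algebra -/

namespace WeisfeilerKac

noncomputable section

open DP

section Pairs

attribute [local instance 100] LieRing.ofAssociativeRing

open Matrix

variable {K : Type*} [Field K] [CharP K 2] {μ : K} {A A' : Matrix (Fin 3) (Fin 3) K} {l l' : ℕ}
  {B : Matrix (Fin l) (Fin 3) K} {B' : Matrix (Fin l') (Fin 3) K} {r r' : Fin 3 → ℤ}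
  {W W' : BVar → Fin 3 → ℤ} {σ σ' : Equiv.Perm (Fin 3)}
  {Θ : DerivedModCenter A B ≃ₗ⁅K⁆ buttinAlgebra μ fun _ => 1}
  {Θ' : DerivedModCenter A' B' ≃ₗ⁅K⁆ buttinAlgebra μ fun _ => 1}

/-- The coefficients of the basis of `g₋₁`. -/
def pairCoeff (h0 : μ ≠ 0) (h1 : μ ≠ 1) : Fin 4 → Kˣ :=
  ![1, Units.mk0 μ h0, Units.mk0 μ h0, Units.mk0 μ h0 * Units.mk0 (1 + μ) (one_add_ne_zero_of_ne_one h1)]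

theorem beta_mem_of_mem_zero {S : LieSubalgebra K (buttinAlgebra μ fun _ => 1)} (b4 : beta μ 4 ∈ S)
    (b5 : beta μ 5 ∈ S) (b6 : beta μ 6 ∈ S) (b9 : beta μ 9 ∈ S) (b10 : beta μ 10 ∈ S)
    (b11 : beta μ 11 ∈ S) (i : Fin 16) (hi : 4 ≤ i) (hi' : i ≤ 11) : beta μ i ∈ S := by
  have key : ∀ i : Fin 16, 4 ≤ i → i ≤ 11 →
      i = 4 ∨ i = 5 ∨ i = 6 ∨ i = 7 ∨ i = 8 ∨ i = 9 ∨ i = 10 ∨ i = 11 := by decide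
  rcases key i hi hi' with rfl | rfl | rfl | rfl | rfl | rfl | rfl | rfl
  exacts [b4, b5, b6, beta_seven_mem b5 b10, beta_eight_mem b6 b9, b9, b10, b11]

namespace IsButtinModel

theorem hasMatrices_realization₁ (h : IsButtinModel r W σ Θ) (h0 : μ ≠ 0) (h1 : μ ≠ 1) :
    HasMatrices (h.negBasis (Equiv.refl _) (pairCoeff h0 h1)) (zeroAction A B r)
      (realization₁ μ) := by
  have hs : realization₁ μ = LieSubalgebra.lieSpan K _ (Set.range
      (![single 1 0 1 + single 3 2 1, single 0 1 μ + single 2 3 (1 + μ), single 2 1 1, single 1 2 1] :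
        Fin 4 → Matrix (Fin 4) (Fin 4) K)) := by
    rw [realization₁]
    simp only [Matrix.range_cons, Matrix.range_empty, Set.union_empty, Set.singleton_union]
  rw [hs]
  -- The four generators are the actions of the basis elements 6, 9, 4, 11; the scalars in
  -- `pairCoeff` bring their matrices to exactly the stated form.
  set f : Fin 4 → Fin 6 := ![2, 3, 0, 5]
  refine h.hasMatrices_lieSpan h1 _ (x := fun t => beta μ (zeroIndex (f t)))
    (N := fun t => zeroMatrix μ (f t)) (fun t => beta_mem_buttinDeg h1 _)
    (fun t i => lie_beta_xiEl _ _) (fun t i j => ?_) fun S hx => ?_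
  · fin_cases t <;> fin_cases i <;> fin_cases j <;> (simp [f, zeroMatrix, pairCoeff]; try ring)
  · have b6 : beta μ 6 ∈ S := hx 0
    have b9 : beta μ 9 ∈ S := hx 1
    have b4 : beta μ 4 ∈ S := hx 2
    have b11 : beta μ 11 ∈ S := hx 3
    obtain ⟨-, -, r3, -, r5, -⟩ := lie_beta_rows (μ := μ)
    have b5 := beta_mem_of_lie_eq one_ne_zero r3 b4 b6
    have b10 := beta_mem_of_lie_eq one_ne_zero r5 b9 b11
    exact beta_mem_of_mem_zero b4 b5 b6 b9 b10 b11

theorem hasMatrices_realization₂ (h : IsButtinModel r W σ Θ) (h0 : μ ≠ 0) (h1 : μ ≠ 1) :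
    HasMatrices (h.negBasis xiPerm fun i => pairCoeff h0 h1 (xiPerm i)) (zeroAction A B r)
      (realization₂ μ) := by
  have hs : realization₂ μ = LieSubalgebra.lieSpan K _ (Set.range
      (![single 1 0 1 + single 3 2 1, single 0 1 (μ + 1) + single 2 3 μ,
        single 2 0 1 + single 3 1 ((μ + 1) / μ), single 0 2 μ + single 1 3 μ] :
        Fin 4 → Matrix (Fin 4) (Fin 4) K)) := by
    rw [realization₂]
    simp only [Matrix.range_cons, Matrix.range_empty, Set.union_empty, Set.singleton_union]
  rw [hs]
  -- The generators are the actions of the basis elements 5, 10, 9, 6. The basis of g₋₁ is the same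
  -- up to order, so the remaining scalars, `μ⁻¹` for 9 and `μ` for 6, must be put on the operators.
  set f : Fin 4 → Fin 6 := ![1, 4, 3, 2]
  set s : Fin 4 → K := ![1, 1, μ⁻¹, μ]
  refine h.hasMatrices_lieSpan h1 _ (x := fun t => s t • beta μ (zeroIndex (f t)))
    (N := fun t => s t • zeroMatrix μ (f t)) (fun t => Submodule.smul_mem _ _ (beta_mem_buttinDeg h1 _))
    (fun t i => ?_) (fun t i j => ?_) fun S hx => ?_
  · rw [smul_lie, lie_beta_xiEl, Finset.smul_sum]
    exact Finset.sum_congr rfl fun j _ => smul_smul _ _ _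
  · fin_cases t <;> fin_cases i <;> fin_cases j <;>
      simp [f, s, zeroMatrix, pairCoeff, xiPerm] <;> field_simp <;> ring
  · have hs : ∀ t, s t ≠ 0 := by
      intro t
      fin_cases t <;> simp [s, h0]
    have hx' : ∀ t, beta μ (zeroIndex (f t)) ∈ S := fun t => by
      have h := S.smul_mem (s t)⁻¹ (hx t)
      rwa [smul_smul, inv_mul_cancel₀ (hs t), one_smul] at h
    have b5 : beta μ 5 ∈ S := hx' 0
    have b10 : beta μ 10 ∈ S := hx' 1
    have b9 : beta μ 9 ∈ S := hx' 2
    have b6 : beta μ 6 ∈ S := hx' 3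
    obtain ⟨-, -, -, -, -, -, -, -, -, -, -, r12, r13, -⟩ := lie_beta_rows (μ := μ)
    have b4 := beta_mem_of_lie_eq one_ne_zero r12 b5 b9
    have b11 := beta_mem_of_lie_eq one_ne_zero r13 b6 b10
    exact beta_mem_of_mem_zero b4 b5 b6 b9 b10 b11

/-- The isomorphism of the components of degree 0 that is given by two isomorphisms with the Buttin
algebra. -/
def zeroEquiv (h : IsButtinModel r W σ Θ) (h' : IsButtinModel r' W' σ' Θ') :
    zeroPart A B r ≃ₗ⁅K⁆ zeroPart A' B' r' where
  toFun x := ⟨Θ'.symm (Θ x), (h'.mem_piece_zero _).2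
    (by rw [LieEquiv.apply_symm_apply]; exact (h.mem_piece_zero _).1 x.2)⟩
  invFun x := ⟨Θ.symm (Θ' x), (h.mem_piece_zero _).2
    (by rw [LieEquiv.apply_symm_apply]; exact (h'.mem_piece_zero _).1 x.2)⟩
  map_add' x y := Subtype.ext (by simp)
  map_smul' c x := Subtype.ext (by simp)
  map_lie' {x y} := Subtype.ext (by
    change Θ'.symm (Θ ⁅(x : DerivedModCenter A B), (y : DerivedModCenter A B)⁆) =
      ⁅Θ'.symm (Θ x), Θ'.symm (Θ y)⁆
    rw [LieEquiv.map_lie, LieEquiv.map_lie])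
  left_inv x := Subtype.ext (by simp)
  right_inv x := Subtype.ext (by simp)

theorem coe_zeroEquiv (h : IsButtinModel r W σ Θ) (h' : IsButtinModel r' W' σ' Θ') (x : zeroPart A B r) :
    Θ' (h.zeroEquiv h' x) = Θ x := Θ'.apply_symm_apply _

theorem map_negEquiv (h : IsButtinModel r W σ Θ) (h' : IsButtinModel r' W' σ' Θ')
    (v : piece A B r (-1)) : Θ' (h.equivNegOne.trans h'.equivNegOne.symm v) = Θ v := by
  rw [← h'.coe_equivNegOne, LinearEquiv.trans_apply, LinearEquiv.apply_symm_apply, h.coe_equivNegOne]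

/-- Both vectors correspond to the same multiple of the same ξ-monomial. -/
theorem negEquiv_negBasis (h : IsButtinModel r W σ Θ) (h' : IsButtinModel r' W' σ' Θ')
    (c : Fin 4 → Kˣ) (π : Equiv.Perm (Fin 4)) (i : Fin 4) :
    h.equivNegOne.trans h'.equivNegOne.symm (h.negBasis π (fun i => c (π i)) i) =
      h'.negBasis (Equiv.refl _) c (π i) := by
  refine Subtype.ext (Θ'.injective ?_)
  change Θ' _ = Θ' _
  rw [h.map_negEquiv, h.map_negBasis, h'.map_negBasis]
  rfl

end IsButtinModel

end Pairs

end
end WeisfeilerKac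

theorem mainTheorem3 {K : Type*} [Field K] [IsAlgClosed K] [CharP K 2] (a : K) (h0 : a ≠ 0)
    (h1 : a ≠ 1) :
    -- The first Cartan matrix.
    WeisfeilerKac.ProlongIsButtin (WeisfeilerKac.wkMatrix₁ a) ![1, 0, 0]
      ![![1, 0, 0], ![1, 1, 0], ![1, 1, 1], ![1, 2, 1]] 1 2 a ∧
    WeisfeilerKac.ProlongIsButtin (WeisfeilerKac.wkMatrix₁ a) ![0, 0, 1]
      ![![0, 0, 1], ![0, 1, 1], ![1, 1, 1], ![1, 2, 1]] 1 2 a⁻¹ ∧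
    -- The second Cartan matrix.
    WeisfeilerKac.ProlongIsButtin (WeisfeilerKac.wkMatrix₂ a) ![1, 0, 0]
      ![![1, 0, 0], ![1, 1, 0], ![1, 0, 1], ![1, 1, 1]] 0 3 a ∧
    WeisfeilerKac.ProlongIsButtin (WeisfeilerKac.wkMatrix₂ a) ![0, 1, 0]
      ![![0, 1, 0], ![1, 1, 0], ![0, 1, 1], ![1, 1, 1]] 0 3 a⁻¹ ∧
    WeisfeilerKac.ProlongIsButtin (WeisfeilerKac.wkMatrix₂ a) ![0, 0, 1]
      ![![0, 0, 1], ![1, 0, 1], ![0, 1, 1], ![1, 1, 1]] 0 3 (a / (1 + a)) ∧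
    -- For `r = (100)`, the pairs for the two matrices are isomorphic by a permutation of bases.
    ∀ (l₁ l₂ : ℕ) (B₁ : Matrix (Fin l₁) (Fin 3) K) (B₂ : Matrix (Fin l₂) (Fin 3) K),
      WeisfeilerKac.IsCompletion (WeisfeilerKac.wkMatrix₁ a) B₁ →
      WeisfeilerKac.IsCompletion (WeisfeilerKac.wkMatrix₂ a) B₂ →
      ∃ (b : Module.Basis (Fin 4) K
          (WeisfeilerKac.piece (WeisfeilerKac.wkMatrix₁ a) B₁ ![1, 0, 0] (-1)))
        (c : Module.Basis (Fin 4) K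
          (WeisfeilerKac.piece (WeisfeilerKac.wkMatrix₂ a) B₂ ![1, 0, 0] (-1)))
        (φ : WeisfeilerKac.piece (WeisfeilerKac.wkMatrix₂ a) B₂ ![1, 0, 0] (-1) ≃ₗ[K]
          WeisfeilerKac.piece (WeisfeilerKac.wkMatrix₁ a) B₁ ![1, 0, 0] (-1))
        (ψ : WeisfeilerKac.zeroPart (WeisfeilerKac.wkMatrix₂ a) B₂ ![1, 0, 0] ≃ₗ⁅K⁆
          WeisfeilerKac.zeroPart (WeisfeilerKac.wkMatrix₁ a) B₁ ![1, 0, 0]),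
        WeisfeilerKac.IsWeightBasis (WeisfeilerKac.wkMatrix₁ a) B₁ ![1, 0, 0]
          ![![1, 0, 0], ![1, 1, 0], ![1, 1, 1], ![1, 2, 1]] b ∧
        WeisfeilerKac.HasMatrices b
          (WeisfeilerKac.zeroAction (WeisfeilerKac.wkMatrix₁ a) B₁ ![1, 0, 0])
          (WeisfeilerKac.realization₁ a) ∧
        WeisfeilerKac.IsWeightBasis (WeisfeilerKac.wkMatrix₂ a) B₂ ![1, 0, 0]
          ![![1, 0, 0], ![1, 1, 0], ![1, 0, 1], ![1, 1, 1]] c ∧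
        WeisfeilerKac.HasMatrices c
          (WeisfeilerKac.zeroAction (WeisfeilerKac.wkMatrix₂ a) B₂ ![1, 0, 0])
          (WeisfeilerKac.realization₂ a) ∧
        (∀ i, φ (c i) = b (![1, 3, 0, 2] i)) ∧
        ∀ (x : WeisfeilerKac.zeroPart (WeisfeilerKac.wkMatrix₂ a) B₂ ![1, 0, 0])
          (v : WeisfeilerKac.piece (WeisfeilerKac.wkMatrix₂ a) B₂ ![1, 0, 0] (-1)),
          (φ ⟨⁅(x : WeisfeilerKac.DerivedModCenter (WeisfeilerKac.wkMatrix₂ a) B₂),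
              (v : WeisfeilerKac.DerivedModCenter (WeisfeilerKac.wkMatrix₂ a) B₂)⁆,
            WeisfeilerKac.lie_mem_piece_neg_one (WeisfeilerKac.wkMatrix₂ a) B₂ x.2 v.2⟩ :
              WeisfeilerKac.DerivedModCenter (WeisfeilerKac.wkMatrix₁ a) B₁) =
            ⁅(ψ x : WeisfeilerKac.DerivedModCenter (WeisfeilerKac.wkMatrix₁ a) B₁),
              (φ v : WeisfeilerKac.DerivedModCenter (WeisfeilerKac.wkMatrix₁ a) B₁)⁆ := by
  refine ⟨WeisfeilerKac.prolongIsButtin_wkMatrix₁_first h0 h1,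
    WeisfeilerKac.prolongIsButtin_wkMatrix₁_third h0 h1,
    WeisfeilerKac.prolongIsButtin_wkMatrix₂_first h0 h1,
    WeisfeilerKac.prolongIsButtin_wkMatrix₂_second h0 h1,
    WeisfeilerKac.prolongIsButtin_wkMatrix₂_third h0 h1, fun l₁ l₂ B₁ B₂ _ _ => ?_⟩
  -- For `r = (100)` both matrices lead to the parameter `a`, hence to one and the same Buttin
  -- algebra with the same degree.
  obtain ⟨Θ₁, h₁⟩ := (WeisfeilerKac.buttinRealization₁ h0 h1).exists_isButtinModel
    (r := ![1, 0, 0]) (σ := Equiv.refl _) (WeisfeilerKac.exists_wkMatrix₁_ne_zero h0) WeisfeilerKac.rootWt₁_zero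
    (by decide) B₁
  obtain ⟨Θ₂, h₂⟩ := (WeisfeilerKac.buttinRealization₂ h0 h1).exists_isButtinModel
    (r := ![1, 0, 0]) (σ := Equiv.refl _) (WeisfeilerKac.exists_wkMatrix₂_ne_zero h0) WeisfeilerKac.rootWt₂_zero
    (by decide) B₂
  refine ⟨h₁.negBasis (Equiv.refl _) (WeisfeilerKac.pairCoeff h0 h1),
    h₂.negBasis WeisfeilerKac.xiPerm fun i => WeisfeilerKac.pairCoeff h0 h1 (WeisfeilerKac.xiPerm i),
    h₂.equivNegOne.trans h₁.equivNegOne.symm, h₂.zeroEquiv h₁,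
    h₁.isWeightBasis_negBasis h1 WeisfeilerKac.isRootWeight₁
      (by rw [WeisfeilerKac.betaWt_rootWt₁]; decide) (by decide) _,
    h₁.hasMatrices_realization₁ h0 h1,
    h₂.isWeightBasis_negBasis h1 WeisfeilerKac.isRootWeight₂
      (by rw [WeisfeilerKac.betaWt_rootWt₂]; decide) (by decide) _,
    h₂.hasMatrices_realization₂ h0 h1, h₂.negEquiv_negBasis h₁ _ WeisfeilerKac.xiPerm,
    fun x v => Θ₁.injective ?_⟩
  -- The maps on g₀ and on g₋₁ are restrictions of the same Lie algebra isomorphism, `Θ₂` followed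
  -- by the inverse of `Θ₁`, so compatibility is its multiplicativity.
  refine (h₂.map_negEquiv h₁ _).trans ?_
  change Θ₂ ⁅(x : WeisfeilerKac.DerivedModCenter (WeisfeilerKac.wkMatrix₂ a) B₂),
    (v : WeisfeilerKac.DerivedModCenter (WeisfeilerKac.wkMatrix₂ a) B₂)⁆ = Θ₁ _
  rw [LieEquiv.map_lie, LieEquiv.map_lie, h₂.coe_zeroEquiv h₁, h₂.map_negEquiv h₁]
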